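/- Let $n\ge 1$ and $\hat f(\xi)=\int_{\mathbf R^n} f(x)e^{-2\pi i x\cdot\xi}\,dx$. Fix a cutoff $\chi:\mathbf R^n\to[0,\infty)$ that is smooth, even, equal to $1$ for $|\xi|\le 1$ and supported in $|\xi|\le 2$; put $\varphi(\xi)=\chi(\xi)-\chi(2\xi)$ and, for $k\in\mathbf Z$, $\widehat{P_kf}(\xi)=\varphi(2^{-k}\xi)\hat f(\xi)$. Let $\chi_0:\mathbf R\to[0,\infty)$ be a cutoff of the same kind on $\mathbf R$ and $\varphi_0(t)=\chi_0(t)-\chi_0(2t)$. For $1\le p\le\infty$ let $B^0_{p,1}$ be the (homogeneous) Besov space of tempered distributions $f$ on $\mathbf R^n$ with $\|f\|_{B^0_{p,1}}=\sum_{k\in\mathbf Z}\|P_kf\|_{L^p(\mathbf R^n)}<\infty$. For each $j\ge 0$ let $(Y_{j,k})_k$ be an orthonormal basis, in $L^2(\mathbf S^{n-1})$ with surface measure, of the spherical harmonics of degree $j$ (restrictions to $\mathbf S^{n-1}$ of the harmonic homogeneous polynomials of degree $j$). For $g\in L^1(\mathbf S^{n-1})$ put $c_{j,k}=\int_{\mathbf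 S^{n-1}} g\,\overline{Y_{j,k}}$ and $$P_l g=\sum_{j,k}\varphi_0(2^{-l}j)\,c_{j,k}Y_{j,k}\quad(l\ge 1),\qquad P_0 g=\sum_{j,k}\chi_0(j)\,c_{j,k}Y_{j,k}.$$ Let $q:\mathbf R^n\times\mathbf S^{n-1}\to\mathbf C$ be measurable with $q(x,\cdot)\in L^1(\mathbf S^{n-1})$ for every $x$, and let $$T_qf(x)=\int_{\mathbf R^n}q(x,\xi/|\xi|)\,e^{2\pi i\xi\cdot x}\hat f(\xi)\,d\xi .$$ There is a constant $C$, depending only on $n$ and on the cutoffs $\chi,\chi_0$, such that the following hold. (i) If $\sum_{l\ge0}2^{l(n-1)/2}\sup_x\|P_lq(x,\cdot)\|_{L^2(\mathbf S^{n-1})}<\infty$, then $T_q$ is bounded on $L^2(\mathbf R^n)$ and $$\|T_q\|_{L^2\to L^2}\le C\sum_{l\ge0}2^{l(n-1)/2}\sup_x\|P_lq(x,\cdot)\|_{L^2(\mathbf S^{n-1})}.$$ Here $T_q$ is given by the absolutely convergent integral above for every $f\in L^2$ with $\hat f\in L^1$, and on $L^2$ by bounded extension. (ii) For every $2\le p\le\infty$,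 with $1/p+1/p'=1$, if $\sum_{l\ge0}2^{l(n-1)/p'}\sup_x\|P_lq(x,\cdot)\|_{L^{p'}(\mathbf S^{n-1})}<\infty$, then $T_q$ is bounded from $B^0_{p,1}$ to $L^p(\mathbf R^n)$ and $$\|T_q\|_{B^0_{p,1}\to L^p}\le C\sum_{l\ge0}2^{l(n-1)/p'}\sup_x\|P_lq(x,\cdot)\|_{L^{p'}(\mathbf S^{n-1})},$$ with the same $C$, independent of $p$. Here $T_q$ is linear on $B^0_{p,1}$; it is given by the absolutely convergent integral above for every $f\in B^0_{p,1}$ with $\hat f\in L^1$, and for $f=P_kg$ with $g\in L^p$, $k\in\mathbf Z$, by the absolutely convergent integral $T_qP_kg(x)=\int K_k(x,x-y)g(y)\,dy$, where $K_k(x,z)=\int q(x,\xi/|\xi|)\varphi(2^{-k}\xi)e^{2\pi i\xi\cdot z}\,d\xi$. -/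

import Mathlib

open MeasureTheory Metric
open scoped ENNReal NNReal FourierTransform SchwartzMap ContDiff

noncomputable section

namespace RoughPDO

/-- The Euclidean space `ℝⁿ`. -/
abbrev E (n : ℕ) : Type := EuclideanSpace ℝ (Fin n)

/-- The unit sphere `S^{n-1}` of `ℝⁿ`. -/
abbrev Sph (n : ℕ) : Type := sphere (0 : E n) 1

/-- The surface measure on `S^{n-1}`. -/
abbrev sphMeasure (n : ℕ) : Measure (Sph n) := (volume : Measure (E n)).toSphere

/-! ### Littlewood-Paley cutoffs -/

/-- A Littlewood-Paley cutoff: nonnegative, smooth, even, equal to `1` on the closed unit ball and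
supported in the closed ball of radius `2`. -/
structure IsCutoff {V : Type*} [NormedAddCommGroup V] [NormedSpace ℝ V] (χ : V → ℝ) : Prop where
  smooth : ContDiff ℝ ∞ χ
  nonneg : ∀ v, 0 ≤ χ v
  even : ∀ v, χ (-v) = χ v
  one : ∀ v, ‖v‖ ≤ 1 → χ v = 1
  supp : ∀ v, 2 < ‖v‖ → χ v = 0

/-- The annular bump `φ(ξ) = χ(ξ) - χ(2ξ)`. -/
def bump {V : Type*} [NormedAddCommGroup V] [NormedSpace ℝ V] (χ : V → ℝ) (ξ : V) : ℝ :=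
  χ ξ - χ ((2 : ℝ) • ξ)

/-! ### Spherical harmonics and Littlewood-Paley operators on the sphere -/

/-- Restriction of a polynomial with complex coefficients to the unit sphere. -/
def polyRestrict (n : ℕ) : MvPolynomial (Fin n) ℂ →ₗ[ℂ] C(Sph n, ℂ) :=
  (MvPolynomial.aeval (fun i : Fin n =>
    (⟨fun θ : Sph n => (((θ : E n) i : ℝ) : ℂ), by fun_prop⟩ : C(Sph n, ℂ)))).toLinearMap

/-- The Laplacian on polynomials. -/
def polyLaplacian (n : ℕ) : MvPolynomial (Fin n) ℂ →ₗ[ℂ] MvPolynomial (Fin n) ℂ :=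
  ∑ i : Fin n, (MvPolynomial.pderiv i).toLinearMap ∘ₗ (MvPolynomial.pderiv i).toLinearMap

/-- Harmonic homogeneous polynomials of degree `j` (solid harmonics). -/
def solidHarmonics (n j : ℕ) : Submodule ℂ (MvPolynomial (Fin n) ℂ) :=
  MvPolynomial.homogeneousSubmodule (Fin n) ℂ j ⊓ LinearMap.ker (polyLaplacian n)

/-- Spherical harmonics of degree `j`, as a subspace of `L²(S^{n-1})`. -/
def sphericalHarmonics (n j : ℕ) : Submodule ℂ (Lp ℂ 2 (sphMeasure n)) :=
  (solidHarmonics n j).map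
    ((ContinuousMap.toLp 2 (sphMeasure n) ℂ : C(Sph n, ℂ) →L[ℂ] Lp ℂ 2 (sphMeasure n)).toLinearMap
      ∘ₗ polyRestrict n)

instance finiteDimensional_sphericalHarmonics (n j : ℕ) :
    FiniteDimensional ℂ (sphericalHarmonics n j) := by
  have h1 : FiniteDimensional ℂ (MvPolynomial.homogeneousSubmodule (Fin n) ℂ j) :=
    Module.Finite.iff_fg.mpr (MvPolynomial.homogeneousSubmodule_fg (Fin n) ℂ j)
  have h2 : FiniteDimensional ℂ (solidHarmonics n j) :=
    Submodule.finiteDimensional_of_le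
      (inf_le_left : solidHarmonics n j ≤ MvPolynomial.homogeneousSubmodule (Fin n) ℂ j)
  exact Module.Finite.map (solidHarmonics n j) _

/-- An orthonormal basis `(Y_{j,k})_k` of the spherical harmonics of degree `j`. -/
def harmonicBasis (n j : ℕ) :
    OrthonormalBasis (Fin (Module.finrank ℂ (sphericalHarmonics n j))) ℂ
      (sphericalHarmonics n j) :=
  stdOrthonormalBasis ℂ (sphericalHarmonics n j)

/-- The harmonic `Y_{j,k}` as a function on the sphere. -/
def harmonic (n j : ℕ) (k : Fin (Module.finrank ℂ (sphericalHarmonics n j))) : Sph n → ℂ :=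
  ((harmonicBasis n j k : Lp ℂ 2 (sphMeasure n)) : Sph n → ℂ)

/-- The coefficient `c_{j,k} = ⟨f, Y_{j,k}⟩` of an integrable function on the sphere. -/
def harmonicCoeff (n : ℕ) (f : Sph n → ℂ) (j : ℕ)
    (k : Fin (Module.finrank ℂ (sphericalHarmonics n j))) : ℂ :=
  ∫ θ, f θ * (starRingEnd ℂ) (harmonic n j k θ) ∂(sphMeasure n)

/-- The spherical Littlewood-Paley multiplier: `φ(2^{-l} j)` for `l ≥ 1`; the operator with `l = 0`
also carries the constants (the harmonics of degree `0`), so that these multipliers, `l ≥ 0`, sum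
to `1` for every degree `j ≥ 0`. -/
def sphMult (χ : ℝ → ℝ) (l j : ℕ) : ℝ :=
  if l = 0 then χ (j : ℝ) else bump χ ((2 : ℝ) ^ (-(l : ℤ)) * (j : ℝ))

/-- The spherical Littlewood-Paley operator `P_l f = ∑_{j,k} c_{j,k} φ(2^{-l} j) Y_{j,k}`; the
multiplier vanishes for degrees `j ≥ 2^{l+1}`, so that the sum is finite. -/
def sphLP (n : ℕ) (χ : ℝ → ℝ) (l : ℕ) (f : Sph n → ℂ) (θ : Sph n) : ℂ :=
  ∑ j ∈ Finset.range (2 ^ (l + 1)),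
    ∑ k, (sphMult χ l j : ℂ) * harmonicCoeff n f j k * harmonic n j k θ

/-- `∑_l 2^{l(n-1)/r} sup_x ‖P_l q(x,·)‖_{L^r(S^{n-1})}`, for `1 ≤ r < ∞`. -/
def symbolNorm (n : ℕ) (χ : ℝ → ℝ) (r : ℝ≥0∞) (q : E n → Sph n → ℂ) : ℝ≥0∞ :=
  ∑' l : ℕ, (2 : ℝ≥0∞) ^ ((l : ℝ) * ((n : ℝ) - 1) / r.toReal) *
    ⨆ x : E n, eLpNorm (sphLP n χ l (q x)) r (sphMeasure n)

/-! ### The operator -/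

/-- The symbol `q(x, ξ/|ξ|)`, homogeneous of degree zero in `ξ` (the value at `ξ = 0` is
immaterial). -/
def homSymbol {n : ℕ} (q : E n → Sph n → ℂ) (x ξ : E n) : ℂ :=
  if h : ξ = 0 then 0
  else q x ⟨‖ξ‖⁻¹ • ξ, by
    rw [mem_sphere_zero_iff_norm, norm_smul, norm_inv, norm_norm,
      inv_mul_cancel₀ (norm_ne_zero_iff.mpr h)]⟩

/-- The integrand `q(x, ξ/|ξ|) e^{2πi ξ·x} h(ξ)` of `T_q f(x)`, where `h` is the Fourier transform
of `f`. -/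
def opIntegrand {n : ℕ} (q : E n → Sph n → ℂ) (h : E n → ℂ) (x ξ : E n) : ℂ :=
  homSymbol q x ξ * Complex.exp (2 * Real.pi * Complex.I * (inner ℝ ξ x : ℝ)) * h ξ

/-- `T_q f(x) = ∫ q(x, ξ/|ξ|) e^{2πi ξ·x} h(ξ) dξ`, where `h` is the Fourier transform of `f`. -/
def opIntegral {n : ℕ} (q : E n → Sph n → ℂ) (h : E n → ℂ) (x : E n) : ℂ :=
  ∫ ξ, opIntegrand q h x ξ

/-- The kernel `K_k(x,z) = ∫ q(x, ξ/|ξ|) φ(2^{-k}ξ) e^{2πi ξ·z} dξ` of `T_q P_k`, so that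
`T_q P_k g(x) = ∫ K_k(x, x-y) g(y) dy`. -/
def opKernel {n : ℕ} (χ : E n → ℝ) (q : E n → Sph n → ℂ) (k : ℤ) (x z : E n) : ℂ :=
  ∫ ξ, homSymbol q x ξ * (bump χ ((2 : ℝ) ^ (-k) • ξ) : ℂ) *
    Complex.exp (2 * Real.pi * Complex.I * (inner ℝ ξ z : ℝ))

/-! ### The Besov space `B^0_{p,1}(ℝⁿ)` -/

/-- The Littlewood-Paley operator `P_k`, with Fourier multiplier `φ(2^{-k}ξ)`, on tempered
distributions. -/
def freqLP {n : ℕ} (χ : E n → ℝ) (k : ℤ) : 𝓢'(E n, ℂ) →L[ℂ] 𝓢'(E n, ℂ) :=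
  TemperedDistribution.fourierMultiplierCLM ℂ
    (fun ξ : E n => (bump χ ((2 : ℝ) ^ (-k) • ξ) : ℂ))

/-- The `L^p` norm of a tempered distribution (`∞` if it is not given by an `L^p` function). -/
def distLpNorm {n : ℕ} (p : ℝ≥0∞) [Fact (1 ≤ p)] (u : 𝓢'(E n, ℂ)) : ℝ≥0∞ :=
  ⨅ (g : Lp ℂ p (volume : Measure (E n))) (_ : (g : 𝓢'(E n, ℂ)) = u), ‖g‖ₑ

/-- The homogeneous Besov norm `∑_{k ∈ ℤ} ‖P_k u‖_{L^p}` of `B^0_{p,1}`. -/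
def besovNorm {n : ℕ} (χ : E n → ℝ) (p : ℝ≥0∞) [Fact (1 ≤ p)] (u : 𝓢'(E n, ℂ)) : ℝ≥0∞ :=
  ∑' k : ℤ, distLpNorm p (freqLP χ k u)

theorem distLpNorm_add_le {n : ℕ} (p : ℝ≥0∞) [Fact (1 ≤ p)] (u v : 𝓢'(E n, ℂ)) :
    distLpNorm p (u + v) ≤ distLpNorm p u + distLpNorm p v := by
  refine ENNReal.le_of_forall_pos_le_add ?_
  intro ε hε hfin
  obtain ⟨hu, hv⟩ := ENNReal.add_lt_top.mp hfin
  have hε2 : (0 : ℝ≥0∞) < (ε : ℝ≥0∞) / 2 := by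
    simpa using hε.ne'
  obtain ⟨g, hg⟩ := iInf_lt_iff.mp (ENNReal.lt_add_right hu.ne hε2.ne')
  obtain ⟨hgu, hg⟩ := iInf_lt_iff.mp hg
  obtain ⟨g', hg'⟩ := iInf_lt_iff.mp (ENNReal.lt_add_right hv.ne hε2.ne')
  obtain ⟨hgv, hg'⟩ := iInf_lt_iff.mp hg'
  have hsum : ((g + g' : Lp ℂ p (volume : Measure (E n))) : 𝓢'(E n, ℂ)) = u + v := by
    rw [← hgu, ← hgv]
    exact map_add (Lp.toTemperedDistributionCLM ℂ (volume : Measure (E n)) p) g g'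
  refine (iInf₂_le (g + g') hsum).trans ((enorm_add_le g g').trans ?_)
  refine (add_le_add hg.le hg'.le).trans (le_of_eq ?_)
  rw [add_add_add_comm, ENNReal.add_halves]
  rfl

theorem distLpNorm_smul_le {n : ℕ} (p : ℝ≥0∞) [Fact (1 ≤ p)] (c : ℂ) (u : 𝓢'(E n, ℂ))
    (hu : distLpNorm p u ≠ ⊤) : distLpNorm p (c • u) ≤ ‖c‖ₑ * distLpNorm p u := by
  refine ENNReal.le_of_forall_pos_le_add ?_
  intro ε hε _
  by_cases hc : c = 0
  · subst hc
    have h0 : ((0 : Lp ℂ p (volume : Measure (E n))) : 𝓢'(E n, ℂ)) = (0 : ℂ) • u := by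
      refine Eq.trans ?_ (zero_smul ℂ u).symm
      exact map_zero (Lp.toTemperedDistributionCLM ℂ (volume : Measure (E n)) p)
    exact (iInf₂_le (0 : Lp ℂ p (volume : Measure (E n))) h0).trans (by simp)
  · have hc' : ‖c‖ₑ ≠ 0 := by simpa using hc
    have hd : (ε : ℝ≥0∞) / ‖c‖ₑ ≠ 0 :=
      (ENNReal.div_pos (by simpa using hε.ne') enorm_ne_top).ne'
    have hlt := ENNReal.lt_add_right hu hd
    unfold distLpNorm at hlt
    obtain ⟨g, hg⟩ := iInf_lt_iff.mp hlt
    obtain ⟨hgu, hg⟩ := iInf_lt_iff.mp hg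
    have hs : ((c • g : Lp ℂ p (volume : Measure (E n))) : 𝓢'(E n, ℂ)) = c • u := by
      rw [← hgu]
      exact map_smul (Lp.toTemperedDistributionCLM ℂ (volume : Measure (E n)) p) c g
    refine (iInf₂_le (c • g) hs).trans ?_
    rw [enorm_smul]
    refine (mul_le_mul_right hg.le _).trans (le_of_eq ?_)
    rw [mul_add, ENNReal.mul_div_cancel hc' enorm_ne_top]
    rfl

/-- The homogeneous Besov space `B^0_{p,1}(ℝⁿ)`: tempered distributions with finite norm (the norm
vanishes on polynomials). -/
def besovSpace {n : ℕ} (χ : E n → ℝ) (p : ℝ≥0∞) [Fact (1 ≤ p)] : Submodule ℂ 𝓢'(E n, ℂ) where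
  carrier := {u | besovNorm χ p u ≠ ⊤}
  zero_mem' := by
    have h : ∀ k : ℤ, distLpNorm p (freqLP χ k (0 : 𝓢'(E n, ℂ))) = 0 := by
      intro k
      rw [map_zero]
      refine le_antisymm ((iInf₂_le (0 : Lp ℂ p (volume : Measure (E n))) ?_).trans ?_) zero_le
      · exact map_zero (Lp.toTemperedDistributionCLM ℂ (volume : Measure (E n)) p)
      · simp
    have h0 : besovNorm χ p (0 : 𝓢'(E n, ℂ)) = 0 := ENNReal.tsum_eq_zero.mpr h
    exact h0.trans_ne ENNReal.zero_ne_top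
  add_mem' := by
    intro u v hu hv
    refine ne_top_of_le_ne_top (ENNReal.add_ne_top.mpr ⟨hu, hv⟩) ?_
    unfold besovNorm
    rw [← ENNReal.tsum_add]
    refine ENNReal.tsum_le_tsum fun k => ?_
    rw [map_add]
    exact distLpNorm_add_le p _ _
  smul_mem' := by
    intro c u hu
    refine ne_top_of_le_ne_top (ENNReal.mul_ne_top (enorm_ne_top (x := c)) hu) ?_
    unfold besovNorm
    rw [← ENNReal.tsum_mul_left]
    refine ENNReal.tsum_le_tsum fun k => ?_
    rw [map_smul]
    exact distLpNorm_smul_le p c _ (ENNReal.ne_top_of_tsum_ne_top hu k)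

end RoughPDO

end

open RoughPDO

open MeasureTheory Metric
open scoped ENNReal NNReal FourierTransform SchwartzMap ContDiff
noncomputable section
namespace RoughPDO

open scoped LineDeriv Laplacian

/-! ### Polynomial functions on `ℝⁿ` -/

/-! Suppose first that, for every x, the symbol is a polynomial s(x,·) of degree at most N
restricted to the sphere. The heart of the matter is that T_s P_k then has norm at most C
N^{(n-1)/p'} sup_x ‖s(x,·)‖_{p'} on L^p, for 2 ≤ p ≤ ∞. The pieces P_l q(x,·) are such polynomials
with N = 2^{l+1}, and summing over l gives the weights 2^{l(n-1)/p'}.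

The dependence on x is removed by a reproducing formula s(x,θ) = ∫ s(x,η) Φ(η,θ) dη. It writes T_s
P_k f(x) as the pairing of s(x,·) with η ↦ A_k f(η,x), where A_k f(η,·) is f acted on by the Fourier
multiplier Φ(η,ξ/|ξ|) φ(2^{-k}ξ). Hölder's inequality in η, for each fixed x, leaves the bound
N^{(n-1)/p'} for A_k from L^p(ℝⁿ) to L^p of the product of the sphere and ℝⁿ
(`ReproFamily.eLpNorm_polyOp_le`). For p = 2 this is Plancherel and ∫ |Φ(η,θ)|² dη ≤ C N^{n-1}; for
p = ∞ it says that the kernels of the multipliers have L¹ norm at most C N^{n-1}; between the two it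
follows from the three lines theorem (`ReproFamily.eLpNorm_op_le`).

The L¹ bound dictates the choice of Φ. The reproducing kernel of the polynomials of degree 2N has
the right L² size, but its transform lives in |z| ≲ N, a set of volume N^n, and Cauchy-Schwarz loses
N^{1/2}. Multiplying it by the Chebyshev factor U_{N-1}(⟨η,θ⟩)/N, which is 1 at θ = η, keeps the
reproducing property for degree N and makes the derivative in the direction η bounded independently
of N: the tangential part of η at θ has length √(1-⟨η,θ⟩²), and the Chebyshev factor times this
length is at most 1/N, which offsets Bernstein's N. The transform is then concentrated where
moreover |⟨z,η⟩| ≲ 1, a set of volume N^{n-1}, and nothing is lost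
(`exists_integral_norm_fourierInv_le`, `exists_reproducing`).

On L² no frequency localisation is needed: expanding s(x,·) in an orthonormal basis of polynomials,
Cauchy-Schwarz and Plancherel give the bound N^{(n-1)/2} for T_s itself
(`exists_eLpNorm_opIntegral_le`). Nikolskii's inequality and the completeness of the harmonics
justify q = ∑ P_l q (`exists_symbolSeries`). On the Besov space the operators T_q P_k are summed
over k, with a factor 3 for the overlap of neighbouring dyadic pieces
(`SymbolSeries.exists_besov_operator`). -/

/-- Evaluation of a polynomial with complex coefficients at a point of `ℝⁿ`. -/
def pev {n : ℕ} (x : E n) : MvPolynomial (Fin n) ℂ →ₐ[ℂ] ℂ :=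
  MvPolynomial.aeval (fun i => ((x i : ℝ) : ℂ))

@[simp] theorem pev_X {n : ℕ} (x : E n) (i : Fin n) :
    pev x (MvPolynomial.X i) = ((x i : ℝ) : ℂ) := by simp [pev]

@[simp] theorem pev_C {n : ℕ} (x : E n) (c : ℂ) : pev x (MvPolynomial.C c) = c := by
  simp [pev]

theorem polyRestrict_apply {n : ℕ} (p : MvPolynomial (Fin n) ℂ) (θ : Sph n) :
    polyRestrict n p θ = pev (θ : E n) p := by
  induction p using MvPolynomial.induction_on with
  | C a => simp [polyRestrict]
  | add p q hp hq => rw [map_add, map_add, ContinuousMap.add_apply, hp, hq]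
  | mul_X p i hp =>
    have h : ∀ a b : MvPolynomial (Fin n) ℂ,
        polyRestrict n (a * b) θ = polyRestrict n a θ * polyRestrict n b θ := by
      intro a b; simp [polyRestrict]
    rw [h, hp, map_mul]
    simp [polyRestrict]

theorem hasFDerivAt_pev {n : ℕ} (p : MvPolynomial (Fin n) ℂ) (x : E n) :
    HasFDerivAt (fun y : E n => pev y p)
      (∑ i, (EuclideanSpace.proj i : E n →L[ℝ] ℝ).smulRight
        (pev x (MvPolynomial.pderiv i p))) x := by
  induction p using MvPolynomial.induction_on with
  | C a => simpa using hasFDerivAt_const a x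
  | add p q hp hq =>
    simp only [map_add]
    refine (hp.add hq).congr_fderiv ?_
    ext v
    simp [smul_add, Finset.sum_add_distrib]
  | mul_X p j hp =>
    have hX : HasFDerivAt (fun y : E n => ((y j : ℝ) : ℂ))
        (Complex.ofRealCLM.comp (EuclideanSpace.proj j : E n →L[ℝ] ℝ)) x :=
      Complex.ofRealCLM.hasFDerivAt.comp x (EuclideanSpace.proj j : E n →L[ℝ] ℝ).hasFDerivAt
    have := hp.mul hX
    simp only [map_mul, pev_X]
    refine this.congr_fderiv ?_
    ext v
    simp only [add_apply, smul_apply,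
      sum_apply, ContinuousLinearMap.smulRight_apply,
      ContinuousLinearMap.comp_apply, Derivation.leibniz, map_add, smul_eq_mul, map_mul, pev_X,
      PiLp.proj_apply, Complex.ofRealCLM_apply, MvPolynomial.pderiv_X, Complex.real_smul]
    rw [Finset.mul_sum, ← sub_eq_zero]
    simp only [mul_add, Finset.sum_add_distrib]
    rw [show (∑ i, (v i : ℂ) * (pev x p * pev x (Pi.single (M := fun _ => MvPolynomial (Fin n) ℂ) i 1 j)))
      = pev x p * v j by
        rw [Finset.sum_eq_single j]
        · simp; ring
        · intro b _ hb; simp [Pi.single_apply, hb.symm]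
        · simp]
    rw [show (∑ i, (x j : ℂ) * ((v i : ℂ) * pev x (MvPolynomial.pderiv i p))) =
      ∑ i, (v i : ℂ) * ((x j : ℂ) * pev x (MvPolynomial.pderiv i p)) from
      Finset.sum_congr rfl fun i _ => by ring]
    ring

theorem contDiff_pev {n : ℕ} (p : MvPolynomial (Fin n) ℂ) :
    ContDiff ℝ ∞ (fun y : E n => pev y p) := by
  induction p using MvPolynomial.induction_on with
  | C a => simpa using contDiff_const
  | add p q hp hq => simpa only [map_add] using hp.add hq
  | mul_X p j hp =>
    simp only [map_mul, pev_X]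
    refine hp.mul ?_
    exact (Complex.ofRealCLM.contDiff).comp (EuclideanSpace.proj j : E n →L[ℝ] ℝ).contDiff

theorem continuous_pev {n : ℕ} (p : MvPolynomial (Fin n) ℂ) :
    Continuous (fun y : E n => pev y p) := (contDiff_pev p).continuous

/-- The linear form `w ↦ ⟨w, x⟩` as a polynomial. -/
def linForm {n : ℕ} (w : E n) : MvPolynomial (Fin n) ℂ :=
  ∑ i, MvPolynomial.C ((w i : ℝ) : ℂ) * MvPolynomial.X i

theorem pev_linForm {n : ℕ} (w x : E n) : pev x (linForm w) = ((inner ℝ w x : ℝ) : ℂ) := by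
  simp [linForm, PiLp.inner_apply, mul_comm]

/-- The directional derivative of a polynomial. -/
def dirDeriv {n : ℕ} (w : E n) (p : MvPolynomial (Fin n) ℂ) : MvPolynomial (Fin n) ℂ :=
  ∑ i, MvPolynomial.C ((w i : ℝ) : ℂ) * MvPolynomial.pderiv i p

/-- The polynomial `|x|²`. -/
def normSqPoly (n : ℕ) : MvPolynomial (Fin n) ℂ := ∑ i, MvPolynomial.X i ^ 2

theorem pev_normSqPoly {n : ℕ} (x : E n) : pev x (normSqPoly n) = ((‖x‖ ^ 2 : ℝ) : ℂ) := by
  simp [normSqPoly, EuclideanSpace.norm_sq_eq]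

/-! ### Radial profiles -/

/-- Smooth functions on `ℝ` that vanish on `(6, ∞)`. -/
def profileSubmodule : Submodule ℝ (ℝ → ℝ) where
  carrier := {u | ContDiff ℝ ∞ u ∧ ∀ ρ, 6 < ρ → u ρ = 0}
  zero_mem' := ⟨contDiff_const, fun _ _ => rfl⟩
  add_mem' := fun {u v} hu hv => ⟨hu.1.add hv.1, fun ρ h => by simp [hu.2 ρ h, hv.2 ρ h]⟩
  smul_mem' := fun c u hu => ⟨contDiff_const.smul hu.1, fun ρ h => by simp [hu.2 ρ h]⟩

/-- The type of smooth functions on `ℝ` that vanish on `(6, ∞)`. -/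
def Profile : Type := profileSubmodule

instance : AddCommGroup Profile := inferInstanceAs (AddCommGroup profileSubmodule)
instance : Module ℝ Profile := inferInstanceAs (Module ℝ profileSubmodule)
instance : CoeFun Profile (fun _ => ℝ → ℝ) := ⟨fun u => u.1⟩

@[simp] theorem Profile.smul_apply (c : ℝ) (u : Profile) (ρ : ℝ) : (c • u) ρ = c * u ρ := rfl

theorem Profile.contDiff (u : Profile) : ContDiff ℝ ∞ (u : ℝ → ℝ) := u.2.1

theorem Profile.eq_zero (u : Profile) {ρ : ℝ} (h : 6 < ρ) : u ρ = 0 := u.2.2 ρ h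

/-- Multiplication of a profile by a smooth function. -/
def Profile.mulLeft (u : Profile) (f : ℝ → ℝ) (hf : ContDiff ℝ ∞ f) : Profile :=
  ⟨fun ρ => f ρ * u ρ, hf.mul u.contDiff, fun ρ h => by simp [u.eq_zero h]⟩

@[simp] theorem Profile.mulLeft_apply (f : ℝ → ℝ) (hf : ContDiff ℝ ∞ f) (u : Profile) (ρ : ℝ) :
    u.mulLeft f hf ρ = f ρ * u ρ := rfl

theorem deriv_eq_zero_of_eqOn_Ioi {u : ℝ → ℝ} {a : ℝ} (hu : ∀ ρ, a < ρ → u ρ = 0) {ρ : ℝ}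
    (h : a < ρ) : deriv u ρ = 0 := by
  have : u =ᶠ[nhds ρ] fun _ => 0 := by
    filter_upwards [lt_mem_nhds h] with y hy using hu y hy
  rw [this.deriv_eq]; simp

theorem deriv_eq_zero_of_eqOn_Iio {u : ℝ → ℝ} {a : ℝ} (hu : ∀ ρ, ρ < a → u ρ = 0) {ρ : ℝ}
    (h : ρ < a) : deriv u ρ = 0 := by
  have : u =ᶠ[nhds ρ] fun _ => 0 := by
    filter_upwards [gt_mem_nhds h] with y hy using hu y hy
  rw [this.deriv_eq]; simp

/-- The derivative of a profile. -/
def Profile.der (u : Profile) : Profile :=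
  ⟨deriv u, (contDiff_infty_iff_deriv.mp u.contDiff).2,
    fun _ h => deriv_eq_zero_of_eqOn_Ioi u.2.2 h⟩

theorem Profile.hasDerivAt (u : Profile) (ρ : ℝ) : HasDerivAt u (u.der ρ) ρ :=
  ((contDiff_infty_iff_deriv.mp u.contDiff).1 ρ).hasDerivAt

/-- The Schwartz function `p(x) u(|x|²)`. -/
def radS {n : ℕ} (p : MvPolynomial (Fin n) ℂ) (u : Profile) : 𝓢(E n, ℂ) :=
  HasCompactSupport.toSchwartzMap (f := fun x : E n => pev x p * ((u (‖x‖ ^ 2) : ℝ) : ℂ))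
    (by
      refine HasCompactSupport.intro (isCompact_closedBall (0 : E n) 3) fun x hx => ?_
      have : 3 < ‖x‖ := by simpa using hx
      rw [u.eq_zero (by nlinarith)]; simp)
    -- Profiles are functions of `‖x‖ ^ 2`, which is smooth everywhere, so no condition at the
    -- origin is needed.
    ((contDiff_pev p).mul (Complex.ofRealCLM.contDiff.comp
      (u.contDiff.comp (contDiff_norm_sq ℝ))))

@[simp] theorem radS_apply {n : ℕ} (p : MvPolynomial (Fin n) ℂ) (u : Profile) (x : E n) :
    radS p u x = pev x p * ((u (‖x‖ ^ 2) : ℝ) : ℂ) := rfl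

/-- The gradient of u(|x|²) is 2 u'(|x|²) x. Products of a polynomial and a radial profile are thus
stable under differentiation, and the Laplacian can be computed inside this class. -/
theorem lineDeriv_radS {n : ℕ} (w : E n) (p : MvPolynomial (Fin n) ℂ) (u : Profile) :
    ∂_{w} (radS p u) = radS (dirDeriv w p) u + radS (linForm w * p) ((2 : ℝ) • u.der) := by
  ext x
  rw [SchwartzMap.lineDerivOp_apply_eq_fderiv]
  have h1 := hasFDerivAt_pev p x
  have h2 : HasFDerivAt (fun y : E n => ((u (‖y‖ ^ 2) : ℝ) : ℂ))
      (Complex.ofRealCLM.comp ((u.der (‖x‖ ^ 2)) • ((2 : ℕ) • innerSL ℝ x))) x := by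
    refine Complex.ofRealCLM.hasFDerivAt.comp x ?_
    exact (u.hasDerivAt (‖x‖ ^ 2)).comp_hasFDerivAt x (hasStrictFDerivAt_norm_sq x).hasFDerivAt
  have h3 := (h1.mul h2).fderiv
  have h4 : (radS p u : E n → ℂ) = fun x : E n => pev x p * ((u (‖x‖ ^ 2) : ℝ) : ℂ) := rfl
  rw [h4]
  erw [h3]
  simp only [add_apply, smul_apply,
    sum_apply, ContinuousLinearMap.smulRight_apply,
    ContinuousLinearMap.comp_apply, add_apply, radS_apply, map_mul, pev_linForm,
    dirDeriv, map_sum, pev_C, innerSL_apply_apply, smul_eq_mul, Complex.ofRealCLM_apply,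
    PiLp.proj_apply, Complex.real_smul]
  rw [real_inner_comm]
  simp
  ring

theorem linForm_basis {n : ℕ} (i : Fin n) :
    linForm (EuclideanSpace.basisFun (Fin n) ℝ i) = MvPolynomial.X i := by
  unfold linForm
  rw [Finset.sum_eq_single i]
  · simp
  · intro j _ hj; simp [hj]
  · simp

theorem dirDeriv_basis {n : ℕ} (i : Fin n) (p : MvPolynomial (Fin n) ℂ) :
    dirDeriv (EuclideanSpace.basisFun (Fin n) ℝ i) p = MvPolynomial.pderiv i p := by
  unfold dirDeriv
  rw [Finset.sum_eq_single i]
  · simp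
  · intro j _ hj; simp [hj]
  · simp

theorem polyLaplacian_apply {n : ℕ} (p : MvPolynomial (Fin n) ℂ) :
    polyLaplacian n p = ∑ i, MvPolynomial.pderiv i (MvPolynomial.pderiv i p) := by
  simp [polyLaplacian]

/-- The radial part of the Laplacian on solid harmonics of degree `j`. -/
def Profile.lap (n j : ℕ) (u : Profile) : Profile :=
  u.der.der.mulLeft (fun ρ => 4 * ρ) (contDiff_const.mul contDiff_id) +
    ((2 * n + 4 * j : ℝ)) • u.der

/-- Harmonicity removes Δp and Euler's identity ∑ x_i ∂_i p = j p turns the cross terms into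
multiples of p, so only the profile changes: in ρ = |x|² the Laplacian becomes 4ρ∂² + (2n + 4j)∂. -/
theorem laplacian_radS {n j : ℕ} {p : MvPolynomial (Fin n) ℂ} (hp : p ∈ solidHarmonics n j)
    (u : Profile) : Δ (radS p u) = radS p (u.lap n j) := by
  have hh : p.IsHomogeneous j := (MvPolynomial.mem_homogeneousSubmodule j p).mp hp.1
  have hl : ∑ i, MvPolynomial.pderiv i (MvPolynomial.pderiv i p) = 0 := by
    rw [← polyLaplacian_apply]; exact hp.2
  rw [SchwartzMap.laplacian_eq_sum (EuclideanSpace.basisFun (Fin n) ℝ)]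
  simp only [lineDeriv_radS, LineDeriv.lineDerivOp_add, linForm_basis, dirDeriv_basis]
  ext x
  simp only [sum_apply, add_apply, radS_apply, Derivation.leibniz,
    smul_eq_mul, map_add, map_mul, MvPolynomial.pderiv_X_self, pev_X, map_one]
  have hl' : ∑ i, pev x (MvPolynomial.pderiv i (MvPolynomial.pderiv i p)) = 0 := by
    rw [← map_sum, hl, map_zero]
  have he : ∑ i, (x i : ℂ) * pev x (MvPolynomial.pderiv i p) = j * pev x p := by
    have := congrArg (pev x) hh.sum_X_mul_pderiv
    simpa using this
  have hn : ∑ i, (x i : ℂ) * (x i : ℂ) = ((‖x‖ ^ 2 : ℝ) : ℂ) := by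
    rw [EuclideanSpace.norm_sq_eq]; simp [pow_two]
  have key : ∀ a b c : ℂ, ∑ i, (pev x (MvPolynomial.pderiv i (MvPolynomial.pderiv i p)) * a +
      (x i : ℂ) * pev x (MvPolynomial.pderiv i p) * b +
      (((x i : ℂ) * pev x (MvPolynomial.pderiv i p) + pev x p * 1) * b +
      (x i : ℂ) * ((x i : ℂ) * pev x p) * c)) =
      pev x p * ((2 * j + n) * b + ((‖x‖ ^ 2 : ℝ) : ℂ) * c) := by
    intro a b c
    simp only [Finset.sum_add_distrib, ← Finset.sum_mul, hl', he, ← mul_assoc, hn]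
    simp
    ring
  have h3 : ((2 : ℝ) • ((2 : ℝ) • u.der).der : ℝ → ℝ) (‖x‖ ^ 2) = 4 * u.der.der (‖x‖ ^ 2) := by
    have : (((2 : ℝ) • u.der).der : ℝ → ℝ) (‖x‖ ^ 2) = 2 * u.der.der (‖x‖ ^ 2) := by
      have h := (u.der.hasDerivAt (‖x‖ ^ 2)).const_mul 2
      exact h.deriv
    simp [this]; ring
  erw [key]
  have h3' : (((2 : ℝ) • ((2 : ℝ) • u.der).der : Profile) : ℝ → ℝ) (‖x‖ ^ 2) =
    4 * u.der.der (‖x‖ ^ 2) := h3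
  rw [h3']
  rw [show (u.lap n j) (‖x‖ ^ 2) = 4 * ‖x‖ ^ 2 * u.der.der (‖x‖ ^ 2) + (2 * n + 4 * j) * u.der (‖x‖ ^ 2)
    from rfl, show ((2 : ℝ) • u.der) (‖x‖ ^ 2) = 2 * u.der (‖x‖ ^ 2) from rfl]
  push_cast
  ring

end RoughPDO
end

noncomputable section
namespace RoughPDO

open scoped LineDeriv Laplacian

/-! ### Decomposition of polynomials into harmonics -/

-- Leibniz: Δ|x|² = 2n, and the cross term is 4 ∑ x_i ∂_i p = 4m p by Euler's identity.
open MvPolynomial in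
theorem polyLaplacian_normSqPoly_mul {n m : ℕ} {p : MvPolynomial (Fin n) ℂ}
    (hp : p.IsHomogeneous m) :
    polyLaplacian n (normSqPoly n * p) =
      C (2 * n + 4 * m : ℂ) * p + normSqPoly n * polyLaplacian n p := by
  have h1 : ∀ i : Fin n, pderiv i (normSqPoly n) = C 2 * X i := by
    intro i
    rw [normSqPoly, map_sum, Finset.sum_eq_single i]
    · simp [pderiv_X_self, show (C 2 : MvPolynomial (Fin n) ℂ) = 2 from map_ofNat C 2]
    · intro j _ hj; simp [pderiv_X_of_ne hj]
    · simp
  have h2 := hp.sum_X_mul_pderiv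
  rw [polyLaplacian_apply, polyLaplacian_apply]
  have h3 : ∀ i : Fin n, pderiv i (pderiv i (normSqPoly n * p)) =
      C 2 * p + C 4 * (X i * pderiv i p) + normSqPoly n * pderiv i (pderiv i p) := by
    intro i
    simp only [Derivation.leibniz, smul_eq_mul, h1, map_add, pderiv_X_self, pderiv_C]
    rw [show (C 4 : MvPolynomial (Fin n) ℂ) = C 2 * C 2 by rw [← C_mul]; norm_num,
      show (C 2 : MvPolynomial (Fin n) ℂ) = 2 from map_ofNat C 2]
    ring
  simp only [h3, Finset.sum_add_distrib, ← Finset.mul_sum, h2]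
  simp
  ring

theorem isHomogeneous_normSqPoly (n : ℕ) : (normSqPoly n).IsHomogeneous 2 := by
  refine MvPolynomial.IsHomogeneous.sum _ _ _ fun i _ => ?_
  simpa using (MvPolynomial.isHomogeneous_X ℂ i).pow 2

-- Each factor |x|² is moved through Δ by the preceding identity. The constant does not vanish when
-- n > 0, which allows Δ to be inverted on the products |x|^{2k} h.
open MvPolynomial in
theorem polyLaplacian_normSqPoly_pow_mul {n j : ℕ} {h : MvPolynomial (Fin n) ℂ}
    (hh : h ∈ solidHarmonics n j) (k : ℕ) :
    polyLaplacian n (normSqPoly n ^ (k + 1) * h) =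
      C (2 * (k + 1) * (2 * k + n + 2 * j) : ℂ) * (normSqPoly n ^ k * h) := by
  have hhom : h.IsHomogeneous j := (mem_homogeneousSubmodule j h).mp hh.1
  have hk : ∀ k, (normSqPoly n ^ k * h).IsHomogeneous (2 * k + j) := fun k =>
    ((isHomogeneous_normSqPoly n).pow k).mul hhom
  induction k with
  | zero =>
    have h0 := polyLaplacian_normSqPoly_mul (hk 0)
    have h1 : polyLaplacian n h = 0 := hh.2
    simp only [pow_zero, one_mul, h1, mul_zero, add_zero] at h0
    simp only [pow_zero, one_mul, zero_add, pow_one, h0]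
    congr 2; push_cast; ring
  | succ k ih =>
    rw [pow_succ', mul_assoc, polyLaplacian_normSqPoly_mul (hk (k + 1)), ih]
    rw [show normSqPoly n * (C (2 * (k + 1) * (2 * k + n + 2 * j) : ℂ) * (normSqPoly n ^ k * h)) =
      C (2 * (k + 1) * (2 * k + n + 2 * j) : ℂ) * (normSqPoly n ^ (k + 1) * h) by ring,
      ← add_mul, ← C_add]
    congr 2; push_cast; ring

/-- The span of the products `|x|^{2k} h` of degree `m` with `h` harmonic. -/
def harmonicSpan (n m : ℕ) : Submodule ℂ (MvPolynomial (Fin n) ℂ) :=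
  Submodule.span ℂ {p | ∃ k j : ℕ, ∃ h ∈ solidHarmonics n j, 2 * k + j = m ∧
    p = normSqPoly n ^ k * h}

-- On a generator |x|^{2k} h, a multiple of |x|^{2k+2} h is a preimage; linearity does the rest.
open MvPolynomial in
theorem exists_laplacian_lift {n : ℕ} (hn : 0 < n) {m : ℕ} {q : MvPolynomial (Fin n) ℂ}
    (hq : q ∈ harmonicSpan n m) :
    ∃ q' ∈ harmonicSpan n (m + 2), polyLaplacian n q' = q := by
  induction hq using Submodule.span_induction with
  | mem p hp =>
    obtain ⟨k, j, h, hh, hkj, rfl⟩ := hp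
    have hc : (2 * (k + 1) * (2 * k + n + 2 * j) : ℂ) ≠ 0 := by
      have : ((2 * (k + 1) * (2 * k + n + 2 * j) : ℕ) : ℂ) ≠ 0 := by
        rw [Nat.cast_ne_zero]; positivity
      simpa using this
    refine ⟨(2 * (k + 1) * (2 * k + n + 2 * j) : ℂ)⁻¹ • (normSqPoly n ^ (k + 1) * h),
      Submodule.smul_mem _ _ (Submodule.subset_span ⟨k + 1, j, h, hh, by omega, rfl⟩), ?_⟩
    rw [map_smul, polyLaplacian_normSqPoly_pow_mul hh, ← smul_eq_C_mul, smul_smul,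
      inv_mul_cancel₀ hc, one_smul]
  | zero => exact ⟨0, Submodule.zero_mem _, map_zero _⟩
  | add p q _ _ hp hq =>
    obtain ⟨p', hp', rfl⟩ := hp
    obtain ⟨q', hq', rfl⟩ := hq
    exact ⟨p' + q', Submodule.add_mem _ hp' hq', map_add _ _ _⟩
  | smul c p _ hp =>
    obtain ⟨p', hp', rfl⟩ := hp
    exact ⟨c • p', Submodule.smul_mem _ c hp', map_smul _ _ _⟩

open MvPolynomial in
theorem isHomogeneous_of_mem_harmonicSpan {n m : ℕ} {q : MvPolynomial (Fin n) ℂ}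
    (hq : q ∈ harmonicSpan n m) : q.IsHomogeneous m := by
  rw [← mem_homogeneousSubmodule]
  refine Submodule.span_le.mpr ?_ hq
  rintro p ⟨k, j, h, hh, hkj, rfl⟩
  have hhom : h.IsHomogeneous j := (mem_homogeneousSubmodule j h).mp hh.1
  rw [SetLike.mem_coe, mem_homogeneousSubmodule, ← hkj]
  exact ((isHomogeneous_normSqPoly n).pow k).mul hhom

-- Induction on the degree: Δp has degree m - 2, hence lies in the span and equals Δq with q in the
-- span of degree m. Then p - q is harmonic, and p = (p - q) + q.
open MvPolynomial in
theorem mem_harmonicSpan {n : ℕ} (hn : 0 < n) (m : ℕ) :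
    ∀ p : MvPolynomial (Fin n) ℂ, p.IsHomogeneous m → p ∈ harmonicSpan n m := by
  induction m using Nat.strong_induction_on with
  | _ m ih =>
    intro p hp
    have hlift : ∃ q ∈ harmonicSpan n m, polyLaplacian n q = polyLaplacian n p := by
      -- In degree 0 or 1 the Laplacian vanishes and p is harmonic already; this also keeps the
      -- subtraction m - 2 honest.
      rcases lt_or_ge m 2 with hm | hm
      · refine ⟨0, Submodule.zero_mem _, ?_⟩
        rw [map_zero, polyLaplacian_apply]
        symm
        refine Finset.sum_eq_zero fun i _ => ?_
        have h1 : (pderiv i p).IsHomogeneous 0 := by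
          have := hp.pderiv (i := i)
          rwa [show m - 1 = 0 by omega] at this
        rw [← totalDegree_zero_iff_isHomogeneous] at h1
        rw [totalDegree_eq_zero_iff_eq_C.mp h1, pderiv_C]
      · have hL : (polyLaplacian n p).IsHomogeneous (m - 2) := by
          rw [polyLaplacian_apply]
          refine IsHomogeneous.sum _ _ _ fun i _ => ?_
          exact (hp.pderiv (i := i)).pderiv (i := i)
        obtain ⟨q, hq, hqp⟩ := exists_laplacian_lift hn (ih (m - 2) (by omega) _ hL)
        rw [show m - 2 + 2 = m by omega] at hq
        exact ⟨q, hq, hqp⟩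
    obtain ⟨q, hq, hqp⟩ := hlift
    have h1 : p - q ∈ harmonicSpan n m := by
      refine Submodule.subset_span ⟨0, m, p - q, ⟨?_, ?_⟩, by omega, by simp⟩
      · exact (mem_homogeneousSubmodule m _).mpr (hp.sub (isHomogeneous_of_mem_harmonicSpan hq))
      · change polyLaplacian n (p - q) = 0
        rw [map_sub, hqp, sub_self]
    simpa using Submodule.add_mem _ h1 hq

open MvPolynomial in
/-- On the sphere, a polynomial of degree at most `M` is a sum of harmonics of degree at most
`M`. -/
theorem exists_harmonic_decomposition {n : ℕ} (hn : 0 < n) {M : ℕ}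
    (p : MvPolynomial (Fin n) ℂ) (hp : p.totalDegree ≤ M) :
    ∃ h : ℕ → MvPolynomial (Fin n) ℂ, (∀ j, h j ∈ solidHarmonics n j) ∧
      ∀ x : E n, ‖x‖ = 1 → pev x p = ∑ j ∈ Finset.range (M + 1), pev x (h j) := by
  let V : Submodule ℂ (MvPolynomial (Fin n) ℂ) :=
    { carrier := {p | ∃ h : ℕ → MvPolynomial (Fin n) ℂ, (∀ j, h j ∈ solidHarmonics n j) ∧
        ∀ x : E n, ‖x‖ = 1 → pev x p = ∑ j ∈ Finset.range (M + 1), pev x (h j)}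
      zero_mem' := ⟨0, fun j => Submodule.zero_mem _, fun x _ => by simp⟩
      add_mem' := by
        rintro p q ⟨h, hh, hp⟩ ⟨k, hk, hq⟩
        exact ⟨h + k, fun j => Submodule.add_mem _ (hh j) (hk j), fun x hx => by
          simp [hp x hx, hq x hx, Finset.sum_add_distrib]⟩
      smul_mem' := by
        rintro c p ⟨h, hh, hp⟩
        exact ⟨c • h, fun j => Submodule.smul_mem _ c (hh j), fun x hx => by
          simp [hp x hx, Finset.mul_sum]⟩ }
  have hV : ∀ m ≤ M, harmonicSpan n m ≤ V := by
    intro m hm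
    refine Submodule.span_le.mpr ?_
    rintro p ⟨k, j, h, hh, hkj, rfl⟩
    -- On the unit sphere the factor `normSqPoly n ^ k` equals 1, so |x|^{2k} h contributes h alone,
    -- in degree j ≤ M.
    refine ⟨fun i => if i = j then h else 0, fun i => ?_, fun x hx => ?_⟩
    · dsimp only
      split_ifs with hij
      · exact hij ▸ hh
      · exact Submodule.zero_mem _
    · rw [Finset.sum_eq_single j]
      · simp [pev_normSqPoly, hx]
      · intro b _ hb; simp [hb]
      · intro hj; simp at hj; omega
  have : p ∈ V := by
    rw [← sum_homogeneousComponent p]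
    refine Submodule.sum_mem _ fun i hi => hV i ?_ (mem_harmonicSpan hn i _
      (homogeneousComponent_isHomogeneous i p))
    simp at hi; omega
  exact this

/-! ### Conjugation of polynomials -/

/-- The polynomial with conjugated coefficients. -/
def conjPoly {n : ℕ} (p : MvPolynomial (Fin n) ℂ) : MvPolynomial (Fin n) ℂ :=
  MvPolynomial.map (starRingEnd ℂ) p

theorem pev_conjPoly {n : ℕ} (x : E n) (p : MvPolynomial (Fin n) ℂ) :
    pev x (conjPoly p) = (starRingEnd ℂ) (pev x p) := by
  induction p using MvPolynomial.induction_on with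
  | C a => simp [conjPoly]
  | add p q hp hq => simp only [conjPoly, map_add] at *; rw [hp, hq]
  | mul_X p i hp => simp only [conjPoly, map_mul, MvPolynomial.map_X, pev_X] at *; simp [hp]

theorem conjPoly_mem_solidHarmonics {n j : ℕ} {p : MvPolynomial (Fin n) ℂ}
    (hp : p ∈ solidHarmonics n j) : conjPoly p ∈ solidHarmonics n j := by
  refine ⟨?_, ?_⟩
  · exact (MvPolynomial.mem_homogeneousSubmodule _ _).mpr
      (((MvPolynomial.mem_homogeneousSubmodule _ _).mp hp.1).map _)
  · have h : polyLaplacian n p = 0 := hp.2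
    change polyLaplacian n (conjPoly p) = 0
    rw [polyLaplacian_apply]
    rw [polyLaplacian_apply] at h
    simp only [conjPoly, MvPolynomial.pderiv_map]
    rw [← map_sum, h, map_zero]

theorem isHomogeneous_of_mem_solidHarmonics {n j : ℕ} {p : MvPolynomial (Fin n) ℂ}
    (hp : p ∈ solidHarmonics n j) : p.IsHomogeneous j :=
  (MvPolynomial.mem_homogeneousSubmodule j p).mp hp.1

theorem pev_smul_of_isHomogeneous {n j : ℕ} {p : MvPolynomial (Fin n) ℂ} (hp : p.IsHomogeneous j)
    (r : ℝ) (x : E n) : pev (r • x) p = (r : ℂ) ^ j * pev x p := by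
  simp only [pev, PiLp.smul_apply, smul_eq_mul, Complex.ofReal_mul]
  rw [MvPolynomial.aeval_def, MvPolynomial.eval₂_eq, MvPolynomial.aeval_def, MvPolynomial.eval₂_eq,
    Finset.mul_sum]
  refine Finset.sum_congr rfl fun d hd => ?_
  have hd' : ∑ i ∈ d.support, d i = j := by
    have := hp (MvPolynomial.mem_support_iff.mp hd)
    rw [Finsupp.weight_apply, Finsupp.sum] at this
    simpa using this
  simp only [mul_pow, Finset.prod_mul_distrib, Finset.prod_pow_eq_pow_sum]
  rw [hd']
  ring

/-! ### Polar coordinates -/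

/-- The radial measure `r^{n-1} dr` on `(0, ∞)`. -/
abbrev radMeasure (n : ℕ) : Measure (Set.Ioi (0 : ℝ)) := Measure.volumeIoiPow (n - 1)

/-- The point `ξ/|ξ|` of the sphere, for `ξ ≠ 0`. -/
def dirOf {n : ℕ} (ξ : E n) (h : ξ ≠ 0) : Sph n :=
  ⟨‖ξ‖⁻¹ • ξ, by
    rw [mem_sphere_zero_iff_norm, norm_smul, norm_inv, norm_norm,
      inv_mul_cancel₀ (norm_ne_zero_iff.mpr h)]⟩

theorem measurePreserving_polar (n : ℕ) :
    MeasurePreserving (homeomorphUnitSphereProd (E n))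
      ((volume : Measure (E n)).comap (Subtype.val : ({0}ᶜ : Set (E n)) → E n))
      ((sphMeasure n).prod (radMeasure n)) := by
  have := (volume : Measure (E n)).measurePreserving_homeomorphUnitSphereProd
  simpa using this

theorem volume_compl_zero {n : ℕ} (hn : 0 < n) :
    (volume : Measure (E n)).restrict ({0}ᶜ : Set (E n)) = volume := by
  haveI : Nonempty (Fin n) := ⟨⟨0, hn⟩⟩
  exact MeasureTheory.restrict_compl_singleton _

/-- Polar coordinates are a homeomorphism onto the complement of the origin, which is a null set
because n > 0. -/
theorem map_polar {n : ℕ} (hn : 0 < n) :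
    ((sphMeasure n).prod (radMeasure n)).map (fun z => (z.2 : ℝ) • (z.1 : E n)) = volume := by
  have h1 := measurePreserving_polar n
  have h2 := (h1.symm (homeomorphUnitSphereProd (E n)).toMeasurableEquiv).map_eq
  have h3 : (fun z : Sph n × Set.Ioi (0 : ℝ) => (z.2 : ℝ) • (z.1 : E n)) =
      Subtype.val ∘ ((homeomorphUnitSphereProd (E n)).toMeasurableEquiv.symm) := by
    funext z; simp
  rw [h3, ← Measure.map_map measurable_subtype_coe (MeasurableEquiv.measurable _), h2,
    map_comap_subtype_coe (measurableSet_singleton _).compl, volume_compl_zero hn]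

theorem measurableEmbedding_polar (n : ℕ) :
    MeasurableEmbedding (fun z : Sph n × Set.Ioi (0 : ℝ) => (z.2 : ℝ) • (z.1 : E n)) := by
  have h3 : (fun z : Sph n × Set.Ioi (0 : ℝ) => (z.2 : ℝ) • (z.1 : E n)) =
      Subtype.val ∘ ((homeomorphUnitSphereProd (E n)).toMeasurableEquiv.symm) := by
    funext z; simp
  rw [h3]
  exact (MeasurableEmbedding.subtype_coe (measurableSet_singleton _).compl).comp
    (MeasurableEquiv.measurableEmbedding _)

theorem measurePreserving_polar_map {n : ℕ} (hn : 0 < n) :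
    MeasurePreserving (fun z : Sph n × Set.Ioi (0 : ℝ) => (z.2 : ℝ) • (z.1 : E n))
      ((sphMeasure n).prod (radMeasure n)) volume :=
  ⟨(measurableEmbedding_polar n).measurable, map_polar hn⟩

theorem integral_polar {n : ℕ} (hn : 0 < n) {G : Type*} [NormedAddCommGroup G] [NormedSpace ℝ G]
    (F : E n → G) :
    ∫ x, F x = ∫ z : Sph n × Set.Ioi (0 : ℝ), F ((z.2 : ℝ) • (z.1 : E n))
      ∂((sphMeasure n).prod (radMeasure n)) :=
  ((measurePreserving_polar_map hn).integral_comp (measurableEmbedding_polar n) F).symm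

theorem lintegral_polar {n : ℕ} (hn : 0 < n) (F : E n → ℝ≥0∞) :
    ∫⁻ x, F x = ∫⁻ z : Sph n × Set.Ioi (0 : ℝ), F ((z.2 : ℝ) • (z.1 : E n))
      ∂((sphMeasure n).prod (radMeasure n)) :=
  ((measurePreserving_polar_map hn).lintegral_comp_emb (measurableEmbedding_polar n) F).symm

theorem integrable_polar_iff {n : ℕ} (hn : 0 < n) {G : Type*} [NormedAddCommGroup G]
    (F : E n → G) :
    Integrable F ↔ Integrable (fun z : Sph n × Set.Ioi (0 : ℝ) => F ((z.2 : ℝ) • (z.1 : E n)))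
      ((sphMeasure n).prod (radMeasure n)) :=
  ((measurePreserving_polar_map hn).integrable_comp_emb (measurableEmbedding_polar n)).symm

theorem dirOf_smul {n : ℕ} (θ : Sph n) {r : ℝ} (hr : 0 < r) (h : r • (θ : E n) ≠ 0) :
    dirOf (r • (θ : E n)) h = θ := by
  ext1
  have : ‖(θ : E n)‖ = 1 := mem_sphere_zero_iff_norm.mp θ.2
  simp [dirOf, norm_smul, this, abs_of_pos hr, smul_smul, inv_mul_cancel₀ hr.ne']

theorem norm_sph {n : ℕ} (θ : Sph n) : ‖(θ : E n)‖ = 1 := mem_sphere_zero_iff_norm.mp θ.2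

theorem norm_smul_sph {n : ℕ} (θ : Sph n) {r : ℝ} (hr : 0 < r) : ‖r • (θ : E n)‖ = r := by
  rw [norm_smul, norm_sph, mul_one, Real.norm_of_nonneg hr.le]

theorem smul_sph_ne_zero {n : ℕ} (θ : Sph n) {r : ℝ} (hr : 0 < r) : r • (θ : E n) ≠ 0 := by
  rw [← norm_ne_zero_iff, norm_smul_sph θ hr]; exact hr.ne'

/-- A property that holds almost everywhere on the sphere holds for almost every direction. -/
theorem ae_dirOf {n : ℕ} (hn : 0 < n) {P : Sph n → Prop} (h : ∀ᵐ θ ∂(sphMeasure n), P θ) :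
    ∀ᵐ ξ : E n, ∀ hξ : ξ ≠ 0, P (dirOf ξ hξ) := by
  rw [← (measurePreserving_polar_map hn).map_eq, (measurableEmbedding_polar n).ae_map_iff]
  have h2 : ∀ᵐ z ∂((sphMeasure n).prod (radMeasure n)), P z.1 :=
    (Measure.quasiMeasurePreserving_fst).ae h
  filter_upwards [h2] with z hz hξ
  have := dirOf_smul z.1 z.2.2 hξ
  rw [this]; exact hz

/-! ### Orthogonality of harmonics of different degrees -/

/-- A profile equal to `1` near the origin and nonincreasing. -/
def stepProfile : Profile :=
  ⟨fun ρ => Real.smoothTransition (2 - ρ),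
    Real.smoothTransition.contDiff.comp (contDiff_const.sub contDiff_id),
    fun ρ h => Real.smoothTransition.zero_of_nonpos (by linarith)⟩

theorem stepProfile_one : stepProfile 1 = 1 := by
  change Real.smoothTransition (2 - 1) = 1
  exact Real.smoothTransition.one_of_one_le (by norm_num)

theorem stepProfile_two : stepProfile 2 = 0 := by
  change Real.smoothTransition (2 - 2) = 0
  exact Real.smoothTransition.zero_of_nonpos (by norm_num)

theorem stepProfile_nonneg (ρ : ℝ) : 0 ≤ stepProfile ρ := Real.smoothTransition.nonneg _

theorem stepProfile_der_nonpos (ρ : ℝ) : stepProfile.der ρ ≤ 0 := by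
  have h : Antitone (stepProfile : ℝ → ℝ) := fun a b hab =>
    Real.smoothTransition.monotone (by linarith)
  exact h.deriv_nonpos

/-- Otherwise u² would have zero derivative on (0, ∞), whereas it falls from 1 at ρ = 1 to 0 at ρ =
2. -/
theorem exists_stepProfile_mul_der_ne_zero :
    ∃ ρ : ℝ, 0 < ρ ∧ stepProfile ρ * stepProfile.der ρ ≠ 0 := by
  by_contra! h
  have hd : ∀ ρ, HasDerivAt (fun ρ => stepProfile ρ ^ 2)
      (2 * (stepProfile ρ * stepProfile.der ρ)) ρ := fun ρ => by
    have := (stepProfile.hasDerivAt ρ).fun_pow 2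
    simpa [mul_assoc] using this
  obtain ⟨c, hc, hc'⟩ := exists_hasDerivAt_eq_slope (fun ρ => stepProfile ρ ^ 2)
    (fun ρ => 2 * (stepProfile ρ * stepProfile.der ρ)) (a := 1) (b := 2) (by norm_num)
    (fun x _ => (hd x).continuousAt.continuousWithinAt) (fun x _ => hd x)
  rw [h c (by linarith [hc.1]), stepProfile_one, stepProfile_two] at hc'
  norm_num at hc'

/-- The integral of `|x|^s (u u')(|x|²)` against the radial measure does not vanish. -/
theorem radial_integral_ne_zero {n : ℕ} (hn : 0 < n) (s : ℕ) :
    ∫ r : Set.Ioi (0 : ℝ), (r : ℝ) ^ s * (stepProfile ((r : ℝ) ^ 2) *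
      stepProfile.der ((r : ℝ) ^ 2)) ∂(radMeasure n) ≠ 0 := by
  intro h0
  -- Up to sign and the area of the sphere, the radial integral is the integral over ℝⁿ of this
  -- continuous function. It is nonnegative since u ≥ 0 ≥ u', and it is positive somewhere.
  set F : E n → ℝ := fun x => ‖x‖ ^ s * (stepProfile (‖x‖ ^ 2) * -stepProfile.der (‖x‖ ^ 2)) with hF
  have hint : ∫ x, F x = 0 := by
    rw [integral_polar hn]
    have : ∀ z : Sph n × Set.Ioi (0 : ℝ), F ((z.2 : ℝ) • (z.1 : E n)) =
        (-1 : ℝ) * ((z.2 : ℝ) ^ s * (stepProfile ((z.2 : ℝ) ^ 2) *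
          stepProfile.der ((z.2 : ℝ) ^ 2))) := by
      intro z
      simp only [hF, norm_smul_sph z.1 z.2.2]; ring
    simp_rw [this]
    rw [integral_prod_mul (fun _ => (-1 : ℝ)) (fun r : Set.Ioi (0 : ℝ) =>
      (r : ℝ) ^ s * (stepProfile ((r : ℝ) ^ 2) * stepProfile.der ((r : ℝ) ^ 2))), h0, mul_zero]
  have hcont : Continuous F := by
    have h1 := stepProfile.contDiff.continuous
    have h2 := stepProfile.der.contDiff.continuous
    fun_prop
  obtain ⟨ρ, hρ, hne⟩ := exists_stepProfile_mul_der_ne_zero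
  have hpos : 0 < ∫ x, F x := by
    refine Continuous.integral_pos_of_hasCompactSupport_nonneg_nonzero
      (x := √ρ • EuclideanSpace.basisFun (Fin n) ℝ ⟨0, hn⟩) hcont ?_ ?_ ?_
    · refine HasCompactSupport.intro (isCompact_closedBall (0 : E n) 3) fun x hx => ?_
      have : 3 < ‖x‖ := by simpa using hx
      simp only [hF]
      rw [stepProfile.eq_zero (by nlinarith)]; simp
    · intro x
      simp only [hF, Pi.zero_apply]
      exact mul_nonneg (by positivity) (mul_nonneg (stepProfile_nonneg _)
        (by linarith [stepProfile_der_nonpos (‖x‖ ^ 2)]))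
    · have : ‖√ρ • EuclideanSpace.basisFun (Fin n) ℝ ⟨0, hn⟩‖ = √ρ := by
        rw [norm_smul]; simp
      simp only [hF, this, Real.sq_sqrt hρ.le]
      have := Real.sqrt_pos.mpr hρ
      rw [mul_neg]
      exact mul_ne_zero (by positivity) (neg_ne_zero.mpr hne)
  exact hpos.ne' hint

/-- Green's identity for p(x)u(|x|²) and q(x)u(|x|²): the terms with u'' cancel, and in polar
coordinates what remains is 4(k - j) ∫ p q over the sphere times the radial integral of r^{j+k} u
u'. The latter is nonzero. This avoids any Laplacian on the sphere. -/
theorem integral_mul_eq_zero_of_ne {n : ℕ} (hn : 0 < n) {j k : ℕ} (hjk : j ≠ k)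
    {p q : MvPolynomial (Fin n) ℂ} (hp : p ∈ solidHarmonics n j) (hq : q ∈ solidHarmonics n k) :
    ∫ θ : Sph n, pev (θ : E n) p * pev (θ : E n) q ∂(sphMeasure n) = 0 := by
  have h := SchwartzMap.integral_mul_laplacian_right_eq_left (radS p stepProfile)
    (radS q stepProfile) (μ := (volume : Measure (E n)))
  rw [laplacian_radS hp, laplacian_radS hq] at h
  have h2 : ∫ x : E n, ((radS p stepProfile) x * (radS q (stepProfile.lap n k)) x -
      (radS p (stepProfile.lap n j)) x * (radS q stepProfile) x) = 0 := by
    rw [integral_sub, h, sub_self]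
    · exact ((radS p stepProfile).pairing (ContinuousLinearMap.mul ℝ ℂ)
        (radS q (stepProfile.lap n k))).integrable
    · exact ((radS p (stepProfile.lap n j)).pairing (ContinuousLinearMap.mul ℝ ℂ)
        (radS q stepProfile)).integrable
  rw [integral_polar hn] at h2
  have h3 : ∀ z : Sph n × Set.Ioi (0 : ℝ),
      (radS p stepProfile) ((z.2 : ℝ) • (z.1 : E n)) *
        (radS q (stepProfile.lap n k)) ((z.2 : ℝ) • (z.1 : E n)) -
      (radS p (stepProfile.lap n j)) ((z.2 : ℝ) • (z.1 : E n)) *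
        (radS q stepProfile) ((z.2 : ℝ) • (z.1 : E n)) =
      (4 * ((k : ℂ) - j) * (pev (z.1 : E n) p * pev (z.1 : E n) q)) *
        (((z.2 : ℝ) ^ (j + k) * (stepProfile ((z.2 : ℝ) ^ 2) *
          stepProfile.der ((z.2 : ℝ) ^ 2)) : ℝ) : ℂ) := by
    intro z
    have e : ∀ i ρ, (stepProfile.lap n i) ρ = 4 * ρ * stepProfile.der.der ρ +
      (2 * n + 4 * i) * stepProfile.der ρ := fun _ _ => rfl
    simp only [radS_apply, norm_smul_sph z.1 z.2.2, e,
      pev_smul_of_isHomogeneous (isHomogeneous_of_mem_solidHarmonics hp),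
      pev_smul_of_isHomogeneous (isHomogeneous_of_mem_solidHarmonics hq)]
    push_cast
    ring
  simp_rw [h3] at h2
  rw [integral_prod_mul (fun θ : Sph n => 4 * ((k : ℂ) - j) * (pev (θ : E n) p * pev (θ : E n) q))
    (fun r : Set.Ioi (0 : ℝ) => (((r : ℝ) ^ (j + k) * (stepProfile ((r : ℝ) ^ 2) *
          stepProfile.der ((r : ℝ) ^ 2)) : ℝ) : ℂ)), integral_const_mul, integral_complex_ofReal] at h2
  have hne := radial_integral_ne_zero hn (j + k)
  rcases mul_eq_zero.mp h2 with h4 | h4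
  · rcases mul_eq_zero.mp h4 with h5 | h5
    · exfalso
      have : (k : ℂ) = j := by
        rcases mul_eq_zero.mp h5 with h6 | h6
        · norm_num at h6
        · exact sub_eq_zero.mp h6
      exact hjk (by exact_mod_cast this.symm)
    · exact h5
  · exact absurd (by exact_mod_cast h4) hne

theorem integral_mul_conj_eq_zero_of_ne {n : ℕ} (hn : 0 < n) {j k : ℕ} (hjk : j ≠ k)
    {p q : MvPolynomial (Fin n) ℂ} (hp : p ∈ solidHarmonics n j) (hq : q ∈ solidHarmonics n k) :
    ∫ θ : Sph n, pev (θ : E n) p * (starRingEnd ℂ) (pev (θ : E n) q) ∂(sphMeasure n) = 0 := by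
  simpa only [pev_conjPoly] using
    integral_mul_eq_zero_of_ne hn hjk hp (conjPoly_mem_solidHarmonics hq)

theorem continuous_pev_sph {n : ℕ} (p : MvPolynomial (Fin n) ℂ) :
    Continuous (fun θ : Sph n => pev (θ : E n) p) :=
  (continuous_pev p).comp continuous_subtype_val

theorem integrable_sph_of_continuous {n : ℕ} {G : Type*} [NormedAddCommGroup G] {f : Sph n → G}
    (hf : Continuous f) : Integrable f (sphMeasure n) :=
  hf.integrable_of_hasCompactSupport (HasCompactSupport.of_compactSpace f)

/-- Pythagoras for sums of harmonics of different degrees. -/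
theorem integral_norm_sq_sum_harmonics {n : ℕ} (hn : 0 < n) (M : ℕ)
    {h : ℕ → MvPolynomial (Fin n) ℂ} (hh : ∀ j, h j ∈ solidHarmonics n j) (c : ℕ → ℂ) :
    ∫ θ : Sph n, ‖∑ j ∈ Finset.range M, c j * pev (θ : E n) (h j)‖ ^ 2 ∂(sphMeasure n) =
      ∑ j ∈ Finset.range M, ‖c j‖ ^ 2 * ∫ θ : Sph n, ‖pev (θ : E n) (h j)‖ ^ 2 ∂(sphMeasure n) := by
  have hint : ∀ i j, Integrable (fun θ : Sph n =>
      (c i * (starRingEnd ℂ) (c j)) * (pev (θ : E n) (h i) * (starRingEnd ℂ) (pev (θ : E n) (h j))))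
      (sphMeasure n) := fun i j => integrable_sph_of_continuous <| by
    have h1 := continuous_pev_sph (h i)
    have h2 := continuous_pev_sph (h j)
    exact continuous_const.mul (h1.mul (Complex.continuous_conj.comp h2))
  have key : ∫ θ : Sph n, ((‖∑ j ∈ Finset.range M, c j * pev (θ : E n) (h j)‖ ^ 2 : ℝ) : ℂ)
      ∂(sphMeasure n) = ∑ j ∈ Finset.range M, ((‖c j‖ ^ 2 : ℝ) : ℂ) *
        ∫ θ : Sph n, ((‖pev (θ : E n) (h j)‖ ^ 2 : ℝ) : ℂ) ∂(sphMeasure n) := by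
    have e1 : ∀ θ : Sph n, ((‖∑ j ∈ Finset.range M, c j * pev (θ : E n) (h j)‖ ^ 2 : ℝ) : ℂ) =
        ∑ i ∈ Finset.range M, ∑ j ∈ Finset.range M, (c i * (starRingEnd ℂ) (c j)) *
          (pev (θ : E n) (h i) * (starRingEnd ℂ) (pev (θ : E n) (h j))) := by
      intro θ
      push_cast
      rw [← Complex.mul_conj', map_sum, Finset.sum_mul_sum]
      refine Finset.sum_congr rfl fun i _ => Finset.sum_congr rfl fun j _ => ?_
      rw [map_mul]; ring
    simp_rw [e1]
    rw [integral_finsetSum _ fun i _ => integrable_finsetSum _ fun j _ => hint i j]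
    refine Finset.sum_congr rfl fun i hi => ?_
    rw [integral_finsetSum _ fun j _ => hint i j, Finset.sum_eq_single i]
    · rw [integral_const_mul]
      congr 1
      · rw [Complex.mul_conj']; push_cast; rfl
      · refine integral_congr_ae (Filter.Eventually.of_forall fun θ => ?_)
        simp only [Complex.mul_conj']; push_cast; rfl
    · intro j _ hj
      rw [integral_const_mul, integral_mul_conj_eq_zero_of_ne hn hj.symm (hh i) (hh j), mul_zero]
    · intro h; exact absurd hi h
  simp only [integral_complex_ofReal] at key
  exact_mod_cast key

end RoughPDO
end

noncomputable section
namespace RoughPDO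

open scoped LineDeriv Laplacian

/-! ### Annular profiles -/

/-- Smooth functions on `ℝ` supported in `[1/10, 6]`. -/
def annProfileSubmodule : Submodule ℝ (ℝ → ℝ) where
  carrier := {u | ContDiff ℝ ∞ u ∧ (∀ ρ, 6 < ρ → u ρ = 0) ∧ ∀ ρ, ρ < 1 / 10 → u ρ = 0}
  zero_mem' := ⟨contDiff_const, fun _ _ => rfl, fun _ _ => rfl⟩
  add_mem' := fun {u v} hu hv => ⟨hu.1.add hv.1, fun ρ h => by simp [hu.2.1 ρ h, hv.2.1 ρ h],
    fun ρ h => by simp only [Pi.add_apply, hu.2.2 ρ h, hv.2.2 ρ h, add_zero]⟩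
  smul_mem' := fun c u hu => ⟨contDiff_const.smul hu.1, fun ρ h => by simp [hu.2.1 ρ h],
    fun ρ h => by simp only [Pi.smul_apply, hu.2.2 ρ h, smul_zero]⟩

/-- The type of smooth functions on `ℝ` supported in `[1/10, 6]`. -/
def AnnProfile : Type := annProfileSubmodule

instance : AddCommGroup AnnProfile := inferInstanceAs (AddCommGroup annProfileSubmodule)
instance : Module ℝ AnnProfile := inferInstanceAs (Module ℝ annProfileSubmodule)
instance : CoeFun AnnProfile (fun _ => ℝ → ℝ) := ⟨fun u => u.1⟩

namespace AnnProfile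

@[ext] theorem ext {u v : AnnProfile} (h : ∀ ρ, u ρ = v ρ) : u = v :=
  Subtype.ext (funext h)

@[simp] theorem add_apply (u v : AnnProfile) (ρ : ℝ) : (u + v) ρ = u ρ + v ρ := rfl
@[simp] theorem sub_apply (u v : AnnProfile) (ρ : ℝ) : (u - v) ρ = u ρ - v ρ := rfl
@[simp] theorem smul_apply (c : ℝ) (u : AnnProfile) (ρ : ℝ) : (c • u) ρ = c * u ρ := rfl

theorem contDiff (u : AnnProfile) : ContDiff ℝ ∞ (u : ℝ → ℝ) := u.2.1
theorem eq_zero (u : AnnProfile) {ρ : ℝ} (h : 6 < ρ) : u ρ = 0 := u.2.2.1 ρ h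
theorem eq_zero' (u : AnnProfile) {ρ : ℝ} (h : ρ < 1 / 10) : u ρ = 0 := u.2.2.2 ρ h

/-- An annular profile as a profile. -/
def toProfile (u : AnnProfile) : Profile := ⟨u, u.contDiff, u.2.2.1⟩

@[simp] theorem toProfile_apply (u : AnnProfile) (ρ : ℝ) : u.toProfile ρ = u ρ := rfl

/-- Multiplication by a function that is smooth on `(0, ∞)`. -/
def mulOn (f : ℝ → ℝ) (hf : ∀ ρ, 0 < ρ → ContDiffAt ℝ ∞ f ρ) : AnnProfile →ₗ[ℝ] AnnProfile where
  toFun u := ⟨fun ρ => f ρ * u ρ, by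
      refine contDiff_iff_contDiffAt.mpr fun ρ => ?_
      rcases lt_or_ge 0 ρ with h | h
      · exact (hf ρ h).mul u.contDiff.contDiffAt
      · have : (fun ρ => f ρ * u ρ) =ᶠ[nhds ρ] fun _ => 0 := by
          filter_upwards [gt_mem_nhds (show ρ < 1 / 10 by linarith)] with y hy
          rw [u.eq_zero' hy, mul_zero]
        exact contDiffAt_const.congr_of_eventuallyEq this,
    fun ρ h => by simp [u.eq_zero h], fun ρ h => by simp only [u.eq_zero' h, mul_zero]⟩
  map_add' u v := by ext ρ; exact mul_add _ _ _
  map_smul' c u := by ext ρ; exact mul_left_comm _ _ _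

@[simp] theorem mulOn_apply (f : ℝ → ℝ) (hf : ∀ ρ, 0 < ρ → ContDiffAt ℝ ∞ f ρ) (u : AnnProfile)
    (ρ : ℝ) : mulOn f hf u ρ = f ρ * u ρ := rfl

theorem hasDerivAt_aux (u : AnnProfile) (ρ : ℝ) : HasDerivAt u (deriv u ρ) ρ :=
  ((contDiff_infty_iff_deriv.mp u.contDiff).1 ρ).hasDerivAt

/-- The derivative of annular profiles. -/
def der : AnnProfile →ₗ[ℝ] AnnProfile where
  toFun u := ⟨deriv u, (contDiff_infty_iff_deriv.mp u.contDiff).2,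
    fun _ h => deriv_eq_zero_of_eqOn_Ioi u.2.2.1 h, fun _ h => deriv_eq_zero_of_eqOn_Iio u.2.2.2 h⟩
  map_add' u v := by
    ext ρ; exact ((u.hasDerivAt_aux ρ).add (v.hasDerivAt_aux ρ)).deriv
  map_smul' c u := by
    ext ρ; exact ((u.hasDerivAt_aux ρ).const_mul c).deriv

theorem hasDerivAt (u : AnnProfile) (ρ : ℝ) : HasDerivAt u (der u ρ) ρ := u.hasDerivAt_aux ρ

theorem toProfile_der (u : AnnProfile) : u.toProfile.der = (der u).toProfile := rfl

/-- Multiplication of annular profiles by `ρ^s`. -/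
def pw (s : ℝ) : AnnProfile →ₗ[ℝ] AnnProfile :=
  mulOn (fun ρ => ρ ^ s) fun _ h => Real.contDiffAt_rpow_const_of_ne h.ne'

@[simp] theorem pw_apply (s : ℝ) (u : AnnProfile) (ρ : ℝ) : pw s u ρ = ρ ^ s * u ρ := rfl

/-- Multiplication of annular profiles by `1/ρ`. -/
def divOn : AnnProfile →ₗ[ℝ] AnnProfile :=
  mulOn (fun ρ => ρ⁻¹) fun _ h => contDiffAt_inv ℝ h.ne'

@[simp] theorem divOn_apply (u : AnnProfile) (ρ : ℝ) : divOn u ρ = ρ⁻¹ * u ρ := rfl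

theorem ext_pos {u v : AnnProfile} (h : ∀ ρ, 0 < ρ → u ρ = v ρ) : u = v := by
  ext ρ
  rcases lt_or_ge 0 ρ with h0 | h0
  · exact h ρ h0
  · rw [u.eq_zero' (by linarith), v.eq_zero' (by linarith)]

theorem der_pw (s : ℝ) (u : AnnProfile) : der (pw s u) = pw s (der u + s • divOn u) := by
  refine ext_pos fun ρ hρ => ?_
  have h := (Real.hasDerivAt_rpow_const (p := s) (Or.inl hρ.ne')).mul (u.hasDerivAt ρ)
  have h2 : der (pw s u) ρ = _ := h.deriv
  rw [h2]
  simp only [pw_apply, add_apply, smul_apply, divOn_apply, Real.rpow_sub_one hρ.ne']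
  ring

theorem der_divOn (u : AnnProfile) : der (divOn u) = divOn (der u) - divOn (divOn u) := by
  refine ext_pos fun ρ hρ => ?_
  have h := (hasDerivAt_inv hρ.ne').mul (u.hasDerivAt ρ)
  have h2 : der (divOn u) ρ = _ := h.deriv
  rw [h2]
  simp only [sub_apply, divOn_apply]
  field_simp
  ring

/-- The radial part `4ρ∂² + 2n∂` of the Laplacian in the variable `ρ = |x|²`. -/
def radLap (n : ℕ) : AnnProfile →ₗ[ℝ] AnnProfile :=
  mulOn (fun ρ => 4 * ρ) (fun _ _ => (contDiff_const.mul contDiff_id).contDiffAt) ∘ₗ der ∘ₗ der +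
    (2 * n : ℝ) • der

/-- The factor ρ^{-j/2} turns a homogeneous p of degree j into p(x/|x|). After this conjugation the
degree enters only through the term of order zero j(j+n-2)/ρ, the eigenvalue of the spherical
Laplacian, and no longer through the coefficient of ∂. -/
theorem lap_pw (n j : ℕ) (u : AnnProfile) {ρ : ℝ} (hρ : 0 < ρ) :
    (pw (-(j : ℝ) / 2) u).toProfile.lap n j ρ =
      pw (-(j : ℝ) / 2) (radLap n u - (j * (j + n - 2) : ℝ) • divOn u) ρ := by
  have e : (pw (-(j : ℝ) / 2) u).toProfile.lap n j ρ =
    4 * ρ * der (der (pw (-(j : ℝ) / 2) u)) ρ + (2 * n + 4 * j) * der (pw (-(j : ℝ) / 2) u) ρ := rfl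
  have e2 : radLap n u ρ = 4 * ρ * der (der u) ρ + 2 * n * der u ρ := rfl
  rw [e, der_pw, der_pw]
  simp only [map_add, map_smul, der_divOn, pw_apply, add_apply, smul_apply, divOn_apply, sub_apply,
    e2]
  field_simp
  ring

theorem bounded (u : AnnProfile) : ∃ C, ∀ ρ, |u ρ| ≤ C := by
  have hc : HasCompactSupport (u : ℝ → ℝ) := by
    refine HasCompactSupport.intro (isCompact_Icc (a := (1 / 10 : ℝ)) (b := 6)) fun ρ h => ?_
    rw [Set.mem_Icc, not_and_or, not_le, not_le] at h
    rcases h with h | h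
    · exact u.eq_zero' h
    · exact u.eq_zero h
  exact hc.exists_bound_of_continuous u.contDiff.continuous

/-- The operator `1 - s (4ρ∂² + 2n∂) + t/ρ`. -/
def helm (n : ℕ) (s t : ℝ) : Module.End ℝ AnnProfile := 1 - s • radLap n + t • divOn

/-- The operator is affine in (s, t) with fixed coefficients `radLap` and `divOn`, and (s, t) ranges
over a bounded set. The uniformity in s and t becomes uniformity in the degree of the polynomials
later on. -/
theorem exists_bound_helm_pow (n : ℕ) (K : ℝ) (b : ℕ) :
    ∀ u : AnnProfile, ∃ C, 0 ≤ C ∧ ∀ s t : ℝ, 0 ≤ s → s ≤ K → 0 ≤ t → t ≤ K →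
      ∀ ρ, |((helm n s t) ^ b) u ρ| ≤ C := by
  induction b with
  | zero =>
    intro u
    obtain ⟨C, hC⟩ := u.bounded
    exact ⟨C, (abs_nonneg _).trans (hC 0), fun s t _ _ _ _ ρ => by simpa using hC ρ⟩
  | succ b ih =>
    intro u
    obtain ⟨C₀, h0, hC₀⟩ := ih u
    obtain ⟨C₁, h1, hC₁⟩ := ih (radLap n u)
    obtain ⟨C₂, h2, hC₂⟩ := ih (divOn u)
    refine ⟨C₀ + |K| * C₁ + |K| * C₂, by positivity, fun s t hs hsK ht htK ρ => ?_⟩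
    -- One factor acts on u first, so the induction hypothesis serves for u, `radLap n u` and `divOn
    -- u`; it is therefore quantified over all profiles.
    have e : ((helm n s t) ^ (b + 1)) u ρ = ((helm n s t) ^ b) u ρ -
        s * ((helm n s t) ^ b) (radLap n u) ρ + t * ((helm n s t) ^ b) (divOn u) ρ := by
      rw [pow_succ, Module.End.mul_apply]
      conv_lhs => rw [show helm n s t u = u - s • radLap n u + t • divOn u from rfl]
      rw [map_add, map_sub, map_smul, map_smul]
      rfl
    rw [e]
    refine (abs_add_le _ _).trans (add_le_add ((abs_sub _ _).trans (add_le_add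
      (hC₀ s t hs hsK ht htK ρ) ?_)) ?_)
    · rw [abs_mul]
      exact mul_le_mul (by rw [abs_of_nonneg hs]; exact hsK.trans (le_abs_self K))
        (hC₁ s t hs hsK ht htK ρ) (abs_nonneg _) (abs_nonneg _)
    · rw [abs_mul]
      exact mul_le_mul (by rw [abs_of_nonneg ht]; exact htK.trans (le_abs_self K))
        (hC₂ s t hs hsK ht htK ρ) (abs_nonneg _) (abs_nonneg _)

end AnnProfile

/-! ### Schwartz functions `Q(x/|x|) v(|x|²)` -/

/-- The Schwartz function `Q(x/|x|) v(|x|²)`. -/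
def annS {n : ℕ} (Q : MvPolynomial (Fin n) ℂ) (v : AnnProfile) : 𝓢(E n, ℂ) :=
  ∑ m ∈ Finset.range (Q.totalDegree + 1),
    radS (MvPolynomial.homogeneousComponent m Q) (AnnProfile.pw (-(m : ℝ) / 2) v).toProfile

/-- At ρ = r² the factor ρ^{-j/2} is r^{-j}, which cancels the homogeneity of p: the function is a
product in polar coordinates. -/
theorem radS_pw_polar {n j : ℕ} {p : MvPolynomial (Fin n) ℂ} (hp : p.IsHomogeneous j)
    (v : AnnProfile) (θ : Sph n) {r : ℝ} (hr : 0 < r) :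
    radS p (AnnProfile.pw (-(j : ℝ) / 2) v).toProfile (r • (θ : E n)) =
      pev (θ : E n) p * ((v (r ^ 2) : ℝ) : ℂ) := by
  rw [radS_apply, norm_smul_sph θ hr, pev_smul_of_isHomogeneous hp]
  simp only [AnnProfile.toProfile_apply, AnnProfile.pw_apply]
  have : (r ^ 2 : ℝ) ^ (-(j : ℝ) / 2) = (r ^ j)⁻¹ := by
    rw [← Real.rpow_natCast r 2, ← Real.rpow_mul hr.le]
    push_cast
    rw [show (2 : ℝ) * (-(j : ℝ) / 2) = -(j : ℝ) by ring, Real.rpow_neg hr.le, Real.rpow_natCast]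
  rw [this]
  have hr' : ((r : ℂ)) ^ j ≠ 0 := pow_ne_zero _ (by exact_mod_cast hr.ne')
  push_cast
  field_simp

theorem annS_polar {n : ℕ} (Q : MvPolynomial (Fin n) ℂ) (v : AnnProfile) (θ : Sph n) {r : ℝ}
    (hr : 0 < r) : annS Q v (r • (θ : E n)) = pev (θ : E n) Q * ((v (r ^ 2) : ℝ) : ℂ) := by
  rw [annS, sum_apply]
  simp only [radS_pw_polar (MvPolynomial.homogeneousComponent_isHomogeneous _ Q) v θ hr]
  rw [← Finset.sum_mul, ← map_sum, MvPolynomial.sum_homogeneousComponent]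

/-- The complement of the origin is dense when n > 0, so identities between Schwartz functions may
be checked in polar coordinates. -/
theorem schwartz_ext_polar {n : ℕ} (hn : 0 < n) {f g : 𝓢(E n, ℂ)}
    (h : ∀ (θ : Sph n) (r : ℝ), 0 < r → f (r • (θ : E n)) = g (r • (θ : E n))) : f = g := by
  haveI : Nonempty (Fin n) := ⟨⟨0, hn⟩⟩
  ext x
  refine congrFun (Continuous.ext_on (dense_compl_singleton (0 : E n)) f.continuous g.continuous
    fun y hy => ?_) x
  have hy' : y ≠ 0 := hy
  have := h (dirOf y hy') ‖y‖ (norm_pos_iff.mpr hy')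
  rwa [show ‖y‖ • (dirOf y hy' : E n) = y by
    simp [dirOf, smul_smul, mul_inv_cancel₀ (norm_ne_zero_iff.mpr hy')]] at this

/-- The operator `f ↦ f - c Δ f`. -/
def helmS {n : ℕ} (c : ℝ) (f : 𝓢(E n, ℂ)) : 𝓢(E n, ℂ) := f - (c : ℂ) • Δ f

theorem helmS_sum {n : ℕ} (c : ℝ) {ι : Type*} (s : Finset ι) (f : ι → 𝓢(E n, ℂ)) :
    helmS c (∑ i ∈ s, f i) = ∑ i ∈ s, helmS c (f i) := by
  have hl : Δ (∑ i ∈ s, f i) = ∑ i ∈ s, Δ (f i) := by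
    have := map_sum (LineDeriv.laplacianCLM ℝ (E n) 𝓢(E n, ℂ)) f s
    simp only [SchwartzMap.laplacianCLM_eq'] at this
    exact this
  rw [helmS, hl, Finset.smul_sum, ← Finset.sum_sub_distrib]
  rfl

theorem fourierInv_lineDeriv_apply {n : ℕ} (w : E n) (f : 𝓢(E n, ℂ)) (z : E n) :
    𝓕⁻ (∂_{w} f) z = -(2 * Real.pi * Complex.I) * (inner ℝ z w : ℝ) * 𝓕⁻ f z := by
  rw [SchwartzMap.fourierInv_lineDerivOp_eq, smul_apply, SchwartzMap.smulLeftCLM_apply_apply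
    (by fun_prop)]
  simp; ring

theorem fourierInv_helmS {n : ℕ} (c : ℝ) (f : 𝓢(E n, ℂ)) (z : E n) :
    𝓕⁻ (helmS c f) z = ((1 + c * (2 * Real.pi * ‖z‖) ^ 2 : ℝ) : ℂ) * 𝓕⁻ f z := by
  have h1 : 𝓕⁻ (Δ f) z = -((2 * Real.pi * ‖z‖) ^ 2 : ℝ) * 𝓕⁻ f z := by
    rw [SchwartzMap.laplacian_eq_sum (EuclideanSpace.basisFun (Fin n) ℝ), FourierTransform.fourierInv_sum,
      sum_apply]
    simp only [fourierInv_lineDeriv_apply]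
    rw [show ((2 * Real.pi * ‖z‖) ^ 2 : ℝ) = (2 * Real.pi) ^ 2 * ∑ i, z i ^ 2 by
      rw [mul_pow, EuclideanSpace.norm_sq_eq]; simp]
    simp only [EuclideanSpace.basisFun_apply, EuclideanSpace.inner_single_right]
    push_cast
    rw [Finset.mul_sum, ← Finset.sum_neg_distrib, Finset.sum_mul]
    refine Finset.sum_congr rfl fun i _ => ?_
    simp
    ring_nf
    simp
  have h2 : 𝓕⁻ (helmS c f) = 𝓕⁻ f - (c : ℂ) • 𝓕⁻ (Δ f) := by
    rw [helmS, sub_eq_add_neg, FourierTransform.fourierInv_add, FourierTransform.fourierInv_neg,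
      FourierTransform.fourierInv_smul, ← sub_eq_add_neg]
  rw [h2, sub_apply, smul_apply, h1, smul_eq_mul]
  push_cast
  ring

theorem fourierInv_helmS_iterate {n : ℕ} (c : ℝ) (b : ℕ) (f : 𝓢(E n, ℂ)) (z : E n) :
    𝓕⁻ ((helmS c)^[b] f) z = ((1 + c * (2 * Real.pi * ‖z‖) ^ 2 : ℝ) : ℂ) ^ b * 𝓕⁻ f z := by
  induction b with
  | zero => simp
  | succ b ih => rw [Function.iterate_succ_apply', fourierInv_helmS, ih, pow_succ']; ring

/-- By `AnnProfile.lap_pw`, 1 - cΔ acts on a harmonic of degree j through its profile alone, the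
spherical eigenvalue appearing as the parameter t = c j(j+n-2). -/
theorem helmS_radS {n j : ℕ} (hn : 0 < n) {p : MvPolynomial (Fin n) ℂ}
    (hp : p ∈ solidHarmonics n j) (c : ℝ) (v : AnnProfile) :
    helmS c (radS p (AnnProfile.pw (-(j : ℝ) / 2) v).toProfile) =
      radS p (AnnProfile.pw (-(j : ℝ) / 2)
        (AnnProfile.helm n c (c * (j * (j + n - 2))) v)).toProfile := by
  refine schwartz_ext_polar hn fun θ r hr => ?_
  have e : AnnProfile.helm n c (c * (j * (j + n - 2))) v =
      v - c • (AnnProfile.radLap n v - (j * (j + n - 2) : ℝ) • AnnProfile.divOn v) := by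
    change v - c • AnnProfile.radLap n v + (c * (j * (j + n - 2))) • AnnProfile.divOn v = _
    module
  rw [helmS, laplacian_radS hp, sub_apply, smul_apply, radS_apply, radS_apply, radS_apply,
    norm_smul_sph θ hr, AnnProfile.lap_pw n j v (by positivity : 0 < r ^ 2), e]
  simp only [AnnProfile.toProfile_apply, AnnProfile.pw_apply, AnnProfile.sub_apply,
    AnnProfile.smul_apply, smul_eq_mul]
  push_cast
  ring

theorem helmS_iterate_radS {n j : ℕ} (hn : 0 < n) {p : MvPolynomial (Fin n) ℂ}
    (hp : p ∈ solidHarmonics n j) (c : ℝ) (b : ℕ) (v : AnnProfile) :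
    (helmS c)^[b] (radS p (AnnProfile.pw (-(j : ℝ) / 2) v).toProfile) =
      radS p (AnnProfile.pw (-(j : ℝ) / 2)
        (((AnnProfile.helm n c (c * (j * (j + n - 2)))) ^ b) v)).toProfile := by
  induction b with
  | zero => simp
  | succ b ih =>
    rw [Function.iterate_succ_apply', ih, helmS_radS hn hp, pow_succ', Module.End.mul_apply]

theorem helmS_iterate_sum {n : ℕ} (c : ℝ) {ι : Type*} (s : Finset ι) (f : ι → 𝓢(E n, ℂ)) (b : ℕ) :
    (helmS c)^[b] (∑ i ∈ s, f i) = ∑ i ∈ s, (helmS c)^[b] (f i) := by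
  induction b with
  | zero => simp
  | succ b ih => simp only [Function.iterate_succ_apply', ih, helmS_sum]

theorem integral_norm_sq_fourierInv {n : ℕ} (f : 𝓢(E n, ℂ)) :
    ∫ z, ‖𝓕⁻ f z‖ ^ 2 = ∫ x, ‖f x‖ ^ 2 := by
  have h := SchwartzMap.integral_norm_sq_fourier (𝓕⁻ f)
  rw [← h]
  simp

/-- A weighted `L²` bound for the inverse Fourier transform of `Q(x/|x|) v(|x|²)`. -/
theorem exists_sobolev_bound {n : ℕ} (hn : 0 < n) (b : ℕ) (v : AnnProfile) :
    ∃ C : ℝ, 0 ≤ C ∧ ∀ N : ℕ, 1 ≤ N → ∀ Q : MvPolynomial (Fin n) ℂ, Q.totalDegree ≤ 4 * N →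
      ∫ z : E n, ‖((1 + ((N : ℝ) ^ 2)⁻¹ * (2 * Real.pi * ‖z‖) ^ 2 : ℝ) : ℂ) ^ b *
        𝓕⁻ (annS Q v) z‖ ^ 2 ≤ C * ∫ θ : Sph n, ‖pev (θ : E n) Q‖ ^ 2 ∂(sphMeasure n) := by
  -- With c = N⁻² and j ≤ 4N one has c j(j+n-2) ≤ 16 + 4n and c ≤ 1, whatever N is: one constant C
  -- serves all N.
  obtain ⟨C, hC0, hC⟩ := AnnProfile.exists_bound_helm_pow n (16 + 4 * n) b v
  -- Profiles vanish for r² > 6, in particular for r > 3.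
  set S : Set (Set.Ioi (0 : ℝ)) := {r | (r : ℝ) ≤ 3} with hS
  have hSm : MeasurableSet S := measurableSet_le measurable_subtype_coe measurable_const
  have hSfin : (radMeasure n) S ≠ ⊤ := by
    refine ne_top_of_le_ne_top ?_ (measure_mono (t := Set.Iio ⟨4, by norm_num⟩) ?_)
    · rw [Measure.volumeIoiPow_apply_Iio]; exact ENNReal.ofReal_ne_top
    · intro r hr
      have : (r : ℝ) ≤ 3 := hr
      have h4 : (r : ℝ) < 4 := by linarith
      exact h4
  refine ⟨C ^ 2 * (radMeasure n).real S, by positivity, fun N hN Q hQ => ?_⟩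
  obtain ⟨h, hh, hQh⟩ := exists_harmonic_decomposition hn Q hQ
  set c : ℝ := ((N : ℝ) ^ 2)⁻¹ with hc
  have hN' : (1 : ℝ) ≤ N := by exact_mod_cast hN
  have hc0 : 0 ≤ c := by positivity
  have hc1 : c ≤ 1 := inv_le_one_of_one_le₀ (by nlinarith)
  have hdec : annS Q v = ∑ j ∈ Finset.range (4 * N + 1),
      radS (h j) (AnnProfile.pw (-(j : ℝ) / 2) v).toProfile := by
    refine schwartz_ext_polar hn fun θ r hr => ?_
    rw [annS_polar Q v θ hr, sum_apply]
    simp only [radS_pw_polar (isHomogeneous_of_mem_solidHarmonics (hh _)) v θ hr]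
    rw [← Finset.sum_mul, hQh θ (norm_sph θ)]
  set w : ℕ → AnnProfile := fun j =>
    ((AnnProfile.helm n c (c * (j * (j + n - 2)))) ^ b) v with hw
  set f := (helmS c)^[b] (annS Q v) with hf
  -- (1 - cΔ)^b keeps every harmonic and only replaces the common profile v by a bounded profile w j
  -- that depends on the degree.
  have hfdec : f = ∑ j ∈ Finset.range (4 * N + 1),
      radS (h j) (AnnProfile.pw (-(j : ℝ) / 2) (w j)).toProfile := by
    rw [hf, hdec, helmS_iterate_sum]
    exact Finset.sum_congr rfl fun j _ => helmS_iterate_radS hn (hh j) c b v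
  have hwb : ∀ j ∈ Finset.range (4 * N + 1), ∀ ρ, |w j ρ| ≤ C := by
    intro j hj
    have hj' : (j : ℝ) ≤ 4 * N := by
      have : j ≤ 4 * N := by simp at hj; omega
      exact_mod_cast this
    have hn1 : (1 : ℝ) ≤ n := by exact_mod_cast hn
    have hj0 : (0 : ℝ) ≤ j := by positivity
    have hjn : 0 ≤ (j : ℝ) * (j + n - 2) := by
      rcases Nat.eq_zero_or_pos j with h0 | h0
      · simp [h0]
      · have : (1 : ℝ) ≤ j := by exact_mod_cast h0
        exact mul_nonneg hj0 (by linarith)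
    refine hC c _ hc0 (by linarith) (mul_nonneg hc0 hjn) ?_
    rw [hc, inv_mul_le_iff₀ (by positivity)]
    calc (j : ℝ) * (j + n - 2) ≤ j * (4 * N + n) :=
          mul_le_mul_of_nonneg_left (by linarith) hj0
      _ ≤ (4 * N) * (4 * N + n) := mul_le_mul_of_nonneg_right hj' (by positivity)
      _ ≤ N ^ 2 * (16 + 4 * n) := by nlinarith [mul_nonneg (by linarith : (0 : ℝ) ≤ n) (by nlinarith : (0 : ℝ) ≤ (N : ℝ) ^ 2 - N)]
  -- The weight is the multiplier of (1 - cΔ)^b, so Plancherel leads to ∫ |f|². On each sphere the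
  -- degrees are orthogonal, and the bound |w j| ≤ C may be applied degree by degree.
  calc ∫ z : E n, ‖((1 + c * (2 * Real.pi * ‖z‖) ^ 2 : ℝ) : ℂ) ^ b * 𝓕⁻ (annS Q v) z‖ ^ 2
      = ∫ z : E n, ‖𝓕⁻ f z‖ ^ 2 := by simp only [hf, fourierInv_helmS_iterate]
    _ = ∫ x : E n, ‖f x‖ ^ 2 := integral_norm_sq_fourierInv f
    _ = ∫ r : Set.Ioi (0 : ℝ), ∫ θ : Sph n, ‖f ((r : ℝ) • (θ : E n))‖ ^ 2
          ∂(sphMeasure n) ∂(radMeasure n) := by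
        rw [integral_polar hn]
        refine integral_prod_symm _ ?_
        exact (integrable_polar_iff hn (fun x => ‖f x‖ ^ 2)).mp
          ((memLp_two_iff_integrable_sq_norm f.continuous.aestronglyMeasurable).mp (f.memLp 2))
    _ ≤ ∫ r : Set.Ioi (0 : ℝ), S.indicator (fun _ => C ^ 2 *
          ∫ θ : Sph n, ‖pev (θ : E n) Q‖ ^ 2 ∂(sphMeasure n)) r ∂(radMeasure n) := by
        refine integral_mono_of_nonneg (Filter.Eventually.of_forall fun r => by positivity)
          ((integrable_indicator_iff hSm).mpr (integrableOn_const hSfin)) 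
          (Filter.Eventually.of_forall fun r => ?_)
        have e : ∀ θ : Sph n, f ((r : ℝ) • (θ : E n)) = ∑ j ∈ Finset.range (4 * N + 1),
            ((w j ((r : ℝ) ^ 2) : ℝ) : ℂ) * pev (θ : E n) (h j) := by
          intro θ
          rw [hfdec, sum_apply]
          refine Finset.sum_congr rfl fun j _ => ?_
          rw [radS_pw_polar (isHomogeneous_of_mem_solidHarmonics (hh _)) _ θ r.2, mul_comm]
        simp only [e]
        rw [integral_norm_sq_sum_harmonics hn _ hh
          (fun j => ((w j ((r : ℝ) ^ 2) : ℝ) : ℂ))]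
        by_cases hr : r ∈ S
        · rw [Set.indicator_of_mem hr]
          have e2 : ∫ θ : Sph n, ‖pev (θ : E n) Q‖ ^ 2 ∂(sphMeasure n) =
              ∑ j ∈ Finset.range (4 * N + 1),
                ∫ θ : Sph n, ‖pev (θ : E n) (h j)‖ ^ 2 ∂(sphMeasure n) := by
            have := integral_norm_sq_sum_harmonics hn (4 * N + 1) hh (fun _ => 1)
            simp only [one_mul, norm_one, one_pow] at this
            rw [← this]
            refine integral_congr_ae (Filter.Eventually.of_forall fun θ => ?_)
            simp only [hQh θ (norm_sph θ)]
          rw [e2, Finset.mul_sum]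
          refine Finset.sum_le_sum fun j hj => ?_
          refine mul_le_mul_of_nonneg_right ?_ (integral_nonneg fun _ => by positivity)
          rw [Complex.norm_real, Real.norm_eq_abs]
          exact pow_le_pow_left₀ (abs_nonneg _) (hwb j hj _) 2
        · rw [Set.indicator_of_notMem hr]
          refine le_of_eq (Finset.sum_eq_zero fun j _ => ?_)
          have : 3 < (r : ℝ) := not_le.mp hr
          rw [(w j).eq_zero (by nlinarith)]
          simp
    _ = C ^ 2 * (radMeasure n).real S * ∫ θ : Sph n, ‖pev (θ : E n) Q‖ ^ 2 ∂(sphMeasure n) := by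
        rw [integral_indicator hSm, setIntegral_const, smul_eq_mul]; ring

/-- The polynomial `∂_w P - ⟨w, x⟩ ∑ x_i ∂_i P`, which on the sphere is the derivative of `P` along
the tangential part of `w`. -/
def tanDeriv {n : ℕ} (w : E n) (P : MvPolynomial (Fin n) ℂ) : MvPolynomial (Fin n) ℂ :=
  dirDeriv w P - linForm w * ∑ i, MvPolynomial.X i * MvPolynomial.pderiv i P

/-- Multiplying by r replaces the exponent m - 1 by m, so that m = 0 needs no separate statement. -/
theorem mul_pev_smul_pderiv {n m : ℕ} {p : MvPolynomial (Fin n) ℂ} (hp : p.IsHomogeneous m)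
    (i : Fin n) (r : ℝ) (x : E n) :
    (r : ℂ) * pev (r • x) (MvPolynomial.pderiv i p) =
      (r : ℂ) ^ m * pev x (MvPolynomial.pderiv i p) := by
  rcases Nat.eq_zero_or_pos m with rfl | hm
  · have : MvPolynomial.pderiv i p = 0 := by
      rw [← MvPolynomial.totalDegree_zero_iff_isHomogeneous] at hp
      rw [MvPolynomial.totalDegree_eq_zero_iff_eq_C.mp hp, MvPolynomial.pderiv_C]
    simp [this]
  · rw [pev_smul_of_isHomogeneous (hp.pderiv (i := i)), ← mul_assoc, ← pow_succ',
      Nat.sub_add_cancel hm]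

theorem sum_mul_homogeneousComponent {n : ℕ} (P : MvPolynomial (Fin n) ℂ) (x : E n) :
    ∑ m ∈ Finset.range (P.totalDegree + 1),
      (m : ℂ) * pev x (MvPolynomial.homogeneousComponent m P) =
    pev x (∑ i, MvPolynomial.X i * MvPolynomial.pderiv i P) := by
  have h : ∑ i, MvPolynomial.X i * MvPolynomial.pderiv i P =
      ∑ m ∈ Finset.range (P.totalDegree + 1), m • MvPolynomial.homogeneousComponent m P := by
    conv_lhs => rw [← MvPolynomial.sum_homogeneousComponent P]
    simp only [map_sum, Finset.mul_sum]
    rw [Finset.sum_comm]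
    exact Finset.sum_congr rfl fun m _ =>
      (MvPolynomial.homogeneousComponent_isHomogeneous m P).sum_X_mul_pderiv
  rw [h, map_sum]
  simp

/-- Decompose w at θ: its radial component ⟨w,θ⟩ differentiates the profile, giving 2r v'(r²), and
its tangential component differentiates the polynomial, giving r⁻¹ `tanDeriv`. Both terms have again
the form `annS`. -/
theorem lineDeriv_annS {n : ℕ} (hn : 0 < n) (w : E n) (P : MvPolynomial (Fin n) ℂ)
    (v : AnnProfile) :
    ∂_{w} (annS P v) = annS (linForm w * P) ((2 : ℝ) • AnnProfile.pw (1 / 2) (AnnProfile.der v)) +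
      annS (tanDeriv w P) (AnnProfile.pw (-1 / 2) v) := by
  have hsum : ∂_{w} (annS P v) = ∑ m ∈ Finset.range (P.totalDegree + 1),
      ∂_{w} (radS (MvPolynomial.homogeneousComponent m P)
        (AnnProfile.pw (-(m : ℝ) / 2) v).toProfile) :=
    map_sum (LineDeriv.lineDerivOpCLM ℝ 𝓢(E n, ℂ) w) _ _
  refine schwartz_ext_polar hn fun θ r hr => ?_
  have hr' : (r : ℂ) ≠ 0 := by exact_mod_cast hr.ne'
  rw [hsum, add_apply, annS_polar _ _ θ hr, annS_polar _ _ θ hr, sum_apply]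
  set P' : ℕ → MvPolynomial (Fin n) ℂ := fun m => MvPolynomial.homogeneousComponent m P with hP'
  have hP'h : ∀ m, (P' m).IsHomogeneous m := fun m =>
    MvPolynomial.homogeneousComponent_isHomogeneous m P
  have hpow : ∀ m : ℕ, (r ^ 2 : ℝ) ^ (-(m : ℝ) / 2) = (r ^ m)⁻¹ := by
    intro m
    rw [← Real.rpow_natCast r 2, ← Real.rpow_mul hr.le]
    push_cast
    rw [show (2 : ℝ) * (-(m : ℝ) / 2) = -(m : ℝ) by ring, Real.rpow_neg hr.le, Real.rpow_natCast]
  have hterm : ∀ m, (∂_{w} (radS (P' m) (AnnProfile.pw (-(m : ℝ) / 2) v).toProfile))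
      (r • (θ : E n)) =
      pev (θ : E n) (dirDeriv w (P' m)) * ((r : ℂ)⁻¹ * ((v (r ^ 2) : ℝ) : ℂ)) +
      pev (θ : E n) (linForm w) * pev (θ : E n) (P' m) *
        (2 * r * ((AnnProfile.der v (r ^ 2) : ℝ) : ℂ)) -
      pev (θ : E n) (linForm w) * ((m : ℂ) * pev (θ : E n) (P' m)) *
        ((r : ℂ)⁻¹ * ((v (r ^ 2) : ℝ) : ℂ)) := by
    intro m
    rw [lineDeriv_radS, add_apply, radS_apply, radS_apply, norm_smul_sph θ hr,
      AnnProfile.toProfile_der, AnnProfile.der_pw]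
    have e1 : pev (r • (θ : E n)) (dirDeriv w (P' m)) =
        (r : ℂ)⁻¹ * ((r : ℂ) ^ m * pev (θ : E n) (dirDeriv w (P' m))) := by
      simp only [dirDeriv, map_sum, map_mul, pev_C, Finset.mul_sum]
      refine Finset.sum_congr rfl fun i _ => ?_
      have := mul_pev_smul_pderiv (hP'h m) i r (θ : E n)
      field_simp
      linear_combination ((w i : ℝ) : ℂ) * this
    have e2 : pev (r • (θ : E n)) (linForm w) = (r : ℂ) * pev (θ : E n) (linForm w) := by
      rw [pev_linForm, pev_linForm, inner_smul_right]; push_cast; ring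
    rw [map_mul, e1, e2, pev_smul_of_isHomogeneous (hP'h m)]
    simp only [AnnProfile.toProfile_apply, AnnProfile.pw_apply, Profile.smul_apply,
      AnnProfile.add_apply, AnnProfile.smul_apply, AnnProfile.divOn_apply, hpow]
    push_cast
    field_simp
    ring
  rw [Finset.sum_congr rfl fun m _ => hterm m]
  rw [Finset.sum_sub_distrib, Finset.sum_add_distrib, ← Finset.sum_mul, ← Finset.sum_mul,
    ← Finset.sum_mul, ← Finset.mul_sum, ← Finset.mul_sum, sum_mul_homogeneousComponent]
  have e3 : ∑ m ∈ Finset.range (P.totalDegree + 1), pev (θ : E n) (P' m) = pev (θ : E n) P := by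
    rw [← map_sum, MvPolynomial.sum_homogeneousComponent]
  have e4 : ∑ m ∈ Finset.range (P.totalDegree + 1), pev (θ : E n) (dirDeriv w (P' m)) =
      pev (θ : E n) (dirDeriv w P) := by
    rw [← map_sum]
    congr 1
    simp only [dirDeriv]
    rw [Finset.sum_comm]
    refine Finset.sum_congr rfl fun i _ => ?_
    rw [← Finset.mul_sum, ← map_sum, MvPolynomial.sum_homogeneousComponent]
  rw [e3, e4]
  have hp1 : (r ^ 2 : ℝ) ^ (1 / 2 : ℝ) = r := by
    rw [← Real.sqrt_eq_rpow, Real.sqrt_sq hr.le]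
  have hp2 : (r ^ 2 : ℝ) ^ (-1 / 2 : ℝ) = r⁻¹ := by
    have := hpow 1; simpa using this
  simp only [tanDeriv, map_sub, map_mul, AnnProfile.smul_apply, AnnProfile.pw_apply, hp1, hp2]
  push_cast
  ring

end RoughPDO
end

noncomputable section
namespace RoughPDO

/-! ### Completeness of the spherical harmonics -/

/-- The algebra of polynomial functions on the sphere. -/
def polyStarSubalgebra (n : ℕ) : StarSubalgebra ℂ C(Sph n, ℂ) where
  toSubalgebra := (MvPolynomial.aeval (fun i : Fin n =>
    (⟨fun θ : Sph n => (((θ : E n) i : ℝ) : ℂ), by fun_prop⟩ : C(Sph n, ℂ)))).range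
  star_mem' := by
    rintro _ ⟨p, rfl⟩
    refine ⟨conjPoly p, ?_⟩
    ext θ
    have h1 := polyRestrict_apply (conjPoly p) θ
    have h2 := polyRestrict_apply p θ
    rw [pev_conjPoly, ← h2] at h1
    exact h1

theorem separatesPoints_polyStarSubalgebra (n : ℕ) :
    (polyStarSubalgebra n).SeparatesPoints := by
  intro θ θ' h
  obtain ⟨i, hi⟩ : ∃ i, (θ : E n) i ≠ (θ' : E n) i := by
    by_contra! hc
    exact h (Subtype.ext (by ext i; exact hc i))
  refine ⟨_, ⟨_, ⟨MvPolynomial.X i, rfl⟩, rfl⟩, ?_⟩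
  have h1 := polyRestrict_apply (MvPolynomial.X i) θ
  have h2 := polyRestrict_apply (MvPolynomial.X i) θ'
  rw [pev_X] at h1 h2
  intro hc
  refine hi ?_
  have h3 : ((((θ : E n) i : ℝ)) : ℂ) = (((θ' : E n) i : ℝ) : ℂ) := by
    rw [← h1, ← h2]; exact hc
  exact_mod_cast h3

/-- Stone-Weierstrass: polynomial functions are dense in C(S), and pairing with an integrable
function is continuous for the sup norm. -/
theorem integral_mul_continuous_eq_zero {n : ℕ} {q : Sph n → ℂ} (hq : Integrable q (sphMeasure n))
    (h : ∀ p : MvPolynomial (Fin n) ℂ, ∫ θ : Sph n, q θ * pev (θ : E n) p ∂(sphMeasure n) = 0)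
    (f : C(Sph n, ℂ)) : ∫ θ, q θ * f θ ∂(sphMeasure n) = 0 := by
  have hint : ∀ f : C(Sph n, ℂ), Integrable (fun θ => q θ * f θ) (sphMeasure n) := fun f =>
    hq.mul_bdd (c := ‖f‖) f.continuous.aestronglyMeasurable
      (Filter.Eventually.of_forall fun θ => f.norm_coe_le_norm θ)
  have hcont : Continuous (fun f : C(Sph n, ℂ) => ∫ θ, q θ * f θ ∂(sphMeasure n)) := by
    refine continuous_iff_continuousAt.mpr fun f => ?_
    rw [ContinuousAt, tendsto_iff_norm_sub_tendsto_zero]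
    have hle : ∀ g : C(Sph n, ℂ), ‖∫ θ, q θ * g θ ∂(sphMeasure n) - ∫ θ, q θ * f θ ∂(sphMeasure n)‖ ≤
        (∫ θ, ‖q θ‖ ∂(sphMeasure n)) * ‖g - f‖ := by
      intro g
      rw [← integral_sub (hint g) (hint f), ← integral_mul_const]
      refine (norm_integral_le_integral_norm _).trans (integral_mono_of_nonneg
        (Filter.Eventually.of_forall fun _ => norm_nonneg _) (hq.norm.mul_const _)
        (Filter.Eventually.of_forall fun θ => ?_))
      dsimp only
      rw [← mul_sub, norm_mul]
      exact mul_le_mul_of_nonneg_left ((g - f).norm_coe_le_norm θ) (norm_nonneg _)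
    refine squeeze_zero (fun _ => norm_nonneg _) hle ?_
    have : Filter.Tendsto (fun g : C(Sph n, ℂ) => (∫ θ, ‖q θ‖ ∂(sphMeasure n)) * ‖g - f‖) (nhds f)
        (nhds ((∫ θ, ‖q θ‖ ∂(sphMeasure n)) * ‖f - f‖)) := by
      refine Continuous.tendsto ?_ f
      fun_prop
    simpa using this
  have hd := ContinuousMap.starSubalgebra_topologicalClosure_eq_top_of_separatesPoints _
    (separatesPoints_polyStarSubalgebra n)
  have hclosed : IsClosed {f : C(Sph n, ℂ) | ∫ θ, q θ * f θ ∂(sphMeasure n) = 0} :=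
    isClosed_eq hcont continuous_const
  have hsub : ((polyStarSubalgebra n) : Set C(Sph n, ℂ)) ⊆
      {f : C(Sph n, ℂ) | ∫ θ, q θ * f θ ∂(sphMeasure n) = 0} := by
    rintro _ ⟨p, rfl⟩
    have := h p
    simp only [← polyRestrict_apply] at this
    exact this
  have hmem : f ∈ (polyStarSubalgebra n).topologicalClosure := by rw [hd]; trivial
  exact closure_minimal hsub hclosed hmem

/-- The indicator of a closed set is the pointwise limit of continuous thickened indicators bounded
by 1, so dominated convergence shows that q has zero integral over every closed set. -/
theorem ae_eq_zero_of_forall_integral_pev {n : ℕ} {q : Sph n → ℂ}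
    (hq : Integrable q (sphMeasure n))
    (h : ∀ p : MvPolynomial (Fin n) ℂ, ∫ θ : Sph n, q θ * pev (θ : E n) p ∂(sphMeasure n) = 0) :
    q =ᵐ[sphMeasure n] 0 := by
  refine ae_eq_zero_of_forall_setIntegral_isClosed_eq_zero hq fun s hs => ?_
  have hδ : ∀ k : ℕ, (0 : ℝ) < 1 / ((k : ℝ) + 1) := fun k => by positivity
  have hlim := thickenedIndicator_tendsto_indicator_closure hδ
    tendsto_one_div_add_atTop_nhds_zero_nat s
  rw [tendsto_pi_nhds] at hlim
  have hz : ∀ k : ℕ, ∫ θ, q θ * ((thickenedIndicator (hδ k) s θ : ℝ) : ℂ) ∂(sphMeasure n) = 0 := by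
    intro k
    exact integral_mul_continuous_eq_zero hq h
      ⟨fun θ => ((thickenedIndicator (hδ k) s θ : ℝ) : ℂ), by
        have := (thickenedIndicator (hδ k) s).continuous
        fun_prop⟩
  have htend : Filter.Tendsto
      (fun k : ℕ => ∫ θ, q θ * ((thickenedIndicator (hδ k) s θ : ℝ) : ℂ) ∂(sphMeasure n))
      Filter.atTop (nhds (∫ θ, s.indicator q θ ∂(sphMeasure n))) := by
    refine tendsto_integral_of_dominated_convergence (fun θ => ‖q θ‖) (fun k => ?_) hq.norm
      (fun k => Filter.Eventually.of_forall fun θ => ?_)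
      (Filter.Eventually.of_forall fun θ => ?_)
    · refine hq.aestronglyMeasurable.mul (Continuous.aestronglyMeasurable ?_)
      have := (thickenedIndicator (hδ k) s).continuous
      fun_prop
    · rw [norm_mul]
      refine mul_le_of_le_one_right (norm_nonneg _) ?_
      rw [Complex.norm_real, NNReal.norm_eq]
      exact_mod_cast thickenedIndicator_le_one (hδ k) s θ
    · have h1 := hlim θ
      rw [hs.closure_eq] at h1
      have h2 : s.indicator q θ = q θ * (((s.indicator (fun _ => (1 : ℝ≥0)) θ : ℝ≥0) : ℝ) : ℂ) := by
        by_cases hθ : θ ∈ s <;> simp [hθ]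
      rw [h2]
      refine Filter.Tendsto.const_mul _ ?_
      exact (Complex.continuous_ofReal.tendsto _).comp
        ((NNReal.continuous_coe.tendsto _).comp h1)
  simp only [hz] at htend
  rw [← integral_indicator hs.measurableSet]
  exact (tendsto_nhds_unique htend tendsto_const_nhds)

/-- An integrable function on the sphere that is orthogonal to all harmonics vanishes. -/
theorem ae_eq_zero_of_forall_harmonic {n : ℕ} (hn : 0 < n) {q : Sph n → ℂ}
    (hq : Integrable q (sphMeasure n))
    (h : ∀ j, ∀ p ∈ solidHarmonics n j,
      ∫ θ : Sph n, q θ * (starRingEnd ℂ) (pev (θ : E n) p) ∂(sphMeasure n) = 0) :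
    q =ᵐ[sphMeasure n] 0 := by
  refine ae_eq_zero_of_forall_integral_pev hq fun p => ?_
  obtain ⟨H, hH, hpH⟩ := exists_harmonic_decomposition hn p le_rfl
  -- The hypothesis involves conjugated harmonics, hence the passage to `conjPoly`, which maps solid
  -- harmonics to solid harmonics.
  have e : ∀ θ : Sph n, q θ * pev (θ : E n) p = ∑ j ∈ Finset.range (p.totalDegree + 1),
      q θ * (starRingEnd ℂ) (pev (θ : E n) (conjPoly (H j))) := by
    intro θ
    rw [hpH θ (norm_sph θ), Finset.mul_sum]
    simp [pev_conjPoly]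
  simp_rw [e]
  rw [integral_finsetSum]
  · exact Finset.sum_eq_zero fun j _ => h j _ (conjPoly_mem_solidHarmonics (hH j))
  · intro j _
    have hc : Continuous (fun θ : Sph n => (starRingEnd ℂ) (pev (θ : E n) (conjPoly (H j)))) :=
      Complex.continuous_conj.comp (continuous_pev_sph _)
    obtain ⟨C, hC⟩ := (HasCompactSupport.of_compactSpace _).exists_bound_of_continuous hc
    exact hq.mul_bdd (c := C) hc.aestronglyMeasurable (Filter.Eventually.of_forall hC)

/-! ### Spaces of polynomials on the sphere -/

/-- The restrictions to the sphere of polynomials of degree at most `N`, as a subspace of `L²`. -/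
def sphPolys (n N : ℕ) : Submodule ℂ (Lp ℂ 2 (sphMeasure n)) :=
  (MvPolynomial.restrictTotalDegree (Fin n) ℂ N).map
    ((ContinuousMap.toLp 2 (sphMeasure n) ℂ : C(Sph n, ℂ) →L[ℂ] Lp ℂ 2 (sphMeasure n)).toLinearMap
      ∘ₗ polyRestrict n)

instance (n N : ℕ) : FiniteDimensional ℂ (sphPolys n N) := Module.Finite.map _ _

/-- A polynomial as an element of `L²` of the sphere. -/
def polyLp {n : ℕ} (p : MvPolynomial (Fin n) ℂ) : Lp ℂ 2 (sphMeasure n) :=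
  ContinuousMap.toLp 2 (sphMeasure n) ℂ (polyRestrict n p)

theorem coeFn_polyLp {n : ℕ} (p : MvPolynomial (Fin n) ℂ) :
    (polyLp p : Sph n → ℂ) =ᵐ[sphMeasure n] fun θ => pev (θ : E n) p := by
  filter_upwards [ContinuousMap.coeFn_toLp (p := 2) (𝕜 := ℂ) (sphMeasure n) (polyRestrict n p)] with θ hθ
  rw [polyLp, hθ, polyRestrict_apply]

theorem inner_polyLp {n : ℕ} (p q : MvPolynomial (Fin n) ℂ) :
    inner ℂ (polyLp p) (polyLp q) =
      ∫ θ : Sph n, pev (θ : E n) q * (starRingEnd ℂ) (pev (θ : E n) p) ∂(sphMeasure n) := by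
  rw [L2.inner_def]
  refine integral_congr_ae ?_
  filter_upwards [coeFn_polyLp p, coeFn_polyLp q] with θ h1 h2
  rw [h1, h2]
  simp

/-- Both sides are continuous and the surface measure charges every nonempty open set. This turns
identities in L² into pointwise identities. -/
theorem pev_eq_of_polyLp_eq {n : ℕ} {p q : MvPolynomial (Fin n) ℂ} (h : polyLp p = polyLp q)
    (θ : Sph n) : pev (θ : E n) p = pev (θ : E n) q := by
  have h1 : (fun θ : Sph n => pev (θ : E n) p) =ᵐ[sphMeasure n] fun θ => pev (θ : E n) q := by
    filter_upwards [coeFn_polyLp p, coeFn_polyLp q] with θ h1 h2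
    rw [← h1, ← h2, h]
  exact congrFun (Continuous.ae_eq_iff_eq (sphMeasure n) (continuous_pev_sph p)
    (continuous_pev_sph q) |>.mp h1) θ

/-- An orthonormal basis of the polynomials of degree at most `N` on the sphere. -/
structure SphBasis (n N : ℕ) where
  dim : ℕ
  poly : Fin dim → MvPolynomial (Fin n) ℂ
  degree_le : ∀ i, (poly i).totalDegree ≤ N
  orthonormal : ∀ i j, ∫ θ : Sph n, pev (θ : E n) (poly i) *
    (starRingEnd ℂ) (pev (θ : E n) (poly j)) ∂(sphMeasure n) = if i = j then 1 else 0
  expand : ∀ p : MvPolynomial (Fin n) ℂ, p.totalDegree ≤ N → ∀ θ : Sph n,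
    pev (θ : E n) p = ∑ i, (∫ η : Sph n, pev (η : E n) p *
      (starRingEnd ℂ) (pev (η : E n) (poly i)) ∂(sphMeasure n)) * pev (θ : E n) (poly i)
  dim_eq : dim = Module.finrank ℂ (sphPolys n N)

theorem exists_sphBasis (n N : ℕ) : Nonempty (SphBasis n N) := by
  set b := stdOrthonormalBasis ℂ (sphPolys n N) with hb
  have hp : ∀ i, ∃ p : MvPolynomial (Fin n) ℂ, p.totalDegree ≤ N ∧
      polyLp p = (b i : Lp ℂ 2 (sphMeasure n)) := by
    intro i
    obtain ⟨p, hp, hpe⟩ := (b i).2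
    exact ⟨p, (MvPolynomial.mem_restrictTotalDegree _ _ _).mp hp, hpe⟩
  choose p hpd hpb using hp
  refine ⟨⟨_, p, hpd, fun i j => ?_, fun q hq θ => ?_, rfl⟩⟩
  · rw [← inner_polyLp, hpb, hpb, ← Submodule.coe_inner, orthonormal_iff_ite.mp b.orthonormal]
    simp [eq_comm]
  · have hmem : polyLp q ∈ sphPolys n N :=
      ⟨q, (MvPolynomial.mem_restrictTotalDegree _ _ _).mpr hq, rfl⟩
    have h1 := b.sum_repr' ⟨polyLp q, hmem⟩
    have h2 := congrArg (Submodule.subtype _) h1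
    simp only [map_sum, map_smul, Submodule.subtype_apply] at h2
    have h3 : polyLp (∑ i, (∫ η : Sph n, pev (η : E n) q *
        (starRingEnd ℂ) (pev (η : E n) (p i)) ∂(sphMeasure n)) • p i) = polyLp q := by
      rw [← h2]
      simp only [polyLp, map_sum, map_smul]
      refine Finset.sum_congr rfl fun i _ => ?_
      rw [← inner_polyLp, hpb, Submodule.coe_inner]
      congr 1
      exact hpb i
    rw [← pev_eq_of_polyLp_eq h3 θ]
    simp

theorem integral_norm_sq_sum_basis {n N : ℕ} (B : SphBasis n N) (c : Fin B.dim → ℂ) :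
    ∫ θ : Sph n, ‖∑ i, c i * pev (θ : E n) (B.poly i)‖ ^ 2 ∂(sphMeasure n) = ∑ i, ‖c i‖ ^ 2 := by
  have hint : ∀ i j, Integrable (fun θ : Sph n => (c i * (starRingEnd ℂ) (c j)) *
      (pev (θ : E n) (B.poly i) * (starRingEnd ℂ) (pev (θ : E n) (B.poly j))))
      (sphMeasure n) := fun i j => integrable_sph_of_continuous <| by
    have h1 := continuous_pev_sph (B.poly i)
    have h2 := continuous_pev_sph (B.poly j)
    exact continuous_const.mul (h1.mul (Complex.continuous_conj.comp h2))
  have key : ∫ θ : Sph n, ((‖∑ i, c i * pev (θ : E n) (B.poly i)‖ ^ 2 : ℝ) : ℂ)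
      ∂(sphMeasure n) = ∑ i, ((‖c i‖ ^ 2 : ℝ) : ℂ) := by
    have e1 : ∀ θ : Sph n, ((‖∑ i, c i * pev (θ : E n) (B.poly i)‖ ^ 2 : ℝ) : ℂ) =
        ∑ i, ∑ j, (c i * (starRingEnd ℂ) (c j)) *
          (pev (θ : E n) (B.poly i) * (starRingEnd ℂ) (pev (θ : E n) (B.poly j))) := by
      intro θ
      push_cast
      rw [← Complex.mul_conj', map_sum, Finset.sum_mul_sum]
      refine Finset.sum_congr rfl fun i _ => Finset.sum_congr rfl fun j _ => ?_
      rw [map_mul]; ring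
    simp_rw [e1]
    rw [integral_finsetSum _ fun i _ => integrable_finsetSum _ fun j _ => hint i j]
    refine Finset.sum_congr rfl fun i hi => ?_
    rw [integral_finsetSum _ fun j _ => hint i j, Finset.sum_eq_single i]
    · rw [integral_const_mul, B.orthonormal, Complex.mul_conj']; simp
    · intro j _ hj
      rw [integral_const_mul, B.orthonormal, if_neg hj.symm, mul_zero]
    · intro h; exact absurd (Finset.mem_univ i) h
  rw [integral_complex_ofReal] at key
  exact_mod_cast key

/-- The function `∑ |e_i|²` of an orthonormal basis. -/
def SphBasis.diag {n N : ℕ} (B : SphBasis n N) (θ : Sph n) : ℝ :=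
  ∑ i, ‖pev (θ : E n) (B.poly i)‖ ^ 2

/-- Cauchy-Schwarz in the orthonormal expansion; `diag` is thus the squared norm of point
evaluation. -/
theorem SphBasis.norm_sq_le {n N : ℕ} (B : SphBasis n N) {p : MvPolynomial (Fin n) ℂ}
    (hp : p.totalDegree ≤ N) (θ : Sph n) :
    ‖pev (θ : E n) p‖ ^ 2 ≤
      B.diag θ * ∫ η : Sph n, ‖pev (η : E n) p‖ ^ 2 ∂(sphMeasure n) := by
  set c : Fin B.dim → ℂ := fun i => ∫ η : Sph n, pev (η : E n) p *
      (starRingEnd ℂ) (pev (η : E n) (B.poly i)) ∂(sphMeasure n) with hc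
  have h1 : ∀ θ : Sph n, pev (θ : E n) p = ∑ i, c i * pev (θ : E n) (B.poly i) := B.expand p hp
  simp_rw [h1]
  rw [integral_norm_sq_sum_basis, SphBasis.diag, mul_comm]
  calc ‖∑ i, c i * pev (θ : E n) (B.poly i)‖ ^ 2
      ≤ (∑ i, ‖c i‖ * ‖pev (θ : E n) (B.poly i)‖) ^ 2 := by
        gcongr
        exact (norm_sum_le _ _).trans (le_of_eq (by simp))
    _ ≤ _ := Finset.sum_mul_sq_le_sq_mul_sq _ _ _

/-! ### The dimension of the space of polynomials on the sphere -/

/-- The monomials `x₀^ε x'^a` with `ε ≤ 1`. -/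
def redMonomial (m N : ℕ) (t : Fin 2 × (Fin m → Fin (N + 1))) : MvPolynomial (Fin (m + 1)) ℂ :=
  MvPolynomial.X 0 ^ (t.1 : ℕ) * ∏ i : Fin m, MvPolynomial.X i.succ ^ (t.2 i : ℕ)

theorem polyLp_eq_of_pev_eq {n : ℕ} {p q : MvPolynomial (Fin n) ℂ}
    (h : ∀ θ : Sph n, pev (θ : E n) p = pev (θ : E n) q) : polyLp p = polyLp q := by
  have : polyRestrict n p = polyRestrict n q := by
    ext θ; rw [polyRestrict_apply, polyRestrict_apply, h]
  rw [polyLp, polyLp, this]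

/-- On the sphere x₀² = 1 - ∑ x_k². Each use of this lowers the exponent of x₀ by two without
raising the total degree, until it is at most 1. -/
theorem polyLp_monomial_mem (m N : ℕ) (a : ℕ) : ∀ b : Fin m → ℕ, a + ∑ i, b i ≤ N →
    polyLp (MvPolynomial.X 0 ^ a * ∏ i : Fin m, MvPolynomial.X i.succ ^ (b i)) ∈
      Submodule.span ℂ (Set.range fun t => polyLp (redMonomial m N t)) := by
  induction a using Nat.strong_induction_on with
  | _ a ih =>
    intro b hab
    have hb : ∀ i, b i ≤ ∑ i, b i := fun i => Finset.single_le_sum (fun _ _ => Nat.zero_le _)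
      (Finset.mem_univ i)
    rcases lt_or_ge a 2 with ha | ha
    · refine Submodule.subset_span ⟨(⟨a, ha⟩, fun i => ⟨b i, ?_⟩), rfl⟩
      have := hb i; omega
    · have e : polyLp (MvPolynomial.X 0 ^ a * ∏ i : Fin m, MvPolynomial.X i.succ ^ (b i)) =
          polyLp (MvPolynomial.X 0 ^ (a - 2) * ∏ i : Fin m, MvPolynomial.X i.succ ^ (b i)) -
          ∑ k : Fin m, polyLp (MvPolynomial.X 0 ^ (a - 2) *
            ∏ i : Fin m, MvPolynomial.X i.succ ^ ((b + 2 • Pi.single k 1 : Fin m → ℕ) i)) := by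
        have e2 : polyLp (MvPolynomial.X 0 ^ a * ∏ i : Fin m, MvPolynomial.X i.succ ^ (b i)) =
          polyLp (MvPolynomial.X 0 ^ (a - 2) * ∏ i : Fin m, MvPolynomial.X i.succ ^ (b i) -
          ∑ k : Fin m, (MvPolynomial.X 0 ^ (a - 2) *
            ∏ i : Fin m, MvPolynomial.X i.succ ^ ((b + 2 • Pi.single k 1 : Fin m → ℕ) i))) := by
          refine polyLp_eq_of_pev_eq fun θ => ?_
          have hθ : ((θ : E (m + 1)) 0 : ℂ) ^ 2 + ∑ k : Fin m, ((θ : E (m + 1)) k.succ : ℂ) ^ 2 = 1 := by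
            have := EuclideanSpace.norm_sq_eq (θ : E (m + 1))
            rw [norm_sph, Fin.sum_univ_succ] at this
            simp only [Real.norm_eq_abs, sq_abs, one_pow] at this
            exact_mod_cast this.symm
          simp only [map_sub, map_sum, map_mul, map_pow, map_prod, pev_X, Pi.add_apply, pow_add,
            Finset.prod_mul_distrib]
          have hk : ∀ k : Fin m, ∏ i : Fin m, ((θ : E (m + 1)) i.succ : ℂ) ^
              ((2 • Pi.single k 1 : Fin m → ℕ) i) = ((θ : E (m + 1)) k.succ : ℂ) ^ 2 := by
            intro k
            rw [Finset.prod_eq_single k]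
            · simp
            · intro i _ hi; simp [hi]
            · simp
          simp only [hk, ← mul_assoc]
          rw [← Finset.mul_sum]
          obtain ⟨c, rfl⟩ : ∃ c, a = c + 2 := ⟨a - 2, by omega⟩
          rw [Nat.add_sub_cancel, pow_add]
          linear_combination (((θ : E (m + 1)) 0 : ℂ) ^ c *
            ∏ i : Fin m, ((θ : E (m + 1)) i.succ : ℂ) ^ (b i)) * hθ
        rw [e2]
        simp only [polyLp, map_sub, map_sum]
      rw [e]
      refine Submodule.sub_mem _ (ih (a - 2) (by omega) b (by omega))
        (Submodule.sum_mem _ fun k _ => ih (a - 2) (by omega) _ ?_)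
      simp only [Pi.add_apply, Finset.sum_add_distrib, Pi.smul_apply, smul_eq_mul,
        ← Finset.mul_sum, Finset.sum_pi_single', Finset.mem_univ, if_true]
      omega

/-- The reduced monomials have exponents at most N in m variables and at most 1 in the remaining
one. What matters is the power m, the dimension of the sphere rather than of the space. -/
theorem finrank_sphPolys_le (m N : ℕ) :
    Module.finrank ℂ (sphPolys (m + 1) N) ≤ 2 * (N + 1) ^ m := by
  have hle : sphPolys (m + 1) N ≤
      Submodule.span ℂ (Set.range fun t => polyLp (redMonomial m N t)) := by
    rintro _ ⟨p, hp, rfl⟩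
    have hp' := (MvPolynomial.mem_restrictTotalDegree _ _ _).mp hp
    change polyLp p ∈ _
    rw [MvPolynomial.as_sum p]
    have : polyLp (∑ d ∈ p.support, MvPolynomial.monomial d (p.coeff d)) =
        ∑ d ∈ p.support, (p.coeff d) • polyLp (MvPolynomial.X 0 ^ (d 0) *
          ∏ i : Fin m, MvPolynomial.X i.succ ^ (d i.succ)) := by
      simp only [polyLp, map_sum]
      refine Finset.sum_congr rfl fun d _ => ?_
      rw [MvPolynomial.monomial_eq, Finsupp.prod_fintype _ _ (by simp), Fin.prod_univ_succ,
        ← MvPolynomial.smul_eq_C_mul, map_smul, map_smul]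
    rw [this]
    refine Submodule.sum_mem _ fun d hd => Submodule.smul_mem _ _
      (polyLp_monomial_mem m N _ (fun i => d i.succ) ?_)
    have h1 := MvPolynomial.le_totalDegree hd
    rw [Finsupp.sum_fintype _ _ (by simp), Fin.sum_univ_succ] at h1
    exact h1.trans hp'
  haveI : FiniteDimensional ℂ
      (Submodule.span ℂ (Set.range fun t => polyLp (redMonomial m N t))) :=
    FiniteDimensional.span_of_finite ℂ (Set.finite_range _)
  refine (Submodule.finrank_mono hle).trans ((finrank_range_le_card _).trans (le_of_eq ?_))
  simp

end RoughPDO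
end

noncomputable section
namespace RoughPDO

/-! ### The diagonal of the reproducing kernel -/

/-- A bump function on `ℝ` equal to `1` on `[1/4, 4]` and supported in `[1/10, 6]`. -/
def annBump : AnnProfile :=
  -- With centre 3 the inner radius 11/4 covers [1/4, 23/4] and the outer radius 29/10 gives the
  -- support [1/10, 59/10].
  let f : ContDiffBump (3 : ℝ) := ⟨11 / 4, 29 / 10, by norm_num, by norm_num⟩
  ⟨f, f.contDiff, fun ρ h => f.zero_of_le_dist (by
      rw [Real.dist_eq]; exact le_trans (by change (29 / 10 : ℝ) ≤ ρ - 3; linarith) (le_abs_self _)),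
    fun ρ h => f.zero_of_le_dist (by
      rw [Real.dist_eq]
      exact le_trans (by change (29 / 10 : ℝ) ≤ -(ρ - 3); linarith) (neg_le_abs _))⟩

theorem annBump_eq_one {ρ : ℝ} (h1 : 1 / 4 ≤ ρ) (h2 : ρ ≤ 4) : annBump ρ = 1 := by
  refine ContDiffBump.one_of_mem_closedBall _ ?_
  rw [mem_closedBall, Real.dist_eq, abs_le]
  constructor
  · change -(11 / 4 : ℝ) ≤ _; linarith
  · change _ ≤ (11 / 4 : ℝ); linarith

/-- The product structure transfers L² statements between the sphere and ℝⁿ, where Plancherel and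
the invariance of Lebesgue measure are at hand. -/
theorem integral_norm_sq_annS {n : ℕ} (hn : 0 < n) (Q : MvPolynomial (Fin n) ℂ) (v : AnnProfile) :
    ∫ x, ‖annS Q v x‖ ^ 2 = (∫ θ : Sph n, ‖pev (θ : E n) Q‖ ^ 2 ∂(sphMeasure n)) *
      ∫ r : Set.Ioi (0 : ℝ), (v ((r : ℝ) ^ 2)) ^ 2 ∂(radMeasure n) := by
  rw [integral_polar hn, ← integral_prod_mul]
  refine integral_congr_ae (Filter.Eventually.of_forall fun z => ?_)
  simp only [annS_polar Q v z.1 z.2.2, norm_mul, Complex.norm_real, mul_pow, Real.norm_eq_abs,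
    sq_abs]

theorem nonempty_sph {n : ℕ} (hn : 0 < n) : Nonempty (Sph n) :=
  ⟨⟨EuclideanSpace.basisFun (Fin n) ℝ ⟨0, hn⟩, by simp⟩⟩

theorem integral_radial_pos {n : ℕ} (hn : 0 < n) {v : AnnProfile} {ρ : ℝ} (hρ : 0 < ρ)
    (hv : v ρ ≠ 0) : 0 < ∫ r : Set.Ioi (0 : ℝ), (v ((r : ℝ) ^ 2)) ^ 2 ∂(radMeasure n) := by
  have h1 := integral_norm_sq_annS hn (1 : MvPolynomial (Fin n) ℂ) v
  have h2 : 0 < ∫ x : E n, ‖annS (1 : MvPolynomial (Fin n) ℂ) v x‖ ^ 2 := by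
    obtain ⟨θ⟩ := nonempty_sph hn
    refine MeasureTheory.integral_pos_of_integrable_nonneg_nonzero (μ := (volume : Measure (E n)))
      (f := fun x => ‖annS (1 : MvPolynomial (Fin n) ℂ) v x‖ ^ 2) (x := √ρ • (θ : E n)) ?_ ?_ ?_ ?_
    · have := (annS (1 : MvPolynomial (Fin n) ℂ) v).continuous; fun_prop
    · exact (memLp_two_iff_integrable_sq_norm (annS (1 : MvPolynomial (Fin n) ℂ) v).continuous.aestronglyMeasurable).mp
        ((annS (1 : MvPolynomial (Fin n) ℂ) v).memLp 2)
    · intro x; positivity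
    · rw [annS_polar _ _ θ (Real.sqrt_pos.mpr hρ), Real.sq_sqrt hρ.le]
      simpa using hv
  rw [h1] at h2
  exact (pos_iff_pos_of_mul_pos h2).mp
    (lt_of_le_of_ne (integral_nonneg fun _ => by positivity) fun h0 => by
      rw [← h0, zero_mul] at h2; exact lt_irrefl _ h2)

/-- Composition of a polynomial with a linear isometry. -/
def rotPoly {n : ℕ} (R : E n ≃ₗᵢ[ℝ] E n) (P : MvPolynomial (Fin n) ℂ) : MvPolynomial (Fin n) ℂ :=
  MvPolynomial.aeval (fun i => linForm (R.symm (EuclideanSpace.basisFun (Fin n) ℝ i))) P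

theorem pev_rotPoly {n : ℕ} (R : E n ≃ₗᵢ[ℝ] E n) (P : MvPolynomial (Fin n) ℂ) (x : E n) :
    pev x (rotPoly R P) = pev (R x) P := by
  induction P using MvPolynomial.induction_on with
  | C a => simp [rotPoly]
  | add p q hp hq => simp only [rotPoly, map_add] at *; rw [hp, hq]
  | mul_X p i hp =>
    simp only [rotPoly, map_mul, MvPolynomial.aeval_X, pev_X] at *
    rw [hp, pev_linForm]
    congr 2
    rw [← R.inner_map_map, R.apply_symm_apply]
    simp [EuclideanSpace.inner_single_left]

theorem totalDegree_linForm_le {n : ℕ} (w : E n) : (linForm w).totalDegree ≤ 1 := by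
  refine MvPolynomial.totalDegree_finsetSum_le fun i _ => ?_
  refine (MvPolynomial.totalDegree_mul _ _).trans ?_
  simp

theorem totalDegree_rotPoly_le {n : ℕ} (R : E n ≃ₗᵢ[ℝ] E n) (P : MvPolynomial (Fin n) ℂ) :
    (rotPoly R P).totalDegree ≤ P.totalDegree := by
  conv_lhs => rw [MvPolynomial.as_sum P, rotPoly, map_sum]
  refine MvPolynomial.totalDegree_finsetSum_le fun d hd => ?_
  rw [MvPolynomial.aeval_monomial, Finsupp.prod_fintype _ _ (by simp)]
  refine (MvPolynomial.totalDegree_mul _ _).trans ?_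
  rw [MvPolynomial.algebraMap_eq, MvPolynomial.totalDegree_C, zero_add]
  refine (MvPolynomial.totalDegree_finsetProd _ _).trans ?_
  have h1 := MvPolynomial.le_totalDegree hd
  rw [Finsupp.sum_fintype _ _ (by simp)] at h1
  refine le_trans (Finset.sum_le_sum fun i _ => ?_) h1
  refine (MvPolynomial.totalDegree_pow _ _).trans ?_
  have := totalDegree_linForm_le (R.symm (EuclideanSpace.basisFun (Fin n) ℝ i))
  nlinarith

/-- Lebesgue measure is invariant under R; dividing by the nonzero radial factor of
`integral_norm_sq_annS` gives the invariance on the sphere. -/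
theorem integral_norm_sq_rotPoly {n : ℕ} (hn : 0 < n) (R : E n ≃ₗᵢ[ℝ] E n)
    (P : MvPolynomial (Fin n) ℂ) :
    ∫ θ : Sph n, ‖pev (θ : E n) (rotPoly R P)‖ ^ 2 ∂(sphMeasure n) =
      ∫ θ : Sph n, ‖pev (θ : E n) P‖ ^ 2 ∂(sphMeasure n) := by
  have h0 := integral_radial_pos hn (v := annBump) one_pos
    (by rw [annBump_eq_one] <;> norm_num)
  refine mul_right_cancel₀ h0.ne' ?_
  rw [← integral_norm_sq_annS hn, ← integral_norm_sq_annS hn,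
    ← R.measurePreserving.integral_comp R.toHomeomorph.measurableEmbedding
      (fun x => ‖annS P annBump x‖ ^ 2),
    integral_polar hn, integral_polar hn (fun x => ‖annS P annBump (R x)‖ ^ 2)]
  refine integral_congr_ae (Filter.Eventually.of_forall fun z => ?_)
  have e : R ((z.2 : ℝ) • (z.1 : E n)) = (z.2 : ℝ) •
      (((⟨R (z.1 : E n), by simp [norm_sph]⟩ : Sph n)) : E n) := by simp
  dsimp only
  rw [e, annS_polar _ _ _ z.2.2, annS_polar _ _ _ z.2.2, pev_rotPoly]

/-- Polynomials of degree at most N and their L² norms are invariant under the reflection that maps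
θ to θ', so the norms of the two point evaluations agree. The inequality tests this on the extremal
polynomial at θ'. -/
theorem SphBasis.diag_le_diag {n N : ℕ} (hn : 0 < n) (B : SphBasis n N) (θ θ' : Sph n) :
    B.diag θ' ≤ B.diag θ := by
  set R : E n ≃ₗᵢ[ℝ] E n := (ℝ ∙ ((θ : E n) - θ'))ᗮ.reflection
  have hR : R θ = θ' := Submodule.reflection_sub (by rw [norm_sph, norm_sph])
  -- The section of the reproducing kernel at θ': both its value there and its squared L² norm equal
  -- `B.diag θ'`.
  set D : MvPolynomial (Fin n) ℂ := ∑ i, (starRingEnd ℂ) (pev (θ' : E n) (B.poly i)) • B.poly i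
  have hDeg : D.totalDegree ≤ N := MvPolynomial.totalDegree_finsetSum_le fun i _ =>
    (MvPolynomial.totalDegree_smul_le _ _).trans (B.degree_le i)
  have hD1 : pev (θ' : E n) D = (B.diag θ' : ℂ) := by
    simp only [D, map_sum, map_smul, smul_eq_mul, SphBasis.diag, Complex.conj_mul']
    push_cast; rfl
  have hD2 : ∫ η : Sph n, ‖pev (η : E n) D‖ ^ 2 ∂(sphMeasure n) = B.diag θ' := by
    have := integral_norm_sq_sum_basis B (fun i => (starRingEnd ℂ) (pev (θ' : E n) (B.poly i)))
    simp only [D, map_sum, map_smul, smul_eq_mul]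
    rw [this]
    simp [SphBasis.diag]
  have h := B.norm_sq_le ((totalDegree_rotPoly_le R D).trans hDeg) θ
  rw [pev_rotPoly, hR, hD1, integral_norm_sq_rotPoly hn, hD2] at h
  have hnn : 0 ≤ B.diag θ' := Finset.sum_nonneg fun i _ => by positivity
  rw [Complex.norm_real, Real.norm_of_nonneg hnn, sq] at h
  rcases hnn.eq_or_lt with h0 | h0
  · rw [← h0]; exact Finset.sum_nonneg fun i _ => by positivity
  · exact le_of_mul_le_mul_right h h0

theorem SphBasis.integral_diag {n N : ℕ} (B : SphBasis n N) :
    ∫ θ : Sph n, B.diag θ ∂(sphMeasure n) = B.dim := by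
  simp only [SphBasis.diag]
  rw [integral_finsetSum]
  · have : ∀ i, ∫ θ : Sph n, ‖pev (θ : E n) (B.poly i)‖ ^ 2 ∂(sphMeasure n) = 1 := by
      intro i
      have h := B.orthonormal i i
      simp only [Complex.mul_conj', if_true] at h
      have h2 : ∫ θ : Sph n, ((‖pev (θ : E n) (B.poly i)‖ ^ 2 : ℝ) : ℂ) ∂(sphMeasure n) = 1 := by
        rw [← h]; push_cast; rfl
      rw [integral_complex_ofReal] at h2
      exact_mod_cast h2
    simp [this]
  · intro i _
    refine integrable_sph_of_continuous ?_
    have := continuous_pev_sph (B.poly i); fun_prop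

theorem sphMeasure_real_univ_pos {n : ℕ} (hn : 0 < n) : 0 < (sphMeasure n).real Set.univ := by
  haveI : Nonempty (Fin n) := ⟨⟨0, hn⟩⟩
  refine ENNReal.toReal_pos ?_ (measure_ne_top _ _)
  rw [Measure.measure_univ_ne_zero]
  exact Measure.toSphere_ne_zero _

/-- The reproducing kernel of the polynomials of degree at most `N` is of size at most
`N^{n-1}`. -/
theorem exists_diag_bound {n : ℕ} (hn : 0 < n) : ∃ C : ℝ, 1 ≤ C ∧ ∀ N : ℕ, 1 ≤ N →
    ∀ M ≤ 2 * N, ∀ (B : SphBasis n M) (θ : Sph n), B.diag θ ≤ C * (N : ℝ) ^ (n - 1) := by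
  set A := (sphMeasure n).real Set.univ with hA
  have hApos : 0 < A := sphMeasure_real_univ_pos hn
  refine ⟨max 1 (A⁻¹ * (2 * 3 ^ (n - 1))), le_max_left _ _, fun N hN M hM B θ => ?_⟩
  -- As `diag` is constant, it is the dimension divided by the area of the sphere.
  have h1 : B.diag θ * A = B.dim := by
    rw [← B.integral_diag]
    have : ∀ θ', B.diag θ' = B.diag θ := fun θ' =>
      le_antisymm (B.diag_le_diag hn θ θ') (B.diag_le_diag hn θ' θ)
    simp [this, hA, mul_comm]
  have h2 : (B.dim : ℝ) ≤ 2 * 3 ^ (n - 1) * (N : ℝ) ^ (n - 1) := by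
    obtain ⟨m, rfl⟩ : ∃ m, n = m + 1 := ⟨n - 1, by omega⟩
    have h3 : B.dim ≤ 2 * (M + 1) ^ m := by rw [B.dim_eq]; exact finrank_sphPolys_le m M
    -- M + 1 ≤ 3N because M ≤ 2N and 1 ≤ N.
    have h4 : B.dim ≤ 2 * (3 * N) ^ m := h3.trans (by gcongr; omega)
    rw [Nat.add_sub_cancel, mul_assoc, ← mul_pow]
    exact_mod_cast h4
  have h5 : B.diag θ = A⁻¹ * B.dim := by rw [← h1]; field_simp
  rw [h5]
  calc A⁻¹ * (B.dim : ℝ) ≤ A⁻¹ * (2 * 3 ^ (n - 1) * (N : ℝ) ^ (n - 1)) := by gcongr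
    _ = (A⁻¹ * (2 * 3 ^ (n - 1))) * (N : ℝ) ^ (n - 1) := by ring
    _ ≤ _ := by gcongr; exact le_max_right _ _

/-- Nikolskii's inequality on the sphere. -/
theorem exists_nikolskii {n : ℕ} (hn : 0 < n) : ∃ C : ℝ, 1 ≤ C ∧ ∀ N : ℕ, 1 ≤ N →
    ∀ r : ℝ, 1 ≤ r → r ≤ 2 → ∀ p : MvPolynomial (Fin n) ℂ, p.totalDegree ≤ N → ∀ θ : Sph n,
      ‖pev (θ : E n) p‖ ^ r ≤ C * (N : ℝ) ^ (n - 1) *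
        ∫ η : Sph n, ‖pev (η : E n) p‖ ^ r ∂(sphMeasure n) := by
  obtain ⟨C, hC1, hC⟩ := exists_diag_bound hn
  refine ⟨C, hC1, fun N hN r hr1 hr2 p hp θ => ?_⟩
  obtain ⟨B⟩ := exists_sphBasis n N
  haveI := nonempty_sph hn
  have hc := (continuous_pev_sph p).norm
  -- It suffices to argue at a point where |p| is largest; there the L² inequality self-improves to
  -- exponents below 2.
  obtain ⟨θ₀, -, hθ₀⟩ := isCompact_univ.exists_isMaxOn Set.univ_nonempty hc.continuousOn
  have hmax : ∀ η : Sph n, ‖pev (η : E n) p‖ ≤ ‖pev (θ₀ : E n) p‖ := fun η =>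
    hθ₀ (Set.mem_univ η)
  set M := ‖pev (θ₀ : E n) p‖ with hM
  have hM0 : 0 ≤ M := norm_nonneg _
  have hr0 : 0 < r := by linarith
  refine (Real.rpow_le_rpow (norm_nonneg _) (hmax θ) hr0.le).trans ?_
  rcases hM0.eq_or_lt with h0 | h0
  · rw [← h0, Real.zero_rpow hr0.ne']
    exact mul_nonneg (by positivity) (integral_nonneg fun _ => by positivity)
  have hcr : Continuous (fun η : Sph n => ‖pev (η : E n) p‖ ^ r) :=
    hc.rpow_const fun _ => Or.inr hr0.le
  have h1 := B.norm_sq_le hp θ₀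
  -- As r ≤ 2, |p|² ≤ M^{2-r} |p|^r. The factor M^{2-r} is cancelled at the end against M² = M^r
  -- M^{2-r}.
  have h2 : ∫ η : Sph n, ‖pev (η : E n) p‖ ^ 2 ∂(sphMeasure n) ≤
      M ^ (2 - r) * ∫ η : Sph n, ‖pev (η : E n) p‖ ^ r ∂(sphMeasure n) := by
    rw [← integral_const_mul]
    refine integral_mono (integrable_sph_of_continuous (hc.pow 2))
      ((integrable_sph_of_continuous hcr).const_mul _) fun η => ?_
    dsimp only
    rw [← Real.rpow_natCast]
    push_cast
    rw [show (2 : ℝ) = (2 - r) + r by ring, Real.rpow_add' (norm_nonneg _) (by norm_num)]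
    rw [show 2 - r + r - r = 2 - r by ring]
    exact mul_le_mul_of_nonneg_right (Real.rpow_le_rpow (norm_nonneg _) (hmax η) (by linarith))
      (by positivity)
  have h3 : M ^ 2 ≤ C * (N : ℝ) ^ (n - 1) *
      (M ^ (2 - r) * ∫ η : Sph n, ‖pev (η : E n) p‖ ^ r ∂(sphMeasure n)) :=
    h1.trans (mul_le_mul (hC N hN N (by omega) B θ₀) h2 (integral_nonneg fun _ => by positivity)
      (by positivity))
  have h4 : M ^ 2 = M ^ r * M ^ (2 - r) := by
    rw [← Real.rpow_add h0, ← Real.rpow_natCast]; norm_num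
  have h5 : 0 < M ^ (2 - r) := Real.rpow_pos_of_pos h0 _
  refine le_of_mul_le_mul_right ?_ h5
  rw [← h4]
  linarith

end RoughPDO
end

noncomputable section
namespace RoughPDO
open scoped LineDeriv Laplacian

/-! ### The Chebyshev factor -/

/-- The normalized Chebyshev polynomial `U_{N-1}/N`. -/
def chebU (N : ℕ) : Polynomial ℝ :=
  Polynomial.C ((N : ℝ)⁻¹) * Polynomial.Chebyshev.U ℝ ((N : ℤ) - 1)

/-- The recurrence U_{m+1} = X U_m + T_{m+1} with |T_{m+1}| ≤ 1 adds at most 1 at each step. -/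
theorem abs_eval_U_le (m : ℕ) {t : ℝ} (ht : |t| ≤ 1) :
    |(Polynomial.Chebyshev.U ℝ m).eval t| ≤ m + 1 := by
  induction m with
  | zero => simp
  | succ m ih =>
    have h := congrArg (Polynomial.eval t) (Polynomial.Chebyshev.U_eq_X_mul_U_add_T ℝ (m : ℤ))
    push_cast at h ⊢
    rw [h]
    simp only [Polynomial.eval_add, Polynomial.eval_mul, Polynomial.eval_X]
    have h1 := Polynomial.Chebyshev.abs_eval_T_real_le_one ((m : ℤ) + 1) ht
    calc _ ≤ |t| * |(Polynomial.Chebyshev.U ℝ m).eval t| + 1 := by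
          refine (abs_add_le _ _).trans ?_
          rw [abs_mul]; gcongr
      _ ≤ 1 * (m + 1) + 1 := by gcongr
      _ = _ := by ring

theorem eval_chebU_one {N : ℕ} (hN : 1 ≤ N) : (chebU N).eval 1 = 1 := by
  have : (N : ℝ) ≠ 0 := by positivity
  simp [chebU, this]

theorem natDegree_chebU_le {N : ℕ} (hN : 1 ≤ N) : (chebU N).natDegree ≤ N - 1 := by
  obtain ⟨m, rfl⟩ : ∃ m, N = m + 1 := ⟨N - 1, by omega⟩
  refine (Polynomial.natDegree_C_mul_le _ _).trans ?_
  push_cast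
  rw [add_sub_cancel_right, Polynomial.Chebyshev.natDegree_U_natCast]

theorem abs_eval_chebU_le {N : ℕ} (hN : 1 ≤ N) {t : ℝ} (ht : |t| ≤ 1) :
    |(chebU N).eval t| ≤ 1 := by
  obtain ⟨m, rfl⟩ : ∃ m, N = m + 1 := ⟨N - 1, by omega⟩
  have h := abs_eval_U_le m ht
  have h0 : (0 : ℝ) < m + 1 := by positivity
  simp only [chebU, Polynomial.eval_mul, Polynomial.eval_C, abs_mul, abs_inv]
  push_cast
  rw [add_sub_cancel_right, abs_of_pos h0, inv_mul_le_iff₀ h0, mul_one]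
  exact h

/-- U_{N-1}(cos a) sin a = sin(N a). This decay away from t = ±1 is the gain of N⁻¹ that offsets the
N of Bernstein's inequality. -/
theorem sq_eval_chebU_mul_le {N : ℕ} (hN : 1 ≤ N) {t : ℝ} (ht : |t| ≤ 1) :
    ((chebU N).eval t) ^ 2 * (1 - t ^ 2) ≤ ((N : ℝ) ^ 2)⁻¹ := by
  obtain ⟨m, rfl⟩ : ∃ m, N = m + 1 := ⟨N - 1, by omega⟩
  have hm := abs_le.mp ht
  have h := Polynomial.Chebyshev.U_real_cos (Real.arccos t) (m : ℤ)
  rw [Real.cos_arccos hm.1 hm.2] at h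
  have h2 : Real.sin (Real.arccos t) ^ 2 = 1 - t ^ 2 := by
    rw [Real.sin_arccos, Real.sq_sqrt]; nlinarith
  simp only [chebU, Polynomial.eval_mul, Polynomial.eval_C, mul_pow]
  push_cast
  rw [add_sub_cancel_right, ← h2, mul_assoc, ← mul_pow, h, inv_pow]
  have h3 := Real.sin_sq_le_one (((m : ℤ) + 1 : ℝ) * Real.arccos t)
  have h4 : (0 : ℝ) ≤ (((m : ℝ) + 1) ^ 2)⁻¹ := by positivity
  exact mul_le_of_le_one_right h4 h3

/-- From (1 - t²) U_m' = t U_m - (m+1) T_{m+1}: both terms are at most m + 1 = N, and the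
normalization divides by N. -/
theorem abs_derivative_chebU_mul_le {N : ℕ} (hN : 1 ≤ N) {t : ℝ} (ht : |t| ≤ 1) :
    |(Polynomial.derivative (chebU N)).eval t * (1 - t ^ 2)| ≤ 2 := by
  obtain ⟨m, rfl⟩ : ∃ m, N = m + 1 := ⟨N - 1, by omega⟩
  have h := congrArg (Polynomial.eval t) (Polynomial.Chebyshev.add_one_mul_T_eq_poly_in_U (R := ℝ) (m : ℤ))
  have h0 : (0 : ℝ) < m + 1 := by positivity
  simp only [Polynomial.eval_mul, Polynomial.eval_add, Polynomial.eval_sub, Polynomial.eval_X,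
    Polynomial.eval_one, Polynomial.eval_pow, Int.cast_natCast, Polynomial.eval_natCast] at h
  simp only [chebU, Polynomial.derivative_mul, Polynomial.derivative_C, zero_mul, zero_add,
    Polynomial.eval_mul, Polynomial.eval_C]
  push_cast
  rw [add_sub_cancel_right]
  have h1 := Polynomial.Chebyshev.abs_eval_T_real_le_one ((m : ℤ) + 1) ht
  have h2 := abs_eval_U_le m ht
  rw [mul_assoc, abs_mul, abs_inv, abs_of_pos h0, inv_mul_le_iff₀ h0]
  have h3 : (Polynomial.derivative (Polynomial.Chebyshev.U ℝ m)).eval t * (1 - t ^ 2) =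
      t * (Polynomial.Chebyshev.U ℝ m).eval t -
        (m + 1) * (Polynomial.Chebyshev.T ℝ (m + 1)).eval t := by linarith
  rw [h3]
  calc _ ≤ |t| * |(Polynomial.Chebyshev.U ℝ m).eval t| +
        (m + 1) * |(Polynomial.Chebyshev.T ℝ (m + 1)).eval t| := by
        refine (abs_sub _ _).trans ?_
        rw [abs_mul, abs_mul, abs_of_pos h0]
    _ ≤ 1 * (m + 1) + (m + 1) * 1 := by gcongr
    _ = _ := by ring

/-- The polynomial `x ↦ U_{N-1}(⟨w, x⟩)/N`. -/
def chebPoly {n : ℕ} (N : ℕ) (w : E n) : MvPolynomial (Fin n) ℂ :=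
  Polynomial.aeval (linForm w) ((chebU N).map (algebraMap ℝ ℂ))

theorem pev_aeval_linForm {n : ℕ} (w x : E n) (g : Polynomial ℝ) :
    pev x (Polynomial.aeval (linForm w) (g.map (algebraMap ℝ ℂ))) =
      ((g.eval (inner ℝ w x) : ℝ) : ℂ) := by
  rw [← Polynomial.aeval_algHom_apply, pev_linForm, Polynomial.aeval_map_algebraMap]
  exact Polynomial.aeval_algebraMap_apply_eq_algebraMap_eval _ _

theorem pev_chebPoly {n : ℕ} (N : ℕ) (w x : E n) :
    pev x (chebPoly N w) = (((chebU N).eval (inner ℝ w x) : ℝ) : ℂ) := pev_aeval_linForm w x _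

theorem totalDegree_chebPoly_le {n N : ℕ} (hN : 1 ≤ N) (w : E n) :
    (chebPoly N w).totalDegree ≤ N - 1 := by
  rw [chebPoly, Polynomial.aeval_eq_sum_range]
  refine MvPolynomial.totalDegree_finsetSum_le fun i hi => ?_
  refine (MvPolynomial.totalDegree_smul_le _ _).trans ((MvPolynomial.totalDegree_pow _ _).trans ?_)
  have h1 := totalDegree_linForm_le w
  have h2 := natDegree_chebU_le hN
  have h3 : i ≤ ((chebU N).map (algebraMap ℝ ℂ)).natDegree := by
    have := Finset.mem_range.mp hi; omega
  rw [Polynomial.natDegree_map] at h3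
  calc i * _ ≤ i * 1 := by gcongr
    _ ≤ N - 1 := by omega

/-! ### Tangential derivatives -/

theorem dirDeriv_mul {n : ℕ} (w : E n) (P Q : MvPolynomial (Fin n) ℂ) :
    dirDeriv w (P * Q) = dirDeriv w P * Q + P * dirDeriv w Q := by
  simp only [dirDeriv, Finset.sum_mul, Finset.mul_sum, ← Finset.sum_add_distrib]
  refine Finset.sum_congr rfl fun i _ => ?_
  rw [Derivation.leibniz, smul_eq_mul, smul_eq_mul]; ring

theorem tanDeriv_mul {n : ℕ} (w : E n) (P Q : MvPolynomial (Fin n) ℂ) :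
    tanDeriv w (P * Q) = tanDeriv w P * Q + P * tanDeriv w Q := by
  have h : ∑ i, MvPolynomial.X i * MvPolynomial.pderiv i (P * Q) =
      (∑ i, MvPolynomial.X i * MvPolynomial.pderiv i P) * Q +
        P * ∑ i, MvPolynomial.X i * MvPolynomial.pderiv i Q := by
    simp only [Finset.sum_mul, Finset.mul_sum, ← Finset.sum_add_distrib]
    refine Finset.sum_congr rfl fun i _ => ?_
    rw [Derivation.leibniz, smul_eq_mul, smul_eq_mul]; ring
  rw [tanDeriv, h, dirDeriv_mul, tanDeriv, tanDeriv]; ring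

theorem pderiv_linForm {n : ℕ} (w : E n) (i : Fin n) :
    MvPolynomial.pderiv i (linForm w) = MvPolynomial.C ((w i : ℝ) : ℂ) := by
  rw [linForm, map_sum, Finset.sum_eq_single i]
  · rw [Derivation.leibniz]; simp
  · intro j _ hj
    rw [Derivation.leibniz]; simp [MvPolynomial.pderiv_X_of_ne hj]
  · simp

theorem pderiv_aeval_linForm {n : ℕ} (w : E n) (g : Polynomial ℂ) (i : Fin n) :
    MvPolynomial.pderiv i (Polynomial.aeval (linForm w) g) =
      Polynomial.aeval (linForm w) (Polynomial.derivative g) * MvPolynomial.C ((w i : ℝ) : ℂ) := by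
  induction g using Polynomial.induction_on' with
  | add p q hp hq => simp only [map_add, hp, hq, add_mul]
  | monomial k a =>
    rw [Polynomial.aeval_monomial, Polynomial.derivative_monomial, Polynomial.aeval_monomial,
      MvPolynomial.algebraMap_eq, MvPolynomial.pderiv_C_mul, Derivation.leibniz_pow, pderiv_linForm]
    simp only [smul_eq_mul, nsmul_eq_mul, map_mul, map_natCast, MvPolynomial.smul_eq_C_mul]
    ring

/-- For |x| = 1 the factor ‖w‖² - ⟨w,x⟩² is the squared length of the tangential part of w, that is
1 - t² when w is a unit vector. It tames the derivative of the Chebyshev polynomial. -/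
theorem pev_tanDeriv_chebPoly {n N : ℕ} (w x : E n) :
    pev x (tanDeriv w (chebPoly N w)) =
      (((Polynomial.derivative (chebU N)).eval (inner ℝ w x) *
        (‖w‖ ^ 2 - (inner ℝ w x) ^ 2) : ℝ) : ℂ) := by
  simp only [tanDeriv, dirDeriv, chebPoly, pderiv_aeval_linForm, Polynomial.derivative_map,
    map_sub, map_mul, map_sum, pev_aeval_linForm, pev_C, pev_X, pev_linForm]
  have h1 : ∑ i, ((w i : ℝ) : ℂ) * ((w i : ℝ) : ℂ) = ((‖w‖ ^ 2 : ℝ) : ℂ) := by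
    rw [EuclideanSpace.real_norm_sq_eq]; push_cast; exact Finset.sum_congr rfl fun i _ => by ring
  have h2 : ∑ i, ((x i : ℝ) : ℂ) * ((w i : ℝ) : ℂ) = ((inner ℝ w x : ℝ) : ℂ) := by
    rw [PiLp.inner_apply]; push_cast
    exact Finset.sum_congr rfl fun i _ => by simp
  set G := (((Polynomial.derivative (chebU N)).eval (inner ℝ w x) : ℝ) : ℂ)
  have h3 : ∑ i, ((w i : ℝ) : ℂ) * (G * ((w i : ℝ) : ℂ)) = G * ((‖w‖ ^ 2 : ℝ) : ℂ) := by
    rw [← h1, Finset.mul_sum]; exact Finset.sum_congr rfl fun i _ => by ring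
  have h4 : ∑ i, ((x i : ℝ) : ℂ) * (G * ((w i : ℝ) : ℂ)) = G * ((inner ℝ w x : ℝ) : ℂ) := by
    rw [← h2, Finset.mul_sum]; exact Finset.sum_congr rfl fun i _ => by ring
  rw [h3, h4]; push_cast; ring

/-- At θ, `tanDeriv` depends only on the tangential part v = η - tθ of the direction, and |v|² = 1 -
t². Expand v in coordinates and apply Cauchy-Schwarz. -/
theorem norm_sq_pev_tanDeriv_le {n : ℕ} (η θ : Sph n) (D : MvPolynomial (Fin n) ℂ) :
    ‖pev (θ : E n) (tanDeriv (η : E n) D)‖ ^ 2 ≤ (1 - (inner ℝ (η : E n) (θ : E n)) ^ 2) *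
      ∑ i, ‖pev (θ : E n) (tanDeriv (EuclideanSpace.basisFun (Fin n) ℝ i) D)‖ ^ 2 := by
  set t : ℝ := inner ℝ (η : E n) (θ : E n) with ht
  set v : E n := (η : E n) - t • (θ : E n) with hv
  have hη := norm_sph η
  have hθ := norm_sph θ
  have hvθ : inner ℝ v (θ : E n) = 0 := by
    rw [hv, inner_sub_left, inner_smul_left, real_inner_self_eq_norm_sq, hθ]; simp [ht]
  have hv2 : ‖v‖ ^ 2 = 1 - t ^ 2 := by
    rw [hv, norm_sub_sq_real, inner_smul_right, norm_smul, hη, hθ, ← ht, Real.norm_eq_abs]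
    have := sq_abs t
    nlinarith
  set Ed := pev (θ : E n) (∑ i, MvPolynomial.X i * MvPolynomial.pderiv i D) with hEd
  have e1 : ∀ w : E n, pev (θ : E n) (tanDeriv w D) =
      (∑ i, ((w i : ℝ) : ℂ) * pev (θ : E n) (MvPolynomial.pderiv i D)) -
        ((inner ℝ w (θ : E n) : ℝ) : ℂ) * Ed := by
    intro w
    simp only [tanDeriv, dirDeriv, map_sub, map_sum, map_mul, pev_C, pev_linForm, hEd]
  have hEd2 : Ed = ∑ i, (((θ : E n) i : ℝ) : ℂ) * pev (θ : E n) (MvPolynomial.pderiv i D) := by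
    simp only [hEd, map_sum, map_mul, pev_X]
  have e2 : pev (θ : E n) (tanDeriv (η : E n) D) =
      ∑ i, ((v i : ℝ) : ℂ) * pev (θ : E n) (tanDeriv (EuclideanSpace.basisFun (Fin n) ℝ i) D) := by
    have h1 : ∀ i, pev (θ : E n) (tanDeriv (EuclideanSpace.basisFun (Fin n) ℝ i) D) =
        pev (θ : E n) (MvPolynomial.pderiv i D) - (((θ : E n) i : ℝ) : ℂ) * Ed := by
      intro i
      rw [tanDeriv, dirDeriv_basis, linForm_basis, map_sub, map_mul, pev_X]
    simp only [h1, mul_sub, Finset.sum_sub_distrib]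
    have h2 : ∑ i, ((v i : ℝ) : ℂ) * ((((θ : E n) i : ℝ) : ℂ) * Ed) = 0 := by
      have : ∑ i, ((v i : ℝ) : ℂ) * (((θ : E n) i : ℝ) : ℂ) = ((inner ℝ v (θ : E n) : ℝ) : ℂ) := by
        rw [PiLp.inner_apply]; push_cast
        exact Finset.sum_congr rfl fun i _ => by simp [mul_comm]
      simp only [← mul_assoc]
      rw [← Finset.sum_mul, this, hvθ]; simp
    rw [h2, sub_zero, e1, ← ht]
    have h3 : ∀ i, ((v i : ℝ) : ℂ) = (((η : E n) i : ℝ) : ℂ) - (t : ℂ) * (((θ : E n) i : ℝ) : ℂ) := by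
      intro i; simp [hv]
    simp only [h3, sub_mul, Finset.sum_sub_distrib, mul_assoc]
    rw [← Finset.mul_sum, ← hEd2]
  rw [e2, ← hv2, EuclideanSpace.real_norm_sq_eq]
  calc _ ≤ (∑ i, |v i| * ‖pev (θ : E n) (tanDeriv (EuclideanSpace.basisFun (Fin n) ℝ i) D)‖) ^ 2 := by
        gcongr
        exact (norm_sum_le _ _).trans (le_of_eq (by simp))
    _ ≤ (∑ i, |v i| ^ 2) *
        ∑ i, ‖pev (θ : E n) (tanDeriv (EuclideanSpace.basisFun (Fin n) ℝ i) D)‖ ^ 2 :=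
        Finset.sum_mul_sq_le_sq_mul_sq _ _ _
    _ = _ := by simp only [sq_abs]

theorem totalDegree_pderiv_le {n : ℕ} (i : Fin n) (P : MvPolynomial (Fin n) ℂ) :
    (MvPolynomial.pderiv i P).totalDegree ≤ P.totalDegree - 1 := by
  conv_lhs => rw [MvPolynomial.as_sum P, map_sum]
  refine MvPolynomial.totalDegree_finsetSum_le fun d hd => ?_
  rw [MvPolynomial.pderiv_monomial]
  by_cases h : d i = 0
  · simp [h]
  refine (MvPolynomial.totalDegree_monomial_le _ _).trans ?_
  have h1 := MvPolynomial.le_totalDegree hd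
  have h2 : (d - Finsupp.single i 1).degree + 1 = d.degree := by
    have : d = (d - Finsupp.single i 1) + Finsupp.single i 1 := by
      rw [tsub_add_cancel_of_le]; simpa using Nat.one_le_iff_ne_zero.mpr h
    conv_rhs => rw [this]
    simp
  have h3 : d.degree ≤ P.totalDegree := h1
  have h4 : ((d - Finsupp.single i 1).sum fun _ e => e) = (d - Finsupp.single i 1).degree := rfl
  change ((d - Finsupp.single i 1).sum fun _ e => e) ≤ _
  rw [h4]; omega

theorem totalDegree_tanDeriv_le {n : ℕ} (w : E n) (P : MvPolynomial (Fin n) ℂ) :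
    (tanDeriv w P).totalDegree ≤ P.totalDegree + 1 := by
  rcases Nat.eq_zero_or_pos P.totalDegree with h0 | h0
  · have hC := MvPolynomial.totalDegree_eq_zero_iff_eq_C.mp h0
    have : tanDeriv w P = 0 := by rw [tanDeriv, dirDeriv, hC]; simp
    simp [this]
  refine (MvPolynomial.totalDegree_sub _ _).trans (max_le ?_ ?_)
  · refine MvPolynomial.totalDegree_finsetSum_le fun i _ => ?_
    refine (MvPolynomial.totalDegree_mul _ _).trans ?_
    have := totalDegree_pderiv_le i P
    simp; omega
  · refine (MvPolynomial.totalDegree_mul _ _).trans ?_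
    have h1 := totalDegree_linForm_le w
    have h2 : (∑ i, MvPolynomial.X i * MvPolynomial.pderiv i P).totalDegree ≤ P.totalDegree := by
      refine MvPolynomial.totalDegree_finsetSum_le fun i _ => ?_
      refine (MvPolynomial.totalDegree_mul _ _).trans ?_
      have := totalDegree_pderiv_le i P
      simp; omega
    omega

theorem integrable_norm_sq_schwartz {n : ℕ} (f : 𝓢(E n, ℂ)) : Integrable (fun x => ‖f x‖ ^ 2) :=
  (memLp_two_iff_integrable_sq_norm f.continuous.aestronglyMeasurable).mp (f.memLp 2)

theorem norm_sq_add_le' {V : Type*} [NormedAddCommGroup V] (a b : V) :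
    ‖a + b‖ ^ 2 ≤ 2 * (‖a‖ ^ 2 + ‖b‖ ^ 2) := by
  nlinarith [norm_add_le a b, norm_nonneg (a + b), sq_nonneg (‖a‖ - ‖b‖)]

theorem integral_norm_sq_add_le {α V : Type*} [MeasurableSpace α] {μ : Measure α}
    [NormedAddCommGroup V] {f g : α → V} (hf : Integrable (fun x => ‖f x‖ ^ 2) μ)
    (hg : Integrable (fun x => ‖g x‖ ^ 2) μ) :
    ∫ x, ‖f x + g x‖ ^ 2 ∂μ ≤ 2 * (∫ x, ‖f x‖ ^ 2 ∂μ + ∫ x, ‖g x‖ ^ 2 ∂μ) := by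
  rw [← integral_add hf hg, ← integral_const_mul]
  exact integral_mono_of_nonneg (Filter.Eventually.of_forall fun x => by positivity)
    ((hf.add hg).const_mul 2) (Filter.Eventually.of_forall fun x => norm_sq_add_le' _ _)

theorem integrable_norm_sq_pev {n : ℕ} (P : MvPolynomial (Fin n) ℂ) :
    Integrable (fun θ : Sph n => ‖pev (θ : E n) P‖ ^ 2) (sphMeasure n) :=
  integrable_sph_of_continuous (by have := continuous_pev_sph P; fun_prop)

/-- Bernstein's inequality for tangential derivatives in `L²`. -/
theorem exists_bernstein {n : ℕ} (hn : 0 < n) : ∃ C : ℝ, 0 ≤ C ∧ ∀ N : ℕ, 1 ≤ N →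
    ∀ D : MvPolynomial (Fin n) ℂ, D.totalDegree ≤ 4 * N → ∀ w : E n, ‖w‖ = 1 →
      ∫ θ : Sph n, ‖pev (θ : E n) (tanDeriv w D)‖ ^ 2 ∂(sphMeasure n) ≤
        C * (N : ℝ) ^ 2 * ∫ θ : Sph n, ‖pev (θ : E n) D‖ ^ 2 ∂(sphMeasure n) := by
  obtain ⟨C, hC0, hC⟩ := exists_sobolev_bound hn 1 annBump
  set v₁ := (2 : ℝ) • AnnProfile.pw (1 / 2) (AnnProfile.der annBump) with hv₁
  set v₂ := AnnProfile.pw (-1 / 2) annBump with hv₂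
  set c₁ := ∫ r : Set.Ioi (0 : ℝ), (v₁ ((r : ℝ) ^ 2)) ^ 2 ∂(radMeasure n) with hc₁
  set c₂ := ∫ r : Set.Ioi (0 : ℝ), (v₂ ((r : ℝ) ^ 2)) ^ 2 ∂(radMeasure n) with hc₂
  have hc1 : 0 ≤ c₁ := integral_nonneg fun _ => by positivity
  have hc2 : 0 < c₂ := by
    refine integral_radial_pos hn one_pos ?_
    rw [hv₂, AnnProfile.pw_apply, annBump_eq_one] <;> norm_num
  refine ⟨c₂⁻¹ * (2 * (C + c₁)), by positivity, fun N hN D hD w hw => ?_⟩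
  set I := ∫ θ : Sph n, ‖pev (θ : E n) D‖ ^ 2 ∂(sphMeasure n) with hI
  have hI0 : 0 ≤ I := integral_nonneg fun _ => by positivity
  have hN1 : (1 : ℝ) ≤ N := by exact_mod_cast hN
  -- The multiplier of the derivative has size at most a = 2π|z|, and a ≤ N(1 + N⁻²a²): the weighted
  -- bound with b = 1 costs a factor N.
  have h1 : ∫ x, ‖(∂_{w} (annS D annBump)) x‖ ^ 2 ≤ (N : ℝ) ^ 2 * (C * I) := by
    rw [← integral_norm_sq_fourierInv]
    refine le_trans ?_ (mul_le_mul_of_nonneg_left (hC N hN D hD) (by positivity))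
    rw [← integral_const_mul]
    have hint : Integrable (fun z => ‖(((1 + ((N : ℝ) ^ 2)⁻¹ * (2 * Real.pi * ‖z‖) ^ 2 : ℝ) : ℂ)) ^ 1
        * 𝓕⁻ (annS D annBump) z‖ ^ 2) := by
      simp only [← fourierInv_helmS_iterate]
      exact integrable_norm_sq_schwartz _
    refine integral_mono_of_nonneg (Filter.Eventually.of_forall fun x => by positivity)
      (hint.const_mul _) (Filter.Eventually.of_forall fun z => ?_)
    dsimp only
    rw [fourierInv_lineDeriv_apply, ← mul_pow]
    refine pow_le_pow_left₀ (norm_nonneg _) ?_ 2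
    rw [norm_mul, norm_mul, pow_one, norm_mul, ← mul_assoc]
    refine mul_le_mul_of_nonneg_right ?_ (norm_nonneg _)
    have h0 : (0 : ℝ) ≤ 1 + ((N : ℝ) ^ 2)⁻¹ * (2 * Real.pi * ‖z‖) ^ 2 := by positivity
    rw [Complex.norm_real, Complex.norm_real, Real.norm_of_nonneg h0]
    have h2 : ‖(inner ℝ z w : ℝ)‖ ≤ ‖z‖ := by
      simpa [hw] using norm_inner_le_norm (𝕜 := ℝ) z w
    have h3 : ‖-(2 * (Real.pi : ℂ) * Complex.I)‖ = 2 * Real.pi := by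
      simp [abs_of_pos Real.pi_pos]
    rw [h3]
    set a := 2 * Real.pi * ‖z‖ with ha
    have ha0 : 0 ≤ a := by positivity
    calc 2 * Real.pi * ‖(inner ℝ z w : ℝ)‖ ≤ a := by rw [ha]; gcongr
      _ ≤ N * (1 + ((N : ℝ) ^ 2)⁻¹ * a ^ 2) := by
        have : (N : ℝ) * (1 + ((N : ℝ) ^ 2)⁻¹ * a ^ 2) = (N ^ 2 + a ^ 2) / N := by field_simp
        rw [this, le_div_iff₀ (by positivity)]
        nlinarith [sq_nonneg ((N : ℝ) - a)]
  -- The tangential part is the full derivative minus the radial part, and the latter is bounded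
  -- without any power of N.
  have h2 : annS (tanDeriv w D) v₂ = ∂_{w} (annS D annBump) + -annS (linForm w * D) v₁ := by
    rw [lineDeriv_annS hn w D annBump]; abel
  have h3 : (∫ θ : Sph n, ‖pev (θ : E n) (linForm w * D)‖ ^ 2 ∂(sphMeasure n)) ≤ I := by
    refine integral_mono (integrable_norm_sq_pev _) (integrable_norm_sq_pev _) fun θ => ?_
    dsimp only
    refine pow_le_pow_left₀ (norm_nonneg _) ?_ 2
    rw [map_mul, norm_mul, pev_linForm]
    refine mul_le_of_le_one_left (norm_nonneg _) ?_
    rw [Complex.norm_real]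
    simpa [hw, norm_sph] using norm_inner_le_norm (𝕜 := ℝ) w (θ : E n)
  have h4 := integral_norm_sq_annS hn (tanDeriv w D) v₂
  rw [h2] at h4
  have h5 : ∫ x, ‖(∂_{w} (annS D annBump) + -annS (linForm w * D) v₁) x‖ ^ 2 ≤
      2 * ((N : ℝ) ^ 2 * (C * I) + c₁ * I) := by
    simp only [add_apply]
    refine (integral_norm_sq_add_le (integrable_norm_sq_schwartz _)
      (integrable_norm_sq_schwartz _)).trans ?_
    refine mul_le_mul_of_nonneg_left (add_le_add h1 ?_) (by norm_num)
    have : ∀ x, ‖(-annS (linForm w * D) v₁) x‖ = ‖annS (linForm w * D) v₁ x‖ := fun x => by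
      rw [neg_apply, norm_neg]
    simp only [this]
    rw [integral_norm_sq_annS hn, mul_comm]
    exact mul_le_mul_of_nonneg_left h3 hc1
  rw [h4, ← hc₂] at h5
  have h6 : c₁ * I ≤ (N : ℝ) ^ 2 * (c₁ * I) :=
    le_mul_of_one_le_left (by positivity) (by nlinarith)
  rw [mul_assoc, mul_assoc, ← div_eq_inv_mul, le_div_iff₀ hc2]
  nlinarith

/-- The tangential derivative of `U_{N-1}(⟨η, x⟩)/N · D(x)` in the direction `η`. -/
theorem exists_tanDeriv_chebPoly_bound {n : ℕ} (hn : 0 < n) : ∃ C : ℝ, 0 ≤ C ∧ ∀ N : ℕ, 1 ≤ N →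
    ∀ D : MvPolynomial (Fin n) ℂ, D.totalDegree ≤ 4 * N → ∀ η : Sph n,
      ∫ θ : Sph n, ‖pev (θ : E n) (tanDeriv (η : E n) (chebPoly N (η : E n) * D))‖ ^ 2
        ∂(sphMeasure n) ≤ C * ∫ θ : Sph n, ‖pev (θ : E n) D‖ ^ 2 ∂(sphMeasure n) := by
  obtain ⟨C, hC0, hC⟩ := exists_bernstein hn
  refine ⟨2 * (4 + n * C), by positivity, fun N hN D hD η => ?_⟩
  set I := ∫ θ : Sph n, ‖pev (θ : E n) D‖ ^ 2 ∂(sphMeasure n) with hI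
  have hN1 : (1 : ℝ) ≤ N := by exact_mod_cast hN
  have ht : ∀ θ : Sph n, |(inner ℝ (η : E n) (θ : E n) : ℝ)| ≤ 1 := fun θ => by
    simpa [norm_sph] using abs_real_inner_le_norm (η : E n) (θ : E n)
  -- Leibniz. When the derivative falls on the Chebyshev factor, it is at most 2 pointwise. When it
  -- falls on D, the factor 1 - t² from the tangential part of η and the square of the Chebyshev
  -- factor give N⁻², against the N² of Bernstein's inequality.
  simp only [tanDeriv_mul, map_add]
  refine (integral_norm_sq_add_le (integrable_norm_sq_pev _) (integrable_norm_sq_pev _)).trans ?_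
  rw [mul_assoc 2]
  refine mul_le_mul_of_nonneg_left ?_ (by norm_num)
  rw [add_mul]
  refine add_le_add ?_ ?_
  · rw [hI, ← integral_const_mul]
    refine integral_mono (integrable_norm_sq_pev _) ((integrable_norm_sq_pev _).const_mul _)
      fun θ => ?_
    dsimp only
    rw [map_mul, norm_mul, mul_pow, pev_tanDeriv_chebPoly, norm_sph, one_pow, Complex.norm_real,
      Real.norm_eq_abs]
    refine mul_le_mul_of_nonneg_right ?_ (by positivity)
    have := abs_derivative_chebU_mul_le hN (ht θ)
    calc _ ≤ (2 : ℝ) ^ 2 := pow_le_pow_left₀ (abs_nonneg _) this 2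
      _ = 4 := by norm_num
  · have h1 : ∀ θ : Sph n, ‖pev (θ : E n) (chebPoly N (η : E n) * tanDeriv (η : E n) D)‖ ^ 2 ≤
        ((N : ℝ) ^ 2)⁻¹ *
          ∑ i, ‖pev (θ : E n) (tanDeriv (EuclideanSpace.basisFun (Fin n) ℝ i) D)‖ ^ 2 := by
      intro θ
      rw [map_mul, norm_mul, mul_pow, pev_chebPoly, Complex.norm_real, Real.norm_eq_abs, sq_abs]
      refine (mul_le_mul_of_nonneg_left (norm_sq_pev_tanDeriv_le η θ D) (sq_nonneg _)).trans ?_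
      rw [← mul_assoc]
      exact mul_le_mul_of_nonneg_right (sq_eval_chebU_mul_le hN (ht θ))
        (Finset.sum_nonneg fun i _ => by positivity)
    calc _ ≤ ∫ θ : Sph n, ((N : ℝ) ^ 2)⁻¹ *
          ∑ i, ‖pev (θ : E n) (tanDeriv (EuclideanSpace.basisFun (Fin n) ℝ i) D)‖ ^ 2
            ∂(sphMeasure n) :=
          integral_mono (integrable_norm_sq_pev _)
            ((integrable_finsetSum _ fun i _ => integrable_norm_sq_pev _).const_mul _) h1
      _ = ((N : ℝ) ^ 2)⁻¹ * ∑ i : Fin n, ∫ θ : Sph n,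
          ‖pev (θ : E n) (tanDeriv (EuclideanSpace.basisFun (Fin n) ℝ i) D)‖ ^ 2
            ∂(sphMeasure n) := by
          rw [integral_const_mul, integral_finsetSum _ fun i _ => integrable_norm_sq_pev _]
      _ ≤ ((N : ℝ) ^ 2)⁻¹ * ∑ i : Fin n, (C * (N : ℝ) ^ 2 * I) := by
          gcongr with i
          exact hC N hN D hD _ (by simp)
      _ = n * C * I := by
          rw [Finset.sum_const, Finset.card_univ, Fintype.card_fin, nsmul_eq_mul]
          field_simp

end RoughPDO
end

noncomputable section
namespace RoughPDO
open scoped LineDeriv Laplacian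

/-! ### The integral of the kernels -/

/-- The weight `(1 + (2π⟨z, w⟩)²) (1 + |2πz|²/N²)^{2n}`. -/
def kerWeight {n : ℕ} (N : ℕ) (w z : E n) : ℝ :=
  (1 + (2 * Real.pi * inner ℝ z w) ^ 2) *
    (1 + ((N : ℝ) ^ 2)⁻¹ * (2 * Real.pi * ‖z‖) ^ 2) ^ (2 * n)

theorem kerWeight_pos {n : ℕ} (N : ℕ) (w z : E n) : 0 < kerWeight N w z := by
  unfold kerWeight; positivity

theorem continuous_kerWeight {n : ℕ} (N : ℕ) (w : E n) : Continuous (kerWeight N w) := by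
  unfold kerWeight; fun_prop

theorem integral_inv_one_add_mul_sq {a : ℝ} (ha : 0 < a) :
    Integrable (fun t : ℝ => (1 + (a⁻¹ * t) ^ 2)⁻¹) ∧
      ∫ t : ℝ, (1 + (a⁻¹ * t) ^ 2)⁻¹ = a * Real.pi := by
  constructor
  · exact integrable_inv_one_add_sq.comp_mul_left' (inv_ne_zero ha.ne')
  · rw [Measure.integral_comp_inv_mul_left (fun t : ℝ => (1 + t ^ 2)⁻¹) a,
      integral_univ_inv_one_add_sq, abs_of_pos ha, smul_eq_mul]

/-- The first factor of the weight controls the coordinate along w at scale 1. Each of the m other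
coordinates takes one power of the second factor, at scale N, and more than m powers are available.
-/
theorem kerWeight_inv_le {m N : ℕ} (hN : 1 ≤ N) (z : E (m + 1)) :
    (kerWeight N (EuclideanSpace.basisFun (Fin (m + 1)) ℝ 0) z)⁻¹ ≤
      ∏ i : Fin (m + 1), (1 + ((if i = 0 then (1 : ℝ) else N)⁻¹ * z i) ^ 2)⁻¹ := by
  rw [Finset.prod_inv_distrib]
  refine inv_anti₀ (Finset.prod_pos fun i _ => by positivity) ?_
  have hpi : (1 : ℝ) ≤ 2 * Real.pi := by linarith [Real.pi_gt_three]
  have hN1 : (1 : ℝ) ≤ N := by exact_mod_cast hN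
  set A : ℝ := 1 + ((N : ℝ) ^ 2)⁻¹ * (2 * Real.pi * ‖z‖) ^ 2 with hA
  have hA1 : 1 ≤ A := by rw [hA]; linarith [show 0 ≤ ((N : ℝ) ^ 2)⁻¹ * (2 * Real.pi * ‖z‖) ^ 2 by positivity]
  have hz : ∀ i, 1 + ((N : ℝ)⁻¹ * z i) ^ 2 ≤ A := by
    intro i
    have h1 : |z i| ≤ ‖z‖ := by simpa using PiLp.norm_apply_le z i
    have h2 : z i ^ 2 ≤ (2 * Real.pi * ‖z‖) ^ 2 := by
      rw [← sq_abs (z i)]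
      refine pow_le_pow_left₀ (abs_nonneg _) (h1.trans ?_) 2
      exact le_mul_of_one_le_left (norm_nonneg _) hpi
    rw [hA, mul_pow, inv_pow]
    gcongr
  rw [Fin.prod_univ_succ, kerWeight]
  refine mul_le_mul ?_ ?_ (Finset.prod_nonneg fun i _ => by positivity) (by positivity)
  · have : inner ℝ z (EuclideanSpace.basisFun (Fin (m + 1)) ℝ 0) = z 0 := by
      simp [EuclideanSpace.inner_single_right]
    rw [this, if_pos rfl, inv_one, one_mul, mul_pow]
    have : (1 : ℝ) ≤ (2 * Real.pi) ^ 2 := one_le_pow₀ hpi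
    nlinarith [sq_nonneg (z 0)]
  · calc ∏ i : Fin m, (1 + ((if i.succ = 0 then (1 : ℝ) else N)⁻¹ * z i.succ) ^ 2)
        ≤ ∏ _i : Fin m, A := by
          refine Finset.prod_le_prod (fun i _ => by positivity) fun i _ => ?_
          rw [if_neg (Fin.succ_ne_zero i)]
          exact hz _
      _ = A ^ m := by simp
      _ ≤ A ^ (2 * (m + 1)) := pow_le_pow_right₀ hA1 (by omega)

/-- A reflection reduces to the first basis vector, where the majorant is a product of one-variable
integrals: one at scale 1 and n - 1 at scale N. -/
theorem exists_integral_kerWeight_inv_le {n : ℕ} (hn : 0 < n) : ∃ C : ℝ, 0 ≤ C ∧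
    ∀ N : ℕ, 1 ≤ N → ∀ η : Sph n, Integrable (fun z => (kerWeight N (η : E n) z)⁻¹) ∧
      ∫ z, (kerWeight N (η : E n) z)⁻¹ ≤ C * (N : ℝ) ^ (n - 1) := by
  obtain ⟨m, rfl⟩ : ∃ m, n = m + 1 := ⟨n - 1, by omega⟩
  refine ⟨Real.pi * Real.pi ^ m, by positivity, fun N hN η => ?_⟩
  have hN0 : (0 : ℝ) < N := by exact_mod_cast hN
  set e := EuclideanSpace.basisFun (Fin (m + 1)) ℝ 0 with he
  set R : E (m + 1) ≃ₗᵢ[ℝ] E (m + 1) := (ℝ ∙ (e - (η : E (m + 1))))ᗮ.reflection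
  have hR : R e = η := Submodule.reflection_sub (by rw [norm_sph, he]; simp)
  have hW : ∀ z, kerWeight N (η : E (m + 1)) (R z) = kerWeight N e z := by
    intro z
    rw [kerWeight, kerWeight, ← hR, R.inner_map_map, R.norm_map]
  have hpos : ∀ i : Fin (m + 1), (0 : ℝ) < if i = 0 then (1 : ℝ) else N := by
    intro i; split_ifs <;> positivity
  set f : Fin (m + 1) → ℝ → ℝ := fun i t => (1 + ((if i = 0 then (1 : ℝ) else N)⁻¹ * t) ^ 2)⁻¹ with hf
  have hfi : Integrable (fun x : Fin (m + 1) → ℝ => ∏ i, f i (x i)) :=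
    Integrable.fintype_prod fun i => (integral_inv_one_add_mul_sq (hpos i)).1
  have hP := PiLp.volume_preserving_ofLp (Fin (m + 1))
  have hme : MeasurableEmbedding (@WithLp.ofLp 2 (Fin (m + 1) → ℝ)) :=
    (MeasurableEquiv.toLp 2 (Fin (m + 1) → ℝ)).symm.measurableEmbedding
  have hfi2 : Integrable (fun z : E (m + 1) => ∏ i, f i (z i)) :=
    (hP.integrable_comp_emb hme).mpr hfi
  have hint : Integrable (fun z => (kerWeight N e z)⁻¹) := by
    refine hfi2.mono' ((continuous_kerWeight N e).inv₀
      fun z => (kerWeight_pos N e z).ne').aestronglyMeasurable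
      (Filter.Eventually.of_forall fun z => ?_)
    rw [Real.norm_of_nonneg (inv_nonneg.mpr (kerWeight_pos N e z).le)]
    exact kerWeight_inv_le hN z
  constructor
  · rw [← R.measurePreserving.integrable_comp_emb R.toHomeomorph.measurableEmbedding]
    exact hint.congr (Filter.Eventually.of_forall fun z => by simp only [Function.comp, hW])
  · rw [← R.measurePreserving.integral_comp R.toHomeomorph.measurableEmbedding]
    simp only [hW]
    calc ∫ z, (kerWeight N e z)⁻¹ ≤ ∫ z : E (m + 1), ∏ i, f i (z i) :=
          integral_mono hint hfi2 fun z => kerWeight_inv_le hN z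
      _ = ∫ x : Fin (m + 1) → ℝ, ∏ i, f i (x i) :=
          hP.integral_comp hme (fun x : Fin (m + 1) → ℝ => ∏ i, f i (x i))
      _ = ∏ i, ∫ t, f i t := integral_fintype_prod_volume_eq_prod f
      _ = Real.pi * (N * Real.pi) ^ m := by
          rw [Fin.prod_univ_succ]
          congr 1
          · rw [(integral_inv_one_add_mul_sq (hpos 0)).2]; simp
          · rw [Finset.prod_congr rfl fun i _ => (integral_inv_one_add_mul_sq (hpos (Fin.succ i))).2]
            simp
      _ ≤ _ := by
          rw [mul_pow, Nat.add_sub_cancel]; exact le_of_eq (by ring)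

/-- The `L¹` norm of the inverse Fourier transform of `U_{N-1}(⟨η, θ⟩)/N · D(θ) v(|ξ|²)`. -/
theorem exists_integral_norm_fourierInv_le {n : ℕ} (hn : 0 < n) (v : AnnProfile) :
    ∃ C : ℝ, 0 ≤ C ∧ ∀ N : ℕ, 1 ≤ N → ∀ D : MvPolynomial (Fin n) ℂ, D.totalDegree ≤ 2 * N →
      ∀ η : Sph n, ∫ z, ‖𝓕⁻ (annS (chebPoly N (η : E n) * D) v) z‖ ≤
        C * ((N : ℝ) ^ (n - 1) + ∫ θ : Sph n, ‖pev (θ : E n) D‖ ^ 2 ∂(sphMeasure n)) := by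
  set v₁ := (2 : ℝ) • AnnProfile.pw (1 / 2) (AnnProfile.der v) with hv₁
  set v₂ := AnnProfile.pw (-1 / 2) v with hv₂
  -- With b = n the squared weight has the exponent 2n that occurs in `kerWeight`.
  obtain ⟨C₀, hC₀, h0⟩ := exists_sobolev_bound hn n v
  obtain ⟨C₁, hC₁, h1⟩ := exists_sobolev_bound hn n v₁
  obtain ⟨C₂, hC₂, h2⟩ := exists_sobolev_bound hn n v₂
  obtain ⟨C₃, hC₃, h3⟩ := exists_tanDeriv_chebPoly_bound hn
  obtain ⟨C₄, hC₄, h4⟩ := exists_integral_kerWeight_inv_le hn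
  set K := C₀ + 2 * (C₁ + C₂ * C₃) with hK
  have hK0 : 0 ≤ K := by positivity
  refine ⟨C₄ + K, by positivity, fun N hN D hD η => ?_⟩
  set I := ∫ θ : Sph n, ‖pev (θ : E n) D‖ ^ 2 ∂(sphMeasure n) with hI
  have hI0 : 0 ≤ I := integral_nonneg fun _ => by positivity
  set Φ := chebPoly N (η : E n) * D with hΦ
  set F := annS Φ v with hF
  set c := ((N : ℝ) ^ 2)⁻¹ with hc
  have ht : ∀ θ : Sph n, |(inner ℝ (η : E n) (θ : E n) : ℝ)| ≤ 1 := fun θ => by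
    simpa [norm_sph] using abs_real_inner_le_norm (η : E n) (θ : E n)
  -- The degree of Φ is at most (N - 1) + 2N; the extra 1 leaves room for `linForm` and `tanDeriv`,
  -- well below the 4N allowed by `exists_sobolev_bound`.
  have hdegΦ : Φ.totalDegree + 1 ≤ 3 * N := by
    have e1 := MvPolynomial.totalDegree_mul (chebPoly N (η : E n)) D
    have e2 := totalDegree_chebPoly_le hN (η : E n)
    rw [← hΦ] at e1
    omega
  have hΦI : ∫ θ : Sph n, ‖pev (θ : E n) Φ‖ ^ 2 ∂(sphMeasure n) ≤ I := by
    refine integral_mono (integrable_norm_sq_pev _) (integrable_norm_sq_pev _) fun θ => ?_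
    dsimp only
    refine pow_le_pow_left₀ (norm_nonneg _) ?_ 2
    rw [hΦ, map_mul, norm_mul, pev_chebPoly, Complex.norm_real]
    exact mul_le_of_le_one_left (norm_nonneg _) (abs_eval_chebU_le hN (ht θ))
  have hlΦI : ∫ θ : Sph n, ‖pev (θ : E n) (linForm (η : E n) * Φ)‖ ^ 2 ∂(sphMeasure n) ≤ I := by
    refine (integral_mono (integrable_norm_sq_pev _) (integrable_norm_sq_pev _) fun θ => ?_).trans hΦI
    dsimp only
    refine pow_le_pow_left₀ (norm_nonneg _) ?_ 2
    rw [map_mul, norm_mul, pev_linForm, Complex.norm_real]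
    exact mul_le_of_le_one_left (norm_nonneg _) (ht θ)
  set Hm : 𝓢(E n, ℂ) → 𝓢(E n, ℂ) := fun f => 𝓕⁻ ((helmS c)^[n] f) with hHm
  have hHma : ∀ f z, Hm f z = ((1 + c * (2 * Real.pi * ‖z‖) ^ 2 : ℝ) : ℂ) ^ n * 𝓕⁻ f z := fun f z =>
    fourierInv_helmS_iterate c n f z
  have b0 : ∫ z, ‖Hm F z‖ ^ 2 ≤ C₀ * I := by
    simp only [hHma]
    exact (h0 N hN Φ (by omega)).trans (mul_le_mul_of_nonneg_left hΦI hC₀)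
  have b1 : ∫ z, ‖Hm (∂_{(η : E n)} F) z‖ ^ 2 ≤ 2 * (C₁ * I + C₂ * (C₃ * I)) := by
    have e : ∀ z, Hm (∂_{(η : E n)} F) z = Hm (annS (linForm (η : E n) * Φ) v₁) z +
        Hm (annS (tanDeriv (η : E n) Φ) v₂) z := by
      intro z
      rw [hHma, hHma, hHma, hF, lineDeriv_annS hn, FourierTransform.fourierInv_add, add_apply, mul_add]
    simp only [e]
    refine (integral_norm_sq_add_le (integrable_norm_sq_schwartz _)
      (integrable_norm_sq_schwartz _)).trans (mul_le_mul_of_nonneg_left (add_le_add ?_ ?_) (by norm_num))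
    · simp only [hHma]
      refine (h1 N hN _ ?_).trans (mul_le_mul_of_nonneg_left hlΦI hC₁)
      have := MvPolynomial.totalDegree_mul (linForm (η : E n)) Φ
      have := totalDegree_linForm_le (η : E n)
      omega
    · simp only [hHma]
      refine (h2 N hN _ ?_).trans (mul_le_mul_of_nonneg_left (h3 N hN D (by omega) η) hC₂)
      have := totalDegree_tanDeriv_le (η : E n) Φ
      omega
  -- The weight is chosen so that its two summands are the energies of F and of its derivative in
  -- the direction η, both at most a constant times I.
  have hW : ∀ z, kerWeight N (η : E n) z * ‖𝓕⁻ F z‖ ^ 2 =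
      ‖Hm F z‖ ^ 2 + ‖Hm (∂_{(η : E n)} F) z‖ ^ 2 := by
    intro z
    rw [hHma, hHma, fourierInv_lineDeriv_apply]
    have hpos : (0 : ℝ) ≤ 1 + c * (2 * Real.pi * ‖z‖) ^ 2 := by positivity
    have e1 : kerWeight N (η : E n) z = (1 + (2 * Real.pi * inner ℝ z (η : E n)) ^ 2) *
        (1 + c * (2 * Real.pi * ‖z‖) ^ 2) ^ (2 * n) := rfl
    rw [e1]
    set A := 1 + c * (2 * Real.pi * ‖z‖) ^ 2
    have e2 : ‖((A : ℝ) : ℂ) ^ n‖ = A ^ n := by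
      rw [norm_pow, Complex.norm_real, Real.norm_of_nonneg hpos]
    have e3 : ‖-(2 * (Real.pi : ℂ) * Complex.I) * ((inner ℝ z (η : E n) : ℝ) : ℂ)‖ ^ 2 =
        (2 * Real.pi * inner ℝ z (η : E n)) ^ 2 := by
      rw [norm_mul, Complex.norm_real, mul_pow, Real.norm_eq_abs, sq_abs, mul_pow _ (inner ℝ z _)]
      congr 1
      simp [mul_pow]
    rw [norm_mul (((A : ℝ) : ℂ) ^ n), norm_mul (((A : ℝ) : ℂ) ^ n),
      norm_mul (-(2 * (Real.pi : ℂ) * Complex.I) * ((inner ℝ z (η : E n) : ℝ) : ℂ)), e2]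
    linear_combination -(A ^ (2 * n) * ‖𝓕⁻ F z‖ ^ 2) * e3
  obtain ⟨hWi, hWb⟩ := h4 N hN η
  have hsum : Integrable (fun z => ‖Hm F z‖ ^ 2 + ‖Hm (∂_{(η : E n)} F) z‖ ^ 2) :=
    (integrable_norm_sq_schwartz _).add (integrable_norm_sq_schwartz _)
  have hsumb : ∫ z, (‖Hm F z‖ ^ 2 + ‖Hm (∂_{(η : E n)} F) z‖ ^ 2) ≤ K * I := by
    rw [integral_add (integrable_norm_sq_schwartz _) (integrable_norm_sq_schwartz _)]
    refine (add_le_add b0 b1).trans (le_of_eq ?_)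
    rw [hK]; ring
  -- Pointwise a ≤ w⁻¹ + w a² takes the place of Cauchy-Schwarz. In the application both integrals
  -- are of order N^{n-1}.
  calc ∫ z, ‖𝓕⁻ F z‖ ≤ ∫ z, ((kerWeight N (η : E n) z)⁻¹ +
        (‖Hm F z‖ ^ 2 + ‖Hm (∂_{(η : E n)} F) z‖ ^ 2)) := by
        refine integral_mono_of_nonneg (Filter.Eventually.of_forall fun z => norm_nonneg _)
          (hWi.add hsum) (Filter.Eventually.of_forall fun z => ?_)
        dsimp only
        rw [← hW]
        have hw := kerWeight_pos N (η : E n) z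
        set w := kerWeight N (η : E n) z
        set a := ‖𝓕⁻ F z‖
        have ha : 0 ≤ a := norm_nonneg _
        have : w⁻¹ + w * a ^ 2 - a = w⁻¹ * (1 - w * a + (w * a) ^ 2) := by field_simp; ring
        have h5 : 0 ≤ w⁻¹ * (1 - w * a + (w * a) ^ 2) := by
          refine mul_nonneg (inv_nonneg.mpr hw.le) ?_
          nlinarith [sq_nonneg (w * a - 1 / 2)]
        linarith
    _ ≤ C₄ * (N : ℝ) ^ (n - 1) + K * I := by
        rw [integral_add hWi hsum]; exact add_le_add hWb hsumb
    _ ≤ _ := by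
        have : 0 ≤ (N : ℝ) ^ (n - 1) := by positivity
        nlinarith [mul_nonneg hC₄ hI0, mul_nonneg hK0 this]

end RoughPDO
end

noncomputable section
namespace RoughPDO

/-! ### Young's inequality -/

/-- The convolution `∫ K(x - y) f(y) dy`. -/
def cnv {n : ℕ} (K f : E n → ℂ) (x : E n) : ℂ := ∫ y, K (x - y) * f y

theorem aestronglyMeasurable_cnv_integrand {n : ℕ} {K f : E n → ℂ} (hK : AEStronglyMeasurable K)
    (hf : AEStronglyMeasurable f) :
    AEStronglyMeasurable (fun z : E n × E n => K (z.1 - z.2) * f z.2) (volume.prod volume) := by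
  refine AEStronglyMeasurable.mul ?_ hf.comp_snd
  exact hK.comp_quasiMeasurePreserving (quasiMeasurePreserving_sub_of_right_invariant _ _)

theorem aestronglyMeasurable_cnv {n : ℕ} {K f : E n → ℂ} (hK : AEStronglyMeasurable K)
    (hf : AEStronglyMeasurable f) : AEStronglyMeasurable (cnv K f) :=
  (aestronglyMeasurable_cnv_integrand hK hf).integral_prod_right'

theorem enorm_cnv_le {n : ℕ} (K f : E n → ℂ) (x : E n) :
    ‖cnv K f x‖ₑ ≤ ∫⁻ y, ‖K (x - y)‖ₑ * ‖f y‖ₑ := by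
  refine (enorm_integral_le_lintegral_enorm _).trans (le_of_eq ?_)
  simp only [enorm_mul]

theorem aemeasurable_enorm_sub {n : ℕ} {K : E n → ℂ} (hK : AEStronglyMeasurable K) (x : E n) :
    AEMeasurable (fun y => ‖K (x - y)‖ₑ) :=
  (hK.comp_quasiMeasurePreserving
    (quasiMeasurePreserving_sub_left volume x)).enorm

theorem lintegral_enorm_sub {n : ℕ} (K : E n → ℂ) (x : E n) :
    ∫⁻ y, ‖K (x - y)‖ₑ = eLpNorm K 1 := by
  rw [eLpNorm_one_eq_lintegral_enorm]
  exact lintegral_sub_left_eq_self (fun y => ‖K y‖ₑ) x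

/-- The convolution of absolute values. -/
def absCnv {n : ℕ} (K f : E n → ℂ) (x : E n) : ℝ≥0∞ := ∫⁻ y, ‖K (x - y)‖ₑ * ‖f y‖ₑ

theorem absCnv_le_top {n : ℕ} {K : E n → ℂ} (f : E n → ℂ) (hK : AEStronglyMeasurable K) (x : E n) :
    absCnv K f x ≤ eLpNorm K 1 * eLpNorm f ∞ := by
  rw [absCnv]
  rw [← lintegral_enorm_sub K x, ← lintegral_mul_const'' _ (aemeasurable_enorm_sub hK x)]
  refine lintegral_mono_ae ?_
  filter_upwards [enorm_ae_le_eLpNormEssSup f volume] with y hy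
  rw [eLpNorm_exponent_top]
  gcongr

theorem enorm_cnv_le_top {n : ℕ} {K f : E n → ℂ} (hK : AEStronglyMeasurable K) (x : E n) :
    ‖cnv K f x‖ₑ ≤ eLpNorm K 1 * eLpNorm f ∞ :=
  (enorm_cnv_le K f x).trans (absCnv_le_top f hK x)

theorem aemeasurable_absCnv {n : ℕ} {K f : E n → ℂ} (hK : AEStronglyMeasurable K)
    (hf : AEStronglyMeasurable f) : AEMeasurable (absCnv K f) :=
  (aestronglyMeasurable_cnv_integrand hK hf).enorm.lintegral_prod_right'.congr
    (Filter.Eventually.of_forall fun x => by simp only [absCnv, enorm_mul])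

/-- Hölder after the splitting |K| = |K|^{1-1/r} |K|^{1/r}, then Tonelli. Stating it for absolute
values also supplies the integrability that Fubini needs later. -/
theorem eLpNorm_absCnv_le {n : ℕ} {K f : E n → ℂ} (hK : AEStronglyMeasurable K)
    (hf : AEStronglyMeasurable f) {p : ℝ≥0∞} (hp : 1 ≤ p) :
    eLpNorm (absCnv K f) p volume ≤ eLpNorm K 1 volume * eLpNorm f p volume := by
  rcases eq_or_ne p ∞ with rfl | hpt
  · rw [eLpNorm_exponent_top (f := absCnv K f)]
    exact essSup_le_of_ae_le _ (Filter.Eventually.of_forall fun x => absCnv_le_top f hK x)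
  have hp0 : p ≠ 0 := (zero_lt_one.trans_le hp).ne'
  set r := p.toReal with hr
  have hr1 : 1 ≤ r := by
    rw [hr, ← ENNReal.toReal_one]; exact ENNReal.toReal_mono hpt hp
  have hr0 : 0 < r := by linarith
  set κ := eLpNorm K 1 volume with hκ
  have key : ∫⁻ x, absCnv K f x ^ r ≤ κ ^ r * ∫⁻ y, ‖f y‖ₑ ^ r := by
    have h1 : ∀ x, absCnv K f x ^ r ≤
        κ ^ (r - 1) * ∫⁻ y, ‖K (x - y)‖ₑ * ‖f y‖ₑ ^ r := by
      intro x
      have e : ∀ y, ‖K (x - y)‖ₑ * ‖f y‖ₑ =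
          ‖K (x - y)‖ₑ ^ (1 - r⁻¹) * (‖K (x - y)‖ₑ * ‖f y‖ₑ ^ r) ^ (r⁻¹) := by
        intro y
        rw [ENNReal.mul_rpow_of_nonneg _ _ (by positivity), ← ENNReal.rpow_mul,
          mul_inv_cancel₀ hr0.ne', ENNReal.rpow_one, ← mul_assoc,
          ← ENNReal.rpow_add_of_nonneg _ _ (by rw [sub_nonneg]; exact inv_le_one_of_one_le₀ hr1)
            (by positivity), sub_add_cancel, ENNReal.rpow_one]
      have h2 : absCnv K f x ≤
          κ ^ (1 - r⁻¹) * (∫⁻ y, ‖K (x - y)‖ₑ * ‖f y‖ₑ ^ r) ^ (r⁻¹) := by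
        rw [absCnv, lintegral_congr e, hκ, ← lintegral_enorm_sub K x]
        exact ENNReal.lintegral_mul_norm_pow_le (aemeasurable_enorm_sub hK x)
          ((aemeasurable_enorm_sub hK x).mul (hf.enorm.pow_const _))
          (by rw [sub_nonneg]; exact inv_le_one_of_one_le₀ hr1) (by positivity) (by ring)
      refine (ENNReal.rpow_le_rpow h2 hr0.le).trans (le_of_eq ?_)
      rw [ENNReal.mul_rpow_of_nonneg _ _ hr0.le, ← ENNReal.rpow_mul, ← ENNReal.rpow_mul,
        inv_mul_cancel₀ hr0.ne', ENNReal.rpow_one]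
      congr 2
      field_simp
    have hmeas : AEMeasurable (fun z : E n × E n => ‖K (z.1 - z.2)‖ₑ * ‖f z.2‖ₑ ^ r)
        (volume.prod volume) := by
      refine AEMeasurable.mul ?_ ((hf.comp_snd.enorm).pow_const _)
      exact (hK.comp_quasiMeasurePreserving
        (quasiMeasurePreserving_sub_of_right_invariant _ _)).enorm
    calc ∫⁻ x, absCnv K f x ^ r ≤ ∫⁻ x, κ ^ (r - 1) * ∫⁻ y, ‖K (x - y)‖ₑ * ‖f y‖ₑ ^ r :=
          lintegral_mono h1
      _ = κ ^ (r - 1) * ∫⁻ x, ∫⁻ y, ‖K (x - y)‖ₑ * ‖f y‖ₑ ^ r :=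
          lintegral_const_mul'' _ hmeas.lintegral_prod_right'
      _ = κ ^ (r - 1) * ∫⁻ y, ∫⁻ x, ‖K (x - y)‖ₑ * ‖f y‖ₑ ^ r := by
          rw [lintegral_lintegral_swap hmeas]
      _ = κ ^ (r - 1) * ∫⁻ y, κ * ‖f y‖ₑ ^ r := by
          congr 1
          refine lintegral_congr fun y => ?_
          have hm : AEMeasurable (fun x => ‖K (x - y)‖ₑ) :=
            (hK.comp_quasiMeasurePreserving
              (measurePreserving_sub_right volume y).quasiMeasurePreserving).enorm
          rw [lintegral_mul_const'' _ hm, lintegral_sub_right_eq_self (fun x => ‖K x‖ₑ) y, hκ,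
            eLpNorm_one_eq_lintegral_enorm]
      _ = κ ^ r * ∫⁻ y, ‖f y‖ₑ ^ r := by
          rw [lintegral_const_mul'' _ (hf.enorm.pow_const _), ← mul_assoc]
          congr 1
          conv_lhs => rw [← ENNReal.rpow_one κ, ENNReal.rpow_one, mul_comm]
          nth_rw 1 [← ENNReal.rpow_one κ]
          rw [← ENNReal.rpow_add_of_nonneg _ _ zero_le_one (by linarith)]
          congr 1; ring
  rw [eLpNorm_eq_lintegral_rpow_enorm_toReal hp0 hpt, eLpNorm_eq_lintegral_rpow_enorm_toReal hp0 hpt,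
    ← hr]
  simp only [enorm_eq_self]
  refine (ENNReal.rpow_le_rpow key (by positivity)).trans (le_of_eq ?_)
  rw [ENNReal.mul_rpow_of_nonneg _ _ (by positivity), ← ENNReal.rpow_mul, mul_one_div_cancel hr0.ne',
    ENNReal.rpow_one]

/-- Young's inequality `‖K * f‖_p ≤ ‖K‖_1 ‖f‖_p`. -/
theorem eLpNorm_cnv_le {n : ℕ} {K f : E n → ℂ} (hK : AEStronglyMeasurable K)
    (hf : AEStronglyMeasurable f) {p : ℝ≥0∞} (hp : 1 ≤ p) :
    eLpNorm (cnv K f) p volume ≤ eLpNorm K 1 volume * eLpNorm f p volume :=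
  (eLpNorm_mono_enorm fun x => (enorm_cnv_le K f x).trans_eq (enorm_eq_self _).symm).trans
    (eLpNorm_absCnv_le hK hf hp)

/-! ### Symbols that are polynomials in the direction -/

/-- The homogeneous extension of degree zero of a function on the sphere. -/
def hom {n : ℕ} (s : Sph n → ℂ) (ξ : E n) : ℂ := if h : ξ = 0 then 0 else s (dirOf ξ h)

theorem homSymbol_eq_hom {n : ℕ} (q : E n → Sph n → ℂ) (x ξ : E n) :
    homSymbol q x ξ = hom (q x) ξ := rfl

theorem hom_smul_sph {n : ℕ} (s : Sph n → ℂ) (θ : Sph n) {r : ℝ} (hr : 0 < r) :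
    hom s (r • (θ : E n)) = s θ := by
  rw [hom, dif_neg (smul_sph_ne_zero θ hr), dirOf_smul θ hr]

theorem exists_polar {n : ℕ} {ξ : E n} (h : ξ ≠ 0) : ∃ (θ : Sph n) (r : ℝ), 0 < r ∧
    ξ = r • (θ : E n) :=
  ⟨dirOf ξ h, ‖ξ‖, norm_pos_iff.mpr h, by
    simp [dirOf, smul_smul, mul_inv_cancel₀ (norm_ne_zero_iff.mpr h)]⟩

theorem hom_smul {n : ℕ} (s : Sph n → ℂ) {c : ℝ} (hc : 0 < c) (ξ : E n) :
    hom s (c • ξ) = hom s ξ := by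
  by_cases h : ξ = 0
  · simp [h]
  · obtain ⟨θ, r, hr, rfl⟩ := exists_polar h
    rw [smul_smul, hom_smul_sph s θ (mul_pos hc hr), hom_smul_sph s θ hr]

/-- The dilated bump `φ(2^{-k}ξ)`. -/
def bumpK {n : ℕ} (χ : E n → ℝ) (k : ℤ) (ξ : E n) : ℝ := bump χ ((2 : ℝ) ^ (-k) • ξ)

theorem IsCutoff.bump_eq_zero_of_lt {V : Type*} [NormedAddCommGroup V] [NormedSpace ℝ V]
    {χ : V → ℝ} (hχ : IsCutoff χ) {v : V} (h : ‖v‖ ≤ 1 / 2) : bump χ v = 0 := by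
  rw [bump, hχ.one _ (by linarith), hχ.one, sub_self]
  rw [norm_smul]; norm_num; linarith

theorem IsCutoff.bump_eq_zero_of_gt {V : Type*} [NormedAddCommGroup V] [NormedSpace ℝ V]
    {χ : V → ℝ} (hχ : IsCutoff χ) {v : V} (h : 2 < ‖v‖) : bump χ v = 0 := by
  rw [bump, hχ.supp _ h, hχ.supp, sub_self]
  rw [norm_smul]; norm_num; linarith

theorem IsCutoff.contDiff_bump {V : Type*} [NormedAddCommGroup V] [NormedSpace ℝ V]
    {χ : V → ℝ} (hχ : IsCutoff χ) : ContDiff ℝ ∞ (bump χ) :=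
  hχ.smooth.sub (hχ.smooth.comp (contDiff_const_smul 2))

theorem contDiff_bumpK {n : ℕ} {χ : E n → ℝ} (hχ : IsCutoff χ) (k : ℤ) :
    ContDiff ℝ ∞ (bumpK χ k) := hχ.contDiff_bump.comp (contDiff_const_smul _)

theorem bumpK_eq_zero {n : ℕ} {χ : E n → ℝ} (hχ : IsCutoff χ) (k : ℤ) {ξ : E n}
    (h : 2 * 2 ^ k < ‖ξ‖) : bumpK χ k ξ = 0 := by
  refine hχ.bump_eq_zero_of_gt ?_
  rw [norm_smul, norm_zpow, Real.norm_ofNat, zpow_neg, lt_inv_mul_iff₀ (by positivity)]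
  linarith

theorem hasCompactSupport_bumpK {n : ℕ} {χ : E n → ℝ} (hχ : IsCutoff χ) (k : ℤ) :
    HasCompactSupport (bumpK χ k) :=
  HasCompactSupport.intro (isCompact_closedBall (0 : E n) (2 * 2 ^ k)) fun ξ h =>
    bumpK_eq_zero hχ k (by simpa using h)

theorem exists_bound_bump {n : ℕ} {χ : E n → ℝ} (hχ : IsCutoff χ) :
    ∃ C : ℝ, 0 ≤ C ∧ ∀ ξ, |bump χ ξ| ≤ C := by
  have h1 : HasCompactSupport (bump χ) := by
    have := hasCompactSupport_bumpK hχ 0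
    unfold bumpK at this; simpa using this
  obtain ⟨C, hC⟩ := h1.exists_bound_of_continuous hχ.contDiff_bump.continuous
  exact ⟨C, (norm_nonneg _).trans (hC 0), hC⟩

/-- The dilated bump as a Schwartz function. -/
def bumpS {n : ℕ} {χ : E n → ℝ} (hχ : IsCutoff χ) (k : ℤ) : 𝓢(E n, ℂ) :=
  HasCompactSupport.toSchwartzMap (f := fun ξ : E n => ((bumpK χ k ξ : ℝ) : ℂ))
    ((hasCompactSupport_bumpK hχ k).comp_left (g := fun t : ℝ => (t : ℂ)) (by simp))
    (Complex.ofRealCLM.contDiff.comp (contDiff_bumpK hχ k))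

@[simp] theorem bumpS_apply {n : ℕ} {χ : E n → ℝ} (hχ : IsCutoff χ) (k : ℤ) (ξ : E n) :
    bumpS hχ k ξ = ((bumpK χ k ξ : ℝ) : ℂ) := rfl

/-- The symbol `p(ξ/|ξ|) φ(2^{-k}ξ)`, for a polynomial `p`. -/
def polySym {n : ℕ} {χ : E n → ℝ} (hχ : IsCutoff χ) (p : MvPolynomial (Fin n) ℂ) (k : ℤ) :
    𝓢(E n, ℂ) :=
  HasCompactSupport.toSchwartzMap
    (f := fun ξ : E n => annS p annBump ((2 : ℝ) ^ (-k) • ξ) * ((bumpK χ k ξ : ℝ) : ℂ))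
    (((hasCompactSupport_bumpK hχ k).comp_left (g := fun t : ℝ => (t : ℂ)) (by simp)).mul_left)
    (((annS p annBump).smooth ⊤ |>.comp (contDiff_const_smul _)).mul
      (Complex.ofRealCLM.contDiff.comp (contDiff_bumpK hχ k)))

/-- On the support of the bump, |2^{-k}ξ| lies in [1/2, 2], where `annBump` of its square is 1. The
factor `annBump` only serves to make the symbol visibly smooth at the origin. -/
theorem polySym_apply {n : ℕ} {χ : E n → ℝ} (hχ : IsCutoff χ) (p : MvPolynomial (Fin n) ℂ) (k : ℤ)
    (ξ : E n) : polySym hχ p k ξ = hom (fun θ => pev (θ : E n) p) ξ * ((bumpK χ k ξ : ℝ) : ℂ) := by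
  have e : polySym hχ p k ξ = annS p annBump ((2 : ℝ) ^ (-k) • ξ) * ((bumpK χ k ξ : ℝ) : ℂ) := rfl
  rw [e]
  by_cases h0 : bumpK χ k ξ = 0
  · simp [h0]
  congr 1
  have h1 : 1 / 2 < ‖(2 : ℝ) ^ (-k) • ξ‖ := by
    by_contra h; exact h0 (hχ.bump_eq_zero_of_lt (not_lt.mp h))
  have h2 : ‖(2 : ℝ) ^ (-k) • ξ‖ ≤ 2 := by
    by_contra h; exact h0 (hχ.bump_eq_zero_of_gt (not_le.mp h))
  have hne : (2 : ℝ) ^ (-k) • ξ ≠ 0 := by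
    intro h; rw [h, norm_zero] at h1; norm_num at h1
  rw [← hom_smul _ (show (0 : ℝ) < 2 ^ (-k) by positivity)]
  obtain ⟨θ, r, hr, hξ⟩ := exists_polar hne
  rw [hξ] at h1 h2 ⊢
  rw [norm_smul_sph θ hr] at h1 h2
  rw [annS_polar _ _ θ hr, hom_smul_sph _ θ hr, annBump_eq_one (by nlinarith) (by nlinarith)]
  simp

/-- The kernel `∫ p(ξ/|ξ|) φ(2^{-k}ξ) e^{2πiξ·z} dξ`, for a polynomial `p`. -/
def polyKer {n : ℕ} {χ : E n → ℝ} (hχ : IsCutoff χ) (p : MvPolynomial (Fin n) ℂ) (k : ℤ) :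
    𝓢(E n, ℂ) := 𝓕⁻ (polySym hχ p k)

/-- The kernel `∫ s(ξ/|ξ|) φ(2^{-k}ξ) e^{2πiξ·z} dξ`. -/
def mulKer {n : ℕ} (χ : E n → ℝ) (s : Sph n → ℂ) (k : ℤ) (z : E n) : ℂ :=
  ∫ ξ, hom s ξ * ((bumpK χ k ξ : ℝ) : ℂ) *
    Complex.exp (2 * Real.pi * Complex.I * (inner ℝ ξ z : ℝ))

theorem opKernel_eq_mulKer {n : ℕ} (χ : E n → ℝ) (q : E n → Sph n → ℂ) (k : ℤ) (x z : E n) :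
    opKernel χ q k x z = mulKer χ (q x) k z := rfl

theorem fourierInv_eq_integral_exp {n : ℕ} (f : E n → ℂ) (z : E n) :
    𝓕⁻ f z = ∫ ξ, f ξ * Complex.exp (2 * Real.pi * Complex.I * (inner ℝ ξ z : ℝ)) := by
  rw [Real.fourierInv_eq']
  refine integral_congr_ae (Filter.Eventually.of_forall fun ξ => ?_)
  dsimp only
  rw [smul_eq_mul, mul_comm]
  congr 2
  push_cast; ring

theorem mulKer_pev {n : ℕ} {χ : E n → ℝ} (hχ : IsCutoff χ) (p : MvPolynomial (Fin n) ℂ) (k : ℤ)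
    (z : E n) : mulKer χ (fun θ => pev (θ : E n) p) k z = polyKer hχ p k z := by
  rw [polyKer, SchwartzMap.fourierInv_coe, fourierInv_eq_integral_exp]
  simp only [polySym_apply]; rfl

/-- The symbol sees only the values of p on the unit sphere, so identities valid there suffice,
though the polynomials may differ. -/
theorem polyKer_congr {n : ℕ} {χ : E n → ℝ} (hχ : IsCutoff χ) {p : MvPolynomial (Fin n) ℂ}
    {ι : Type*} {t : Finset ι} {c : ι → ℂ} {P : ι → MvPolynomial (Fin n) ℂ}
    (h : ∀ θ : Sph n, pev (θ : E n) p = ∑ i ∈ t, c i * pev (θ : E n) (P i)) (k : ℤ) :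
    polyKer hχ p k = ∑ i ∈ t, c i • polyKer hχ (P i) k := by
  have h1 : polySym hχ p k = ∑ i ∈ t, c i • polySym hχ (P i) k := by
    ext ξ
    simp only [sum_apply, smul_apply, polySym_apply, hom]
    split_ifs with h0
    · simp
    · rw [h, Finset.sum_mul]
      simp only [smul_eq_mul, mul_assoc]
  rw [polyKer, h1, FourierTransform.fourierInv_sum]
  simp only [FourierTransform.fourierInv_smul]
  rfl

theorem polyKer_scale {n : ℕ} {χ : E n → ℝ} (hχ : IsCutoff χ) (p : MvPolynomial (Fin n) ℂ) (k : ℤ)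
    (z : E n) : polyKer hχ p k z = ((((2 : ℝ) ^ k) ^ n : ℝ) : ℂ) * polyKer hχ p 0 ((2 : ℝ) ^ k • z) := by
  rw [← mulKer_pev, ← mulKer_pev, mulKer, mulKer]
  have hc : (0 : ℝ) < 2 ^ k := by positivity
  have h := Measure.integral_comp_smul (volume : Measure (E n))
    (fun ξ => hom (fun θ => pev (θ : E n) p) ξ * ((bumpK χ k ξ : ℝ) : ℂ) *
      Complex.exp (2 * Real.pi * Complex.I * (inner ℝ ξ z : ℝ))) ((2 : ℝ) ^ k)
  rw [finrank_euclideanSpace_fin, abs_of_pos (by positivity)] at h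
  have h2 : ∀ ξ : E n, hom (fun θ => pev (θ : E n) p) ((2 : ℝ) ^ k • ξ) *
      ((bumpK χ k ((2 : ℝ) ^ k • ξ) : ℝ) : ℂ) *
      Complex.exp (2 * Real.pi * Complex.I * (inner ℝ ((2 : ℝ) ^ k • ξ) z : ℝ)) =
      hom (fun θ => pev (θ : E n) p) ξ * ((bumpK χ 0 ξ : ℝ) : ℂ) *
      Complex.exp (2 * Real.pi * Complex.I * (inner ℝ ξ ((2 : ℝ) ^ k • z) : ℝ)) := by
    intro ξ
    rw [hom_smul _ hc, inner_smul_left, inner_smul_right]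
    congr 3
    simp [bumpK, smul_smul, inv_mul_cancel₀ hc.ne']
  simp only [h2] at h
  rw [h, Complex.real_smul, ← mul_assoc, ← Complex.ofReal_mul, mul_inv_cancel₀ (by positivity)]
  simp

/-- The kernels for different k are L¹-normalised dilates of one another, because the symbol is
homogeneous of degree zero up to the bump. Bounds for k = 0 therefore hold for all k. -/
theorem integral_norm_polyKer_scale {n : ℕ} {χ : E n → ℝ} (hχ : IsCutoff χ)
    (p : MvPolynomial (Fin n) ℂ) (k : ℤ) :
    ∫ z, ‖polyKer hχ p k z‖ = ∫ z, ‖polyKer hχ p 0 z‖ := by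
  have h := Measure.integral_comp_smul (volume : Measure (E n))
    (fun z => ‖polyKer hχ p 0 z‖) ((2 : ℝ) ^ k)
  rw [finrank_euclideanSpace_fin, abs_of_pos (by positivity)] at h
  have e : ∀ z, ‖polyKer hχ p k z‖ = ((2 : ℝ) ^ k) ^ n * ‖polyKer hχ p 0 ((2 : ℝ) ^ k • z)‖ := by
    intro z
    rw [polyKer_scale, norm_mul, Complex.norm_real, Real.norm_of_nonneg (by positivity)]
  simp only [e]
  rw [integral_const_mul, h, smul_eq_mul, ← mul_assoc, mul_inv_cancel₀ (by positivity), one_mul]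

theorem fourierInv_mul_eq_cnv {n : ℕ} {f a b : 𝓢(E n, ℂ)} (h : ∀ ξ, f ξ = a ξ * b ξ) (z : E n) :
    𝓕⁻ f z = cnv (𝓕⁻ a : 𝓢(E n, ℂ)) (𝓕⁻ b : 𝓢(E n, ℂ)) z := by
  have h1 : f = SchwartzMap.pairing (ContinuousLinearMap.mul ℂ ℂ) (𝓕 (𝓕⁻ a)) (𝓕 (𝓕⁻ b)) := by
    ext ξ
    rw [SchwartzMap.pairing_apply_apply, FourierTransform.fourier_fourierInv_eq,
      FourierTransform.fourier_fourierInv_eq, h]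
    rfl
  clear h
  subst h1
  rw [← SchwartzMap.fourier_convolution, FourierTransform.fourierInv_fourier_eq,
    SchwartzMap.convolution_apply, convolution_eq_swap]
  rfl

theorem integral_norm_eq_toReal {n : ℕ} (f : 𝓢(E n, ℂ)) :
    ∫ z, ‖f z‖ = (eLpNorm f 1 volume).toReal := by
  rw [eLpNorm_one_eq_lintegral_enorm, integral_norm_eq_lintegral_enorm f.continuous.aestronglyMeasurable]

theorem polySym_eq_annS_mul {n : ℕ} {χ : E n → ℝ} (hχ : IsCutoff χ) (p : MvPolynomial (Fin n) ℂ)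
    (ξ : E n) : polySym hχ p 0 ξ = bumpS hχ 0 ξ * annS p annBump ξ := by
  have e : polySym hχ p 0 ξ =
    annS p annBump ((2 : ℝ) ^ (-(0 : ℤ)) • ξ) * ((bumpK χ 0 ξ : ℝ) : ℂ) := rfl
  rw [e, bumpS_apply, neg_zero, zpow_zero, one_smul, mul_comm]

theorem polyKer_zero_eq_cnv {n : ℕ} {χ : E n → ℝ} (hχ : IsCutoff χ) (p : MvPolynomial (Fin n) ℂ) :
    (polyKer hχ p 0 : E n → ℂ) =
      cnv (𝓕⁻ (bumpS hχ 0) : 𝓢(E n, ℂ)) (𝓕⁻ (annS p annBump) : 𝓢(E n, ℂ)) :=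
  funext fun z => fourierInv_mul_eq_cnv (polySym_eq_annS_mul hχ p) z

theorem integral_norm_le_of_eq_cnv {n : ℕ} {f a b : 𝓢(E n, ℂ)} (h : (f : E n → ℂ) = cnv a b) :
    ∫ z, ‖f z‖ ≤ (∫ z, ‖a z‖) * ∫ z, ‖b z‖ := by
  have hm : ∀ f : 𝓢(E n, ℂ), eLpNorm f 1 volume ≠ ⊤ := fun f => (f.memLp 1 volume).2.ne
  have h1 : eLpNorm f 1 volume ≤ eLpNorm a 1 volume * eLpNorm b 1 volume := by
    rw [h]
    exact eLpNorm_cnv_le a.continuous.aestronglyMeasurable b.continuous.aestronglyMeasurable le_rfl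
  rw [integral_norm_eq_toReal f, integral_norm_eq_toReal a, integral_norm_eq_toReal b,
    ← ENNReal.toReal_mul]
  exact ENNReal.toReal_mono (ENNReal.mul_ne_top (hm a) (hm b)) h1

/-- For k = 0 the symbol is `annS p annBump` times the fixed bump, so its kernel is a convolution
with a fixed Schwartz function. -/
theorem exists_integral_norm_polyKer_le {n : ℕ} {χ : E n → ℝ} (hχ : IsCutoff χ) :
    ∃ C : ℝ, 0 ≤ C ∧ ∀ p k, ∫ z, ‖polyKer hχ p k z‖ ≤ C * ∫ z, ‖𝓕⁻ (annS p annBump) z‖ := by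
  refine ⟨∫ z, ‖𝓕⁻ (bumpS hχ 0) z‖, integral_nonneg fun _ => norm_nonneg _, fun p k => ?_⟩
  rw [integral_norm_polyKer_scale]
  exact integral_norm_le_of_eq_cnv (polyKer_zero_eq_cnv hχ p)

/-! ### A reproducing kernel with integrable multiplier kernels -/

/-- The section at `w` of the reproducing kernel of the polynomials on the sphere. -/
def SphBasis.repr {n N : ℕ} (B : SphBasis n N) (w : E n) : MvPolynomial (Fin n) ℂ :=
  ∑ i, (starRingEnd ℂ) (pev w (B.poly i)) • B.poly i

theorem SphBasis.pev_repr {n N : ℕ} (B : SphBasis n N) (w x : E n) :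
    pev x (B.repr w) = ∑ i, (starRingEnd ℂ) (pev w (B.poly i)) * pev x (B.poly i) := by
  simp [SphBasis.repr]

theorem SphBasis.integral_norm_sq_repr {n N : ℕ} (B : SphBasis n N) (η : Sph n) :
    ∫ θ : Sph n, ‖pev (θ : E n) (B.repr (η : E n))‖ ^ 2 ∂(sphMeasure n) = B.diag η := by
  simp only [B.pev_repr]
  rw [integral_norm_sq_sum_basis]
  simp [SphBasis.diag]

theorem SphBasis.norm_repr_comm {n N : ℕ} (B : SphBasis n N) (w x : E n) :
    ‖pev x (B.repr w)‖ = ‖pev w (B.repr x)‖ := by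
  rw [B.pev_repr, B.pev_repr, ← Complex.norm_conj, map_sum]
  simp [mul_comm]

/-- Φ(η,·) is the kernel section of degree 2N at η times the Chebyshev factor with pole η, which is
symmetric in η and θ. For s of degree at most N, the product of s and the Chebyshev factor with pole
θ has degree at most 2N and takes the value s(θ) at θ; the kernel of degree 2N reproduces it. The
sizes come from `exists_diag_bound` and `exists_integral_norm_fourierInv_le`. -/
theorem exists_reproducing {n : ℕ} (hn : 0 < n) {χ : E n → ℝ} (hχ : IsCutoff χ) :
    ∃ C : ℝ, 1 ≤ C ∧ ∀ N : ℕ, 1 ≤ N → ∃ Φ : Sph n → MvPolynomial (Fin n) ℂ,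
      (∀ η, (Φ η).totalDegree ≤ 3 * N) ∧
      (Continuous fun z : Sph n × Sph n => pev (z.2 : E n) (Φ z.1)) ∧
      (∀ s : MvPolynomial (Fin n) ℂ, s.totalDegree ≤ N → ∀ θ : Sph n, pev (θ : E n) s =
        ∫ η : Sph n, pev (η : E n) s * pev (θ : E n) (Φ η) ∂(sphMeasure n)) ∧
      (∀ θ : Sph n, ∫ η : Sph n, ‖pev (θ : E n) (Φ η)‖ ^ 2 ∂(sphMeasure n) ≤
        C * (N : ℝ) ^ (n - 1)) ∧
      (∀ η k, ∫ z, ‖polyKer hχ (Φ η) k z‖ ≤ C * (N : ℝ) ^ (n - 1)) := by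
  obtain ⟨C₁, hC₁, h1⟩ := exists_diag_bound hn
  obtain ⟨C₂, hC₂, h2⟩ := exists_integral_norm_fourierInv_le hn annBump
  obtain ⟨C₃, hC₃, h3⟩ := exists_integral_norm_polyKer_le hχ
  have hC : C₁ ≤ C₁ + C₃ * (C₂ * (1 + C₁)) := le_add_of_nonneg_right (by positivity)
  refine ⟨C₁ + C₃ * (C₂ * (1 + C₁)), hC₁.trans hC, fun N hN => ?_⟩
  obtain ⟨B⟩ := exists_sphBasis n (2 * N)
  have hX : 0 ≤ (N : ℝ) ^ (n - 1) := by positivity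
  have hrepdeg : ∀ w : E n, (B.repr w).totalDegree ≤ 2 * N := fun w =>
    MvPolynomial.totalDegree_finsetSum_le fun i _ =>
      (MvPolynomial.totalDegree_smul_le _ _).trans (B.degree_le i)
  refine ⟨fun η => chebPoly N (η : E n) * B.repr (η : E n), fun η => ?_, ?_,
    fun s hs θ => ?_, fun θ => ?_, fun η k => ?_⟩
  · have := MvPolynomial.totalDegree_mul (chebPoly N (η : E n)) (B.repr (η : E n))
    have := totalDegree_chebPoly_le hN (η : E n)
    have := hrepdeg (η : E n)
    change (chebPoly N (η : E n) * B.repr (η : E n)).totalDegree ≤ _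
    omega
  · simp only [map_mul, pev_chebPoly, B.pev_repr]
    have h4 : ∀ i, Continuous fun η : Sph n => pev (η : E n) (B.poly i) := fun i =>
      continuous_pev_sph _
    have h5 := (chebU N).continuous
    refine Continuous.mul (Complex.continuous_ofReal.comp (h5.comp (by fun_prop))) ?_
    exact continuous_finsetSum _ fun i _ =>
      (Complex.continuous_conj.comp ((h4 i).comp continuous_fst)).mul ((h4 i).comp continuous_snd)
  · have hdeg : (s * chebPoly N (θ : E n)).totalDegree ≤ 2 * N := by
      have := MvPolynomial.totalDegree_mul s (chebPoly N (θ : E n))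
      have := totalDegree_chebPoly_le hN (θ : E n)
      omega
    have h4 := B.expand _ hdeg θ
    rw [map_mul, pev_chebPoly, real_inner_self_eq_norm_sq, norm_sph, one_pow, eval_chebU_one hN,
      Complex.ofReal_one, mul_one] at h4
    rw [h4]
    simp only [← integral_mul_const]
    rw [← integral_finsetSum]
    · refine integral_congr_ae (Filter.Eventually.of_forall fun η => ?_)
      simp only [map_mul, pev_chebPoly, B.pev_repr, Finset.mul_sum, real_inner_comm]
      refine Finset.sum_congr rfl fun i _ => by ring
    · intro i _
      refine (integrable_sph_of_continuous ?_).mul_const _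
      exact (continuous_pev_sph _).mul (Complex.continuous_conj.comp (continuous_pev_sph _))
  · refine le_trans ?_ (mul_le_mul_of_nonneg_right hC hX)
    refine le_trans ?_ (h1 N hN (2 * N) le_rfl B θ)
    rw [← B.integral_norm_sq_repr]
    have hcont : ∀ (x : E n), Continuous fun η : Sph n => pev x (B.repr (η : E n)) := by
      intro x
      simp only [B.pev_repr]
      exact continuous_finsetSum _ fun i _ =>
        (Complex.continuous_conj.comp (continuous_pev_sph (B.poly i))).mul continuous_const
    refine integral_mono_of_nonneg (Filter.Eventually.of_forall fun _ => by positivity)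
      (integrable_norm_sq_pev _) (Filter.Eventually.of_forall fun η => ?_)
    dsimp only
    refine pow_le_pow_left₀ (norm_nonneg _) ?_ 2
    rw [map_mul, norm_mul, pev_chebPoly, Complex.norm_real, B.norm_repr_comm]
    refine mul_le_of_le_one_left (norm_nonneg _) (abs_eval_chebU_le hN ?_)
    simpa [norm_sph] using abs_real_inner_le_norm (η : E n) (θ : E n)
  · refine (h3 _ k).trans ?_
    have h4 := h2 N hN (B.repr (η : E n)) (hrepdeg _) η
    rw [B.integral_norm_sq_repr] at h4
    have h5 := h1 N hN (2 * N) le_rfl B η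
    calc _ ≤ C₃ * (C₂ * ((N : ℝ) ^ (n - 1) + C₁ * (N : ℝ) ^ (n - 1))) := by
          refine mul_le_mul_of_nonneg_left (h4.trans ?_) hC₃
          gcongr
      _ = C₃ * (C₂ * (1 + C₁)) * (N : ℝ) ^ (n - 1) := by ring
      _ ≤ _ := mul_le_mul_of_nonneg_right (le_add_of_nonneg_left (by linarith)) hX

end RoughPDO
end

noncomputable section
namespace RoughPDO

/-! ### Interpolation between `L²` and `L^∞` -/

/-- The map `a ↦ (a/|a|) |a|^s`. -/
def anaPow (s a : ℂ) : ℂ := a / (‖a‖ : ℂ) * (‖a‖ : ℂ) ^ s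

@[simp] theorem anaPow_zero (s : ℂ) : anaPow s 0 = 0 := by simp [anaPow]

theorem anaPow_one (a : ℂ) : anaPow 1 a = a := by
  by_cases h : a = 0
  · simp [h]
  · have : (‖a‖ : ℂ) ≠ 0 := by exact_mod_cast norm_ne_zero_iff.mpr h
    rw [anaPow, Complex.cpow_one, div_mul_cancel₀ _ this]

theorem norm_anaPow {a : ℂ} (h : a ≠ 0) (s : ℂ) : ‖anaPow s a‖ = ‖a‖ ^ s.re := by
  have h0 : 0 < ‖a‖ := norm_pos_iff.mpr h
  rw [anaPow, norm_mul, norm_div, Complex.norm_real, norm_norm, div_self h0.ne', one_mul,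
    Complex.norm_cpow_eq_rpow_re_of_pos h0]

theorem enorm_anaPow {s : ℂ} (hs : 0 < s.re) (a : ℂ) : ‖anaPow s a‖ₑ = ‖a‖ₑ ^ s.re := by
  by_cases h : a = 0
  · simp [h, hs]
  · rw [← ofReal_norm, norm_anaPow h, ← ofReal_norm,
      ENNReal.ofReal_rpow_of_nonneg (norm_nonneg _) hs.le]

theorem enorm_anaPow_le_one {s : ℂ} (hs : s.re = 0) (a : ℂ) : ‖anaPow s a‖ₑ ≤ 1 := by
  by_cases h : a = 0
  · simp [h]
  · rw [← ofReal_norm, norm_anaPow h, hs, Real.rpow_zero, ENNReal.ofReal_one]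

theorem differentiable_anaPow (a : ℂ) : Differentiable ℂ fun s => anaPow s a := by
  by_cases h : a = 0
  · simp [h]
  · have : (‖a‖ : ℂ) ≠ 0 := by exact_mod_cast norm_ne_zero_iff.mpr h
    intro s
    exact (differentiableAt_id.const_cpow (Or.inl this)).const_mul _

theorem norm_anaPow_le {a s : ℂ} {R : ℝ} (h0 : 0 ≤ s.re) (h1 : s.re ≤ R) :
    ‖anaPow s a‖ ≤ (1 + ‖a‖) ^ R := by
  by_cases h : a = 0
  · simp [h]
  · rw [norm_anaPow h]
    calc ‖a‖ ^ s.re ≤ (1 + ‖a‖) ^ s.re := by gcongr; linarith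
      _ ≤ (1 + ‖a‖) ^ R := Real.rpow_le_rpow_of_exponent_le (by linarith [norm_nonneg a]) h1

section
variable {α β : Type*} [MeasurableSpace α] [MeasurableSpace β] {μ : Measure α} {ν : Measure β}

theorem enorm_integral_mul_le {F G : β → ℂ} (hF : AEStronglyMeasurable F ν)
    (hG : AEStronglyMeasurable G ν) (p q : ℝ≥0∞) [p.HolderTriple q 1] :
    ‖∫ y, F y * G y ∂ν‖ₑ ≤ eLpNorm F p ν * eLpNorm G q ν := by
  refine (enorm_integral_le_lintegral_enorm _).trans ?_
  rw [← eLpNorm_one_eq_lintegral_enorm]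
  change eLpNorm (F • G) 1 ν ≤ _
  exact eLpNorm_smul_le_mul_eLpNorm (p := p) (q := q) (r := 1) hG hF

theorem lintegral_rpow_ne_top_of_finMeasSupp {g : SimpleFunc α ℂ} {r : ℝ} (hr : 0 < r)
    (hg : g.FinMeasSupp μ) : ∫⁻ x, ‖g x‖ₑ ^ r ∂μ ≠ ⊤ := by
  have := (SimpleFunc.memLp_iff_finMeasSupp (p := ENNReal.ofReal r) (by simpa using hr)
    ENNReal.ofReal_ne_top).mpr hg
  have h3 := (lintegral_rpow_enorm_lt_top_of_eLpNorm_lt_top (by simpa using hr)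
    ENNReal.ofReal_ne_top this.2).ne
  rwa [ENNReal.toReal_ofReal hr.le] at h3

/-- Indicator of a level set of a simple function. -/
def levelInd (f : SimpleFunc α ℂ) (a : ℂ) : SimpleFunc α ℂ :=
  f.map fun b => if b = a then 1 else 0

/-- An operator that is linear on the level sets of simple functions. -/
def LevelLinear (A : (α → ℂ) → β → ℂ) : Prop :=
  ∀ (f : SimpleFunc α ℂ) (x : ℂ → ℂ) (y : β),
    A (f.map x) y = ∑ a ∈ f.range, x a * A (levelInd f a) y

/-- Riesz-Thorin between L^∞ (Re z = 0) and L² (Re z = 1), evaluated at z = 2/p. The analytic family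
changes only the values of simple functions, never their level sets, so `LevelLinear` is all the
linearity required. -/
theorem interpolation_pairing {A : (α → ℂ) → β → ℂ} (hlin : LevelLinear A)
    {M : ℝ≥0} (hmeas : ∀ f : SimpleFunc α ℂ, f.FinMeasSupp μ → AEStronglyMeasurable (A f) ν)
    (h2 : ∀ f : SimpleFunc α ℂ, f.FinMeasSupp μ →
      eLpNorm (A f) 2 ν ≤ (M : ℝ≥0∞) ^ (1 / 2 : ℝ) * eLpNorm f 2 μ)
    (hinf : ∀ f : SimpleFunc α ℂ, f.FinMeasSupp μ →
      eLpNorm (A f) ⊤ ν ≤ (M : ℝ≥0∞) * eLpNorm f ⊤ μ)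
    {p q : ℝ} (hpq : p.HolderConjugate q) (hp : 2 ≤ p)
    {f : SimpleFunc α ℂ} (hf : f.FinMeasSupp μ) {G : SimpleFunc β ℂ} (hG : G.FinMeasSupp ν) :
    ‖∫ y, A f y * G y ∂ν‖ₑ ≤ (M : ℝ≥0∞) ^ (1 / q) * (∫⁻ x, ‖f x‖ₑ ^ p ∂μ) ^ (1 / p) *
      (∫⁻ y, ‖G y‖ₑ ^ q ∂ν) ^ (1 / q) := by
  have hp0 : 0 < p := by linarith
  have hq0 : 0 < q := hpq.symm.pos
  have hqe : 1 / q = 1 - 1 / p := by have := hpq.inv_add_inv_eq_one; rw [one_div, one_div]; linarith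
  set I := ∫⁻ x, ‖f x‖ₑ ^ p ∂μ with hI
  set J := ∫⁻ y, ‖G y‖ₑ ^ q ∂ν with hJ
  have hIf : I ≠ ⊤ := lintegral_rpow_ne_top_of_finMeasSupp hp0 hf
  have hJf : J ≠ ⊤ := lintegral_rpow_ne_top_of_finMeasSupp hq0 hG
  -- Both exponents p z/2 and q(1 - z/2) equal 1 at z = 2/p. The moduli are |f|⁰ and |G|^q on Re z =
  -- 0, and |f|^{p/2} and |G|^{q/2} on Re z = 1, which fit the two endpoint estimates.
  set fz : ℂ → SimpleFunc α ℂ := fun z => f.map (anaPow (p * z / 2)) with hfz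
  set Gz : ℂ → SimpleFunc β ℂ := fun z => G.map (anaPow (q * (1 - z / 2))) with hGz
  have hfzs : ∀ z, (fz z).FinMeasSupp μ := fun z => hf.map (anaPow_zero _)
  have hGzs : ∀ z, (Gz z).FinMeasSupp ν := fun z => hG.map (anaPow_zero _)
  set Φ : ℂ → ℂ := fun z => ∫ y, A (fz z) y * Gz z y ∂ν with hΦ
  have hGm : ∀ z, AEStronglyMeasurable (Gz z) ν := fun z => (Gz z).aestronglyMeasurable
  have re1 : ∀ z : ℂ, (p * z / 2 : ℂ).re = p * z.re / 2 := by
    intro z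
    rw [show (p * z / 2 : ℂ) = ((p / 2 : ℝ) : ℂ) * z by push_cast; ring, Complex.re_ofReal_mul]; ring
  have re2 : ∀ z : ℂ, (q * (1 - z / 2) : ℂ).re = q * (1 - z.re / 2) := by
    intro z
    rw [Complex.re_ofReal_mul, Complex.sub_re, Complex.one_re,
      show (z / 2 : ℂ) = ((1 / 2 : ℝ) : ℂ) * z by push_cast; ring, Complex.re_ofReal_mul]; ring
  -- the two edges
  have b0 : ∀ z : ℂ, z.re = 0 → ‖Φ z‖ₑ ≤ M * J := by
    intro z hz
    refine (enorm_integral_mul_le (hmeas _ (hfzs z)) (hGm z) ⊤ 1).trans ?_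
    refine mul_le_mul' ((hinf _ (hfzs z)).trans ?_) (le_of_eq ?_)
    · refine mul_le_of_le_one_right' ?_
      rw [eLpNorm_exponent_top]
      refine essSup_le_of_ae_le _ (Filter.Eventually.of_forall fun x => ?_)
      exact enorm_anaPow_le_one (by rw [re1, hz]; simp) _
    · rw [eLpNorm_one_eq_lintegral_enorm]
      refine lintegral_congr fun y => ?_
      simp only [hGz, SimpleFunc.map_apply]
      rw [enorm_anaPow (by rw [re2, hz]; simpa using hq0), re2, hz]
      simp
  have b1 : ∀ z : ℂ, z.re = 1 → ‖Φ z‖ₑ ≤ (M : ℝ≥0∞) ^ (1 / 2 : ℝ) * I ^ (1 / 2 : ℝ) *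
      J ^ (1 / 2 : ℝ) := by
    intro z hz
    refine (enorm_integral_mul_le (hmeas _ (hfzs z)) (hGm z) 2 2).trans ?_
    refine mul_le_mul' ((h2 _ (hfzs z)).trans (mul_le_mul' le_rfl (le_of_eq ?_))) (le_of_eq ?_)
    · rw [eLpNorm_eq_lintegral_rpow_enorm_toReal (by norm_num) (by norm_num)]
      simp only [ENNReal.toReal_ofNat]
      congr 1
      refine lintegral_congr fun y => ?_
      simp only [hfz, SimpleFunc.map_apply]
      rw [enorm_anaPow (by rw [re1, hz]; positivity), re1, hz, ← ENNReal.rpow_mul]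
      congr 1; ring
    · rw [eLpNorm_eq_lintegral_rpow_enorm_toReal (by norm_num) (by norm_num)]
      simp only [ENNReal.toReal_ofNat]
      congr 1
      refine lintegral_congr fun y => ?_
      simp only [hGz, SimpleFunc.map_apply]
      rw [enorm_anaPow (by rw [re2, hz]; linarith), re2, hz, ← ENNReal.rpow_mul]
      congr 1; ring
  -- the finite expansion
  set m : ℂ → ℂ → ℂ := fun a b => ∫ y, A (levelInd f a) y * levelInd G b y ∂ν with hm
  have hexp : ∀ z, Φ z = ∑ a ∈ f.range, ∑ b ∈ G.range,
      anaPow (p * z / 2) a * anaPow (q * (1 - z / 2)) b * m a b := by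
    intro z
    have e1 : ∀ y, A (fz z) y * Gz z y = ∑ a ∈ f.range, ∑ b ∈ G.range,
        anaPow (p * z / 2) a * anaPow (q * (1 - z / 2)) b *
          (A (levelInd f a) y * levelInd G b y) := by
      intro y
      have e2 : Gz z y = ∑ b ∈ G.range, anaPow (q * (1 - z / 2)) b * levelInd G b y := by
        simp only [hGz, levelInd, SimpleFunc.map_apply]
        rw [Finset.sum_eq_single (G y)]
        · simp
        · intro b _ hb; simp [Ne.symm hb]
        · intro h; exact absurd (SimpleFunc.mem_range_self G y) h
      rw [e2, hfz, hlin, Finset.sum_mul]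
      refine Finset.sum_congr rfl fun a _ => ?_
      rw [Finset.mul_sum]
      exact Finset.sum_congr rfl fun b _ => by ring
    have hint : ∀ a ∈ f.range, ∀ b ∈ G.range, Integrable (fun y =>
        anaPow (p * z / 2) a * anaPow (q * (1 - z / 2)) b *
          (A (levelInd f a) y * levelInd G b y)) ν := by
      intro a _ b _
      by_cases ha : a = 0
      · simp [ha]
      by_cases hb : b = 0
      · simp [hb]
      refine Integrable.const_mul ?_ _
      have s1 : (levelInd f a).FinMeasSupp μ := hf.map (by simp [Ne.symm ha])
      have s2 : (levelInd G b).FinMeasSupp ν := hG.map (by simp [Ne.symm hb])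
      have m1 : MemLp (A (levelInd f a)) 2 ν := by
        refine ⟨hmeas _ s1, (h2 _ s1).trans_lt (ENNReal.mul_lt_top ?_ ?_)⟩
        · exact ENNReal.rpow_lt_top_of_nonneg (by norm_num) ENNReal.coe_ne_top
        · exact ((SimpleFunc.memLp_iff_finMeasSupp (by norm_num) (by norm_num)).mpr s1).2
      have m2 : MemLp (levelInd G b) 2 ν :=
        (SimpleFunc.memLp_iff_finMeasSupp (by norm_num) (by norm_num)).mpr s2
      exact m1.integrable_mul m2
    simp only [hΦ, e1]
    rw [integral_finsetSum _ fun a ha => integrable_finsetSum _ fun b hb => hint a ha b hb]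
    refine Finset.sum_congr rfl fun a ha => ?_
    rw [integral_finsetSum _ fun b hb => hint a ha b hb]
    exact Finset.sum_congr rfl fun b _ => integral_const_mul _ _
  -- By the expansion Φ is a finite sum of entire functions; the same sum gives the boundedness on
  -- the strip that the three lines theorem asks for.
  have hdiff : Differentiable ℂ Φ := by
    have : Φ = fun z => ∑ a ∈ f.range, ∑ b ∈ G.range,
      anaPow (p * z / 2) a * anaPow (q * (1 - z / 2)) b * m a b := funext hexp
    rw [this]
    refine Differentiable.fun_sum fun a _ => Differentiable.fun_sum fun b _ => ?_
    refine Differentiable.mul_const (Differentiable.mul ?_ ?_) _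
    · exact (differentiable_anaPow a).comp (by fun_prop : Differentiable ℂ fun z : ℂ => p * z / 2)
    · exact (differentiable_anaPow b).comp
        (by fun_prop : Differentiable ℂ fun z : ℂ => (q : ℂ) * (1 - z / 2))
  have hbdd : BddAbove ((norm ∘ Φ) '' Complex.HadamardThreeLines.verticalClosedStrip 0 1) := by
    refine ⟨∑ a ∈ f.range, ∑ b ∈ G.range, (1 + ‖a‖) ^ p * (1 + ‖b‖) ^ q * ‖m a b‖, ?_⟩
    rintro _ ⟨z, hz, rfl⟩
    have hz' : 0 ≤ z.re ∧ z.re ≤ 1 := hz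
    simp only [Function.comp, hexp]
    refine (norm_sum_le _ _).trans (Finset.sum_le_sum fun a _ => (norm_sum_le _ _).trans
      (Finset.sum_le_sum fun b _ => ?_))
    rw [norm_mul, norm_mul]
    gcongr
    · exact norm_anaPow_le (by rw [re1]; nlinarith) (by rw [re1]; nlinarith)
    · exact norm_anaPow_le (by rw [re2]; nlinarith) (by rw [re2]; nlinarith)
  have toR : ∀ {z : ℂ} {B : ℝ≥0∞}, B ≠ ⊤ → ‖Φ z‖ₑ ≤ B → ‖Φ z‖ ≤ B.toReal := by
    intro z B hB h
    rw [← toReal_enorm]; exact ENNReal.toReal_mono hB h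
  set B0 := (M : ℝ≥0∞) * J with hB0
  set B1 := (M : ℝ≥0∞) ^ (1 / 2 : ℝ) * I ^ (1 / 2 : ℝ) * J ^ (1 / 2 : ℝ) with hB1
  have hB0t : B0 ≠ ⊤ := ENNReal.mul_ne_top ENNReal.coe_ne_top hJf
  have hB1t : B1 ≠ ⊤ := ENNReal.mul_ne_top (ENNReal.mul_ne_top
    (ENNReal.rpow_ne_top_of_nonneg (by norm_num) ENNReal.coe_ne_top)
    (ENNReal.rpow_ne_top_of_nonneg (by norm_num) hIf))
    (ENNReal.rpow_ne_top_of_nonneg (by norm_num) hJf)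
  have hmem : ((2 / p : ℝ) : ℂ) ∈ Complex.HadamardThreeLines.verticalClosedStrip 0 1 := by
    constructor
    · simp; positivity
    · simp only [Complex.ofReal_re]; rw [div_le_one hp0]; exact hp
  have main := Complex.HadamardThreeLines.norm_le_interp_of_mem_verticalClosedStrip₀₁' Φ hmem
    hdiff.diffContOnCl hbdd (fun z hz => toR hB0t (b0 z hz)) (fun z hz => toR hB1t (b1 z hz))
  rw [Complex.ofReal_re] at main
  have hval : Φ ((2 / p : ℝ) : ℂ) = ∫ y, A f y * G y ∂ν := by
    have e1 : (p * ((2 / p : ℝ) : ℂ) / 2 : ℂ) = 1 := by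
      have : (p : ℂ) ≠ 0 := by exact_mod_cast hp0.ne'
      push_cast; field_simp
    have e2 : (q * (1 - ((2 / p : ℝ) : ℂ) / 2) : ℂ) = 1 := by
      have : q * (1 - (2 / p) / 2) = 1 := by
        have h3 : 1 - (2 / p) / 2 = 1 / q := by rw [hqe]; ring
        rw [h3]; field_simp
      exact_mod_cast this
    have e3 : fz ((2 / p : ℝ) : ℂ) = f := by
      simp only [hfz]; rw [e1]; ext x; simp [anaPow_one]
    have e4 : Gz ((2 / p : ℝ) : ℂ) = G := by
      simp only [hGz]; rw [e2]; ext x; simp [anaPow_one]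
    simp only [hΦ]
    rw [e3, e4]
  rw [hval] at main
  have main2 : ‖∫ y, A f y * G y ∂ν‖ₑ ≤ B0 ^ (1 - 2 / p) * B1 ^ (2 / p) := by
    have h3 : 0 ≤ 1 - 2 / p := by rw [sub_nonneg, div_le_one hp0]; exact hp
    have h4 : 0 ≤ 2 / p := by positivity
    rw [ENNReal.toReal_rpow, ENNReal.toReal_rpow, ← ENNReal.toReal_mul] at main
    rw [← ofReal_norm]
    exact ENNReal.ofReal_le_of_le_toReal main
  refine main2.trans (le_of_eq ?_)
  have h3 : 0 ≤ 1 - 2 / p := by rw [sub_nonneg, div_le_one hp0]; exact hp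
  have h4 : 0 ≤ 2 / p := by positivity
  rw [hB0, hB1, ENNReal.mul_rpow_of_nonneg _ _ h3, ENNReal.mul_rpow_of_nonneg _ _ h4,
    ENNReal.mul_rpow_of_nonneg _ _ h4, ← ENNReal.rpow_mul, ← ENNReal.rpow_mul, ← ENNReal.rpow_mul]
  -- The exponents of M and of J are both (1 - 2/p) + 1/p = 1/q, and that of I is 1/p.
  have e5 : (1 / 2 : ℝ) * (2 / p) = 1 / p := by ring
  have e6 : 1 / q = (1 - 2 / p) + 1 / p := by rw [hqe]; ring
  rw [e5, e6, ENNReal.rpow_add_of_nonneg _ _ h3 (by positivity),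
    ENNReal.rpow_add_of_nonneg _ _ h3 (by positivity)]
  ring

/-- Duality: a bound for pairings with simple functions gives a bound in `L^p`. -/
theorem lintegral_rpow_le_of_pairing {F : β → ℂ} (hF : MemLp F 2 ν) {K : ℝ≥0∞} (hK : K ≠ ⊤)
    {p q : ℝ} (hpq : p.HolderConjugate q)
    (h : ∀ G : SimpleFunc β ℂ, G.FinMeasSupp ν →
      ‖∫ y, F y * G y ∂ν‖ₑ ≤ K * (∫⁻ y, ‖G y‖ₑ ^ q ∂ν) ^ (1 / q)) :
    (∫⁻ y, ‖F y‖ₑ ^ p ∂ν) ^ (1 / p) ≤ K := by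
  have hp0 : 0 < p := hpq.pos
  have hq0 : 0 < q := hpq.symm.pos
  wlog hFm : StronglyMeasurable F with H
  · have hae := hF.1.ae_eq_mk
    have := H (F := hF.1.mk F) ((memLp_congr_ae hae).mp hF) hK hpq ?_ hp0 hq0
      hF.1.stronglyMeasurable_mk
    · rwa [lintegral_congr_ae (g := fun y => ‖hF.1.mk F y‖ₑ ^ p)]
      filter_upwards [hae] with y hy; rw [hy]
    · intro G hG
      rw [integral_congr_ae (g := fun y => F y * G y)]
      · exact h G hG
      · filter_upwards [hae] with y hy; rw [hy]
  -- extension to bounded functions with support of finite measure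
  have hext : ∀ G : β → ℂ, Measurable G → MemLp G 2 ν → MemLp G (ENNReal.ofReal q) ν →
      ‖∫ y, F y * G y ∂ν‖ₑ ≤ K * (∫⁻ y, ‖G y‖ₑ ^ q ∂ν) ^ (1 / q) := by
    intro G hGm hG2 hGq
    have hq' : ENNReal.ofReal q ≠ 0 := by simpa using hq0
    have hnorm : ∀ g : β → ℂ, (∫⁻ y, ‖g y‖ₑ ^ q ∂ν) ^ (1 / q) = eLpNorm g (ENNReal.ofReal q) ν := by
      intro g
      rw [eLpNorm_eq_lintegral_rpow_enorm_toReal hq' ENNReal.ofReal_ne_top,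
        ENNReal.toReal_ofReal hq0.le]
    set Gm := fun k => SimpleFunc.approxOn G hGm (Set.range G ∪ {0}) 0 (by simp) k with hGmdef
    have t2 := SimpleFunc.tendsto_approxOn_range_Lp_eLpNorm (by norm_num) hGm hG2.2
    have tq := SimpleFunc.tendsto_approxOn_range_Lp_eLpNorm ENNReal.ofReal_ne_top hGm hGq.2
    have hsupp : ∀ k, (Gm k).FinMeasSupp ν := fun k =>
      (SimpleFunc.memLp_iff_finMeasSupp (by norm_num) (by norm_num)).mp
        (SimpleFunc.memLp_approxOn_range hGm hG2 k)
    have hstep : ∀ k, ‖∫ y, F y * G y ∂ν‖ₑ ≤ eLpNorm F 2 ν * eLpNorm (⇑(Gm k) - G) 2 ν +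
        K * (eLpNorm (⇑(Gm k) - G) (ENNReal.ofReal q) ν + eLpNorm G (ENNReal.ofReal q) ν) := by
      intro k
      have hk2 : MemLp (Gm k) 2 ν := SimpleFunc.memLp_approxOn_range hGm hG2 k
      have e : ∫ y, F y * G y ∂ν = ∫ y, F y * Gm k y ∂ν - ∫ y, F y * (⇑(Gm k) - G) y ∂ν := by
        have h1 : Integrable (fun y => F y * Gm k y) ν := hF.integrable_mul hk2
        have h2 : Integrable (fun y => F y * (⇑(Gm k) - G) y) ν := hF.integrable_mul (hk2.sub hG2)
        rw [← integral_sub h1 h2]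
        refine integral_congr_ae (Filter.Eventually.of_forall fun y => ?_)
        simp only [Pi.sub_apply]; ring
      rw [e, add_comm]
      refine enorm_sub_le.trans (add_le_add ?_ ?_)
      · refine (h _ (hsupp k)).trans ?_
        rw [hnorm]
        gcongr
        have : (Gm k : β → ℂ) = (⇑(Gm k) - G) + G := by simp
        conv_lhs => rw [this]
        exact eLpNorm_add_le ((Gm k).aestronglyMeasurable.sub hGm.aestronglyMeasurable)
          hGm.aestronglyMeasurable (by rw [← ENNReal.ofReal_one]; exact ENNReal.ofReal_le_ofReal hpq.symm.lt.le)
      · exact enorm_integral_mul_le hF.1 (hk2.sub hG2).1 2 2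
    rw [hnorm]
    have tlim : Filter.Tendsto (fun k => eLpNorm F 2 ν * eLpNorm (⇑(Gm k) - G) 2 ν +
        K * (eLpNorm (⇑(Gm k) - G) (ENNReal.ofReal q) ν + eLpNorm G (ENNReal.ofReal q) ν))
        Filter.atTop (nhds (eLpNorm F 2 ν * 0 + K * (0 + eLpNorm G (ENNReal.ofReal q) ν))) := by
      refine Filter.Tendsto.add ?_ ?_
      · exact ENNReal.Tendsto.const_mul t2 (Or.inr hF.2.ne)
      · exact ENNReal.Tendsto.const_mul (tq.add tendsto_const_nhds) (Or.inr hK)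
    rw [mul_zero, zero_add, zero_add] at tlim
    exact ge_of_tendsto' tlim hstep
  -- truncations
  set S : ℕ → Set β := fun k => {y | 1 / ((k : ℝ) + 1) ≤ ‖F y‖ ∧ ‖F y‖ ≤ k} with hS
  have hSm : ∀ k, MeasurableSet (S k) := fun k =>
    (measurableSet_le measurable_const hFm.norm.measurable).inter
      (measurableSet_le hFm.norm.measurable measurable_const)
  have hSfin : ∀ k, ν (S k) < ⊤ := by
    intro k
    have hk : (0 : ℝ) < 1 / ((k : ℝ) + 1) := by positivity
    refine lt_of_le_of_lt (measure_mono ?_) (hF.meas_ge_lt_top (by norm_num) (by norm_num)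
      (ε := (1 / ((k : ℝ) + 1)).toNNReal) (by simpa using hk))
    intro y hy
    change (1 / ((k : ℝ) + 1)).toNNReal ≤ ‖F y‖₊
    rw [Real.toNNReal_le_iff_le_coe]; exact hy.1
  have hcore : ∀ k, (∫⁻ y in S k, ‖F y‖ₑ ^ p ∂ν) ≤ K ^ p := by
    intro k
    set I := ∫⁻ y in S k, ‖F y‖ₑ ^ p ∂ν with hI
    -- The extremal function for Hölder's inequality, cut to the set where |F| lies between 1/(k+1)
    -- and k. That set has finite measure, so I is finite and a power of it can be divided out.
    set G : β → ℂ := (S k).indicator fun y => (starRingEnd ℂ) (F y) * ((‖F y‖ ^ (p - 2) : ℝ) : ℂ) with hG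
    have hGm : Measurable G := by
      refine Measurable.indicator ?_ (hSm k)
      exact (Complex.continuous_conj.measurable.comp hFm.measurable).mul
        (Complex.measurable_ofReal.comp (hFm.norm.measurable.pow_const _))
    have hFpos : ∀ y ∈ S k, 0 < ‖F y‖ := fun y hy => lt_of_lt_of_le (by positivity) hy.1
    have hGn : ∀ y ∈ S k, ‖G y‖ = ‖F y‖ ^ (p - 1) := by
      intro y hy
      rw [hG, Set.indicator_of_mem hy, norm_mul, Complex.norm_conj, Complex.norm_real,
        Real.norm_of_nonneg (by positivity)]
      nth_rw 1 [← Real.rpow_one ‖F y‖]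
      rw [← Real.rpow_add (hFpos y hy)]
      congr 1; ring
    have hGb : ∀ y, ‖G y‖ ≤ (k : ℝ) ^ (p - 1) := by
      intro y
      by_cases hy : y ∈ S k
      · rw [hGn y hy]
        exact Real.rpow_le_rpow (norm_nonneg _) hy.2 (by linarith [hpq.lt])
      · rw [hG, Set.indicator_of_notMem hy, norm_zero]; positivity
    have hGmem : ∀ r : ℝ≥0∞, MemLp G r ν := by
      intro r
      have hGr : MemLp G r (ν.restrict (S k)) := by
        haveI : IsFiniteMeasure (ν.restrict (S k)) := ⟨by simpa using hSfin k⟩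
        exact MemLp.of_bound hGm.aestronglyMeasurable _ (Filter.Eventually.of_forall hGb)
      have : G = (S k).indicator G := by rw [hG, Set.indicator_indicator, Set.inter_self]
      rw [this]
      exact (memLp_indicator_iff_restrict (hSm k)).mpr hGr
    have e1 : ∫ y, F y * G y ∂ν = ∫ y in S k, ((‖F y‖ ^ p : ℝ) : ℂ) ∂ν := by
      rw [← integral_indicator (hSm k)]
      refine integral_congr_ae (Filter.Eventually.of_forall fun y => ?_)
      dsimp only
      by_cases hy : y ∈ S k
      · rw [Set.indicator_of_mem hy, hG, Set.indicator_of_mem hy, ← mul_assoc, Complex.mul_conj']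
        norm_cast
        rw [← Real.rpow_natCast, ← Real.rpow_add (hFpos y hy)]
        congr 1; push_cast; ring
      · rw [Set.indicator_of_notMem hy, hG, Set.indicator_of_notMem hy, mul_zero]
    have e2 : ‖∫ y, F y * G y ∂ν‖ₑ = I := by
      rw [e1, integral_complex_ofReal, ← ofReal_norm, Complex.norm_real, Real.norm_of_nonneg
        (integral_nonneg fun y => by positivity), integral_eq_lintegral_of_nonneg_ae
        (Filter.Eventually.of_forall fun y => by positivity)
        ((hFm.norm.measurable.pow_const p).aestronglyMeasurable)]
      have e3 : ∫⁻ y in S k, ENNReal.ofReal (‖F y‖ ^ p) ∂ν = I := by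
        refine lintegral_congr fun y => ?_
        rw [← ENNReal.ofReal_rpow_of_nonneg (norm_nonneg _) hp0.le, ofReal_norm]
      rw [e3, ENNReal.ofReal_toReal]
      rw [hI]
      refine ne_top_of_le_ne_top (b := ENNReal.ofReal k ^ p * ν (S k)) (ENNReal.mul_ne_top
        (ENNReal.rpow_ne_top_of_nonneg hp0.le ENNReal.ofReal_ne_top) (hSfin k).ne) ?_
      rw [← setLIntegral_const]
      refine setLIntegral_mono' (hSm k) fun y hy => ENNReal.rpow_le_rpow ?_ hp0.le
      rw [← ofReal_norm]; exact ENNReal.ofReal_le_ofReal hy.2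
    have e4 : ∫⁻ y, ‖G y‖ₑ ^ q ∂ν = I := by
      rw [hI, ← lintegral_indicator (hSm k)]
      refine lintegral_congr fun y => ?_
      by_cases hy : y ∈ S k
      · rw [Set.indicator_of_mem hy, ← ofReal_norm, hGn y hy, ← ofReal_norm,
          ENNReal.ofReal_rpow_of_nonneg (by positivity) hq0.le,
          ENNReal.ofReal_rpow_of_nonneg (by positivity) hp0.le, ← Real.rpow_mul (norm_nonneg _)]
        congr 2
        exact hpq.sub_one_mul_conj
      · rw [Set.indicator_of_notMem hy, hG, Set.indicator_of_notMem hy, enorm_zero,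
          ENNReal.zero_rpow_of_pos hq0]
    have hIt : I ≠ ⊤ := by rw [← e2]; exact enorm_ne_top
    have h5 := hext G hGm (hGmem 2) (hGmem _)
    rw [e2, e4] at h5
    rcases eq_or_ne I 0 with h0 | h0
    · rw [h0]; exact zero_le
    have h6 : I ^ (1 / p) * I ^ (1 / q) ≤ K * I ^ (1 / q) := by
      rw [← ENNReal.rpow_add _ _ h0 hIt]
      have : 1 / p + 1 / q = 1 := by rw [one_div, one_div]; exact hpq.inv_add_inv_eq_one
      rw [this, ENNReal.rpow_one]; exact h5
    have h7 : I ^ (1 / p) ≤ K := by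
      refine (ENNReal.mul_le_mul_iff_left ?_ ?_).mp h6
      · exact (ENNReal.rpow_pos (pos_iff_ne_zero.mpr h0) hIt).ne'
      · exact ENNReal.rpow_ne_top_of_nonneg (by positivity) hIt
    calc I = (I ^ (1 / p)) ^ p := by rw [← ENNReal.rpow_mul, one_div_mul_cancel hp0.ne', ENNReal.rpow_one]
      _ ≤ K ^ p := ENNReal.rpow_le_rpow h7 hp0.le
  have hSmono : Monotone S := by
    intro i j hij y hy
    have : (i : ℝ) ≤ j := by exact_mod_cast hij
    exact ⟨le_trans (one_div_le_one_div_of_le (by positivity) (by linarith)) hy.1, hy.2.trans this⟩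
  have hfinal : ∫⁻ y, ‖F y‖ₑ ^ p ∂ν ≤ K ^ p := by
    have e : ∫⁻ y, ‖F y‖ₑ ^ p ∂ν = ∫⁻ y in ⋃ k, S k, ‖F y‖ₑ ^ p ∂ν := by
      rw [← lintegral_indicator (MeasurableSet.iUnion hSm)]
      refine lintegral_congr fun y => ?_
      by_cases hy : y ∈ ⋃ k, S k
      · rw [Set.indicator_of_mem hy]
      · rw [Set.indicator_of_notMem hy]
        have : F y = 0 := by
          by_contra hne
          refine hy (Set.mem_iUnion.mpr ?_)
          obtain ⟨k1, hk1⟩ := exists_nat_one_div_lt (norm_pos_iff.mpr hne)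
          obtain ⟨k2, hk2⟩ := exists_nat_ge ‖F y‖
          refine ⟨max k1 k2, ?_, ?_⟩
          · refine le_trans (one_div_le_one_div_of_le (by positivity) ?_) hk1.le
            push_cast; gcongr; exact le_max_left _ _
          · push_cast; exact hk2.trans (le_max_right _ _)
        rw [this, enorm_zero, ENNReal.zero_rpow_of_pos hp0]
    rw [e, setLIntegral_iUnion_of_directed _ hSmono.directed_le]
    exact iSup_le hcore
  calc _ ≤ (K ^ p) ^ (1 / p) := ENNReal.rpow_le_rpow hfinal (by positivity)
    _ = K := by rw [← ENNReal.rpow_mul, mul_one_div_cancel hp0.ne', ENNReal.rpow_one]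

end

end RoughPDO
end

noncomputable section
namespace RoughPDO

/-! ### Reproducing families of finite rank and their convolution kernels -/

/-- A reproducing family for the polynomials of degree at most `N` on the sphere, given by a kernel
of finite rank, together with bounds on the associated multipliers. -/
structure ReproFamily {n : ℕ} {χ : E n → ℝ} (hχ : IsCutoff χ) (N : ℕ) (M : ℝ≥0) where
  dim : ℕ
  coef : Fin dim → Sph n → ℂ
  continuous_coef : ∀ j, Continuous (coef j)
  poly : Fin dim → MvPolynomial (Fin n) ℂ
  repro : ∀ s : MvPolynomial (Fin n) ℂ, s.totalDegree ≤ N → ∀ θ : Sph n, pev (θ : E n) s =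
    ∑ j, (∫ η : Sph n, pev (η : E n) s * coef j η ∂(sphMeasure n)) * pev (θ : E n) (poly j)
  lintegral_sq_le : ∀ (k : ℤ) (ξ : E n),
    ∫⁻ η, ‖∑ j, coef j η * polySym hχ (poly j) k ξ‖ₑ ^ 2 ∂(sphMeasure n) ≤ M
  ker_le : ∀ (k : ℤ) (η : Sph n),
    eLpNorm (fun z => ∑ j, coef j η * polyKer hχ (poly j) k z) 1 volume ≤ M

theorem continuous_integral_sph {n : ℕ} {f : Sph n → Sph n → ℂ}
    (hf : Continuous (Function.uncurry f)) :
    Continuous fun η => ∫ θ, f η θ ∂(sphMeasure n) := by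
  have := continuous_parametric_integral_of_continuous (μ := sphMeasure n) hf
    (isCompact_univ : IsCompact (Set.univ : Set (Sph n)))
  simpa using this

/-- Expanding Φ(η,·) in an orthonormal basis of the polynomials of degree at most 3N gives finite
rank, so that exchanging the η-integral with a transform or a convolution becomes a finite sum. The
factor 1 + c² absorbs the size of the bump. -/
theorem exists_reproFamily {n : ℕ} (hn : 0 < n) {χ : E n → ℝ} (hχ : IsCutoff χ) :
    ∃ C : ℝ≥0, 1 ≤ C ∧ ∀ N : ℕ, 1 ≤ N → Nonempty (ReproFamily hχ N (C * (N : ℝ≥0) ^ (n - 1))) := by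
  obtain ⟨C, hC1, hC⟩ := exists_reproducing hn hχ
  obtain ⟨c, hc0, hc⟩ := exists_bound_bump hχ
  have hK0 : 0 ≤ C * (1 + c ^ 2) := by positivity
  refine ⟨(C * (1 + c ^ 2)).toNNReal, ?_, fun N hN => ?_⟩
  · rw [Real.one_le_toNNReal]; nlinarith [sq_nonneg c]
  obtain ⟨Φ, hdeg, hcont, hrep, hsq, hker⟩ := hC N hN
  obtain ⟨B⟩ := exists_sphBasis n (3 * N)
  set b : Fin B.dim → Sph n → ℂ := fun j η => ∫ θ : Sph n, pev (θ : E n) (Φ η) *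
      (starRingEnd ℂ) (pev (θ : E n) (B.poly j)) ∂(sphMeasure n) with hb
  have hbc : ∀ j, Continuous (b j) := by
    intro j
    refine continuous_integral_sph ?_
    exact hcont.mul (Complex.continuous_conj.comp ((continuous_pev_sph _).comp continuous_snd))
  have hΦ : ∀ (η θ : Sph n), pev (θ : E n) (Φ η) = ∑ j, b j η * pev (θ : E n) (B.poly j) :=
    fun η θ => B.expand _ (hdeg η) θ
  have hX : 0 ≤ (N : ℝ) ^ (n - 1) := by positivity
  have hM : ∀ a : ℝ, a ≤ C * (1 + c ^ 2) * (N : ℝ) ^ (n - 1) → ENNReal.ofReal a ≤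
      (((C * (1 + c ^ 2)).toNNReal * (N : ℝ≥0) ^ (n - 1) : ℝ≥0) : ℝ≥0∞) := by
    intro a ha
    refine ENNReal.ofReal_le_of_le_toReal (ha.trans (le_of_eq ?_))
    simp [hK0]
  refine ⟨⟨B.dim, b, hbc, B.poly, fun s hs θ => ?_, fun k ξ => ?_, fun k η => ?_⟩⟩
  · rw [hrep s hs θ]
    simp only [hΦ, Finset.mul_sum, ← integral_mul_const]
    rw [integral_finsetSum]
    · simp only [mul_assoc]
    · intro j _
      exact integrable_sph_of_continuous
        ((continuous_pev_sph s).mul ((hbc j).mul continuous_const))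
  · have h1 : ∀ η, ‖∑ j, b j η * polySym hχ (B.poly j) k ξ‖ₑ ^ 2 =
        ENNReal.ofReal (‖∑ j, b j η * polySym hχ (B.poly j) k ξ‖ ^ 2) := fun η => by
      rw [ENNReal.ofReal_pow (norm_nonneg _), ofReal_norm]
    simp only [h1]
    rw [← ofReal_integral_eq_lintegral_ofReal]
    · refine hM _ ?_
      by_cases h0 : ξ = 0
      · simp only [polySym_apply, hom, h0]
        simp only [dif_pos, zero_mul, mul_zero, Finset.sum_const_zero, norm_zero, ne_eq,
          OfNat.ofNat_ne_zero, not_false_eq_true, zero_pow, integral_zero]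
        positivity
      · have h2 : ∀ η, ‖∑ j, b j η * polySym hχ (B.poly j) k ξ‖ ^ 2 =
            ‖pev (dirOf ξ h0 : E n) (Φ η)‖ ^ 2 * ‖bumpK χ k ξ‖ ^ 2 := by
          intro η
          rw [hΦ, ← mul_pow, ← Complex.norm_real (bumpK χ k ξ), ← norm_mul, Finset.sum_mul]
          simp only [polySym_apply, hom, dif_neg h0, mul_assoc]
        simp only [h2]
        rw [integral_mul_const]
        have h3 : ‖bumpK χ k ξ‖ ^ 2 ≤ c ^ 2 := pow_le_pow_left₀ (norm_nonneg _) (hc _) 2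
        calc _ ≤ C * (N : ℝ) ^ (n - 1) * c ^ 2 :=
              mul_le_mul (hsq _) h3 (by positivity) (by positivity)
          _ ≤ _ := by
              have : 0 ≤ C * (N : ℝ) ^ (n - 1) := by positivity
              nlinarith
    · refine integrable_sph_of_continuous ?_
      exact (continuous_finsetSum _ fun j _ => (hbc j).mul continuous_const).norm.pow 2
    · exact Filter.Eventually.of_forall fun _ => by positivity
  · have h1 : (fun z => ∑ j, b j η * polyKer hχ (B.poly j) k z) = polyKer hχ (Φ η) k := by
      ext z
      rw [polyKer_congr hχ (hΦ η) k]
      simp [sum_apply]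
    rw [h1, ← ENNReal.ofReal_toReal ((polyKer hχ (Φ η) k).memLp 1 volume).2.ne,
      ← integral_norm_eq_toReal]
    refine hM _ ((hker η k).trans ?_)
    have : 0 ≤ C * (N : ℝ) ^ (n - 1) := by positivity
    nlinarith [sq_nonneg c]

section
variable {n : ℕ} {χ : E n → ℝ} {hχ : IsCutoff χ} {N : ℕ} {M : ℝ≥0}

/-- The kernels `F^{-1}[Φ(η, ξ/|ξ|) φ(2^{-k}ξ)]` of a reproducing family. -/
def ReproFamily.ker (R : ReproFamily hχ N M) (k : ℤ) (η : Sph n) : 𝓢(E n, ℂ) :=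
  ∑ j, R.coef j η • polyKer hχ (R.poly j) k

theorem ReproFamily.ker_apply (R : ReproFamily hχ N M) (k : ℤ) (η : Sph n) (z : E n) :
    R.ker k η z = ∑ j, R.coef j η * polyKer hχ (R.poly j) k z := by
  simp [ReproFamily.ker, sum_apply]

theorem ReproFamily.eLpNorm_ker_le (R : ReproFamily hχ N M) (k : ℤ) (η : Sph n) :
    eLpNorm (R.ker k η) 1 volume ≤ M := by
  refine le_trans (le_of_eq ?_) (R.ker_le k η)
  congr 1
  ext z; exact R.ker_apply k η z

theorem ReproFamily.continuous_ker (R : ReproFamily hχ N M) (k : ℤ) :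
    Continuous fun z : Sph n × E n => R.ker k z.1 z.2 := by
  simp only [R.ker_apply]
  exact continuous_finsetSum _ fun j _ => ((R.continuous_coef j).comp continuous_fst).mul
    ((polyKer hχ (R.poly j) k).continuous.comp continuous_snd)

theorem ReproFamily.polyKer_eq (R : ReproFamily hχ N M) {s : MvPolynomial (Fin n) ℂ}
    (hs : s.totalDegree ≤ N) (k : ℤ) : polyKer hχ s k =
      ∑ j, (∫ η : Sph n, pev (η : E n) s * R.coef j η ∂(sphMeasure n)) •
        polyKer hχ (R.poly j) k :=
  polyKer_congr hχ (R.repro s hs) k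

theorem ReproFamily.polyKer_eq_integral (R : ReproFamily hχ N M) {s : MvPolynomial (Fin n) ℂ}
    (hs : s.totalDegree ≤ N) (k : ℤ) (z : E n) : polyKer hχ s k z =
      ∫ η : Sph n, pev (η : E n) s * R.ker k η z ∂(sphMeasure n) := by
  simp only [R.polyKer_eq hs, sum_apply, smul_apply, smul_eq_mul,
    R.ker_apply, Finset.mul_sum, ← integral_mul_const]
  rw [integral_finsetSum]
  · simp only [mul_assoc]
  · intro j _
    exact integrable_sph_of_continuous
      ((continuous_pev_sph s).mul ((R.continuous_coef j).mul continuous_const))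

/-- The kernel of s is the superposition of the kernels R.ker k η with weights s(η); Tonelli gives
the norm bound. This is the endpoint p = ∞. -/
theorem ReproFamily.eLpNorm_polyKer_le (R : ReproFamily hχ N M) {s : MvPolynomial (Fin n) ℂ}
    (hs : s.totalDegree ≤ N) (k : ℤ) : eLpNorm (polyKer hχ s k) 1 volume ≤
      M * eLpNorm (fun θ : Sph n => pev (θ : E n) s) 1 (sphMeasure n) := by
  rw [eLpNorm_one_eq_lintegral_enorm, eLpNorm_one_eq_lintegral_enorm]
  calc ∫⁻ z, ‖polyKer hχ s k z‖ₑ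
      ≤ ∫⁻ z, ∫⁻ η : Sph n, ‖pev (η : E n) s‖ₑ * ‖R.ker k η z‖ₑ ∂(sphMeasure n) := by
        refine lintegral_mono fun z => ?_
        rw [R.polyKer_eq_integral hs]
        refine (enorm_integral_le_lintegral_enorm _).trans (le_of_eq ?_)
        simp only [enorm_mul]
    _ = ∫⁻ η : Sph n, (∫⁻ z : E n, ‖pev (η : E n) s‖ₑ * ‖R.ker k η z‖ₑ) ∂(sphMeasure n) := by
        refine lintegral_lintegral_swap ?_
        have h1 : Continuous fun p : E n × Sph n => pev (p.2 : E n) s :=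
          (continuous_pev_sph s).comp continuous_snd
        have h2 : Continuous fun p : E n × Sph n => R.ker k p.2 p.1 :=
          (R.continuous_ker k).comp continuous_swap
        exact (h1.measurable.enorm.mul h2.measurable.enorm).aemeasurable
    _ ≤ ∫⁻ η : Sph n, ‖pev (η : E n) s‖ₑ * M ∂(sphMeasure n) := by
        refine lintegral_mono fun η => ?_
        rw [lintegral_const_mul _ ((R.ker k η).continuous.measurable.enorm),
          ← eLpNorm_one_eq_lintegral_enorm]
        gcongr
        exact R.eLpNorm_ker_le k η
    _ = _ := by
        rw [lintegral_mul_const _ (continuous_pev_sph s).measurable.enorm, mul_comm]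

end

end RoughPDO
end

noncomputable section
namespace RoughPDO

/-! ### Approximation in L^p and conjugate exponents -/

section
variable {α β : Type*} [MeasurableSpace α] [MeasurableSpace β] {μ : Measure α} {ν : Measure β}

/-- A density argument with two constants: the sharp bound K is known for the approximants only, and
any finite K' controls the error, disappearing in the limit. -/
theorem eLpNorm_le_of_approx {f : α → ℂ} {F : β → ℂ} {p : ℝ≥0∞} (hp : 1 ≤ p) (K K' : ℝ≥0)
    (hf : AEStronglyMeasurable f μ) (hF : AEStronglyMeasurable F ν)
    (h : ∀ ε : ℝ≥0∞, ε ≠ 0 → ∃ (g : α → ℂ) (G : β → ℂ), AEStronglyMeasurable g μ ∧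
      AEStronglyMeasurable G ν ∧ eLpNorm (f - g) p μ ≤ ε ∧
      eLpNorm (F - G) p ν ≤ K' * eLpNorm (f - g) p μ ∧ eLpNorm G p ν ≤ K * eLpNorm g p μ) :
    eLpNorm F p ν ≤ K * eLpNorm f p μ := by
  refine ENNReal.le_of_forall_pos_le_add fun ε hε _ => ?_
  have hε' : (ε : ℝ≥0∞) / (K + K' + 1 : ℝ≥0) ≠ 0 :=
    (ENNReal.div_pos (by simpa using hε.ne') ENNReal.coe_ne_top).ne'
  obtain ⟨g, G, hg, hG, h1, h2, h3⟩ := h _ hε'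
  have h4 : eLpNorm F p ν ≤ eLpNorm (F - G) p ν + eLpNorm G p ν := by
    simpa using eLpNorm_add_le (hF.sub hG) hG hp
  have h5 : eLpNorm g p μ ≤ eLpNorm f p μ + eLpNorm (f - g) p μ := by
    have := eLpNorm_sub_le hf (hf.sub hg) hp
    simpa using this
  have h6 : ((K + K' : ℝ≥0) : ℝ≥0∞) * ((ε : ℝ≥0∞) / (K + K' + 1 : ℝ≥0)) ≤ ε := by
    rw [← ENNReal.coe_div (by positivity), ← ENNReal.coe_mul, ENNReal.coe_le_coe, mul_div_assoc',
      div_le_iff₀ (by positivity), mul_comm]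
    exact mul_le_mul_right le_self_add _
  calc eLpNorm F p ν ≤ K' * eLpNorm (f - g) p μ + K * (eLpNorm f p μ + eLpNorm (f - g) p μ) := by
        refine h4.trans (add_le_add h2 (h3.trans ?_)); gcongr
    _ = K * eLpNorm f p μ + ((K + K' : ℝ≥0) : ℝ≥0∞) * eLpNorm (f - g) p μ := by
        rw [ENNReal.coe_add]; ring
    _ ≤ K * eLpNorm f p μ + ((K + K' : ℝ≥0) : ℝ≥0∞) * ((ε : ℝ≥0∞) / (K + K' + 1 : ℝ≥0)) := by
        gcongr
    _ ≤ _ := by gcongr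

theorem eLpNorm_two_sq (f : α → ℂ) : eLpNorm f 2 μ ^ 2 = ∫⁻ x, ‖f x‖ₑ ^ 2 ∂μ := by
  have := eLpNorm_nnreal_pow_eq_lintegral (f := f) (μ := μ) (p := 2) (by norm_num)
  simpa using this

theorem eLpNorm_toReal_rpow (f : α → ℂ) {p : ℝ≥0∞} (h0 : p ≠ 0) (ht : p ≠ ⊤) :
    eLpNorm f p μ ^ p.toReal = ∫⁻ x, ‖f x‖ₑ ^ p.toReal ∂μ := by
  rw [eLpNorm_eq_lintegral_rpow_enorm_toReal h0 ht, ← ENNReal.rpow_mul,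
    one_div, inv_mul_cancel₀ (ENNReal.toReal_pos h0 ht).ne', ENNReal.rpow_one]

end

theorem holderConjugate_ne_top {p p' : ℝ≥0∞} [p.HolderConjugate p'] (hp : 2 ≤ p) : p' ≠ ⊤ :=
  ((ENNReal.HolderConjugate.lt_top_iff_one_lt p' p).mpr (ENNReal.one_lt_two.trans_le hp)).ne

theorem holderConjugate_le_two {p p' : ℝ≥0∞} [hpp : p.HolderConjugate p'] (hp : 2 ≤ p) :
    p' ≤ 2 := by
  have h1 := ENNReal.HolderConjugate.inv_add_inv_eq_one p p'
  have h2 : p⁻¹ ≤ 2⁻¹ := ENNReal.inv_le_inv.mpr hp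
  rw [← ENNReal.inv_le_inv]
  by_contra h
  rw [not_le] at h
  have h3 : p⁻¹ + p'⁻¹ < 2⁻¹ + 2⁻¹ :=
    ENNReal.add_lt_add_of_le_of_lt (ne_top_of_le_ne_top (by norm_num) h2) h2 h
  rw [h1, ENNReal.inv_two_add_inv_two] at h3
  exact lt_irrefl _ h3

/-! ### Convolutions of Schwartz functions with `L^p` functions -/

theorem integrable_cnv {n : ℕ} {K f : E n → ℂ} {p q : ℝ≥0∞} [p.HolderConjugate q]
    (hK : MemLp K q volume) (hf : MemLp f p volume) (x : E n) :
    Integrable fun y => K (x - y) * f y := by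
  have h1 : MemLp (fun y => K (x - y)) q volume :=
    hK.comp_measurePreserving (volume.measurePreserving_sub_left x)
  haveI : q.HolderConjugate p := ENNReal.HolderConjugate.symm
  exact MemLp.integrable_mul h1 hf

theorem integrable_cnv_schwartz {n : ℕ} (K : 𝓢(E n, ℂ)) {f : E n → ℂ} {p : ℝ≥0∞} (hp : 1 ≤ p)
    (hf : MemLp f p volume) (x : E n) : Integrable fun y => K (x - y) * f y := by
  haveI := ENNReal.HolderConjugate.conjExponent hp
  exact integrable_cnv (K.memLp p.conjExponent volume) hf x

theorem cnv_sub_right {n : ℕ} (K : 𝓢(E n, ℂ)) {f g : E n → ℂ} {p : ℝ≥0∞} (hp : 1 ≤ p)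
    (hf : MemLp f p volume) (hg : MemLp g p volume) (x : E n) :
    cnv K (f - g) x = cnv K f x - cnv K g x := by
  rw [cnv, cnv, cnv, ← integral_sub (integrable_cnv_schwartz K hp hf x)
    (integrable_cnv_schwartz K hp hg x)]
  simp only [Pi.sub_apply, mul_sub]

theorem cnv_sum_left {n : ℕ} {ι : Type*} (t : Finset ι) (c : ι → ℂ) (K : ι → 𝓢(E n, ℂ))
    {f : E n → ℂ} {p : ℝ≥0∞} (hp : 1 ≤ p) (hf : MemLp f p volume) (x : E n) :
    cnv (∑ i ∈ t, c i • K i : 𝓢(E n, ℂ)) f x = ∑ i ∈ t, c i * cnv (K i) f x := by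
  simp only [cnv, ← integral_const_mul]
  rw [← integral_finsetSum _ fun i _ => (integrable_cnv_schwartz (K i) hp hf x).const_mul _]
  simp only [sum_apply, smul_apply, smul_eq_mul, Finset.sum_mul, mul_assoc]

theorem lintegral_enorm_sq_fourierInv {n : ℕ} (f : 𝓢(E n, ℂ)) :
    ∫⁻ z, ‖𝓕⁻ f z‖ₑ ^ 2 = ∫⁻ x, ‖f x‖ₑ ^ 2 := by
  have h : ∀ g : 𝓢(E n, ℂ), ∫⁻ x, ‖g x‖ₑ ^ 2 = ENNReal.ofReal (∫ x, ‖g x‖ ^ 2) := fun g => by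
    rw [ofReal_integral_eq_lintegral_ofReal (integrable_norm_sq_schwartz g)
      (Filter.Eventually.of_forall fun _ => by positivity)]
    simp only [ENNReal.ofReal_pow (norm_nonneg _), ofReal_norm]
  rw [h, h, integral_norm_sq_fourierInv]

theorem lintegral_enorm_sq_cnv {n : ℕ} (a f : 𝓢(E n, ℂ)) :
    ∫⁻ x, ‖cnv (𝓕⁻ a : 𝓢(E n, ℂ)) f x‖ₑ ^ 2 = ∫⁻ ξ, ‖a ξ‖ₑ ^ 2 * ‖𝓕 f ξ‖ₑ ^ 2 := by
  set b : 𝓢(E n, ℂ) := SchwartzMap.pairing (ContinuousLinearMap.mul ℂ ℂ) a (𝓕 f) with hb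
  have h1 : ∀ ξ, b ξ = a ξ * 𝓕 f ξ := fun ξ => by
    rw [hb, SchwartzMap.pairing_apply_apply]; rfl
  have h2 : ∀ x, cnv (𝓕⁻ a : 𝓢(E n, ℂ)) f x = 𝓕⁻ b x := fun x => by
    rw [fourierInv_mul_eq_cnv h1, FourierTransform.fourierInv_fourier_eq]
  simp only [h2]
  rw [lintegral_enorm_sq_fourierInv]
  simp only [h1, enorm_mul, mul_pow]

theorem fourierInv_finset_sum_smul {n : ℕ} {ι : Type*} (t : Finset ι) (c : ι → ℂ)
    (a : ι → 𝓢(E n, ℂ)) : 𝓕⁻ (∑ i ∈ t, c i • a i) = ∑ i ∈ t, c i • (𝓕⁻ (a i) : 𝓢(E n, ℂ)) := by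
  rw [FourierTransform.fourierInv_sum]
  simp only [FourierTransform.fourierInv_smul]

/-! ### The operator with values in functions on the sphere -/

section
variable {n : ℕ} {χ : E n → ℝ} {hχ : IsCutoff χ} {N : ℕ} {M : ℝ≥0}

/-- The operator `f ↦ F^{-1}[Φ(η, ξ/|ξ|) φ(2^{-k}ξ) f^](x)`. -/
def ReproFamily.op (R : ReproFamily hχ N M) (k : ℤ) (f : E n → ℂ) (z : Sph n × E n) : ℂ :=
  cnv (R.ker k z.1) f z.2

theorem ReproFamily.aestronglyMeasurable_op (R : ReproFamily hχ N M) (k : ℤ) {f : E n → ℂ}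
    (hf : AEStronglyMeasurable f) :
    AEStronglyMeasurable (R.op k f) ((sphMeasure n).prod volume) := by
  have h : AEStronglyMeasurable (fun w : (Sph n × E n) × E n =>
      R.ker k w.1.1 (w.1.2 - w.2) * f w.2) (((sphMeasure n).prod volume).prod volume) := by
    refine AEStronglyMeasurable.mul ?_ hf.comp_snd
    have : Continuous fun w : (Sph n × E n) × E n => R.ker k w.1.1 (w.1.2 - w.2) :=
      (R.continuous_ker k).comp (by fun_prop :
        Continuous fun w : (Sph n × E n) × E n => (w.1.1, w.1.2 - w.2))
    exact this.aestronglyMeasurable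
  exact h.integral_prod_right'

theorem ReproFamily.op_sub (R : ReproFamily hχ N M) (k : ℤ) {f g : E n → ℂ} {p : ℝ≥0∞}
    (hp : 1 ≤ p) (hf : MemLp f p volume) (hg : MemLp g p volume) :
    R.op k f - R.op k g = R.op k (f - g) :=
  funext fun z => (cnv_sub_right (R.ker k z.1) hp hf hg z.2).symm

theorem ReproFamily.levelLinear_op (R : ReproFamily hχ N M) (k : ℤ) : LevelLinear (R.op k) := by
  intro f x z
  have h1 : ∀ a, Integrable fun y => R.ker k z.1 (z.2 - y) * levelInd f a y := fun a =>
    integrable_cnv_schwartz (p := ⊤) _ le_top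
      (memLp_top_of_bound (levelInd f a).aestronglyMeasurable 1
        (Filter.Eventually.of_forall fun y => by
          simp only [levelInd, SimpleFunc.map_apply]; split_ifs <;> simp)) _
  simp only [ReproFamily.op, cnv, ← integral_const_mul]
  rw [← integral_finsetSum _ fun a _ => (h1 a).const_mul _]
  refine integral_congr_ae (Filter.Eventually.of_forall fun y => ?_)
  dsimp only
  rw [Finset.sum_eq_single (f y)]
  · simp only [levelInd, SimpleFunc.map_apply, if_true]; ring
  · intro a _ ha
    simp only [levelInd, SimpleFunc.map_apply, if_neg (Ne.symm ha), mul_zero]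
  · intro h; exact absurd (f.mem_range_self y) h

theorem ReproFamily.eLpNorm_op_top_le (R : ReproFamily hχ N M) (k : ℤ) (f : E n → ℂ) :
    eLpNorm (R.op k f) ⊤ ((sphMeasure n).prod volume) ≤ M * eLpNorm f ⊤ volume := by
  rw [eLpNorm_exponent_top]
  refine essSup_le_of_ae_le _ (Filter.Eventually.of_forall fun z => ?_)
  refine (enorm_cnv_le_top (R.ker k z.1).continuous.aestronglyMeasurable z.2).trans ?_
  exact mul_le_mul_left (R.eLpNorm_ker_le k z.1) _

/-- Young's inequality for each η and the finite area of the sphere. The power of M is not the right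
one; the bound only feeds the error term of `eLpNorm_le_of_approx`. -/
theorem ReproFamily.eLpNorm_op_le_crude (R : ReproFamily hχ N M) (k : ℤ) {f : E n → ℂ}
    (hf : AEStronglyMeasurable f) {p : ℝ≥0∞} (hp : 1 ≤ p) (hpt : p ≠ ⊤) :
    eLpNorm (R.op k f) p ((sphMeasure n).prod volume) ≤
      (sphMeasure n Set.univ) ^ (1 / p.toReal) * M * eLpNorm f p volume := by
  have hp0 : p ≠ 0 := (zero_lt_one.trans_le hp).ne'
  have hr : 0 < p.toReal := ENNReal.toReal_pos hp0 hpt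
  rw [← ENNReal.rpow_le_rpow_iff hr, eLpNorm_toReal_rpow _ hp0 hpt, lintegral_prod _
    ((R.aestronglyMeasurable_op k hf).enorm.pow_const _)]
  calc ∫⁻ η, ∫⁻ x, ‖R.op k f (η, x)‖ₑ ^ p.toReal ∂volume ∂(sphMeasure n)
      ≤ ∫⁻ _, (M * eLpNorm f p volume) ^ p.toReal ∂(sphMeasure n) := by
        refine lintegral_mono fun η => ?_
        have : ∫⁻ x, ‖R.op k f (η, x)‖ₑ ^ p.toReal =
          eLpNorm (cnv (R.ker k η) f) p volume ^ p.toReal := (eLpNorm_toReal_rpow _ hp0 hpt).symm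
        rw [this]
        gcongr
        refine (eLpNorm_cnv_le (R.ker k η).continuous.aestronglyMeasurable hf hp).trans ?_
        gcongr
        exact R.eLpNorm_ker_le k η
    _ = _ := by
        rw [lintegral_const, mul_assoc, ENNReal.mul_rpow_of_nonneg (_ ^ _) _ hr.le, ← ENNReal.rpow_mul,
          one_div, inv_mul_cancel₀ hr.ne', ENNReal.rpow_one, mul_comm]

/-- Plancherel in x for fixed η, after which the integral over η is taken first: it sees the square
of the symbol at a fixed ξ, bounded by M. Hence M^{1/2}, whereas bounding each η separately would
give M. -/
theorem ReproFamily.eLpNorm_op_two_schwartz (R : ReproFamily hχ N M) (k : ℤ) (f : 𝓢(E n, ℂ)) :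
    eLpNorm (R.op k f) 2 ((sphMeasure n).prod volume) ≤
      (M : ℝ≥0∞) ^ (1 / 2 : ℝ) * eLpNorm f 2 volume := by
  rw [← ENNReal.pow_le_pow_left_iff two_ne_zero, mul_pow, eLpNorm_two_sq, eLpNorm_two_sq,
    ← ENNReal.rpow_natCast, ← ENNReal.rpow_mul, lintegral_prod _
    ((R.aestronglyMeasurable_op k f.continuous.aestronglyMeasurable).enorm.pow_const _)]
  norm_num only [Nat.cast_ofNat]
  rw [ENNReal.rpow_one]
  have hsym : ∀ (η : Sph n) ξ, (∑ j, R.coef j η • polySym hχ (R.poly j) k : 𝓢(E n, ℂ)) ξ =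
      ∑ j, R.coef j η * polySym hχ (R.poly j) k ξ := fun η ξ => by simp [sum_apply]
  have h1 : ∀ η, ∫⁻ x, ‖R.op k f (η, x)‖ₑ ^ 2 =
      ∫⁻ ξ, ‖∑ j, R.coef j η * polySym hχ (R.poly j) k ξ‖ₑ ^ 2 * ‖𝓕 f ξ‖ₑ ^ 2 := by
    intro η
    have e : R.ker k η = 𝓕⁻ (∑ j, R.coef j η • polySym hχ (R.poly j) k) :=
      (fourierInv_finset_sum_smul _ _ _).symm
    simp only [ReproFamily.op, e]
    rw [lintegral_enorm_sq_cnv]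
    simp only [hsym]
  simp only [h1]
  rw [lintegral_lintegral_swap]
  · calc _ ≤ ∫⁻ ξ, M * ‖𝓕 f ξ‖ₑ ^ 2 := by
          refine lintegral_mono fun ξ => ?_
          dsimp only
          rw [lintegral_mul_const']
          · gcongr
            exact R.lintegral_sq_le k ξ
          · exact ENNReal.pow_ne_top enorm_ne_top
      _ = M * ∫⁻ ξ, ‖𝓕 f ξ‖ₑ ^ 2 :=
          lintegral_const_mul _ ((𝓕 f).continuous.measurable.enorm.pow_const _)
      _ = _ := by
          rw [← lintegral_enorm_sq_fourierInv, FourierTransform.fourierInv_fourier_eq]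
  · have h2 : Continuous fun w : Sph n × E n =>
        ∑ j, R.coef j w.1 * polySym hχ (R.poly j) k w.2 :=
      continuous_finsetSum _ fun j _ => ((R.continuous_coef j).comp continuous_fst).mul
        ((polySym hχ (R.poly j) k).continuous.comp continuous_snd)
    have h3 : Continuous fun w : Sph n × E n => 𝓕 f w.2 := (𝓕 f).continuous.comp continuous_snd
    exact ((h2.measurable.enorm.pow_const _).mul (h3.measurable.enorm.pow_const _)).aemeasurable

theorem exists_schwartz_eLpNorm_sub_le {f : E n → ℂ} {p : ℝ≥0∞} (hp : 1 ≤ p) (hpt : p ≠ ⊤)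
    (hf : MemLp f p volume) {ε : ℝ≥0∞} (hε : ε ≠ 0) :
    ∃ g : 𝓢(E n, ℂ), eLpNorm (f - (g : E n → ℂ)) p volume ≤ ε := by
  rcases eq_or_ne ε ⊤ with rfl | hεt
  · exact ⟨0, le_top⟩
  obtain ⟨g, h1, h2, h3⟩ := hf.exist_eLpNorm_sub_le hpt hp (ENNReal.toReal_pos hε hεt)
  refine ⟨h1.toSchwartzMap h2, ?_⟩
  rwa [ENNReal.ofReal_toReal hεt] at h3

theorem ReproFamily.eLpNorm_op_two_le (R : ReproFamily hχ N M) (k : ℤ) {f : E n → ℂ}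
    (hf : MemLp f 2 volume) :
    eLpNorm (R.op k f) 2 ((sphMeasure n).prod volume) ≤
      (M : ℝ≥0∞) ^ (1 / 2 : ℝ) * eLpNorm f 2 volume := by
  have e : (M : ℝ≥0∞) ^ (1 / 2 : ℝ) = ((M ^ (1 / 2 : ℝ) : ℝ≥0) : ℝ≥0∞) :=
    (ENNReal.coe_rpow_of_nonneg _ (by norm_num)).symm
  rw [e]
  set K' : ℝ≥0∞ := (sphMeasure n Set.univ) ^ (1 / (2 : ℝ≥0∞).toReal) * M
  have hK' : K' ≠ ⊤ := ENNReal.mul_ne_top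
    (ENNReal.rpow_ne_top_of_nonneg (by positivity) (measure_ne_top _ _)) ENNReal.coe_ne_top
  refine eLpNorm_le_of_approx one_le_two _ K'.toNNReal hf.1 (R.aestronglyMeasurable_op k hf.1)
    fun ε hε => ?_
  obtain ⟨g, hg⟩ := exists_schwartz_eLpNorm_sub_le one_le_two (by norm_num) hf hε
  refine ⟨g, R.op k g, g.continuous.aestronglyMeasurable,
    R.aestronglyMeasurable_op k g.continuous.aestronglyMeasurable, hg, ?_, ?_⟩
  · rw [R.op_sub k one_le_two hf (g.memLp 2 volume), ENNReal.coe_toNNReal hK']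
    exact R.eLpNorm_op_le_crude k (hf.sub (g.memLp 2 volume)).1 one_le_two (by norm_num)
  · rw [← e]; exact R.eLpNorm_op_two_schwartz k g

/-- The endpoints M^{1/2} on L² and M on L^∞ interpolate to M^{1-1/p}. Duality turns the pairing
estimate into a norm estimate for simple functions, which are dense because p is finite. -/
theorem ReproFamily.eLpNorm_op_le (R : ReproFamily hχ N M) (k : ℤ) {f : E n → ℂ} {p p' : ℝ≥0∞}
    [hpp : p.HolderConjugate p'] (hp : 2 ≤ p) (hpt : p ≠ ⊤) (hf : MemLp f p volume) :
    eLpNorm (R.op k f) p ((sphMeasure n).prod volume) ≤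
      (M : ℝ≥0∞) ^ (1 / p'.toReal) * eLpNorm f p volume := by
  have hp1 : 1 ≤ p := one_le_two.trans hp
  have hp0 : p ≠ 0 := (zero_lt_one.trans_le hp1).ne'
  have hr2 : 2 ≤ p.toReal := by
    have := ENNReal.toReal_mono hpt hp; simpa using this
  have hpq : p.toReal.HolderConjugate p'.toReal :=
    ENNReal.HolderConjugate.toReal_of_ne_top hpt (holderConjugate_ne_top hp)
  have hs : 0 ≤ 1 / p'.toReal := by positivity
  have e : (M : ℝ≥0∞) ^ (1 / p'.toReal) = ((M ^ (1 / p'.toReal) : ℝ≥0) : ℝ≥0∞) :=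
    (ENNReal.coe_rpow_of_nonneg _ hs).symm
  rw [e]
  set K' : ℝ≥0∞ := (sphMeasure n Set.univ) ^ (1 / p.toReal) * M
  have hK' : K' ≠ ⊤ := ENNReal.mul_ne_top
    (ENNReal.rpow_ne_top_of_nonneg (by positivity) (measure_ne_top _ _)) ENNReal.coe_ne_top
  refine eLpNorm_le_of_approx hp1 _ K'.toNNReal hf.1 (R.aestronglyMeasurable_op k hf.1)
    fun ε hε => ?_
  obtain ⟨g, hg, hgm⟩ := hf.exists_simpleFunc_eLpNorm_sub_lt hpt hε
  have hfin : g.FinMeasSupp volume := (SimpleFunc.memLp_iff_finMeasSupp hp0 hpt).mp hgm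
  refine ⟨g, R.op k g, hgm.1, R.aestronglyMeasurable_op k hgm.1, hg.le, ?_, ?_⟩
  · rw [R.op_sub k hp1 hf hgm, ENNReal.coe_toNNReal hK']
    exact R.eLpNorm_op_le_crude k (hf.sub hgm).1 hp1 hpt
  · have h2 : ∀ g : SimpleFunc (E n) ℂ, g.FinMeasSupp volume → MemLp g 2 volume := fun g hg =>
      (SimpleFunc.memLp_iff_finMeasSupp two_ne_zero (by norm_num)).mpr hg
    rw [← e, eLpNorm_eq_lintegral_rpow_enorm_toReal hp0 hpt,
      eLpNorm_eq_lintegral_rpow_enorm_toReal hp0 hpt]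
    refine lintegral_rpow_le_of_pairing (q := p'.toReal)
      ⟨R.aestronglyMeasurable_op k hgm.1, (R.eLpNorm_op_two_le k (h2 g hfin)).trans_lt
        (ENNReal.mul_lt_top (ENNReal.rpow_lt_top_of_nonneg (by norm_num) ENNReal.coe_ne_top)
          (h2 g hfin).2)⟩ ?_ hpq fun G hG => ?_
    · refine ENNReal.mul_ne_top (ENNReal.rpow_ne_top_of_nonneg hs ENNReal.coe_ne_top) ?_
      rw [← eLpNorm_eq_lintegral_rpow_enorm_toReal hp0 hpt]
      exact hgm.2.ne
    · exact interpolation_pairing (R.levelLinear_op k)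
        (fun f hf => R.aestronglyMeasurable_op k f.aestronglyMeasurable)
        (fun f hf => R.eLpNorm_op_two_le k (h2 f hf)) (fun f _ => R.eLpNorm_op_top_le k f)
        hpq hr2 hfin hG

end

end RoughPDO
end

noncomputable section
namespace RoughPDO

/-! ### Polynomial symbols whose coefficients depend on x -/

section
variable {n : ℕ} {χ : E n → ℝ} {hχ : IsCutoff χ} {N : ℕ} {M : ℝ≥0}

theorem ReproFamily.cnv_polyKer (R : ReproFamily hχ N M) {s : MvPolynomial (Fin n) ℂ}
    (hs : s.totalDegree ≤ N) (k : ℤ) {f : E n → ℂ} {p : ℝ≥0∞} (hp : 1 ≤ p)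
    (hf : MemLp f p volume) (x : E n) : cnv (polyKer hχ s k) f x =
      ∫ η : Sph n, pev (η : E n) s * R.op k f (η, x) ∂(sphMeasure n) := by
  have h1 : ∀ η, R.op k f (η, x) = ∑ j, R.coef j η * cnv (polyKer hχ (R.poly j) k) f x :=
    fun η => cnv_sum_left _ _ _ hp hf x
  rw [R.polyKer_eq hs, cnv_sum_left _ _ _ hp hf]
  simp only [h1, Finset.mul_sum, ← integral_mul_const]
  rw [integral_finsetSum]
  · simp only [mul_assoc]
  · intro j _
    exact integrable_sph_of_continuous
      ((continuous_pev_sph s).mul ((R.continuous_coef j).mul continuous_const))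

/-- For fixed x the value is a pairing over the sphere of s(x,·) with R.op k f (·,x), and Hölder
separates them. The second factor no longer involves s, so no regularity in x is needed. For p = ∞
the L¹ bound on the kernel at x is used instead. -/
theorem ReproFamily.eLpNorm_polyOp_le (R : ReproFamily hχ N M) {s : E n → MvPolynomial (Fin n) ℂ}
    (hs : ∀ x, (s x).totalDegree ≤ N) (k : ℤ) {f : E n → ℂ} {p p' : ℝ≥0∞}
    [hpp : p.HolderConjugate p'] (hp : 2 ≤ p) (hf : MemLp f p volume) :
    eLpNorm (fun x => cnv (polyKer hχ (s x) k) f x) p volume ≤ (M : ℝ≥0∞) ^ (1 / p'.toReal) *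
      (⨆ x, eLpNorm (fun θ : Sph n => pev (θ : E n) (s x)) p' (sphMeasure n)) *
      eLpNorm f p volume := by
  have hp1 : 1 ≤ p := one_le_two.trans hp
  have hp0 : p ≠ 0 := (zero_lt_one.trans_le hp1).ne'
  set S := ⨆ x, eLpNorm (fun θ : Sph n => pev (θ : E n) (s x)) p' (sphMeasure n) with hS
  have hSx : ∀ x, eLpNorm (fun θ : Sph n => pev (θ : E n) (s x)) p' (sphMeasure n) ≤ S :=
    fun x => le_iSup (fun x => eLpNorm (fun θ : Sph n => pev (θ : E n) (s x)) p' (sphMeasure n)) x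
  rcases eq_or_ne p ⊤ with rfl | hpt
  · have hp' : p' = 1 := by
      have := ENNReal.HolderConjugate.inv_add_inv_eq_one ⊤ p'
      simpa using this
    subst hp'
    rw [eLpNorm_exponent_top (f := fun x => cnv (polyKer hχ (s x) k) f x)]
    refine essSup_le_of_ae_le _ (Filter.Eventually.of_forall fun x => ?_)
    refine (enorm_cnv_le_top (polyKer hχ (s x) k).continuous.aestronglyMeasurable x).trans ?_
    refine mul_le_mul_left ((R.eLpNorm_polyKer_le (hs x) k).trans ?_) _
    rw [ENNReal.toReal_one, div_one, ENNReal.rpow_one]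
    exact mul_le_mul_right (hSx x) _
  · have hr : 0 < p.toReal := ENNReal.toReal_pos hp0 hpt
    have hm := R.aestronglyMeasurable_op k hf.1
    have h1 : ∀ᵐ x : E n, ‖cnv (polyKer hχ (s x) k) f x‖ₑ ≤
        S * eLpNorm (fun η => R.op k f (η, x)) p (sphMeasure n) := by
      have : ∀ᵐ x : E n, AEStronglyMeasurable (fun η => R.op k f (η, x)) (sphMeasure n) :=
        hm.prod_swap.prodMk_left
      filter_upwards [this] with x hx
      rw [R.cnv_polyKer (hs x) k hp1 hf]
      haveI : p'.HolderConjugate p := ENNReal.HolderConjugate.symm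
      exact (enorm_integral_mul_le (continuous_pev_sph (s x)).aestronglyMeasurable hx p' p).trans
        (mul_le_mul_left (hSx x) _)
    have h2 : eLpNorm (fun x => cnv (polyKer hχ (s x) k) f x) p volume ≤
        S * eLpNorm (R.op k f) p ((sphMeasure n).prod volume) := by
      rw [← ENNReal.rpow_le_rpow_iff hr, ENNReal.mul_rpow_of_nonneg _ _ hr.le,
        eLpNorm_toReal_rpow _ hp0 hpt, eLpNorm_toReal_rpow _ hp0 hpt,
        lintegral_prod_symm _ (hm.enorm.pow_const _)]
      have hmm : AEMeasurable (fun x : E n => ∫⁻ η, ‖R.op k f (η, x)‖ₑ ^ p.toReal ∂(sphMeasure n)) :=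
        (hm.prod_swap.enorm.pow_const p.toReal).lintegral_prod_right'
      rw [← lintegral_const_mul'' _ hmm]
      refine lintegral_mono_ae ?_
      filter_upwards [h1] with x hx
      refine (ENNReal.rpow_le_rpow hx hr.le).trans (le_of_eq ?_)
      rw [ENNReal.mul_rpow_of_nonneg _ _ hr.le, eLpNorm_toReal_rpow _ hp0 hpt]
    calc _ ≤ S * ((M : ℝ≥0∞) ^ (1 / p'.toReal) * eLpNorm f p volume) :=
          h2.trans (mul_le_mul_right (R.eLpNorm_op_le k hp hpt hf) _)
      _ = _ := by ring

end

/-! ### Size of the kernels -/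

/-- In polar coordinates the symbol is s(θ) times a factor bounded by c and supported in r ≤ 2·2^k.
-/
theorem exists_lintegral_sq_polySym_le {n : ℕ} (hn : 0 < n) {χ : E n → ℝ} (hχ : IsCutoff χ)
    (k : ℤ) : ∃ G : ℝ≥0, ∀ s : MvPolynomial (Fin n) ℂ, ∫⁻ ξ, ‖polySym hχ s k ξ‖ₑ ^ 2 ≤
      G * ∫⁻ θ : Sph n, ‖pev (θ : E n) s‖ₑ ^ 2 ∂(sphMeasure n) := by
  obtain ⟨c, hc0, hc⟩ := exists_bound_bump hχ
  set ρ : ℝ := 2 * 2 ^ k with hρ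
  set g : Set.Ioi (0 : ℝ) → ℝ≥0∞ := fun r => if (r : ℝ) ≤ ρ then ENNReal.ofReal (c ^ 2) else 0
    with hg
  have hgm : Measurable g :=
    Measurable.ite (measurableSet_le measurable_subtype_coe measurable_const) measurable_const
      measurable_const
  -- The radial integral is read off from the finite volume of a ball, since the sphere has positive
  -- area.
  have hfin : ∫⁻ r, g r ∂(radMeasure n) ≠ ⊤ := by
    have h1 := lintegral_polar hn (fun ξ : E n =>
      (closedBall (0 : E n) ρ).indicator (fun _ => ENNReal.ofReal (c ^ 2)) ξ)
    have h2 : ∀ z : Sph n × Set.Ioi (0 : ℝ), (closedBall (0 : E n) ρ).indicator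
        (fun _ => ENNReal.ofReal (c ^ 2)) ((z.2 : ℝ) • (z.1 : E n)) = g z.2 := by
      intro z
      simp only [Set.indicator, mem_closedBall_zero_iff, norm_smul_sph z.1 z.2.2, hg]
    simp only [h2] at h1
    rw [lintegral_indicator measurableSet_closedBall, lintegral_const,
      lintegral_prod (fun z : Sph n × Set.Ioi (0 : ℝ) => g z.2)
        (hgm.comp measurable_snd).aemeasurable] at h1
    dsimp only at h1
    rw [lintegral_const] at h1
    intro h
    rw [h, ENNReal.top_mul] at h1
    · refine ENNReal.mul_ne_top ENNReal.ofReal_ne_top ?_ h1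
      rw [Measure.restrict_apply_univ]
      exact measure_closedBall_lt_top.ne
    · intro h0
      have := sphMeasure_real_univ_pos hn
      rw [Measure.real, h0] at this
      simp at this
  refine ⟨(∫⁻ r, g r ∂(radMeasure n)).toNNReal, fun s => ?_⟩
  rw [ENNReal.coe_toNNReal hfin, lintegral_polar hn]
  have hsm : Measurable fun θ : Sph n => ‖pev (θ : E n) s‖ₑ ^ 2 :=
    (continuous_pev_sph s).measurable.enorm.pow_const _
  calc _ ≤ ∫⁻ z : Sph n × Set.Ioi (0 : ℝ), ‖pev (z.1 : E n) s‖ₑ ^ 2 * g z.2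
        ∂((sphMeasure n).prod (radMeasure n)) := by
        refine lintegral_mono fun z => ?_
        rw [polySym_apply, hom_smul_sph _ z.1 z.2.2, enorm_mul, mul_pow]
        refine mul_le_mul_right ?_ _
        simp only [hg]
        split_ifs with h
        · rw [← ofReal_norm, ← ENNReal.ofReal_pow (norm_nonneg _), Complex.norm_real]
          exact ENNReal.ofReal_le_ofReal (pow_le_pow_left₀ (norm_nonneg _) (hc _) 2)
        · rw [bumpK_eq_zero hχ k (by rw [norm_smul_sph z.1 z.2.2]; exact not_le.mp h)]
          simp
    _ = _ := by
        rw [lintegral_prod_mul hsm.aemeasurable hgm.aemeasurable, mul_comm]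

/-- For a ≤ Λ the first term dominates, for a ≥ Λ the second. With Λ the size of the symbol this
bounds L^r by L¹ and L² with the right homogeneity. -/
theorem enorm_rpow_le_add {Λ a : ℝ≥0∞} (h0 : Λ ≠ 0) (ha : a ≠ ⊤) {r : ℝ} (hr1 : 1 ≤ r)
    (hr2 : r ≤ 2) : a ^ r ≤ Λ ^ (r - 1) * a + Λ ^ (r - 2) * a ^ 2 := by
  rcases le_total a Λ with h | h
  · refine le_add_right ?_
    have : a ^ r = a ^ (r - 1) * a := by
      nth_rw 3 [← ENNReal.rpow_one a]
      rw [← ENNReal.rpow_add_of_nonneg _ _ (by linarith) zero_le_one, sub_add_cancel]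
    rw [this]
    exact mul_le_mul_left (ENNReal.rpow_le_rpow h (by linarith)) _
  · refine le_add_left ?_
    have ha0 : a ≠ 0 := (lt_of_lt_of_le (pos_iff_ne_zero.mpr h0) h).ne'
    have : a ^ r = a ^ (r - 2) * a ^ 2 := by
      rw [← ENNReal.rpow_natCast, ← ENNReal.rpow_add _ _ ha0 ha]
      norm_num
    rw [this]
    refine mul_le_mul_left ?_ _
    rw [show r - 2 = -(2 - r) by ring, ENNReal.rpow_neg, ENNReal.rpow_neg, ENNReal.inv_le_inv]
    exact ENNReal.rpow_le_rpow h (by linarith)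

theorem one_le_toReal_of_le_two {r : ℝ≥0∞} (hr1 : 1 ≤ r) (hr2 : r ≤ 2) :
    1 ≤ r.toReal ∧ r.toReal ≤ 2 := by
  have hrt : r ≠ ⊤ := ne_top_of_le_ne_top (by norm_num) hr2
  constructor
  · have := ENNReal.toReal_mono hrt hr1; simpa using this
  · have := ENNReal.toReal_mono (by norm_num) hr2; simpa using this

theorem exists_enorm_pev_le {n : ℕ} (hn : 0 < n) : ∃ C : ℝ≥0, 1 ≤ C ∧ ∀ N : ℕ, 1 ≤ N →
    ∀ r : ℝ≥0∞, 1 ≤ r → r ≤ 2 → ∀ s : MvPolynomial (Fin n) ℂ, s.totalDegree ≤ N →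
      ∀ θ : Sph n, ‖pev (θ : E n) s‖ₑ ≤
        ((C * (N : ℝ≥0) ^ (n - 1) : ℝ≥0) : ℝ≥0∞) ^ (1 / r.toReal) *
          eLpNorm (fun θ : Sph n => pev (θ : E n) s) r (sphMeasure n) := by
  obtain ⟨C, hC1, hC⟩ := exists_nikolskii hn
  refine ⟨C.toNNReal, by rwa [Real.one_le_toNNReal], fun N hN r hr1 hr2 s hs θ => ?_⟩
  have hrt : r ≠ ⊤ := ne_top_of_le_ne_top (by norm_num) hr2
  have hr0 : r ≠ 0 := (zero_lt_one.trans_le hr1).ne'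
  obtain ⟨hρ1, hρ2⟩ := one_le_toReal_of_le_two hr1 hr2
  rw [← ENNReal.rpow_le_rpow_iff (show 0 < r.toReal by linarith),
    ENNReal.mul_rpow_of_nonneg _ _ (by linarith), ← ENNReal.rpow_mul,
    one_div_mul_cancel (by linarith), ENNReal.rpow_one, eLpNorm_toReal_rpow _ hr0 hrt]
  have h1 := hC N hN r.toReal hρ1 hρ2 s hs θ
  have h2 : ∀ θ : Sph n, ‖pev (θ : E n) s‖ₑ ^ r.toReal =
      ENNReal.ofReal (‖pev (θ : E n) s‖ ^ r.toReal) := fun θ => by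
    rw [← ofReal_norm, ENNReal.ofReal_rpow_of_nonneg (norm_nonneg _) (by linarith)]
  simp only [h2]
  rw [← ofReal_integral_eq_lintegral_ofReal]
  · have hXe : ((C.toNNReal * (N : ℝ≥0) ^ (n - 1) : ℝ≥0) : ℝ≥0∞) =
        ENNReal.ofReal (C * (N : ℝ) ^ (n - 1)) := by
      rw [ENNReal.ofReal_mul (by linarith), ENNReal.coe_mul]
      congr 1
      rw [ENNReal.ofReal_pow (by positivity)]; simp
    rw [hXe, ← ENNReal.ofReal_mul (by positivity)]
    exact ENNReal.ofReal_le_ofReal h1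
  · exact integrable_sph_of_continuous
      ((continuous_pev_sph s).norm.rpow_const fun _ => Or.inr (by linarith))
  · exact Filter.Eventually.of_forall fun _ => by positivity

/-- |s|² = |s|^{2-ρ} |s|^ρ, and Nikolskii bounds the first factor with the power (2-ρ)/ρ of X, which
is at most 1 because ρ ≥ 1 and X ≥ 1. -/
theorem exists_lintegral_sq_pev_le {n : ℕ} (hn : 0 < n) : ∃ C : ℝ≥0, 1 ≤ C ∧ ∀ N : ℕ, 1 ≤ N →
    ∀ r : ℝ≥0∞, 1 ≤ r → r ≤ 2 → ∀ s : MvPolynomial (Fin n) ℂ, s.totalDegree ≤ N →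
      ∫⁻ θ : Sph n, ‖pev (θ : E n) s‖ₑ ^ 2 ∂(sphMeasure n) ≤ (C * (N : ℝ≥0) ^ (n - 1) : ℝ≥0) *
        eLpNorm (fun θ : Sph n => pev (θ : E n) s) r (sphMeasure n) ^ 2 := by
  obtain ⟨C, hC1, hC⟩ := exists_enorm_pev_le hn
  refine ⟨C, hC1, fun N hN r hr1 hr2 s hs => ?_⟩
  have hrt : r ≠ ⊤ := ne_top_of_le_ne_top (by norm_num) hr2
  have hr0 : r ≠ 0 := (zero_lt_one.trans_le hr1).ne'
  obtain ⟨hρ1, hρ2⟩ := one_le_toReal_of_le_two hr1 hr2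
  have hsup := hC N hN r hr1 hr2 s hs
  set ρ := r.toReal with hρ
  set Λ := eLpNorm (fun θ : Sph n => pev (θ : E n) s) r (sphMeasure n) with hΛ
  set X : ℝ≥0 := C * (N : ℝ≥0) ^ (n - 1) with hX
  have hX1 : 1 ≤ X := one_le_mul hC1 (one_le_pow₀ (by exact_mod_cast hN))
  have hΛr : Λ ^ ρ = ∫⁻ θ : Sph n, ‖pev (θ : E n) s‖ₑ ^ ρ ∂(sphMeasure n) :=
    eLpNorm_toReal_rpow _ hr0 hrt
  have hsup' : ∀ θ : Sph n, ‖pev (θ : E n) s‖ₑ ^ (2 - ρ) ≤ X * Λ ^ (2 - ρ) := by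
    intro θ
    refine (ENNReal.rpow_le_rpow (hsup θ) (by linarith)).trans ?_
    rw [ENNReal.mul_rpow_of_nonneg _ _ (by linarith), ← ENNReal.rpow_mul]
    refine mul_le_mul_left ?_ _
    refine (ENNReal.rpow_le_rpow_of_exponent_le (by exact_mod_cast hX1) ?_).trans_eq
      (ENNReal.rpow_one _)
    rw [one_div, inv_mul_le_iff₀ (by linarith)]; linarith
  calc _ ≤ ∫⁻ θ : Sph n, X * Λ ^ (2 - ρ) * ‖pev (θ : E n) s‖ₑ ^ ρ ∂(sphMeasure n) := by
        refine lintegral_mono fun θ => ?_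
        have : ‖pev (θ : E n) s‖ₑ ^ 2 =
            ‖pev (θ : E n) s‖ₑ ^ (2 - ρ) * ‖pev (θ : E n) s‖ₑ ^ ρ := by
          rw [← ENNReal.rpow_add_of_nonneg _ _ (by linarith) (by linarith), sub_add_cancel,
            ← ENNReal.rpow_natCast]; norm_num
        rw [this]
        exact mul_le_mul_left (hsup' θ) _
    _ = X * (Λ ^ (2 - ρ) * Λ ^ ρ) := by
        rw [lintegral_const_mul _ ((continuous_pev_sph s).measurable.enorm.pow_const _), ← hΛr,
          mul_assoc]
    _ = X * Λ ^ 2 := by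
        rw [← ENNReal.rpow_add_of_nonneg _ _ (by linarith) (by linarith), sub_add_cancel,
            ← ENNReal.rpow_natCast]; norm_num

/-- Interpolates between the L¹ bound of the reproducing family and the L² bound of Plancherel. It
makes the kernel series converge against L^p functions, for which a constant depending on k is
enough. -/
theorem exists_eLpNorm_polyKer_le {n : ℕ} (hn : 0 < n) {χ : E n → ℝ} (hχ : IsCutoff χ) (k : ℤ) :
    ∃ C : ℝ≥0, ∀ N : ℕ, 1 ≤ N → ∀ r : ℝ≥0∞, 1 ≤ r → r ≤ 2 →
      ∀ s : MvPolynomial (Fin n) ℂ, s.totalDegree ≤ N →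
        eLpNorm (polyKer hχ s k) r volume ≤ C * ((N : ℝ≥0∞) ^ (n - 1)) ^ (1 / r.toReal) *
          eLpNorm (fun θ : Sph n => pev (θ : E n) s) r (sphMeasure n) := by
  obtain ⟨C₁, hC₁, h1⟩ := exists_reproFamily hn hχ
  obtain ⟨G, hG⟩ := exists_lintegral_sq_polySym_le hn hχ k
  obtain ⟨C₂, hC₂, h2⟩ := exists_lintegral_sq_pev_le hn
  set σ : ℝ≥0 := (sphMeasure n Set.univ).toNNReal with hσ
  have hσe : sphMeasure n Set.univ = σ := (ENNReal.coe_toNNReal (measure_ne_top _ _)).symm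
  -- The summand 1 ensures D ≥ 1, hence D^{1/ρ} ≤ D with a constant independent of r.
  set D : ℝ≥0 := 1 + (C₁ * (1 + σ) + G * C₂) with hD
  refine ⟨D, fun N hN r hr1 hr2 s hs => ?_⟩
  obtain ⟨R⟩ := h1 N hN
  have hrt : r ≠ ⊤ := ne_top_of_le_ne_top (by norm_num) hr2
  have hr0 : r ≠ 0 := (zero_lt_one.trans_le hr1).ne'
  obtain ⟨hρ1, hρ2⟩ := one_le_toReal_of_le_two hr1 hr2
  have hsq := h2 N hN r hr1 hr2 s hs
  set ρ := r.toReal with hρ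
  have hcs := continuous_pev_sph s
  have hsm : MemLp (fun θ : Sph n => pev (θ : E n) s) r (sphMeasure n) :=
    hcs.memLp_of_hasCompactSupport (HasCompactSupport.of_compactSpace _)
  set Λ := eLpNorm (fun θ : Sph n => pev (θ : E n) s) r (sphMeasure n) with hΛ
  have hΛt : Λ ≠ ⊤ := hsm.2.ne
  set X : ℝ≥0 := (N : ℝ≥0) ^ (n - 1) with hX
  have hXe : (N : ℝ≥0∞) ^ (n - 1) = X := by simp [hX]
  have hL1 : eLpNorm (polyKer hχ s k) 1 volume ≤ (C₁ * X * (1 + σ) : ℝ≥0) * Λ := by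
    refine (R.eLpNorm_polyKer_le hs k).trans ?_
    rw [ENNReal.coe_mul (C₁ * X), mul_assoc]
    refine mul_le_mul_right ?_ _
    refine (eLpNorm_le_eLpNorm_mul_rpow_measure_univ hr1 hcs.aestronglyMeasurable).trans ?_
    rw [mul_comm, hσe]
    refine mul_le_mul_left ?_ _
    rw [ENNReal.toReal_one, div_one, ← hρ]
    have e1 : (0 : ℝ) ≤ 1 - 1 / ρ := by
      rw [sub_nonneg, div_le_one (by linarith)]; exact hρ1
    calc (σ : ℝ≥0∞) ^ (1 - 1 / ρ) ≤ ((1 + σ : ℝ≥0) : ℝ≥0∞) ^ (1 - 1 / ρ) := by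
          gcongr; exact le_add_self
      _ ≤ ((1 + σ : ℝ≥0) : ℝ≥0∞) ^ (1 : ℝ) := by
          refine ENNReal.rpow_le_rpow_of_exponent_le (by exact_mod_cast le_self_add) ?_
          have : 0 < 1 / ρ := by positivity
          linarith
      _ = _ := ENNReal.rpow_one _
  -- Negative powers of Λ occur below. If Λ = 0, the L¹ bound already makes the kernel vanish.
  rcases eq_or_ne Λ 0 with h0 | h0
  · rw [h0, mul_zero] at hL1 ⊢
    rw [le_zero_iff, eLpNorm_eq_zero_iff (polyKer hχ s k).continuous.aestronglyMeasurable
      one_ne_zero] at hL1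
    rw [le_zero_iff, eLpNorm_eq_zero_iff (polyKer hχ s k).continuous.aestronglyMeasurable hr0]
    exact hL1
  have hL2 : ∫⁻ z, ‖polyKer hχ s k z‖ₑ ^ 2 ≤ (G * (C₂ * X) : ℝ≥0) * Λ ^ 2 := by
    rw [polyKer, lintegral_enorm_sq_fourierInv, ENNReal.coe_mul, mul_assoc]
    exact (hG s).trans (mul_le_mul_right hsq _)
  have hm := (polyKer hχ s k).continuous.measurable.enorm
  have key : ∫⁻ z, ‖polyKer hχ s k z‖ₑ ^ ρ ≤ (D * X : ℝ≥0) * Λ ^ ρ := by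
    calc _ ≤ ∫⁻ z, (Λ ^ (ρ - 1) * ‖polyKer hχ s k z‖ₑ + Λ ^ (ρ - 2) * ‖polyKer hχ s k z‖ₑ ^ 2) :=
          lintegral_mono fun z => enorm_rpow_le_add h0 enorm_ne_top hρ1 hρ2
      _ = Λ ^ (ρ - 1) * eLpNorm (polyKer hχ s k) 1 volume +
          Λ ^ (ρ - 2) * ∫⁻ z, ‖polyKer hχ s k z‖ₑ ^ 2 := by
          rw [lintegral_add_left (hm.const_mul _), lintegral_const_mul _ hm,
            lintegral_const_mul _ (hm.pow_const _), eLpNorm_one_eq_lintegral_enorm]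
      _ ≤ Λ ^ (ρ - 1) * ((C₁ * X * (1 + σ) : ℝ≥0) * Λ) +
          Λ ^ (ρ - 2) * ((G * (C₂ * X) : ℝ≥0) * Λ ^ 2) := by gcongr
      _ = (C₁ * X * (1 + σ) + G * (C₂ * X) : ℝ≥0) * Λ ^ ρ := by
          have e1 : Λ ^ (ρ - 1) * Λ = Λ ^ ρ := by
            nth_rw 2 [← ENNReal.rpow_one Λ]
            rw [← ENNReal.rpow_add _ _ h0 hΛt, sub_add_cancel]
          have e2 : Λ ^ (ρ - 2) * Λ ^ 2 = Λ ^ ρ := by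
            rw [← ENNReal.rpow_natCast, ← ENNReal.rpow_add _ _ h0 hΛt]; norm_num
          rw [ENNReal.coe_add, add_mul, ← e1, mul_left_comm, mul_left_comm (Λ ^ (ρ - 2)), e1, e2]
      _ ≤ _ := by
          gcongr
          rw [hD, add_mul, add_mul]
          refine le_add_left (le_of_eq ?_)
          ring
  rw [← ENNReal.rpow_le_rpow_iff (show 0 < ρ by linarith), eLpNorm_toReal_rpow _ hr0 hrt]
  refine key.trans ?_
  rw [ENNReal.mul_rpow_of_nonneg _ _ (by linarith), ENNReal.mul_rpow_of_nonneg _ _ (by linarith),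
    ← ENNReal.rpow_mul, one_div_mul_cancel (by linarith), ENNReal.rpow_one, hXe, ENNReal.coe_mul]
  refine mul_le_mul_left (mul_le_mul_left ?_ _) _
  conv_lhs => rw [← ENNReal.rpow_one (D : ℝ≥0∞)]
  exact ENNReal.rpow_le_rpow_of_exponent_le (by exact_mod_cast le_self_add) hρ1

end RoughPDO
end

noncomputable section
namespace RoughPDO

/-! ### The Littlewood-Paley decomposition on the sphere -/

theorem exists_solid (n j : ℕ) (k : Fin (Module.finrank ℂ (sphericalHarmonics n j))) :
    ∃ h ∈ solidHarmonics n j, polyLp h = (harmonicBasis n j k : Lp ℂ 2 (sphMeasure n)) := by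
  obtain ⟨h, hh, he⟩ := (harmonicBasis n j k).2
  exact ⟨h, hh, he⟩

/-- The solid harmonic whose restriction to the sphere is `Y_{j,k}`. -/
def solid (n j : ℕ) (k : Fin (Module.finrank ℂ (sphericalHarmonics n j))) :
    MvPolynomial (Fin n) ℂ := (exists_solid n j k).choose

theorem solid_mem {n j : ℕ} (k : Fin (Module.finrank ℂ (sphericalHarmonics n j))) :
    solid n j k ∈ solidHarmonics n j := (exists_solid n j k).choose_spec.1

theorem polyLp_solid {n j : ℕ} (k : Fin (Module.finrank ℂ (sphericalHarmonics n j))) :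
    polyLp (solid n j k) = (harmonicBasis n j k : Lp ℂ 2 (sphMeasure n)) :=
  (exists_solid n j k).choose_spec.2

theorem harmonic_ae_eq {n j : ℕ} (k : Fin (Module.finrank ℂ (sphericalHarmonics n j))) :
    harmonic n j k =ᵐ[sphMeasure n] fun θ => pev (θ : E n) (solid n j k) := by
  have := coeFn_polyLp (solid n j k)
  rwa [polyLp_solid] at this

theorem totalDegree_solid_le {n j : ℕ} (k : Fin (Module.finrank ℂ (sphericalHarmonics n j))) :
    (solid n j k).totalDegree ≤ j :=
  (isHomogeneous_of_mem_solidHarmonics (solid_mem k)).totalDegree_le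

theorem harmonicCoeff_eq {n : ℕ} (f : Sph n → ℂ) (j : ℕ)
    (k : Fin (Module.finrank ℂ (sphericalHarmonics n j))) : harmonicCoeff n f j k =
      ∫ θ : Sph n, f θ * (starRingEnd ℂ) (pev (θ : E n) (solid n j k)) ∂(sphMeasure n) := by
  refine integral_congr_ae ?_
  filter_upwards [harmonic_ae_eq k] with θ h
  rw [h]

theorem pev_eq_sum_solid {n j : ℕ} {p : MvPolynomial (Fin n) ℂ} (hp : p ∈ solidHarmonics n j)
    (θ : Sph n) : pev (θ : E n) p = ∑ k, (∫ η : Sph n, pev (η : E n) p *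
      (starRingEnd ℂ) (pev (η : E n) (solid n j k)) ∂(sphMeasure n)) *
        pev (θ : E n) (solid n j k) := by
  have h1 : polyLp p ∈ sphericalHarmonics n j := ⟨p, hp, rfl⟩
  have h2 := (harmonicBasis n j).sum_repr' ⟨polyLp p, h1⟩
  have h3 := congrArg (fun v : sphericalHarmonics n j => (v : Lp ℂ 2 (sphMeasure n))) h2
  simp only [Submodule.coe_sum, Submodule.coe_smul, Submodule.coe_inner, ← polyLp_solid,
    inner_polyLp] at h3
  have h4 : polyLp (∑ k, (∫ η : Sph n, pev (η : E n) p *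
      (starRingEnd ℂ) (pev (η : E n) (solid n j k)) ∂(sphMeasure n)) • solid n j k) = polyLp p := by
    rw [← h3]
    simp [polyLp]
  rw [← pev_eq_of_polyLp_eq h4 θ]
  simp

/-- The polynomial whose restriction to the sphere is `P_l f`. -/
def lpPoly (n : ℕ) (χ₀ : ℝ → ℝ) (l : ℕ) (f : Sph n → ℂ) : MvPolynomial (Fin n) ℂ :=
  ∑ j ∈ Finset.range (2 ^ (l + 1)), ∑ k,
    ((sphMult χ₀ l j : ℂ) * harmonicCoeff n f j k) • solid n j k

theorem totalDegree_lpPoly_le (n : ℕ) (χ₀ : ℝ → ℝ) (l : ℕ) (f : Sph n → ℂ) :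
    (lpPoly n χ₀ l f).totalDegree ≤ 2 ^ (l + 1) := by
  refine MvPolynomial.totalDegree_finsetSum_le fun j hj => ?_
  refine MvPolynomial.totalDegree_finsetSum_le fun k _ => ?_
  exact (MvPolynomial.totalDegree_smul_le _ _).trans
    ((totalDegree_solid_le k).trans (Finset.mem_range.mp hj).le)

theorem pev_lpPoly {n : ℕ} (χ₀ : ℝ → ℝ) (l : ℕ) (f : Sph n → ℂ) (x : E n) :
    pev x (lpPoly n χ₀ l f) = ∑ j ∈ Finset.range (2 ^ (l + 1)), ∑ k,
      (sphMult χ₀ l j : ℂ) * harmonicCoeff n f j k * pev x (solid n j k) := by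
  simp [lpPoly]

theorem sphLP_ae_eq {n : ℕ} (χ₀ : ℝ → ℝ) (l : ℕ) (f : Sph n → ℂ) :
    sphLP n χ₀ l f =ᵐ[sphMeasure n] fun θ => pev (θ : E n) (lpPoly n χ₀ l f) := by
  have h : ∀ᵐ θ ∂(sphMeasure n), ∀ (j : ℕ) (k : Fin (Module.finrank ℂ (sphericalHarmonics n j))),
      harmonic n j k θ = pev (θ : E n) (solid n j k) := by
    rw [ae_all_iff]; intro j
    rw [ae_all_iff]; intro k
    exact harmonic_ae_eq k
  filter_upwards [h] with θ hθ
  simp only [sphLP, pev_lpPoly, hθ]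

/-! The multipliers of the decomposition add up to one. -/

/-- The endpoint t = 2 is not covered by the support condition and follows by continuity. It
matters: the sum in `sphLP` stops before j = 2^{l+1}, where the multiplier is evaluated at exactly
2. -/
theorem IsCutoff.eq_zero_of_two_le {χ₀ : ℝ → ℝ} (hχ₀ : IsCutoff χ₀) {t : ℝ} (ht : 2 ≤ t) :
    χ₀ t = 0 := by
  rcases ht.lt_or_eq with h | rfl
  · exact hχ₀.supp t (by rw [Real.norm_of_nonneg (by linarith)]; exact h)
  · have h1 : Filter.Tendsto χ₀ (nhdsWithin 2 (Set.Ioi 2)) (nhds (χ₀ 2)) :=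
      hχ₀.smooth.continuous.continuousWithinAt
    have h2 : Filter.Tendsto χ₀ (nhdsWithin 2 (Set.Ioi 2)) (nhds 0) := by
      refine tendsto_const_nhds.congr' ?_
      filter_upwards [self_mem_nhdsWithin] with t ht
      rw [hχ₀.supp t]
      rw [Real.norm_of_nonneg (by linarith [Set.mem_Ioi.mp ht])]; exact ht
    exact tendsto_nhds_unique h1 h2

theorem sphMult_eq_zero_of_le {χ₀ : ℝ → ℝ} (hχ₀ : IsCutoff χ₀) {l j : ℕ} (h : 2 ^ (l + 1) ≤ j) :
    sphMult χ₀ l j = 0 := by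
  have hj : (2 : ℝ) ^ (l + 1) ≤ j := by exact_mod_cast h
  rw [sphMult]
  split_ifs with hl
  · subst hl; exact hχ₀.eq_zero_of_two_le (by simpa using hj)
  · have h2 : 2 ≤ (2 : ℝ) ^ (-(l : ℤ)) * j := by
      rw [zpow_neg, zpow_natCast, le_inv_mul_iff₀ (by positivity)]
      rw [pow_succ] at hj; exact hj
    rw [bump, hχ₀.eq_zero_of_two_le h2, hχ₀.eq_zero_of_two_le, sub_self]
    rw [smul_eq_mul]; linarith

theorem sum_sphMult (χ₀ : ℝ → ℝ) (L j : ℕ) :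
    ∑ l ∈ Finset.range (L + 1), sphMult χ₀ l j = χ₀ ((2 : ℝ) ^ (-(L : ℤ)) * j) := by
  induction L with
  | zero => simp [sphMult]
  | succ L ih =>
    rw [Finset.sum_range_succ, ih, sphMult, if_neg (by omega), bump]
    have : (2 : ℝ) • ((2 : ℝ) ^ (-((L + 1 : ℕ) : ℤ)) * (j : ℝ)) = (2 : ℝ) ^ (-(L : ℤ)) * j := by
      rw [smul_eq_mul, ← mul_assoc]
      congr 1
      push_cast
      rw [neg_add, zpow_add₀ two_ne_zero]; norm_num; ring
    rw [this]; ring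

/-- The partial sums telescope, and from l = j on the argument 2^{-l} j lies in [0, 1], where the
cutoff is 1. -/
theorem hasSum_sphMult {χ₀ : ℝ → ℝ} (hχ₀ : IsCutoff χ₀) (j : ℕ) :
    HasSum (fun l => sphMult χ₀ l j) 1 := by
  have hle : ∀ L, j ≤ L → (2 : ℝ) ^ (-(L : ℤ)) * j ≤ 1 := by
    intro L hL
    rw [zpow_neg, zpow_natCast, inv_mul_le_iff₀ (by positivity), mul_one]
    exact (Nat.cast_le.mpr hL).trans (by exact_mod_cast Nat.lt_two_pow_self.le)
  have hnn : ∀ L : ℕ, 0 ≤ (2 : ℝ) ^ (-(L : ℤ)) * j := fun L => by positivity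
  have h1 : ∑ l ∈ Finset.range (j + 1), sphMult χ₀ l j = 1 := by
    rw [sum_sphMult, hχ₀.one]
    rw [Real.norm_of_nonneg (hnn _)]; exact hle j le_rfl
  rw [← h1]
  refine hasSum_sum_of_ne_finset_zero fun l hl => ?_
  have hl' : j + 1 ≤ l := by simpa using hl
  rw [sphMult, if_neg (by omega)]
  refine hχ₀.bump_eq_zero_of_lt ?_
  rw [Real.norm_of_nonneg (hnn _)]
  obtain ⟨m, rfl⟩ : ∃ m, l = m + 1 := ⟨l - 1, by omega⟩
  have := hle m (by omega)
  push_cast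
  rw [neg_add, zpow_add₀ two_ne_zero, zpow_neg_one]
  linarith

/-- Degrees other than j are orthogonal to p, and in degree j the expansion of p in the basis turns
the coefficients back into an integral of q. If j is beyond the truncation, its multiplier is zero.
-/
theorem integral_lpPoly_mul_conj {n : ℕ} (hn : 0 < n) {χ₀ : ℝ → ℝ} (hχ₀ : IsCutoff χ₀) (l : ℕ)
    {q : Sph n → ℂ} (hq : Integrable q (sphMeasure n)) {j : ℕ} {p : MvPolynomial (Fin n) ℂ}
    (hp : p ∈ solidHarmonics n j) :
    ∫ θ : Sph n, pev (θ : E n) (lpPoly n χ₀ l q) * (starRingEnd ℂ) (pev (θ : E n) p)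
      ∂(sphMeasure n) = sphMult χ₀ l j *
        ∫ θ : Sph n, q θ * (starRingEnd ℂ) (pev (θ : E n) p) ∂(sphMeasure n) := by
  have hcont : ∀ (a b : MvPolynomial (Fin n) ℂ), Integrable (fun θ : Sph n =>
      pev (θ : E n) a * (starRingEnd ℂ) (pev (θ : E n) b)) (sphMeasure n) := fun a b =>
    integrable_sph_of_continuous
      ((continuous_pev_sph a).mul (Complex.continuous_conj.comp (continuous_pev_sph b)))
  have hqint : ∀ b : MvPolynomial (Fin n) ℂ, Integrable (fun θ : Sph n =>
      q θ * (starRingEnd ℂ) (pev (θ : E n) b)) (sphMeasure n) := fun b => by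
    have hc : Continuous (fun θ : Sph n => (starRingEnd ℂ) (pev (θ : E n) b)) :=
      Complex.continuous_conj.comp (continuous_pev_sph _)
    obtain ⟨C, hC⟩ := (HasCompactSupport.of_compactSpace _).exists_bound_of_continuous hc
    exact hq.mul_bdd (c := C) hc.aestronglyMeasurable (Filter.Eventually.of_forall hC)
  have h1 : ∫ θ : Sph n, q θ * (starRingEnd ℂ) (pev (θ : E n) p) ∂(sphMeasure n) =
      ∑ k, harmonicCoeff n q j k * ∫ θ : Sph n, pev (θ : E n) (solid n j k) *
        (starRingEnd ℂ) (pev (θ : E n) p) ∂(sphMeasure n) := by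
    have e : ∀ θ : Sph n, q θ * (starRingEnd ℂ) (pev (θ : E n) p) =
        ∑ k, (q θ * (starRingEnd ℂ) (pev (θ : E n) (solid n j k))) *
          ∫ η : Sph n, pev (η : E n) (solid n j k) *
            (starRingEnd ℂ) (pev (η : E n) p) ∂(sphMeasure n) := by
      intro θ
      conv_lhs => rw [pev_eq_sum_solid hp θ]
      rw [map_sum, Finset.mul_sum]
      refine Finset.sum_congr rfl fun k _ => ?_
      rw [map_mul, ← integral_conj]
      simp only [map_mul, Complex.conj_conj, mul_comm, mul_left_comm]
      ring
    simp only [e, harmonicCoeff_eq]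
    rw [integral_finsetSum _ fun k _ => (hqint _).mul_const _]
    simp only [integral_mul_const]
  rw [h1]
  simp only [pev_lpPoly, Finset.sum_mul, mul_assoc]
  rw [integral_finsetSum _ fun i _ => integrable_finsetSum _ fun k _ =>
    ((hcont _ _).const_mul _).const_mul _]
  have h2 : ∀ i, ∫ θ : Sph n, ∑ k, (sphMult χ₀ l i : ℂ) * (harmonicCoeff n q i k *
      (pev (θ : E n) (solid n i k) * (starRingEnd ℂ) (pev (θ : E n) p))) ∂(sphMeasure n) =
      ∑ k, (sphMult χ₀ l i : ℂ) * (harmonicCoeff n q i k *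
        ∫ θ : Sph n, pev (θ : E n) (solid n i k) * (starRingEnd ℂ) (pev (θ : E n) p)
          ∂(sphMeasure n)) := by
    intro i
    rw [integral_finsetSum _ fun k _ => ((hcont _ _).const_mul _).const_mul _]
    simp only [integral_const_mul]
  simp only [h2]
  rw [Finset.sum_eq_single j]
  · rw [Finset.mul_sum]
  · intro i _ hij
    refine Finset.sum_eq_zero fun k _ => ?_
    rw [integral_mul_conj_eq_zero_of_ne hn hij (solid_mem k) hp, mul_zero, mul_zero]
  · intro hj
    rw [sphMult_eq_zero_of_le hχ₀ (by simpa using hj)]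
    simp

/-- The uniformly convergent series has the same moments against all harmonics as q, since the
multipliers add up to 1, and harmonics are complete for integrable functions. -/
theorem ae_eq_tsum_lpPoly {n : ℕ} (hn : 0 < n) {χ₀ : ℝ → ℝ} (hχ₀ : IsCutoff χ₀)
    {q : Sph n → ℂ} (hq : Integrable q (sphMeasure n)) {A : ℕ → ℝ} (hA : Summable A)
    (h : ∀ l (θ : Sph n), ‖pev (θ : E n) (lpPoly n χ₀ l q)‖ ≤ A l) :
    q =ᵐ[sphMeasure n] fun θ => ∑' l, pev (θ : E n) (lpPoly n χ₀ l q) := by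
  set Q : Sph n → ℂ := fun θ => ∑' l, pev (θ : E n) (lpPoly n χ₀ l q) with hQ
  have hQc : Continuous Q := continuous_tsum (fun l => continuous_pev_sph _) hA h
  have hQi := integrable_sph_of_continuous hQc
  have h0 : (q - Q) =ᵐ[sphMeasure n] 0 := by
    refine ae_eq_zero_of_forall_harmonic hn (hq.sub hQi) fun j p hp => ?_
    have hc : Continuous (fun θ : Sph n => (starRingEnd ℂ) (pev (θ : E n) p)) :=
      Complex.continuous_conj.comp (continuous_pev_sph _)
    obtain ⟨B, hB⟩ := (HasCompactSupport.of_compactSpace _).exists_bound_of_continuous hc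
    have hi1 : Integrable (fun θ : Sph n => q θ * (starRingEnd ℂ) (pev (θ : E n) p))
        (sphMeasure n) := hq.mul_bdd (c := B) hc.aestronglyMeasurable (Filter.Eventually.of_forall hB)
    have hi2 : Integrable (fun θ : Sph n => Q θ * (starRingEnd ℂ) (pev (θ : E n) p))
        (sphMeasure n) := integrable_sph_of_continuous (hQc.mul hc)
    have hi3 : ∀ l, Integrable (fun θ : Sph n => pev (θ : E n) (lpPoly n χ₀ l q) *
        (starRingEnd ℂ) (pev (θ : E n) p)) (sphMeasure n) := fun l =>
      integrable_sph_of_continuous ((continuous_pev_sph _).mul hc)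
    have hsum := hasSum_integral_of_summable_integral_norm hi3 (by
      refine Summable.of_nonneg_of_le (fun l => integral_nonneg fun _ => norm_nonneg _) (fun l => ?_)
        (hA.mul_right (B * (sphMeasure n).real Set.univ))
      have hbd : ∀ θ : Sph n, ‖pev (θ : E n) (lpPoly n χ₀ l q) *
          (starRingEnd ℂ) (pev (θ : E n) p)‖ ≤ A l * B := fun θ => by
        rw [norm_mul]
        exact mul_le_mul (h l θ) (hB θ) (norm_nonneg _) ((norm_nonneg _).trans (h l θ))
      refine (integral_mono_of_nonneg (Filter.Eventually.of_forall fun _ => norm_nonneg _)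
        (integrable_const (A l * B)) (Filter.Eventually.of_forall hbd)).trans (le_of_eq ?_)
      rw [integral_const, smul_eq_mul]; ring)
    simp only [integral_lpPoly_mul_conj hn hχ₀ _ hq hp, tsum_mul_right] at hsum
    have h3 : HasSum (fun l => (sphMult χ₀ l j : ℂ) *
        ∫ θ : Sph n, q θ * (starRingEnd ℂ) (pev (θ : E n) p) ∂(sphMeasure n))
        (((1 : ℝ) : ℂ) * ∫ θ : Sph n, q θ * (starRingEnd ℂ) (pev (θ : E n) p) ∂(sphMeasure n)) :=
      (Complex.hasSum_ofReal.mpr (hasSum_sphMult hχ₀ j)).mul_right _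
    have h4 := hsum.unique h3
    simp only [Pi.sub_apply, sub_mul]
    rw [integral_sub hi1 hi2, h4]
    simp
  filter_upwards [h0] with θ hθ
  exact sub_eq_zero.mp hθ

end RoughPDO
end

noncomputable section
namespace RoughPDO

/-! ### Functions as tempered distributions -/

theorem ae_eq_of_forall_integral_schwartz {n : ℕ} {F G : E n → ℂ} {p q : ℝ≥0∞} (hp : 1 ≤ p)
    (hq : 1 ≤ q) (hF : MemLp F p volume) (hG : MemLp G q volume)
    (h : ∀ φ : 𝓢(E n, ℂ), ∫ x, φ x * F x = ∫ x, φ x * G x) : F =ᵐ[volume] G := by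
  have hFl := hF.locallyIntegrable hp
  have hGl := hG.locallyIntegrable hq
  have hint : ∀ (φ : 𝓢(E n, ℂ)) {F : E n → ℂ} {p : ℝ≥0∞}, 1 ≤ p → MemLp F p volume →
      Integrable fun x => φ x * F x := by
    intro φ F p hp hF
    haveI := ENNReal.HolderConjugate.conjExponent hp
    haveI : p.conjExponent.HolderConjugate p := ENNReal.HolderConjugate.symm
    exact MemLp.integrable_mul (φ.memLp p.conjExponent volume) hF
  have h0 : ∀ᵐ x, (F - G) x = 0 := by
    refine ae_eq_zero_of_integral_contDiff_smul_eq_zero (hFl.sub hGl) fun g hg hgc => ?_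
    have hg₁ : HasCompactSupport (Complex.ofRealCLM ∘ g) := hgc.comp_left rfl
    have hg₂ : ContDiff ℝ ∞ (Complex.ofRealCLM ∘ g) := by fun_prop
    set φ := hg₁.toSchwartzMap hg₂ with hφ
    have e : ∀ x, g x • (F - G) x = φ x * F x - φ x * G x := by
      intro x
      have : φ x = (g x : ℂ) := rfl
      rw [this, Pi.sub_apply, Complex.real_smul]; ring
    simp only [e]
    rw [integral_sub (hint φ hp hF) (hint φ hq hG), h φ, sub_self]
  filter_upwards [h0] with x hx
  exact sub_eq_zero.mp hx

theorem Lp_ae_eq_of_coe_eq {n : ℕ} {p q : ℝ≥0∞} [hp : Fact (1 ≤ p)] [hq : Fact (1 ≤ q)]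
    {f : Lp ℂ p (volume : Measure (E n))} {g : Lp ℂ q (volume : Measure (E n))}
    (h : (f : 𝓢'(E n, ℂ)) = (g : 𝓢'(E n, ℂ))) : (f : E n → ℂ) =ᵐ[volume] g := by
  refine ae_eq_of_forall_integral_schwartz hp.out hq.out (Lp.memLp f) (Lp.memLp g) fun φ => ?_
  have := congrArg (fun u : 𝓢'(E n, ℂ) => u φ) h
  simpa using this

theorem integral_mul_fourierInv {n : ℕ} {f h : E n → ℂ} (hf : Integrable f)
    (hh : Integrable h) : ∫ x, f x * 𝓕⁻ h x = ∫ ξ, 𝓕⁻ f ξ * h ξ := by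
  have := VectorFourier.integral_fourierIntegral_smul_eq_flip (μ := (volume : Measure (E n)))
    (ν := (volume : Measure (E n))) (L := -innerₗ (E n)) Real.continuous_fourierChar
    (by
      have : Continuous fun p : E n × E n => -(inner ℝ p.1 p.2) := by fun_prop
      exact this) hf hh
  have hflip : (-innerₗ (E n)).flip = -innerₗ (E n) := by
    ext x y; simp [real_inner_comm]
  rw [hflip] at this
  exact this.symm

theorem integral_schwartz_mul_fourierInv {n : ℕ} (φ : 𝓢(E n, ℂ)) {h : E n → ℂ}
    (hh : Integrable h) : ∫ x, φ x * 𝓕⁻ h x = ∫ ξ, 𝓕⁻ φ ξ * h ξ := by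
  rw [SchwartzMap.fourierInv_coe]
  exact integral_mul_fourierInv φ.integrable hh

theorem continuous_fourierInv {n : ℕ} {h : E n → ℂ} (hh : Integrable h) :
    Continuous (𝓕⁻ h : E n → ℂ) := by
  have h1 : Continuous (𝓕 h : E n → ℂ) :=
    VectorFourier.fourierIntegral_continuous Real.continuous_fourierChar
      (by exact continuous_inner) hh
  have h2 : (𝓕⁻ h : E n → ℂ) = fun x => 𝓕 h (-x) := funext fun x =>
    Real.fourierInv_eq_fourier_neg h x
  rw [h2]; exact h1.comp continuous_neg

theorem norm_fourierInv_le {n : ℕ} (h : E n → ℂ) (x : E n) : ‖𝓕⁻ h x‖ ≤ ∫ ξ, ‖h ξ‖ :=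
  VectorFourier.norm_fourierIntegral_le_integral_norm _ _ _ _ _

theorem memLp_top_fourierInv {n : ℕ} {h : E n → ℂ} (hh : Integrable h) :
    MemLp (𝓕⁻ h : E n → ℂ) ⊤ volume :=
  memLp_top_of_bound (continuous_fourierInv hh).aestronglyMeasurable _
    (Filter.Eventually.of_forall (norm_fourierInv_le h))

/-- On `L¹ ∩ L²`, the inverse Fourier transform of `L²` is given by the integral. -/
theorem fourierInv_toLp_ae_eq {n : ℕ} {g : E n → ℂ} (h1 : Integrable g) (h2 : MemLp g 2 volume) :
    ((𝓕⁻ (h2.toLp g) : Lp ℂ 2 (volume : Measure (E n))) : E n → ℂ) =ᵐ[volume] 𝓕⁻ g := by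
  refine ae_eq_of_forall_integral_schwartz one_le_two le_top (Lp.memLp _)
    (memLp_top_fourierInv h1) fun φ => ?_
  have h3 := congrArg (fun u : 𝓢'(E n, ℂ) => u φ)
    (Lp.fourierInv_toTemperedDistribution_eq (h2.toLp g))
  simp only [TemperedDistribution.fourierInv_apply, Lp.toTemperedDistribution_apply,
    smul_eq_mul] at h3
  rw [← h3, integral_schwartz_mul_fourierInv φ h1]
  refine integral_congr_ae ?_
  filter_upwards [h2.coeFn_toLp] with x hx
  rw [hx]

theorem eLpNorm_fourierInv_eq {n : ℕ} {g : E n → ℂ} (h1 : Integrable g) (h2 : MemLp g 2 volume) :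
    eLpNorm (𝓕⁻ g : E n → ℂ) 2 volume = eLpNorm g 2 volume := by
  rw [← eLpNorm_congr_ae (fourierInv_toLp_ae_eq h1 h2), ← eLpNorm_congr_ae h2.coeFn_toLp,
    ← Lp.enorm_def, ← Lp.enorm_def, ← ofReal_norm, ← ofReal_norm, ← Lp.norm_fourier_eq,
    FourierTransform.fourier_fourierInv_eq]

/-! ### Associativity of convolutions, and convolutions as Fourier multipliers -/

theorem cnv_congr {n : ℕ} (K : E n → ℂ) {f g : E n → ℂ} (h : f =ᵐ[volume] g) : cnv K f = cnv K g :=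
  funext fun _ => integral_congr_ae (by filter_upwards [h] with y hy; rw [hy])

theorem memLp_cnv {n : ℕ} (K : 𝓢(E n, ℂ)) {f : E n → ℂ} {p : ℝ≥0∞} (hp : 1 ≤ p)
    (hf : MemLp f p volume) : MemLp (cnv K f) p volume :=
  ⟨aestronglyMeasurable_cnv K.continuous.aestronglyMeasurable hf.1,
    (eLpNorm_cnv_le K.continuous.aestronglyMeasurable hf.1 hp).trans_lt
      (ENNReal.mul_lt_top (K.memLp 1 volume).2 hf.2)⟩

/-- By Young |K| * |f| is in L^p, so pairing it with |g| is finite by Hölder. This licenses every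
use of Fubini for convolutions below, including p = ∞. -/
theorem integrable_cnv_prod {n : ℕ} {K f g : E n → ℂ} {p q : ℝ≥0∞} [hpq : p.HolderConjugate q]
    (hp : 1 ≤ p) (hK : Integrable K) (hf : MemLp f p volume) (hg : MemLp g q volume) :
    Integrable (fun z : E n × E n => g z.1 * (K (z.1 - z.2) * f z.2)) (volume.prod volume) := by
  have hm : AEStronglyMeasurable (fun z : E n × E n => g z.1 * (K (z.1 - z.2) * f z.2))
      (volume.prod volume) :=
    hg.1.comp_fst.mul (aestronglyMeasurable_cnv_integrand hK.1 hf.1)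
  refine ⟨hm, ?_⟩
  rw [hasFiniteIntegral_iff_enorm, lintegral_prod _ hm.enorm]
  have hW := eLpNorm_absCnv_le hK.1 hf.1 hp
  have hWm := aemeasurable_absCnv hK.1 hf.1
  have hWt : eLpNorm (absCnv K f) p volume < ⊤ := hW.trans_lt
    (ENNReal.mul_lt_top (memLp_one_iff_integrable.mpr hK).2 hf.2)
  have hfin : ∀ᵐ x, absCnv K f x < ⊤ := by
    rcases eq_or_ne p ⊤ with hpt | hpt
    · rw [hpt, eLpNorm_exponent_top] at hWt
      filter_upwards [enorm_ae_le_eLpNormEssSup (absCnv K f) volume] with x hx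
      exact (enorm_eq_self (absCnv K f x) ▸ hx).trans_lt hWt
    · have hp0 : p ≠ 0 := (zero_lt_one.trans_le hp).ne'
      have h2 := lintegral_rpow_enorm_lt_top_of_eLpNorm_lt_top hp0 hpt hWt
      simp only [enorm_eq_self] at h2
      filter_upwards [ae_lt_top' (hWm.pow_const _) h2.ne] with x hx
      exact (ENNReal.rpow_lt_top_iff_of_pos (ENNReal.toReal_pos hp0 hpt)).mp hx
  set G : E n → ℂ := fun x => (((absCnv K f x).toReal : ℝ) : ℂ) with hG
  have hGe : ∀ᵐ x, ‖G x‖ₑ = absCnv K f x := by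
    filter_upwards [hfin] with x hx
    rw [hG, ← ofReal_norm, Complex.norm_real, Real.norm_of_nonneg ENNReal.toReal_nonneg,
      ENNReal.ofReal_toReal hx.ne]
  have hGm : MemLp G p volume := by
    refine ⟨(Complex.measurable_ofReal.comp_aemeasurable hWm.ennreal_toReal).aestronglyMeasurable, ?_⟩
    refine lt_of_le_of_lt (eLpNorm_mono_enorm_ae ?_) hWt
    filter_upwards [hGe] with x hx
    rw [hx, enorm_eq_self]
  haveI : q.HolderConjugate p := ENNReal.HolderConjugate.symm
  have h3 : Integrable (fun x => g x * G x) := MemLp.integrable_mul hg hGm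
  refine lt_of_le_of_lt (lintegral_mono_ae ?_) h3.2
  filter_upwards [hGe] with x hx
  rw [enorm_mul, hx]
  simp only [enorm_mul]
  rw [lintegral_const_mul' _ _ enorm_ne_top]
  rfl

theorem cnv_assoc {n : ℕ} (K L : 𝓢(E n, ℂ)) {f : E n → ℂ} {p : ℝ≥0∞} (hp : 1 ≤ p)
    (hf : MemLp f p volume) (x : E n) : cnv K (cnv L f) x = cnv (cnv K L) f x := by
  haveI := ENNReal.HolderConjugate.conjExponent hp
  have h1 : MemLp (fun y => K (x - y)) p.conjExponent volume :=
    (K.memLp p.conjExponent volume).comp_measurePreserving (volume.measurePreserving_sub_left x)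
  have h2 := integrable_cnv_prod hp L.integrable hf h1
  have h3 := integral_integral_swap (f := fun y w => K (x - y) * (L (y - w) * f w)) h2
  calc cnv K (cnv L f) x = ∫ y, ∫ w, K (x - y) * (L (y - w) * f w) := by
        simp only [cnv, integral_const_mul]
    _ = ∫ w, ∫ y, K (x - y) * (L (y - w) * f w) := h3
    _ = _ := by
        refine integral_congr_ae (Filter.Eventually.of_forall fun w => ?_)
        simp only [cnv, ← mul_assoc, integral_mul_const]
        congr 1
        rw [← integral_sub_right_eq_self (fun y => K (x - w - y) * L y) w]
        simp only [sub_sub_sub_cancel_right]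

/-- A multiplier acts on distributions through its transpose on test functions. Written with the
kernel at x - y, the transpose is ready for Fubini. -/
theorem fourier_mul_fourierInv_apply {n : ℕ} (a φ : 𝓢(E n, ℂ)) (y : E n) :
    𝓕 (SchwartzMap.smulLeftCLM ℂ a (𝓕⁻ φ)) y = ∫ x, φ x * (𝓕⁻ a : 𝓢(E n, ℂ)) (x - y) := by
  have h1 : 𝓕 (SchwartzMap.smulLeftCLM ℂ a (𝓕⁻ φ)) y =
      𝓕⁻ (SchwartzMap.smulLeftCLM ℂ a (𝓕⁻ φ)) (-y) := by
    rw [SchwartzMap.fourier_coe, SchwartzMap.fourierInv_coe, Real.fourierInv_eq_fourier_neg, neg_neg]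
  have h2 : ∀ x, 𝓕⁻ (𝓕⁻ φ) x = φ (-x) := by
    intro x
    have : 𝓕⁻ (𝓕⁻ φ) x = 𝓕 (𝓕⁻ φ) (-x) := by
      rw [SchwartzMap.fourier_coe, SchwartzMap.fourierInv_coe, Real.fourierInv_eq_fourier_neg]
    rw [this, FourierTransform.fourier_fourierInv_eq]
  rw [h1, fourierInv_mul_eq_cnv (a := a) (b := 𝓕⁻ φ) fun ξ => by
    rw [SchwartzMap.smulLeftCLM_apply_apply a.hasTemperateGrowth]; rfl]
  rw [cnv, ← integral_neg_eq_self]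
  refine integral_congr_ae (Filter.Eventually.of_forall fun x => ?_)
  dsimp only
  rw [h2, neg_neg, mul_comm]
  congr 2
  abel

theorem fourierMultiplier_coe_apply {n : ℕ} (a : 𝓢(E n, ℂ)) {p : ℝ≥0∞} [hp : Fact (1 ≤ p)]
    (f : Lp ℂ p (volume : Measure (E n))) (φ : 𝓢(E n, ℂ)) :
    TemperedDistribution.fourierMultiplierCLM ℂ a (f : 𝓢'(E n, ℂ)) φ =
      ∫ x, φ x * cnv (𝓕⁻ a : 𝓢(E n, ℂ)) f x := by
  haveI := ENNReal.HolderConjugate.conjExponent hp.out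
  have h2 := integrable_cnv_prod hp.out (𝓕⁻ a : 𝓢(E n, ℂ)).integrable (Lp.memLp f)
    (φ.memLp p.conjExponent volume)
  have h3 := integral_integral_swap
    (f := fun x y => φ x * ((𝓕⁻ a : 𝓢(E n, ℂ)) (x - y) * f y)) h2
  rw [TemperedDistribution.fourierMultiplierCLM_apply_apply, Lp.toTemperedDistribution_apply]
  simp only [fourier_mul_fourierInv_apply, smul_eq_mul, cnv, ← integral_const_mul,
    ← integral_mul_const]
  rw [h3]
  simp only [mul_assoc]

/-- The convolution with a Schwartz function as an element of `L^p`. -/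
def cnvLp {n : ℕ} (K : 𝓢(E n, ℂ)) {p : ℝ≥0∞} [hp : Fact (1 ≤ p)]
    (f : Lp ℂ p (volume : Measure (E n))) : Lp ℂ p (volume : Measure (E n)) :=
  (memLp_cnv K hp.out (Lp.memLp f)).toLp _

theorem coeFn_cnvLp {n : ℕ} (K : 𝓢(E n, ℂ)) {p : ℝ≥0∞} [hp : Fact (1 ≤ p)]
    (f : Lp ℂ p (volume : Measure (E n))) : (cnvLp K f : E n → ℂ) =ᵐ[volume] cnv K f :=
  MemLp.coeFn_toLp _

theorem coe_cnvLp {n : ℕ} (a : 𝓢(E n, ℂ)) {p : ℝ≥0∞} [hp : Fact (1 ≤ p)]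
    (f : Lp ℂ p (volume : Measure (E n))) : (cnvLp (𝓕⁻ a) f : 𝓢'(E n, ℂ)) =
      TemperedDistribution.fourierMultiplierCLM ℂ a (f : 𝓢'(E n, ℂ)) := by
  ext φ
  rw [fourierMultiplier_coe_apply, Lp.toTemperedDistribution_apply]
  refine integral_congr_ae ?_
  filter_upwards [coeFn_cnvLp (𝓕⁻ a) f] with x hx
  rw [hx, smul_eq_mul]

end RoughPDO
end

noncomputable section
namespace RoughPDO

/-! ### Homogeneous symbols -/

theorem measurable_homSymbol {n : ℕ} {q : E n → Sph n → ℂ} (hq : Measurable (Function.uncurry q)) :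
    Measurable fun z : E n × E n => homSymbol q z.1 z.2 := by
  classical
  have hs : MeasurableSet {z : E n × E n | z.2 = 0} := measurable_snd (measurableSet_singleton 0)
  have hd : Measurable fun z : ({z : E n × E n | z.2 = 0}ᶜ : Set (E n × E n)) =>
      q z.1.1 (dirOf z.1.2 z.2) := by
    have h1 : Measurable fun z : ({z : E n × E n | z.2 = 0}ᶜ : Set (E n × E n)) =>
        dirOf z.1.2 z.2 := by
      refine Measurable.subtype_mk ?_
      fun_prop
    exact hq.comp ((measurable_fst.comp measurable_subtype_coe).prodMk h1)
  have := Measurable.dite (s := {z : E n × E n | z.2 = 0}) (f := fun _ => (0 : ℂ))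
    measurable_const hd hs
  convert this using 2 with z
  rw [homSymbol]
  by_cases h : z.2 = 0
  · rw [dif_pos h, dif_pos (show z ∈ {z : E n × E n | z.2 = 0} from h)]
  · rw [dif_neg h, dif_neg (show z ∉ {z : E n × E n | z.2 = 0} from h)]
    rfl

theorem measurable_hom {n : ℕ} {s : Sph n → ℂ} (hs : Measurable s) : Measurable (hom s) := by
  have h := measurable_homSymbol (q := fun _ : E n => s) (hs.comp measurable_snd)
  exact h.comp (measurable_const.prodMk measurable_id : Measurable fun ξ : E n => ((0 : E n), ξ))

theorem norm_hom_le {n : ℕ} {s : Sph n → ℂ} {a : ℝ} (h : ∀ θ, ‖s θ‖ ≤ a) (h0 : 0 ≤ a) (ξ : E n) :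
    ‖hom s ξ‖ ≤ a := by
  rw [hom]; split_ifs
  · simpa using h0
  · exact h _

theorem opIntegral_eq_fourierInv {n : ℕ} (q : E n → Sph n → ℂ) (h : E n → ℂ) (x : E n) :
    opIntegral q h x = 𝓕⁻ (fun ξ => hom (q x) ξ * h ξ) x := by
  rw [fourierInv_eq_integral_exp]
  refine integral_congr_ae (Filter.Eventually.of_forall fun ξ => ?_)
  simp only [opIntegrand, homSymbol_eq_hom]; ring

theorem integrable_hom_mul {n : ℕ} {s : Sph n → ℂ} (hs : Measurable s) {a : ℝ}
    (h : ∀ θ, ‖s θ‖ ≤ a) (h0 : 0 ≤ a) {f : E n → ℂ} (hf : Integrable f) :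
    Integrable fun ξ => hom s ξ * f ξ :=
  hf.bdd_mul (c := a) (measurable_hom hs).aestronglyMeasurable
    (Filter.Eventually.of_forall fun ξ => norm_hom_le h h0 ξ)

theorem exists_bound_pev {n : ℕ} (p : MvPolynomial (Fin n) ℂ) :
    ∃ a : ℝ, 0 ≤ a ∧ ∀ θ : Sph n, ‖pev (θ : E n) p‖ ≤ a := by
  obtain ⟨C, hC⟩ := (HasCompactSupport.of_compactSpace _).exists_bound_of_continuous
    (continuous_pev_sph p)
  exact ⟨max C 0, le_max_right _ _, fun θ => (hC θ).trans (le_max_left _ _)⟩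

/-- Write s(x,·) = ∑ c_i(x) e_i in an orthonormal basis. Cauchy-Schwarz in i separates the
coefficients, whose square sum is ‖s(x,·)‖₂², from the transforms of e_i(ξ/|ξ|) h. By Plancherel the
latter have total energy at most that of h times the diagonal ∑ |e_i|² ≤ C N^{n-1}. -/
theorem exists_eLpNorm_opIntegral_le {n : ℕ} (hn : 0 < n) : ∃ C : ℝ≥0, ∀ N : ℕ, 1 ≤ N →
    ∀ s : E n → MvPolynomial (Fin n) ℂ, (∀ x, (s x).totalDegree ≤ N) →
      ∀ h : E n → ℂ, Integrable h → MemLp h 2 volume →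
        eLpNorm (opIntegral (fun x θ => pev (θ : E n) (s x)) h) 2 volume ≤
          C * ((N : ℝ≥0∞) ^ (n - 1)) ^ (1 / (2 : ℝ)) *
          (⨆ x, eLpNorm (fun θ : Sph n => pev (θ : E n) (s x)) 2 (sphMeasure n)) *
          eLpNorm h 2 volume := by
  obtain ⟨C, hC1, hC⟩ := exists_diag_bound hn
  refine ⟨C.toNNReal, fun N hN s hs h h1 h2 => ?_⟩
  obtain ⟨B⟩ := exists_sphBasis n N
  set S := ⨆ x, eLpNorm (fun θ : Sph n => pev (θ : E n) (s x)) 2 (sphMeasure n) with hS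
  have hSx : ∀ x, eLpNorm (fun θ : Sph n => pev (θ : E n) (s x)) 2 (sphMeasure n) ≤ S :=
    fun x => le_iSup (fun x => eLpNorm (fun θ : Sph n => pev (θ : E n) (s x)) 2 (sphMeasure n)) x
  set c : E n → Fin B.dim → ℂ := fun x i => ∫ η : Sph n, pev (η : E n) (s x) *
    (starRingEnd ℂ) (pev (η : E n) (B.poly i)) ∂(sphMeasure n) with hc
  set g : Fin B.dim → E n → ℂ := fun i ξ => hom (fun θ => pev (θ : E n) (B.poly i)) ξ * h ξ with hg
  have hgm : ∀ i, AEStronglyMeasurable (g i) := fun i =>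
    (measurable_hom (continuous_pev_sph (B.poly i)).measurable).aestronglyMeasurable.mul h1.1
  have hg1 : ∀ i, Integrable (g i) := fun i => by
    obtain ⟨a, ha0, ha⟩ := exists_bound_pev (B.poly i)
    exact integrable_hom_mul (continuous_pev_sph _).measurable ha ha0 h1
  have hg2 : ∀ i, MemLp (g i) 2 volume := fun i => by
    obtain ⟨a, ha0, ha⟩ := exists_bound_pev (B.poly i)
    refine (h2.const_mul (a : ℂ)).mono (hgm i) (Filter.Eventually.of_forall fun ξ => ?_)
    rw [hg, norm_mul, norm_mul, Complex.norm_real, Real.norm_of_nonneg ha0]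
    exact mul_le_mul_of_nonneg_right (norm_hom_le ha ha0 ξ) (norm_nonneg _)
  have hop : ∀ x, opIntegral (fun x θ => pev (θ : E n) (s x)) h x = ∑ i, c x i * 𝓕⁻ (g i) x := by
    intro x
    rw [opIntegral_eq_fourierInv, fourierInv_eq_integral_exp]
    simp only [fourierInv_eq_integral_exp, ← integral_const_mul]
    rw [← integral_finsetSum]
    · refine integral_congr_ae (Filter.Eventually.of_forall fun ξ => ?_)
      by_cases h0 : ξ = 0
      · simp [hom, h0, hg]
      · simp only [hom, dif_neg h0, hg]
        rw [B.expand _ (hs x), Finset.sum_mul, Finset.sum_mul]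
        simp only [mul_assoc, hc]
    · intro i _
      refine Integrable.const_mul ?_ _
      refine (hg1 i).mul_bdd (c := 1) (Continuous.aestronglyMeasurable (by fun_prop))
        (Filter.Eventually.of_forall fun ξ => le_of_eq ?_)
      rw [show (2 * Real.pi * Complex.I * (inner ℝ ξ x : ℝ) : ℂ) =
        ((2 * Real.pi * inner ℝ ξ x : ℝ) : ℂ) * Complex.I by push_cast; ring,
        Complex.norm_exp_ofReal_mul_I]
  have hcs : ∀ x, ∑ i, ‖c x i‖ₑ ^ 2 ≤ S ^ 2 := by
    intro x
    have e1 : ∑ i, ‖c x i‖ₑ ^ 2 =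
        eLpNorm (fun θ : Sph n => pev (θ : E n) (s x)) 2 (sphMeasure n) ^ 2 := by
      have e2 := integral_norm_sq_sum_basis B (c x)
      have e3 : ∀ θ : Sph n, ∑ i, c x i * pev (θ : E n) (B.poly i) = pev (θ : E n) (s x) :=
        fun θ : Sph n => (B.expand _ (hs x) θ).symm
      simp only [e3] at e2
      have e4 : ∑ i, ‖c x i‖ₑ ^ 2 = ENNReal.ofReal (∑ i, ‖c x i‖ ^ 2) := by
        rw [ENNReal.ofReal_sum_of_nonneg fun _ _ => by positivity]
        simp only [ENNReal.ofReal_pow (norm_nonneg _), ofReal_norm]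
      rw [e4, ← e2, ofReal_integral_eq_lintegral_ofReal (integrable_norm_sq_pev _)
        (Filter.Eventually.of_forall fun _ => by positivity), eLpNorm_two_sq]
      simp only [ENNReal.ofReal_pow (norm_nonneg _), ofReal_norm]
    rw [e1]
    exact pow_le_pow_left₀ zero_le (hSx x) 2
  have hpt : ∀ x, ‖opIntegral (fun x θ => pev (θ : E n) (s x)) h x‖ₑ ^ 2 ≤
      S ^ 2 * ∑ i, ‖𝓕⁻ (g i) x‖ₑ ^ 2 := by
    intro x
    rw [hop]
    refine le_trans ?_ (mul_le_mul_left (hcs x) _)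
    calc ‖∑ i, c x i * 𝓕⁻ (g i) x‖ₑ ^ 2 ≤ (∑ i, ‖c x i‖ₑ * ‖𝓕⁻ (g i) x‖ₑ) ^ 2 := by
          gcongr
          refine (enorm_sum_le _ _).trans (le_of_eq ?_)
          simp only [enorm_mul]
      _ ≤ _ := by
          have := ENNReal.inner_le_Lp_mul_Lq Finset.univ (fun i => ‖c x i‖ₑ)
            (fun i => ‖𝓕⁻ (g i) x‖ₑ) Real.HolderConjugate.two_two
          have h3 := pow_le_pow_left₀ (zero_le) this 2
          refine h3.trans (le_of_eq ?_)
          rw [mul_pow, ← ENNReal.rpow_natCast, ← ENNReal.rpow_natCast, ← ENNReal.rpow_mul,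
            ← ENNReal.rpow_mul]
          norm_num
  have hdiag : ∀ ξ : E n, ∑ i, ‖hom (fun θ : Sph n => pev (θ : E n) (B.poly i)) ξ‖ₑ ^ 2 ≤
      C.toNNReal * (N : ℝ≥0∞) ^ (n - 1) := by
    intro ξ
    by_cases h0 : ξ = 0
    · simp [hom, h0]
    · simp only [hom, dif_neg h0]
      have e4 : ∀ θ : Sph n, ∑ i, ‖pev (θ : E n) (B.poly i)‖ₑ ^ 2 =
          ENNReal.ofReal (B.diag θ) := by
        intro θ
        rw [SphBasis.diag, ENNReal.ofReal_sum_of_nonneg fun _ _ => by positivity]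
        simp only [ENNReal.ofReal_pow (norm_nonneg _), ofReal_norm]
      rw [e4]
      refine (ENNReal.ofReal_le_ofReal (hC N hN N (by omega) B _)).trans (le_of_eq ?_)
      rw [ENNReal.ofReal_mul (by linarith), ENNReal.ofReal_pow (by positivity)]
      simp [ENNReal.ofReal]
  have hfin : eLpNorm (opIntegral (fun x θ => pev (θ : E n) (s x)) h) 2 volume ^ 2 ≤
      S ^ 2 * ((C.toNNReal * (N : ℝ≥0∞) ^ (n - 1)) * eLpNorm h 2 volume ^ 2) := by
    rw [eLpNorm_two_sq]
    calc _ ≤ ∫⁻ x, S ^ 2 * ∑ i, ‖𝓕⁻ (g i) x‖ₑ ^ 2 := lintegral_mono hpt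
      _ = S ^ 2 * ∑ i, ∫⁻ x, ‖𝓕⁻ (g i) x‖ₑ ^ 2 := by
          have hm : ∀ i, Measurable fun x => ‖𝓕⁻ (g i) x‖ₑ ^ 2 := fun i =>
            (continuous_fourierInv (hg1 i)).measurable.enorm.pow_const _
          rw [lintegral_const_mul _ (Finset.measurable_sum _ fun i _ => hm i),
            lintegral_finsetSum _ fun i _ => hm i]
      _ = S ^ 2 * ∑ i, ∫⁻ ξ, ‖g i ξ‖ₑ ^ 2 := by
          congr 2
          ext i
          rw [← eLpNorm_two_sq, eLpNorm_fourierInv_eq (hg1 i) (hg2 i), eLpNorm_two_sq]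
      _ = S ^ 2 * ∫⁻ ξ, ∑ i, ‖g i ξ‖ₑ ^ 2 := by
          rw [lintegral_finsetSum' _ fun i _ => (hgm i).enorm.pow_const _]
      _ ≤ S ^ 2 * ∫⁻ ξ, (C.toNNReal * (N : ℝ≥0∞) ^ (n - 1)) * ‖h ξ‖ₑ ^ 2 := by
          gcongr with ξ
          simp only [hg, enorm_mul, mul_pow]
          rw [← Finset.sum_mul]
          gcongr
          exact hdiag ξ
      _ = _ := by
          rw [lintegral_const_mul'' _ (h1.1.enorm.pow_const _), ← eLpNorm_two_sq]
  rw [← ENNReal.pow_le_pow_left_iff two_ne_zero]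
  refine hfin.trans ?_
  have e5 : (((N : ℝ≥0∞) ^ (n - 1)) ^ (1 / (2 : ℝ))) ^ 2 = (N : ℝ≥0∞) ^ (n - 1) := by
    rw [← ENNReal.rpow_natCast, ← ENNReal.rpow_mul]; norm_num
  -- C ≥ 1 allows C in place of its square root.
  have e6 : (C.toNNReal : ℝ≥0∞) ≤ (C.toNNReal : ℝ≥0∞) ^ 2 := by
    have : (1 : ℝ≥0) ≤ C.toNNReal := by rwa [Real.one_le_toNNReal]
    have h3 : C.toNNReal ≤ C.toNNReal ^ 2 := le_self_pow₀ this two_ne_zero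
    exact_mod_cast h3
  rw [mul_pow, mul_pow, mul_pow, e5]
  calc _ ≤ S ^ 2 * ((C.toNNReal : ℝ≥0∞) ^ 2 * (N : ℝ≥0∞) ^ (n - 1) * eLpNorm h 2 volume ^ 2) := by
        gcongr
    _ = _ := by ring

end RoughPDO
end

noncomputable section
namespace RoughPDO

/-! ### Expansion of the symbol into polynomials in the direction -/

/-- An expansion of the symbol `q` into a series of polynomials in the direction, with the bounds
that lead to operators on `L^p`. -/
structure SymbolSeries {n : ℕ} {χ : E n → ℝ} (hχ : IsCutoff χ) (q : E n → Sph n → ℂ)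
    (p p' S : ℝ≥0∞) where
  a : ℕ → E n → MvPolynomial (Fin n) ℂ
  A : ℕ → ℝ≥0
  summable : Summable A
  tsum_eq : ((∑' l, A l : ℝ≥0) : ℝ≥0∞) = S
  norm_le : ∀ l x (θ : Sph n), ‖pev (θ : E n) (a l x)‖ ≤ A l
  measurable : ∀ l, Measurable (Function.uncurry fun x (θ : Sph n) => pev (θ : E n) (a l x))
  hasSum : ∀ x, ∀ᵐ θ : Sph n ∂(sphMeasure n), HasSum (fun l => pev (θ : E n) (a l x)) (q x θ)
  op_le : ∀ l k (f : E n → ℂ), MemLp f p volume →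
    eLpNorm (fun x => cnv (polyKer hχ (a l x) k) f x) p volume ≤ A l * eLpNorm f p volume
  ker_le : ∀ k, ∃ C : ℝ≥0, ∀ l x, eLpNorm (polyKer hχ (a l x) k) p' volume ≤ C * A l
  opIntegral_le : p = 2 → ∀ l (h : E n → ℂ), Integrable h → MemLp h 2 volume →
    eLpNorm (opIntegral (fun x θ => pev (θ : E n) (a l x)) h) 2 volume ≤ A l * eLpNorm h 2 volume

/-- N = 2^{l+1} exceeds 2^l by a factor 2, whose power (n-1)/ρ is at most 2^n uniformly in ρ ≥ 1. -/
theorem degree_weight_le {n : ℕ} (hn : 0 < n) (l : ℕ) {ρ : ℝ} (hρ : 1 ≤ ρ) :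
    (((2 ^ (l + 1) : ℕ) : ℝ≥0∞) ^ (n - 1)) ^ (1 / ρ) ≤
      ((2 ^ n : ℝ≥0) : ℝ≥0∞) * (2 : ℝ≥0∞) ^ ((l : ℝ) * ((n : ℝ) - 1) / ρ) := by
  have hn1 : ((n - 1 : ℕ) : ℝ) = (n : ℝ) - 1 := by
    rw [Nat.cast_sub hn]; simp
  have hn0 : 0 ≤ (n : ℝ) - 1 := by rw [← hn1]; positivity
  have e1 : (((2 ^ (l + 1) : ℕ) : ℝ≥0∞) ^ (n - 1)) ^ (1 / ρ) =
      (2 : ℝ≥0∞) ^ (((n : ℝ) - 1) / ρ) * (2 : ℝ≥0∞) ^ ((l : ℝ) * ((n : ℝ) - 1) / ρ) := by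
    rw [← ENNReal.rpow_add_of_nonneg _ _ (by positivity) (by positivity), Nat.cast_pow,
      Nat.cast_ofNat, ← pow_mul, ← ENNReal.rpow_natCast, ← ENNReal.rpow_mul]
    congr 1
    push_cast
    rw [hn1]; ring
  rw [e1]
  refine mul_le_mul_left ?_ _
  have e2 : ((2 ^ n : ℝ≥0) : ℝ≥0∞) = (2 : ℝ≥0∞) ^ (n : ℝ) := by simp
  rw [e2]
  refine ENNReal.rpow_le_rpow_of_exponent_le (by norm_num) ?_
  rw [div_le_iff₀ (by linarith)]
  nlinarith

/-- Since C ≥ 1 and 1/ρ ≤ 1, the constant need not be raised to 1/ρ; the final constant is thereby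
independent of p. -/
theorem coe_mul_rpow_le {C X : ℝ≥0} (hC : 1 ≤ C) {ρ : ℝ} (hρ : 1 ≤ ρ) :
    ((C * X : ℝ≥0) : ℝ≥0∞) ^ (1 / ρ) ≤ C * (X : ℝ≥0∞) ^ (1 / ρ) := by
  rw [ENNReal.coe_mul, ENNReal.mul_rpow_of_nonneg _ _ (by positivity)]
  refine mul_le_mul_left ?_ _
  refine (ENNReal.rpow_le_rpow_of_exponent_le (by exact_mod_cast hC) ?_).trans_eq
    (ENNReal.rpow_one _)
  rw [div_le_one (by linarith)]; exact hρ

/-- The terms are the polynomials of P_l q(x,·), of degree at most 2^{l+1}, and A l is C times the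
l-th term of `symbolNorm`. This one sequence dominates the sup norms (Nikolskii), the operator norms
on L^p, the kernels up to a factor depending on k, and for p = 2 the unlocalised operators. -/
theorem exists_symbolSeries {n : ℕ} (hn : 0 < n) {χ : E n → ℝ} (hχ : IsCutoff χ) {χ₀ : ℝ → ℝ}
    (hχ₀ : IsCutoff χ₀) : ∃ C : ℝ≥0, ∀ q : E n → Sph n → ℂ,
      Measurable (Function.uncurry q) → (∀ x, Integrable (q x) (sphMeasure n)) → ∀ (p p' : ℝ≥0∞) [p.HolderConjugate p'], 2 ≤ p →
        symbolNorm n χ₀ p' q ≠ ⊤ →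
          Nonempty (SymbolSeries hχ q p p' (C * symbolNorm n χ₀ p' q)) := by
  obtain ⟨C₁, hC₁, h1⟩ := exists_reproFamily hn hχ
  obtain ⟨C₂, hC₂, h2⟩ := exists_enorm_pev_le hn
  obtain ⟨C₃, h3⟩ := exists_eLpNorm_opIntegral_le hn
  set C : ℝ≥0 := (C₁ + C₂ + C₃) * 2 ^ n with hC
  refine ⟨C, fun q hqm hq p p' _ hp hS => ?_⟩
  have hr1 : 1 ≤ p' := ENNReal.HolderConjugate.one_le p' p
  have hr2 : p' ≤ 2 := holderConjugate_le_two hp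
  obtain ⟨hρ1, hρ2⟩ := one_le_toReal_of_le_two hr1 hr2
  set b : ℕ → ℝ≥0∞ := fun l => (2 : ℝ≥0∞) ^ ((l : ℝ) * ((n : ℝ) - 1) / p'.toReal) *
    ⨆ x : E n, eLpNorm (sphLP n χ₀ l (q x)) p' (sphMeasure n) with hb
  have hbS : ∑' l, b l = symbolNorm n χ₀ p' q := rfl
  have hbt : ∀ l, b l ≠ ⊤ := ENNReal.ne_top_of_tsum_ne_top (hbS ▸ hS)
  set a : ℕ → E n → MvPolynomial (Fin n) ℂ := fun l x => lpPoly n χ₀ l (q x) with ha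
  have hdeg : ∀ l x, (a l x).totalDegree ≤ 2 ^ (l + 1) := fun l x => totalDegree_lpPoly_le _ _ _ _
  have hN : ∀ l : ℕ, 1 ≤ 2 ^ (l + 1) := fun l => Nat.one_le_two_pow
  have hsup : ∀ l, ⨆ x : E n, eLpNorm (sphLP n χ₀ l (q x)) p' (sphMeasure n) =
      ⨆ x : E n, eLpNorm (fun θ : Sph n => pev (θ : E n) (a l x)) p' (sphMeasure n) := fun l =>
    iSup_congr fun x => eLpNorm_congr_ae (sphLP_ae_eq χ₀ l (q x))
  have hle : ∀ l x, eLpNorm (fun θ : Sph n => pev (θ : E n) (a l x)) p' (sphMeasure n) ≤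
      ⨆ x : E n, eLpNorm (sphLP n χ₀ l (q x)) p' (sphMeasure n) := fun l x => by
    rw [hsup]
    exact le_iSup (fun x => eLpNorm (fun θ : Sph n => pev (θ : E n) (a l x)) p' (sphMeasure n)) x
  set A : ℕ → ℝ≥0 := fun l => C * (b l).toNNReal with hA
  have hAe : ∀ l, (A l : ℝ≥0∞) = C * b l := fun l => by
    rw [hA, ENNReal.coe_mul, ENNReal.coe_toNNReal (hbt l)]
  have htsum : ∑' l, (A l : ℝ≥0∞) = C * symbolNorm n χ₀ p' q := by
    simp only [hAe]; rw [ENNReal.tsum_mul_left, hbS]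
  have hsummable : Summable A := ENNReal.tsum_coe_ne_top_iff_summable.mp
    (htsum ▸ ENNReal.mul_ne_top ENNReal.coe_ne_top hS)
  have hw := fun l : ℕ => degree_weight_le hn l hρ1
  have hD : ∀ (D : ℝ≥0), D ≤ C₁ + C₂ + C₃ → ∀ l (Y : ℝ≥0∞),
      Y ≤ ⨆ x : E n, eLpNorm (sphLP n χ₀ l (q x)) p' (sphMeasure n) →
      D * (((2 ^ (l + 1) : ℕ) : ℝ≥0∞) ^ (n - 1)) ^ (1 / p'.toReal) * Y ≤ A l := by
    intro D hD l Y hY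
    rw [hAe, hb, hC]
    calc D * (((2 ^ (l + 1) : ℕ) : ℝ≥0∞) ^ (n - 1)) ^ (1 / p'.toReal) * Y
        ≤ (C₁ + C₂ + C₃ : ℝ≥0) * (((2 ^ n : ℝ≥0) : ℝ≥0∞) *
          (2 : ℝ≥0∞) ^ ((l : ℝ) * ((n : ℝ) - 1) / p'.toReal)) *
          ⨆ x : E n, eLpNorm (sphLP n χ₀ l (q x)) p' (sphMeasure n) := by
          gcongr
          exact hw l
      _ = _ := by rw [ENNReal.coe_mul]; ring
  have hnorm : ∀ l x (θ : Sph n), ‖pev (θ : E n) (a l x)‖ ≤ A l := by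
    intro l x θ
    have h4 : ‖pev (θ : E n) (a l x)‖ₑ ≤ A l := by
      refine (h2 _ (hN l) p' hr1 hr2 (a l x) (hdeg l x) θ).trans ?_
      refine (mul_le_mul_left (coe_mul_rpow_le hC₂ hρ1) _).trans ?_
      have := hD C₂ (by rw [add_right_comm]; exact le_add_self) l _ (hle l x)
      simpa using this
    exact_mod_cast h4
  refine ⟨⟨a, A, hsummable, ?_, hnorm, fun l => ?_, fun x => ?_, fun l k f hf => ?_, fun k => ?_, ?_⟩⟩
  · rw [← htsum, ENNReal.coe_tsum hsummable]
  · have hcoeff : ∀ j k, Measurable fun x => harmonicCoeff n (q x) j k := fun j k => by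
      simp only [harmonicCoeff_eq]
      refine (StronglyMeasurable.integral_prod_right (f := fun x (θ : Sph n) => q x θ *
        (starRingEnd ℂ) (pev (θ : E n) (solid n j k))) ?_).measurable
      refine (hqm.mul ?_).stronglyMeasurable
      exact (Complex.continuous_conj.comp (continuous_pev_sph _)).measurable.comp measurable_snd
    simp only [Function.uncurry_def, ha, pev_lpPoly]
    refine Finset.measurable_sum _ fun j _ => Finset.measurable_sum _ fun k _ => ?_
    exact (((hcoeff j k).comp measurable_fst).const_mul _).mul
      ((continuous_pev_sph _).measurable.comp measurable_snd)
  · have hsr : Summable fun l => (A l : ℝ) := NNReal.summable_coe.mpr hsummable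
    filter_upwards [ae_eq_tsum_lpPoly hn hχ₀ (hq x) hsr fun l θ => hnorm l x θ] with θ hθ
    rw [hθ]
    exact (Summable.of_norm_bounded hsr fun l => hnorm l x θ).hasSum
  · obtain ⟨R⟩ := h1 _ (hN l)
    refine (R.eLpNorm_polyOp_le (p' := p') (hdeg l) k hp hf).trans ?_
    refine mul_le_mul_left ?_ _
    refine (mul_le_mul_left (coe_mul_rpow_le hC₁ hρ1) _).trans ?_
    have := hD C₁ (by rw [add_assoc]; exact le_self_add) l _ (hsup l).ge
    simpa using this
  · obtain ⟨C₄, h4⟩ := exists_eLpNorm_polyKer_le hn hχ k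
    refine ⟨C₄ * 2 ^ n, fun l x => ?_⟩
    refine (h4 _ (hN l) p' hr1 hr2 (a l x) (hdeg l x)).trans ?_
    calc C₄ * (((2 ^ (l + 1) : ℕ) : ℝ≥0∞) ^ (n - 1)) ^ (1 / p'.toReal) *
          eLpNorm (fun θ : Sph n => pev (θ : E n) (a l x)) p' (sphMeasure n)
        ≤ C₄ * (((2 ^ n : ℝ≥0) : ℝ≥0∞) * (2 : ℝ≥0∞) ^ ((l : ℝ) * ((n : ℝ) - 1) / p'.toReal)) *
          ⨆ x : E n, eLpNorm (sphLP n χ₀ l (q x)) p' (sphMeasure n) := by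
          gcongr
          · exact hw l
          · exact hle l x
      _ = (C₄ * 2 ^ n : ℝ≥0) * b l := by rw [hb, ENNReal.coe_mul]; ring
      _ ≤ _ := by
          refine mul_le_mul_right ?_ _
          rw [hAe]
          refine le_mul_of_one_le_left zero_le ?_
          have : (1 : ℝ≥0) ≤ C := one_le_mul
            (hC₁.trans (by rw [add_assoc]; exact le_self_add)) (one_le_pow₀ one_le_two)
          exact_mod_cast this
  · intro hp2 l h hh1 hh2
    subst hp2
    have hp' : p' = 2 := by
      have e := ENNReal.HolderConjugate.inv_add_inv_eq_one 2 p'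
      have e2 : (2 : ℝ≥0∞)⁻¹ + p'⁻¹ = 2⁻¹ + 2⁻¹ := by rw [e, ENNReal.inv_two_add_inv_two]
      exact inv_injective ((ENNReal.add_right_inj (by norm_num)).mp e2)
    subst hp'
    refine (h3 _ (hN l) (a l) (hdeg l) h hh1 hh2).trans ?_
    refine mul_le_mul_left ?_ _
    have := hD C₃ le_add_self l _ (hsup l).ge
    simpa using this

end RoughPDO
end

noncomputable section
namespace RoughPDO

/-! ### Summation of series under integrals and norms -/

section
variable {α : Type*} [MeasurableSpace α] {μ : Measure α}

theorem aestronglyMeasurable_of_hasSum {F : ℕ → α → ℂ} {G : α → ℂ}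
    (hF : ∀ l, AEStronglyMeasurable (F l) μ)
    (hG : ∀ᵐ y ∂μ, HasSum (fun l => F l y) (G y)) : AEStronglyMeasurable G μ := by
  refine aestronglyMeasurable_of_tendsto_ae Filter.atTop
    (f := fun N y => ∑ l ∈ Finset.range N, F l y)
    (fun N => Finset.aestronglyMeasurable_fun_sum _ fun l _ => hF l) ?_
  filter_upwards [hG] with y hy
  exact hy.tendsto_sum_nat

theorem integrable_and_hasSum_integral {F : ℕ → α → ℂ} {G : α → ℂ}
    (hF : ∀ l, Integrable (F l) μ) (hs : Summable fun l => ∫ y, ‖F l y‖ ∂μ)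
    (hG : ∀ᵐ y ∂μ, HasSum (fun l => F l y) (G y)) :
    Integrable G μ ∧ HasSum (fun l => ∫ y, F l y ∂μ) (∫ y, G y ∂μ) := by
  have hGm := aestronglyMeasurable_of_hasSum (fun l => (hF l).1) hG
  constructor
  · refine ⟨hGm, ?_⟩
    rw [hasFiniteIntegral_iff_enorm]
    calc ∫⁻ y, ‖G y‖ₑ ∂μ ≤ ∫⁻ y, ∑' l, ‖F l y‖ₑ ∂μ := by
          refine lintegral_mono_ae ?_
          filter_upwards [hG] with y hy
          rw [← hy.tsum_eq]
          exact enorm_tsum_le_tsum_enorm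
      _ = ∑' l, ∫⁻ y, ‖F l y‖ₑ ∂μ := lintegral_tsum fun l => (hF l).1.enorm
      _ = ∑' l, ENNReal.ofReal (∫ y, ‖F l y‖ ∂μ) := by
          simp only [ofReal_integral_norm_eq_lintegral_enorm (hF _)]
      _ < ⊤ := hs.tsum_ofReal_lt_top
  · have h := hasSum_integral_of_summable_integral_norm hF hs
    have e : ∫ y, ∑' l, F l y ∂μ = ∫ y, G y ∂μ := by
      refine integral_congr_ae ?_
      filter_upwards [hG] with y hy
      exact hy.tsum_eq
    rwa [e] at h

/-- Fatou for the partial sums, then Minkowski; pointwise convergence is enough. -/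
theorem eLpNorm_le_tsum_of_hasSum {F : ℕ → α → ℂ} {G : α → ℂ} {p : ℝ≥0∞} (hp : 1 ≤ p)
    (hF : ∀ l, AEStronglyMeasurable (F l) μ) (hG : ∀ᵐ y ∂μ, HasSum (fun l => F l y) (G y)) :
    eLpNorm G p μ ≤ ∑' l, eLpNorm (F l) p μ := by
  refine (Lp.eLpNorm_lim_le_liminf_eLpNorm (f := fun N => ∑ l ∈ Finset.range N, F l)
    (fun N => Finset.aestronglyMeasurable_sum _ fun l _ => hF l) G ?_).trans ?_
  · filter_upwards [hG] with y hy
    simpa using hy.tendsto_sum_nat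
  · refine Filter.liminf_le_of_le (by isBoundedDefault) fun b hb => ?_
    obtain ⟨N, hN⟩ := hb.exists
    exact hN.trans ((eLpNorm_sum_le (fun l _ => hF l) hp).trans (ENNReal.sum_le_tsum _))

end

/-! ### Products of Schwartz functions -/

/-- The pointwise product. -/
def mulS {n : ℕ} (a b : 𝓢(E n, ℂ)) : 𝓢(E n, ℂ) :=
  SchwartzMap.pairing (ContinuousLinearMap.mul ℂ ℂ) a b

@[simp] theorem mulS_apply {n : ℕ} (a b : 𝓢(E n, ℂ)) (ξ : E n) : mulS a b ξ = a ξ * b ξ := by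
  rw [mulS, SchwartzMap.pairing_apply_apply]; rfl

theorem cnv_fourierInv_cnv {n : ℕ} (a b : 𝓢(E n, ℂ)) {f : E n → ℂ} {p : ℝ≥0∞} (hp : 1 ≤ p)
    (hf : MemLp f p volume) (x : E n) : cnv (𝓕⁻ a : 𝓢(E n, ℂ)) (cnv (𝓕⁻ b : 𝓢(E n, ℂ)) f) x =
      cnv (𝓕⁻ (mulS a b) : 𝓢(E n, ℂ)) f x := by
  rw [cnv_assoc _ _ hp hf]
  congr 1
  exact funext fun z => (fourierInv_mul_eq_cnv (mulS_apply a b) z).symm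

theorem fourierInv_sub_left {n : ℕ} (a : 𝓢(E n, ℂ)) (x ξ : E n) :
    𝓕⁻ (fun y => (𝓕⁻ a : 𝓢(E n, ℂ)) (x - y)) ξ =
      a ξ * Complex.exp (2 * Real.pi * Complex.I * (inner ℝ ξ x : ℝ)) := by
  rw [fourierInv_eq_integral_exp]
  rw [← integral_sub_left_eq_self _ volume x]
  simp only [sub_sub_cancel]
  have h1 : ∀ y : E n, (𝓕⁻ a : 𝓢(E n, ℂ)) y *
      Complex.exp (2 * Real.pi * Complex.I * (inner ℝ (x - y) ξ : ℝ)) =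
      (Complex.exp (-(2 * Real.pi * inner ℝ y ξ : ℝ) * Complex.I) • (𝓕⁻ a : 𝓢(E n, ℂ)) y) *
        Complex.exp (2 * Real.pi * Complex.I * (inner ℝ ξ x : ℝ)) := by
    intro y
    have e : Complex.exp (2 * Real.pi * Complex.I * (inner ℝ (x - y) ξ : ℝ)) =
        Complex.exp (-(2 * Real.pi * inner ℝ y ξ : ℝ) * Complex.I) *
          Complex.exp (2 * Real.pi * Complex.I * (inner ℝ ξ x : ℝ)) := by
      rw [← Complex.exp_add, inner_sub_left, real_inner_comm x ξ]
      congr 1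
      push_cast; ring
    rw [e, smul_eq_mul]; ring
  simp only [h1]
  rw [integral_mul_const]
  congr 1
  have h2 : 𝓕 (𝓕⁻ a : 𝓢(E n, ℂ)) ξ = a ξ := by rw [FourierTransform.fourier_fourierInv_eq]
  rw [← h2, SchwartzMap.fourier_coe, Real.fourier_eq']
  refine integral_congr_ae (Filter.Eventually.of_forall fun y => ?_)
  dsimp only
  congr 2
  push_cast; ring

theorem cnv_fourierInv_eq {n : ℕ} (a : 𝓢(E n, ℂ)) {H : E n → ℂ} (hH : Integrable H) (x : E n) :
    cnv (𝓕⁻ a : 𝓢(E n, ℂ)) (𝓕⁻ H) x =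
      ∫ ξ, a ξ * H ξ * Complex.exp (2 * Real.pi * Complex.I * (inner ℝ ξ x : ℝ)) := by
  have h1 : Integrable fun y => (𝓕⁻ a : 𝓢(E n, ℂ)) (x - y) :=
    (𝓕⁻ a : 𝓢(E n, ℂ)).integrable.comp_sub_left x
  rw [cnv, integral_mul_fourierInv h1 hH]
  simp only [fourierInv_sub_left]
  exact integral_congr_ae (Filter.Eventually.of_forall fun ξ => by ring)

/-! ### The operators `T_q P_k` -/

/-- The integral `∫ K_k(x, x-y) f(y) dy`. -/
def kerOp {n : ℕ} (χ : E n → ℝ) (q : E n → Sph n → ℂ) (k : ℤ) (f : E n → ℂ) (x : E n) : ℂ :=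
  ∫ y, opKernel χ q k x (x - y) * f y

theorem kerOp_congr {n : ℕ} {χ : E n → ℝ} {q : E n → Sph n → ℂ} {k : ℤ} {f g : E n → ℂ}
    (h : f =ᵐ[volume] g) : kerOp χ q k f = kerOp χ q k g :=
  funext fun _ => integral_congr_ae (by filter_upwards [h] with y hy; rw [hy])

theorem measurable_opKernel {n : ℕ} {χ : E n → ℝ} (hχ : IsCutoff χ) {q : E n → Sph n → ℂ}
    (hq : Measurable (Function.uncurry q)) (k : ℤ) :
    Measurable fun w : E n × E n => opKernel χ q k w.1 w.2 := by
  refine (StronglyMeasurable.integral_prod_right (f := fun (w : E n × E n) (ξ : E n) =>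
    homSymbol q w.1 ξ * (bump χ ((2 : ℝ) ^ (-k) • ξ) : ℂ) *
    Complex.exp (2 * Real.pi * Complex.I * (inner ℝ ξ w.2 : ℝ))) ?_).measurable
  have h1 : Measurable fun v : (E n × E n) × E n => homSymbol q v.1.1 v.2 :=
    (measurable_homSymbol hq).comp ((measurable_fst.comp measurable_fst).prodMk measurable_snd)
  have h2 : Continuous fun v : (E n × E n) × E n => ((bumpK χ k v.2 : ℝ) : ℂ) :=
    Complex.continuous_ofReal.comp ((contDiff_bumpK hχ k).continuous.comp continuous_snd)
  have h3 : Continuous fun v : (E n × E n) × E n =>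
      Complex.exp (2 * Real.pi * Complex.I * (inner ℝ v.2 v.1.2 : ℝ)) := by fun_prop
  exact ((h1.mul h2.measurable).mul h3.measurable).stronglyMeasurable

theorem aestronglyMeasurable_kerOp {n : ℕ} {χ : E n → ℝ} (hχ : IsCutoff χ) {q : E n → Sph n → ℂ}
    (hq : Measurable (Function.uncurry q)) (k : ℤ) {f : E n → ℂ} (hf : AEStronglyMeasurable f) :
    AEStronglyMeasurable (kerOp χ q k f) := by
  have h : AEStronglyMeasurable (fun w : E n × E n => opKernel χ q k w.1 (w.1 - w.2) * f w.2)
      (volume.prod volume) := by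
    refine AEStronglyMeasurable.mul ?_ hf.comp_snd
    exact ((measurable_opKernel hχ hq k).comp
      (measurable_fst.prodMk (measurable_fst.sub measurable_snd))).aestronglyMeasurable
  exact h.integral_prod_right'

theorem kerOp_pev {n : ℕ} {χ : E n → ℝ} (hχ : IsCutoff χ) (a : E n → MvPolynomial (Fin n) ℂ)
    (k : ℤ) (f : E n → ℂ) (x : E n) :
    kerOp χ (fun x θ => pev (θ : E n) (a x)) k f x = cnv (polyKer hχ (a x) k) f x := by
  simp only [kerOp, cnv, opKernel_eq_mulKer, mulKer_pev hχ]

section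
variable {n : ℕ} {χ : E n → ℝ} {hχ : IsCutoff χ} {q : E n → Sph n → ℂ} {p p' S : ℝ≥0∞}

theorem SymbolSeries.coe_summable (Q : SymbolSeries hχ q p p' S) : Summable fun l => (Q.A l : ℝ) :=
  NNReal.summable_coe.mpr Q.summable

theorem SymbolSeries.hasSum_hom (hn : 0 < n) (Q : SymbolSeries hχ q p p' S) (x : E n) :
    ∀ᵐ ξ : E n, HasSum (fun l => hom (fun θ => pev (θ : E n) (Q.a l x)) ξ) (hom (q x) ξ) := by
  filter_upwards [ae_dirOf hn (Q.hasSum x)] with ξ hξ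
  by_cases h : ξ = 0
  · simp [hom, h]
  · simpa only [hom, dif_neg h] using hξ h

/-- The l-th term is dominated by A l |g|. This gives both the absolute convergence of the integral
with the symbol q and its termwise evaluation, for every x. -/
theorem SymbolSeries.integral_hom_mul (hn : 0 < n) (Q : SymbolSeries hχ q p p' S) (x : E n)
    {g : E n → ℂ} (hg : Integrable g) : Integrable (fun ξ => hom (q x) ξ * g ξ) ∧
      HasSum (fun l => ∫ ξ, hom (fun θ => pev (θ : E n) (Q.a l x)) ξ * g ξ)
        (∫ ξ, hom (q x) ξ * g ξ) := by
  have hi : ∀ l, Integrable fun ξ => hom (fun θ => pev (θ : E n) (Q.a l x)) ξ * g ξ := fun l =>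
    integrable_hom_mul (continuous_pev_sph _).measurable (Q.norm_le l x) (Q.A l).2 hg
  refine integrable_and_hasSum_integral hi ?_ ?_
  · refine Summable.of_nonneg_of_le (fun l => integral_nonneg fun _ => norm_nonneg _) (fun l => ?_)
      (Q.coe_summable.mul_right (∫ ξ, ‖g ξ‖))
    rw [← integral_const_mul]
    refine integral_mono (hi l).norm (hg.norm.const_mul _) fun ξ => ?_
    simp only [norm_mul]
    exact mul_le_mul_of_nonneg_right (norm_hom_le (Q.norm_le l x) (Q.A l).2 ξ) (norm_nonneg _)
  · filter_upwards [Q.hasSum_hom hn x] with ξ hξ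
    exact hξ.mul_right _

theorem integrable_mul_exp {g : E n → ℂ} (hg : Integrable g) (x : E n) :
    Integrable fun ξ => g ξ * Complex.exp (2 * Real.pi * Complex.I * (inner ℝ ξ x : ℝ)) := by
  refine hg.mul_bdd (c := 1) (Continuous.aestronglyMeasurable (by fun_prop))
    (Filter.Eventually.of_forall fun ξ => le_of_eq ?_)
  rw [show (2 * Real.pi * Complex.I * (inner ℝ ξ x : ℝ) : ℂ) =
    ((2 * Real.pi * inner ℝ ξ x : ℝ) : ℂ) * Complex.I by push_cast; ring,
    Complex.norm_exp_ofReal_mul_I]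

theorem SymbolSeries.integrable_opIntegrand (hn : 0 < n) (Q : SymbolSeries hχ q p p' S)
    {h : E n → ℂ} (hh : Integrable h) (x : E n) : Integrable (opIntegrand q h x) := by
  refine (Q.integral_hom_mul hn x (integrable_mul_exp hh x)).1.congr
    (Filter.Eventually.of_forall fun ξ => ?_)
  simp only [opIntegrand, homSymbol_eq_hom]; ring

theorem SymbolSeries.hasSum_opIntegral (hn : 0 < n) (Q : SymbolSeries hχ q p p' S)
    {h : E n → ℂ} (hh : Integrable h) (x : E n) :
    HasSum (fun l => opIntegral (fun x θ => pev (θ : E n) (Q.a l x)) h x) (opIntegral q h x) := by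
  have h1 := (Q.integral_hom_mul hn x (integrable_mul_exp hh x)).2
  have e : ∀ s : E n → Sph n → ℂ, opIntegral s h x = ∫ ξ, hom (s x) ξ *
      (h ξ * Complex.exp (2 * Real.pi * Complex.I * (inner ℝ ξ x : ℝ))) := fun s =>
    integral_congr_ae (Filter.Eventually.of_forall fun ξ => by
      simp only [opIntegrand, homSymbol_eq_hom]; ring)
  simp only [e]
  exact h1

end

end RoughPDO
end

noncomputable section
namespace RoughPDO

section
variable {n : ℕ} {χ : E n → ℝ} {hχ : IsCutoff χ} {q : E n → Sph n → ℂ} {p p' S : ℝ≥0∞}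

theorem SymbolSeries.hasSum_opKernel (hn : 0 < n) (Q : SymbolSeries hχ q p p' S) (k : ℤ)
    (x z : E n) : HasSum (fun l => polyKer hχ (Q.a l x) k z) (opKernel χ q k x z) := by
  have hg : Integrable fun ξ => bumpS hχ k ξ *
      Complex.exp (2 * Real.pi * Complex.I * (inner ℝ ξ z : ℝ)) :=
    integrable_mul_exp (bumpS hχ k).integrable z
  have h1 := (Q.integral_hom_mul hn x hg).2
  simp only [bumpS_apply, ← mul_assoc] at h1
  simp only [← mulKer_pev hχ, opKernel_eq_mulKer]
  exact h1

theorem integral_norm_mul_le [hpq : p.HolderConjugate p'] {K f : E n → ℂ} (hK : MemLp K p' volume)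
    (hf : MemLp f p volume) (x : E n) :
    ∫ y, ‖K (x - y) * f y‖ ≤ (eLpNorm K p' volume * eLpNorm f p volume).toReal := by
  have h0 := hK.comp_measurePreserving (volume.measurePreserving_sub_left x)
  have h1 := integrable_cnv hK hf x
  rw [integral_norm_eq_lintegral_enorm h1.1]
  refine ENNReal.toReal_mono (ENNReal.mul_ne_top hK.2.ne hf.2.ne) ?_
  haveI : p'.HolderConjugate p := ENNReal.HolderConjugate.symm
  have h2 := eLpNorm_smul_le_mul_eLpNorm (p := p') (q := p) (r := 1) hf.1 h0.1
  rw [eLpNorm_one_eq_lintegral_enorm,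
    eLpNorm_comp_measurePreserving hK.1 (volume.measurePreserving_sub_left x)] at h2
  exact h2

/-- By Hölder the L^{p'} kernel bound makes the l-th term at most C A l ‖f‖_p for every x, so the
kernel integral converges absolutely and may be summed term by term. -/
theorem SymbolSeries.integrable_and_hasSum_kerOp (hn : 0 < n) (Q : SymbolSeries hχ q p p' S)
    [p.HolderConjugate p'] (k : ℤ) {f : E n → ℂ} (hf : MemLp f p volume) (x : E n) :
    Integrable (fun y => opKernel χ q k x (x - y) * f y) ∧
      HasSum (fun l => cnv (polyKer hχ (Q.a l x) k) f x) (kerOp χ q k f x) := by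
  obtain ⟨C, hC⟩ := Q.ker_le k
  have hK : ∀ l, MemLp (polyKer hχ (Q.a l x) k) p' volume := fun l =>
    (polyKer hχ (Q.a l x) k).memLp p' volume
  refine integrable_and_hasSum_integral (fun l => integrable_cnv (hK l) hf x) ?_ ?_
  · refine Summable.of_nonneg_of_le (fun l => integral_nonneg fun _ => norm_nonneg _) (fun l => ?_)
      (Q.coe_summable.mul_right (C * (eLpNorm f p volume).toReal))
    refine (integral_norm_mul_le (hK l) hf x).trans ?_
    rw [ENNReal.toReal_mul, ← mul_assoc]
    refine mul_le_mul_of_nonneg_right ?_ ENNReal.toReal_nonneg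
    have := ENNReal.toReal_mono (by finiteness) (hC l x)
    rw [ENNReal.toReal_mul] at this
    simpa [mul_comm] using this
  · exact Filter.Eventually.of_forall fun y => (Q.hasSum_opKernel hn k x (x - y)).mul_right _

theorem SymbolSeries.eLpNorm_kerOp_le (hn : 0 < n) (Q : SymbolSeries hχ q p p' S)
    [p.HolderConjugate p'] (hp : 1 ≤ p) (k : ℤ) {f : E n → ℂ} (hf : MemLp f p volume) :
    eLpNorm (kerOp χ q k f) p volume ≤ S * eLpNorm f p volume := by
  have h1 := eLpNorm_le_tsum_of_hasSum (μ := volume) (G := kerOp χ q k f) hp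
    (F := fun l x => cnv (polyKer hχ (Q.a l x) k) f x) (fun l => ?_)
    (Filter.Eventually.of_forall fun x => (Q.integrable_and_hasSum_kerOp hn k hf x).2)
  · refine h1.trans ((ENNReal.tsum_le_tsum fun l => Q.op_le l k f hf).trans_eq ?_)
    rw [ENNReal.tsum_mul_right, ← ENNReal.coe_tsum Q.summable, Q.tsum_eq]
  · simp only [← kerOp_pev hχ]
    exact aestronglyMeasurable_kerOp hχ (Q.measurable l) k hf.1

theorem SymbolSeries.memLp_kerOp (hn : 0 < n) (Q : SymbolSeries hχ q p p' S)
    [p.HolderConjugate p'] (hq : Measurable (Function.uncurry q)) (hp : 1 ≤ p) (hS : S ≠ ⊤)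
    (k : ℤ) {f : E n → ℂ} (hf : MemLp f p volume) : MemLp (kerOp χ q k f) p volume :=
  ⟨aestronglyMeasurable_kerOp hχ hq k hf.1,
    (Q.eLpNorm_kerOp_le hn hp k hf).trans_lt (ENNReal.mul_lt_top hS.lt_top hf.2)⟩

theorem cnv_polyKer_cnv (a : MvPolynomial (Fin n) ℂ) (k : ℤ) (b : 𝓢(E n, ℂ)) {f : E n → ℂ}
    (hp : 1 ≤ p) (hf : MemLp f p volume) (x : E n) :
    cnv (polyKer hχ a k) (cnv (𝓕⁻ b : 𝓢(E n, ℂ)) f) x =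
      cnv (𝓕⁻ (mulS (polySym hχ a k) b) : 𝓢(E n, ℂ)) f x :=
  cnv_fourierInv_cnv (polySym hχ a k) b hp hf x

/-- `T_q P_k` only sees the product of the Fourier multipliers. -/
theorem SymbolSeries.kerOp_cnv_congr (hn : 0 < n) (Q : SymbolSeries hχ q p p' S)
    [p.HolderConjugate p'] (hp : 1 ≤ p) {k j : ℤ} {a b : 𝓢(E n, ℂ)}
    (hab : ∀ ξ, (bumpK χ k ξ : ℂ) * a ξ = bumpK χ j ξ * b ξ) {f : E n → ℂ}
    (hf : MemLp f p volume) :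
    kerOp χ q k (cnv (𝓕⁻ a : 𝓢(E n, ℂ)) f) = kerOp χ q j (cnv (𝓕⁻ b : 𝓢(E n, ℂ)) f) := by
  funext x
  refine (Q.integrable_and_hasSum_kerOp hn k (memLp_cnv _ hp hf) x).2.unique ?_
  have h2 := (Q.integrable_and_hasSum_kerOp hn j (memLp_cnv (𝓕⁻ b : 𝓢(E n, ℂ)) hp hf) x).2
  convert h2 using 2 with l
  rw [cnv_polyKer_cnv _ _ _ hp hf, cnv_polyKer_cnv _ _ _ hp hf]
  have e : mulS (polySym hχ (Q.a l x) k) a = mulS (polySym hχ (Q.a l x) j) b := by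
    ext ξ
    simp only [mulS_apply, polySym_apply, mul_assoc, hab]
  rw [e]

theorem SymbolSeries.kerOp_cnv_eq (hn : 0 < n) (Q : SymbolSeries hχ q p p' S)
    [p.HolderConjugate p'] (hp : 1 ≤ p) {k : ℤ} {a : 𝓢(E n, ℂ)}
    (ha : ∀ ξ, (bumpK χ k ξ : ℂ) * a ξ = bumpK χ k ξ) {f : E n → ℂ} (hf : MemLp f p volume) :
    kerOp χ q k (cnv (𝓕⁻ a : 𝓢(E n, ℂ)) f) = kerOp χ q k f := by
  funext x
  refine (Q.integrable_and_hasSum_kerOp hn k (memLp_cnv _ hp hf) x).2.unique ?_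
  convert (Q.integrable_and_hasSum_kerOp hn k hf x).2 using 2 with l
  rw [cnv_polyKer_cnv _ _ _ hp hf, polyKer]
  have e : mulS (polySym hχ (Q.a l x) k) a = polySym hχ (Q.a l x) k := by
    ext ξ
    simp only [mulS_apply, polySym_apply, mul_assoc, ha]
  rw [e]

/-- The kernel form and the Fourier integral form of T_q P_k agree because they agree for each
polynomial term, and both series converge at every x. -/
theorem SymbolSeries.kerOp_fourierInv (hn : 0 < n) (Q : SymbolSeries hχ q p p' S)
    [p.HolderConjugate p'] (k : ℤ) {H : E n → ℂ} (hH : Integrable H)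
    (hf : MemLp (𝓕⁻ H : E n → ℂ) p volume) (x : E n) :
    kerOp χ q k (𝓕⁻ H) x = opIntegral q (fun ξ => bumpK χ k ξ * H ξ) x := by
  have hi : Integrable fun ξ => (bumpK χ k ξ : ℂ) * H ξ := by
    obtain ⟨C, -, hC⟩ := exists_bound_bump hχ
    refine hH.bdd_mul (c := C) (Continuous.aestronglyMeasurable ?_)
      (Filter.Eventually.of_forall fun ξ => ?_)
    · exact Complex.continuous_ofReal.comp (contDiff_bumpK hχ k).continuous
    · rw [Complex.norm_real]; exact hC _
  refine (Q.integrable_and_hasSum_kerOp hn k hf x).2.unique ?_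
  convert Q.hasSum_opIntegral hn hi x using 2 with l
  rw [polyKer, cnv_fourierInv_eq _ hH]
  refine integral_congr_ae (Filter.Eventually.of_forall fun ξ => ?_)
  simp only [opIntegrand, homSymbol_eq_hom, polySym_apply]
  ring

end

end RoughPDO
end

noncomputable section
namespace RoughPDO

/-! ### The dyadic partition of unity -/

section
variable {n : ℕ} {χ : E n → ℝ}

theorem norm_zpow_smul (k : ℤ) (ξ : E n) : ‖(2 : ℝ) ^ (-k) • ξ‖ = ‖ξ‖ / 2 ^ k := by
  rw [norm_smul, Real.norm_of_nonneg (by positivity), zpow_neg, inv_mul_eq_div]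

theorem bumpK_eq_sub (k : ℤ) (ξ : E n) :
    bumpK χ k ξ = χ ((2 : ℝ) ^ (-k) • ξ) - χ ((2 : ℝ) ^ (-(k - 1)) • ξ) := by
  rw [bumpK, bump, smul_smul, show -(k - 1) = 1 + -k by ring, zpow_add₀ two_ne_zero, zpow_one]

theorem IsCutoff.bumpK_ne_zero (hχ : IsCutoff χ) {k : ℤ} {ξ : E n} (h : bumpK χ k ξ ≠ 0) :
    (2 : ℝ) ^ k / 2 < ‖ξ‖ ∧ ‖ξ‖ ≤ 2 * 2 ^ k := by
  have hk : (0 : ℝ) < 2 ^ k := by positivity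
  constructor
  · by_contra hc
    refine h (hχ.bump_eq_zero_of_lt ?_)
    rw [norm_zpow_smul, div_le_iff₀ hk]; linarith
  · by_contra hc
    exact h (bumpK_eq_zero hχ k (lt_of_not_ge hc))

theorem IsCutoff.bumpK_mul_eq_zero (hχ : IsCutoff χ) {j k : ℤ} (h : j + 2 ≤ k) (ξ : E n) :
    bumpK χ j ξ * bumpK χ k ξ = 0 := by
  by_contra hne
  have h1 := (hχ.bumpK_ne_zero (left_ne_zero_of_mul hne)).2
  have h2 := (hχ.bumpK_ne_zero (right_ne_zero_of_mul hne)).1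
  have h3 : (2 : ℝ) ^ (j + 2) ≤ 2 ^ k := zpow_le_zpow_right₀ one_le_two h
  rw [zpow_add₀ two_ne_zero] at h3
  norm_num at h3
  linarith

/-- The sum of three consecutive dyadic pieces is `1` in the middle annulus. -/
theorem IsCutoff.bumpK_add_eq_one (hχ : IsCutoff χ) {k : ℤ} {ξ : E n} (h1 : (2 : ℝ) ^ k / 2 < ‖ξ‖)
    (h2 : ‖ξ‖ ≤ 2 * 2 ^ k) : bumpK χ (k - 1) ξ + bumpK χ k ξ + bumpK χ (k + 1) ξ = 1 := by
  have hk : (0 : ℝ) < 2 ^ k := by positivity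
  -- The sum telescopes to χ(2^{-(k+1)}ξ) - χ(2^{-(k-2)}ξ); in the annulus the first argument has
  -- norm at most 1 and the second has norm greater than 2.
  rw [bumpK_eq_sub, bumpK_eq_sub, bumpK_eq_sub, add_sub_cancel_right]
  have e1 : χ ((2 : ℝ) ^ (-(k + 1)) • ξ) = 1 := by
    refine hχ.one _ ?_
    rw [norm_zpow_smul, div_le_one (by positivity), zpow_add₀ two_ne_zero, zpow_one]; linarith
  have e2 : χ ((2 : ℝ) ^ (-(k - 1 - 1)) • ξ) = 0 := by
    refine hχ.supp _ ?_
    rw [norm_zpow_smul, lt_div_iff₀ (by positivity), zpow_sub₀ two_ne_zero, zpow_sub₀ two_ne_zero,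
      zpow_one]
    linarith
  rw [e1, e2]; ring

theorem IsCutoff.bumpK_mul_add (hχ : IsCutoff χ) (k : ℤ) (ξ : E n) :
    bumpK χ k ξ * (bumpK χ (k - 1) ξ + bumpK χ k ξ + bumpK χ (k + 1) ξ) = bumpK χ k ξ := by
  by_cases h : bumpK χ k ξ = 0
  · rw [h, zero_mul]
  · obtain ⟨h1, h2⟩ := hχ.bumpK_ne_zero h
    rw [hχ.bumpK_add_eq_one h1 h2, mul_one]

theorem IsCutoff.exists_bumpK_eq_zero (hχ : IsCutoff χ) {ξ : E n} (hξ : ξ ≠ 0) : ∃ k : ℤ,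
    bumpK χ (k - 1) ξ + bumpK χ k ξ + bumpK χ (k + 1) ξ = 1 ∧
      ∀ j ∉ ({k - 1, k, k + 1} : Finset ℤ), bumpK χ j ξ = 0 := by
  obtain ⟨k, hk1, hk2⟩ := exists_mem_Ico_zpow (norm_pos_iff.mpr hξ) one_lt_two
  have hk : (0 : ℝ) < 2 ^ k := by positivity
  rw [zpow_add₀ two_ne_zero, zpow_one] at hk2
  refine ⟨k, hχ.bumpK_add_eq_one (by linarith) (by linarith), fun j hj => ?_⟩
  by_contra hne
  obtain ⟨h1, h2⟩ := hχ.bumpK_ne_zero hne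
  simp only [Finset.mem_insert, Finset.mem_singleton, not_or] at hj
  rcases lt_or_ge j (k - 1) with h | h
  · have h3 : (2 : ℝ) ^ (j + 2) ≤ 2 ^ k := zpow_le_zpow_right₀ one_le_two (by omega)
    rw [zpow_add₀ two_ne_zero] at h3
    norm_num at h3
    have : (0 : ℝ) < 2 ^ j := by positivity
    linarith
  · have h3 : (2 : ℝ) ^ (k + 2) ≤ 2 ^ j := zpow_le_zpow_right₀ one_le_two (by omega)
    rw [zpow_add₀ two_ne_zero] at h3
    norm_num at h3
    linarith

theorem sum_insert_three {M : Type*} [AddCommMonoid M] (f : ℤ → M) (k : ℤ) :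
    ∑ j ∈ ({k - 1, k, k + 1} : Finset ℤ), f j = f (k - 1) + f k + f (k + 1) := by
  rw [Finset.sum_insert (by simp; omega), Finset.sum_insert (by simp), Finset.sum_singleton,
    add_assoc]

theorem IsCutoff.hasSum_bumpK (hχ : IsCutoff χ) {ξ : E n} (hξ : ξ ≠ 0) :
    HasSum (fun k => bumpK χ k ξ) 1 := by
  obtain ⟨k, h1, h2⟩ := hχ.exists_bumpK_eq_zero hξ
  rw [← h1, ← sum_insert_three (fun k => bumpK χ k ξ) k]
  exact hasSum_sum_of_ne_finset_zero h2

/-- At most three pieces are nonzero at any point. A bound for all finite partial sums at once is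
what dominated convergence over the finite subsets of ℤ requires. -/
theorem IsCutoff.exists_abs_sum_bumpK_le (hχ : IsCutoff χ) :
    ∃ C : ℝ, ∀ ξ : E n, ξ ≠ 0 → ∀ s : Finset ℤ, |∑ k ∈ s, bumpK χ k ξ| ≤ C := by
  obtain ⟨B, hB0, hB⟩ := exists_bound_bump hχ
  refine ⟨3 * B, fun ξ hξ s => ?_⟩
  obtain ⟨k, -, h2⟩ := hχ.exists_bumpK_eq_zero hξ
  calc |∑ j ∈ s, bumpK χ j ξ| ≤ ∑ j ∈ s, |bumpK χ j ξ| := Finset.abs_sum_le_sum_abs _ _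
    _ ≤ ∑' j, |bumpK χ j ξ| := by
        refine Summable.sum_le_tsum s (fun _ _ => abs_nonneg _) ?_
        exact summable_of_ne_finset_zero (s := {k - 1, k, k + 1}) fun j hj => by simp [h2 j hj]
    _ = ∑ j ∈ ({k - 1, k, k + 1} : Finset ℤ), |bumpK χ j ξ| :=
        tsum_eq_sum fun j hj => by simp [h2 j hj]
    _ ≤ 3 * B := by
        rw [sum_insert_three]
        have := hB ((2 : ℝ) ^ (-(k - 1)) • ξ)
        have := hB ((2 : ℝ) ^ (-k) • ξ)
        have := hB ((2 : ℝ) ^ (-(k + 1)) • ξ)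
        simp only [bumpK]
        linarith

/-- The sum of three consecutive dyadic pieces. -/
def fatBumpS (hχ : IsCutoff χ) (k : ℤ) : 𝓢(E n, ℂ) :=
  bumpS hχ (k - 1) + bumpS hχ k + bumpS hχ (k + 1)

theorem bumpK_mul_fatBumpS (hχ : IsCutoff χ) (k : ℤ) (ξ : E n) :
    (bumpK χ k ξ : ℂ) * fatBumpS hχ k ξ = bumpK χ k ξ := by
  have e : fatBumpS hχ k ξ =
      ((bumpK χ (k - 1) ξ + bumpK χ k ξ + bumpK χ (k + 1) ξ : ℝ) : ℂ) := by
    simp only [fatBumpS, SchwartzMap.add_apply, bumpS_apply]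
    push_cast; rfl
  rw [e, ← Complex.ofReal_mul, hχ.bumpK_mul_add]

theorem bumpK_mul_bumpK_eq_zero (hχ : IsCutoff χ) {j k : ℤ}
    (h : k ∉ ({j - 1, j, j + 1} : Finset ℤ)) (ξ : E n) :
    (bumpK χ k ξ : ℂ) * bumpK χ j ξ = 0 := by
  simp only [Finset.mem_insert, Finset.mem_singleton, not_or] at h
  rw [← Complex.ofReal_mul, Complex.ofReal_eq_zero]
  rcases lt_or_ge k j with h' | h'
  · exact hχ.bumpK_mul_eq_zero (by omega) ξ
  · rw [mul_comm]; exact hχ.bumpK_mul_eq_zero (by omega) ξ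

variable {hχ : IsCutoff χ} {q : E n → Sph n → ℂ} {p p' S : ℝ≥0∞}

theorem SymbolSeries.hasSum_opIntegral_bumpK (hn : 0 < n) (Q : SymbolSeries hχ q p p' S)
    {h : E n → ℂ} (hh : Integrable h) (x : E n) :
    HasSum (fun k : ℤ => opIntegral q (fun ξ => (bumpK χ k ξ : ℂ) * h ξ) x)
      (opIntegral q h x) := by
  obtain ⟨C, hC⟩ := hχ.exists_abs_sum_bumpK_le
  have h0 := Q.integrable_opIntegrand hn hh x
  have hne : ∀ᵐ ξ : E n, ξ ≠ 0 := by
    haveI : Nonempty (Fin n) := ⟨⟨0, hn⟩⟩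
    exact Measure.ae_ne volume 0
  have hmeas : ∀ k, Continuous fun ξ : E n => (bumpK χ k ξ : ℂ) := fun k =>
    Complex.continuous_ofReal.comp (contDiff_bumpK hχ k).continuous
  have e : ∀ (k : ℤ) (ξ : E n), opIntegrand q (fun ξ => (bumpK χ k ξ : ℂ) * h ξ) x ξ =
      (bumpK χ k ξ : ℂ) * opIntegrand q h x ξ := fun k ξ => by simp only [opIntegrand]; ring
  have hi : ∀ k : ℤ, Integrable fun ξ => (bumpK χ k ξ : ℂ) * opIntegrand q h x ξ := fun k => by
    obtain ⟨B, -, hB⟩ := exists_bound_bump hχ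
    refine h0.bdd_mul (c := B) (hmeas k).aestronglyMeasurable
      (Filter.Eventually.of_forall fun ξ => ?_)
    rw [Complex.norm_real]; exact hB _
  simp only [opIntegral, e, HasSum]
  simp only [← integral_finset_sum _ fun k _ => hi k, ← Finset.sum_mul]
  refine tendsto_integral_filter_of_dominated_convergence
    (fun ξ => C * ‖opIntegrand q h x ξ‖) (Filter.Eventually.of_forall fun s => ?_)
    (Filter.Eventually.of_forall fun s => ?_) (h0.norm.const_mul C) ?_
  · refine AEStronglyMeasurable.mul (Continuous.aestronglyMeasurable ?_) h0.1
    exact continuous_finset_sum _ fun k _ => hmeas k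
  · filter_upwards [hne] with ξ hξ
    rw [norm_mul, ← Complex.ofReal_sum, Complex.norm_real]
    exact mul_le_mul_of_nonneg_right (hC ξ hξ s) (norm_nonneg _)
  · filter_upwards [hne] with ξ hξ
    have h1 := (Complex.hasSum_ofReal.mpr (hχ.hasSum_bumpK hξ)).mul_right (opIntegrand q h x ξ)
    simp only [Complex.ofReal_one, one_mul, HasSum, ← Finset.sum_mul] at h1
    exact h1

end

end RoughPDO
end

noncomputable section
namespace RoughPDO

section
variable {n : ℕ} {p : ℝ≥0∞} [hp : Fact (1 ≤ p)]

/-! ### Frequency localisations of distributions -/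

theorem Lp_coe_injective {f g : Lp ℂ p (volume : Measure (E n))}
    (h : (f : 𝓢'(E n, ℂ)) = (g : 𝓢'(E n, ℂ))) : f = g :=
  Lp.ext (Lp_ae_eq_of_coe_eq h)

/-- A distribution is represented by at most one element of L^p, so the infimum in `distLpNorm` is
attained. -/
theorem exists_Lp_of_distLpNorm_ne_top {u : 𝓢'(E n, ℂ)} (hu : distLpNorm p u ≠ ⊤) :
    ∃ w : Lp ℂ p (volume : Measure (E n)), (w : 𝓢'(E n, ℂ)) = u ∧ ‖w‖ₑ ≤ distLpNorm p u := by
  have h1 : ∃ w : Lp ℂ p (volume : Measure (E n)), (w : 𝓢'(E n, ℂ)) = u := by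
    by_contra hc
    push Not at hc
    refine hu ?_
    simp only [distLpNorm, iInf_eq_top]
    exact fun w hw => absurd hw (hc w)
  obtain ⟨w, hw⟩ := h1
  refine ⟨w, hw, le_iInf₂ fun g hg => ?_⟩
  rw [Lp_coe_injective (hw.trans hg.symm)]

theorem fourierMultiplierCLM_add_apply (a b : 𝓢(E n, ℂ)) (u : 𝓢'(E n, ℂ)) :
    TemperedDistribution.fourierMultiplierCLM ℂ (a + b : 𝓢(E n, ℂ)) u =
      TemperedDistribution.fourierMultiplierCLM ℂ a u +
        TemperedDistribution.fourierMultiplierCLM ℂ b u := by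
  have e : ((a + b : 𝓢(E n, ℂ)) : E n → ℂ) = (a : E n → ℂ) + b := rfl
  simp only [TemperedDistribution.fourierMultiplierCLM_apply, e]
  rw [TemperedDistribution.smulLeftCLM_add a.hasTemperateGrowth b.hasTemperateGrowth]
  simp [FourierTransform.fourierInv_add]

theorem freqLP_eq {χ : E n → ℝ} (hχ : IsCutoff χ) (k : ℤ) :
    freqLP χ k = TemperedDistribution.fourierMultiplierCLM ℂ (bumpS hχ k) := rfl

theorem fourierMultiplierCLM_fatBumpS {χ : E n → ℝ} (hχ : IsCutoff χ) (k : ℤ) (u : 𝓢'(E n, ℂ)) :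
    TemperedDistribution.fourierMultiplierCLM ℂ (fatBumpS hχ k) u =
      freqLP χ (k - 1) u + freqLP χ k u + freqLP χ (k + 1) u := by
  rw [fatBumpS, fourierMultiplierCLM_add_apply, fourierMultiplierCLM_add_apply]; rfl

/-- If `𝓕 u` is integrable, a frequency localisation of `u` is an inverse Fourier integral. -/
theorem ae_eq_fourierInv_of_coe_eq {a : 𝓢(E n, ℂ)} {u : 𝓢'(E n, ℂ)}
    {h : Lp ℂ 1 (volume : Measure (E n))} (hu : 𝓕 u = (h : 𝓢'(E n, ℂ)))
    {w : Lp ℂ p (volume : Measure (E n))}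
    (hw : (w : 𝓢'(E n, ℂ)) = TemperedDistribution.fourierMultiplierCLM ℂ a u) :
    (w : E n → ℂ) =ᵐ[volume] 𝓕⁻ fun ξ => a ξ * h ξ := by
  have hi : Integrable fun ξ => a ξ * h ξ :=
    (L1.integrable_coeFn h).bdd_mul a.continuous.aestronglyMeasurable
      (Filter.Eventually.of_forall fun ξ => a.norm_le_seminorm ℂ ξ)
  refine ae_eq_of_forall_integral_schwartz hp.out le_top (Lp.memLp w) (memLp_top_fourierInv hi)
    fun φ => ?_
  rw [integral_schwartz_mul_fourierInv φ hi]
  have h1 := congrArg (fun u : 𝓢'(E n, ℂ) => u φ) hw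
  have h2 : TemperedDistribution.fourierMultiplierCLM ℂ a u φ =
      (𝓕 u) (SchwartzMap.smulLeftCLM ℂ a (𝓕⁻ φ)) := by
    rw [TemperedDistribution.fourierMultiplierCLM_apply_apply]
    rfl
  simp only [h2, hu, Lp.toTemperedDistribution_apply, smul_eq_mul] at h1
  rw [h1]
  refine integral_congr_ae (Filter.Eventually.of_forall fun ξ => ?_)
  dsimp only
  rw [SchwartzMap.smulLeftCLM_apply_apply a.hasTemperateGrowth, smul_eq_mul]; ring

theorem ae_eq_cnv_of_coe_eq {a b : 𝓢(E n, ℂ)} {g w : Lp ℂ p (volume : Measure (E n))}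
    (hw : (w : 𝓢'(E n, ℂ)) = TemperedDistribution.fourierMultiplierCLM ℂ a
      (TemperedDistribution.fourierMultiplierCLM ℂ b (g : 𝓢'(E n, ℂ)))) :
    (w : E n → ℂ) =ᵐ[volume] cnv (𝓕⁻ (mulS a b) : 𝓢(E n, ℂ)) g := by
  rw [← coe_cnvLp, ← coe_cnvLp] at hw
  rw [Lp_coe_injective hw]
  filter_upwards [coeFn_cnvLp (𝓕⁻ a) (cnvLp (𝓕⁻ b) g)] with x hx
  rw [hx, cnv_congr _ (coeFn_cnvLp (𝓕⁻ b) g), cnv_fourierInv_cnv a b hp.out (Lp.memLp g)]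

theorem cnvLp_fatBumpS {χ : E n → ℝ} (hχ : IsCutoff χ) (k : ℤ)
    (g : Lp ℂ p (volume : Measure (E n))) : cnvLp (𝓕⁻ (fatBumpS hχ k)) g =
      ∑ j ∈ ({k - 1, k, k + 1} : Finset ℤ), cnvLp (𝓕⁻ (bumpS hχ j)) g := by
  rw [sum_insert_three]
  refine Lp_coe_injective ?_
  have hadd := map_add (Lp.toTemperedDistributionCLM ℂ (volume : Measure (E n)) p)
  simp only [Lp.toTemperedDistributionCLM_apply] at hadd
  rw [hadd, hadd, coe_cnvLp, coe_cnvLp, coe_cnvLp, coe_cnvLp, fourierMultiplierCLM_fatBumpS]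
  rfl

variable (p) in
/-- The operators with Fourier multiplier `fatBumpS`, from the Besov space to `L^p`. -/
theorem exists_fatBlock {χ : E n → ℝ} (hχ : IsCutoff χ) (k : ℤ) :
    ∃ W : besovSpace χ p →ₗ[ℂ] Lp ℂ p (volume : Measure (E n)), ∀ u : besovSpace χ p,
      (W u : 𝓢'(E n, ℂ)) =
        TemperedDistribution.fourierMultiplierCLM ℂ (fatBumpS hχ k) (u : 𝓢'(E n, ℂ)) ∧
      ‖W u‖ₑ ≤ distLpNorm p (freqLP χ (k - 1) (u : 𝓢'(E n, ℂ))) +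
        distLpNorm p (freqLP χ k (u : 𝓢'(E n, ℂ))) +
        distLpNorm p (freqLP χ (k + 1) (u : 𝓢'(E n, ℂ))) := by
  have hle : ∀ u : besovSpace χ p, distLpNorm p
      (TemperedDistribution.fourierMultiplierCLM ℂ (fatBumpS hχ k) (u : 𝓢'(E n, ℂ))) ≤
      distLpNorm p (freqLP χ (k - 1) (u : 𝓢'(E n, ℂ))) +
        distLpNorm p (freqLP χ k (u : 𝓢'(E n, ℂ))) +
        distLpNorm p (freqLP χ (k + 1) (u : 𝓢'(E n, ℂ))) := fun u => by
    rw [fourierMultiplierCLM_fatBumpS]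
    exact (distLpNorm_add_le p _ _).trans (add_le_add (distLpNorm_add_le p _ _) le_rfl)
  have hfin : ∀ u : besovSpace χ p, distLpNorm p
      (TemperedDistribution.fourierMultiplierCLM ℂ (fatBumpS hχ k) (u : 𝓢'(E n, ℂ))) ≠ ⊤ :=
    fun u => by
      have h : ∀ j : ℤ, distLpNorm p (freqLP χ j (u : 𝓢'(E n, ℂ))) ≠ ⊤ :=
        fun j => ENNReal.ne_top_of_tsum_ne_top u.2 j
      exact ne_top_of_le_ne_top
        (ENNReal.add_ne_top.mpr ⟨ENNReal.add_ne_top.mpr ⟨h _, h _⟩, h _⟩) (hle u)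
  -- The chosen representatives are unique, and this is why the choice is linear in u.
  choose w hw1 hw2 using fun u => exists_Lp_of_distLpNorm_ne_top (hfin u)
  refine ⟨{ toFun := w, map_add' := fun u v => ?_, map_smul' := fun c u => ?_ },
    fun u => ⟨hw1 u, (hw2 u).trans (hle u)⟩⟩
  · refine Lp_coe_injective ?_
    rw [hw1]
    refine Eq.trans ?_ (map_add (Lp.toTemperedDistributionCLM ℂ (volume : Measure (E n)) p)
      (w u) (w v)).symm
    simp only [Lp.toTemperedDistributionCLM_apply, hw1, Submodule.coe_add, map_add]
  · refine Lp_coe_injective ?_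
    rw [hw1]
    refine Eq.trans ?_ (map_smul (Lp.toTemperedDistributionCLM ℂ (volume : Measure (E n)) p)
      c (w u)).symm
    simp only [Lp.toTemperedDistributionCLM_apply, hw1, Submodule.coe_smul, map_smul]

/-! ### The operators `T_q P_k` on `L^p` -/

variable {χ : E n → ℝ} {hχ : IsCutoff χ} {q : E n → Sph n → ℂ} {p' S : ℝ≥0∞}

theorem SymbolSeries.exists_kerLp (hn : 0 < n) (Q : SymbolSeries hχ q p p' S)
    [p.HolderConjugate p'] (hq : Measurable (Function.uncurry q)) (hS : S ≠ ⊤) (k : ℤ) :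
    ∃ K : Lp ℂ p (volume : Measure (E n)) →ₗ[ℂ] Lp ℂ p (volume : Measure (E n)),
      (∀ f, (K f : E n → ℂ) =ᵐ[volume] kerOp χ q k f) ∧ ∀ f, ‖K f‖ₑ ≤ S * ‖f‖ₑ := by
  have hm : ∀ f : Lp ℂ p (volume : Measure (E n)), MemLp (kerOp χ q k f) p volume := fun f =>
    Q.memLp_kerOp hn hq hp.out hS k (Lp.memLp f)
  have hi : ∀ f : Lp ℂ p (volume : Measure (E n)), ∀ x,
      Integrable fun y => opKernel χ q k x (x - y) * f y := fun f x =>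
    (Q.integrable_and_hasSum_kerOp hn k (Lp.memLp f) x).1
  refine ⟨{ toFun := fun f => (hm f).toLp _, map_add' := ?_, map_smul' := ?_ },
    fun f => MemLp.coeFn_toLp (hm f), fun f => ?_⟩
  · intro f g
    rw [← MemLp.toLp_add]
    congr 1
    rw [kerOp_congr (Lp.coeFn_add f g)]
    funext x
    rw [Pi.add_apply, kerOp, kerOp, kerOp, ← integral_add (hi f x) (hi g x)]
    simp only [Pi.add_apply, mul_add]
  · intro c f
    rw [RingHom.id_apply, ← MemLp.toLp_const_smul]
    congr 1
    rw [kerOp_congr (Lp.coeFn_smul c f)]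
    funext x
    rw [Pi.smul_apply, kerOp, kerOp, ← integral_smul]
    simp only [Pi.smul_apply, mul_smul_comm]
  · change ‖(hm f).toLp _‖ₑ ≤ _
    rw [Lp.enorm_toLp, Lp.enorm_def]
    exact Q.eLpNorm_kerOp_le hn hp.out k (Lp.memLp f)

end

end RoughPDO
end

noncomputable section
namespace RoughPDO

/-! ### The operator on the Besov space -/

section
variable {n : ℕ} {p : ℝ≥0∞} [hp : Fact (1 ≤ p)]
variable {χ : E n → ℝ} {hχ : IsCutoff χ} {q : E n → Sph n → ℂ} {p' S : ℝ≥0∞}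

theorem tsum_int_add (d : ℤ → ℝ≥0∞) :
    ∑' k, (d (k - 1) + d k + d (k + 1)) = 3 * ∑' k, d k := by
  rw [ENNReal.tsum_add, ENNReal.tsum_add]
  have h1 : ∑' k, d (k - 1) = ∑' k, d k := (Equiv.subRight (1 : ℤ)).tsum_eq d
  have h2 : ∑' k, d (k + 1) = ∑' k, d k := (Equiv.addRight (1 : ℤ)).tsum_eq d
  rw [h1, h2]; ring

/-- T u is the sum over k of T_q P_k applied to the fat block W k u, the sum of three consecutive
pieces of u. The block belongs to L^p, while u need not, and T_q P_k does not notice the replacement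
because the fat bump is 1 on the support of φ(2^{-k}·). Every piece of u is counted three times,
whence the factor 3. -/
theorem SymbolSeries.exists_besov_operator (hn : 0 < n) (Q : SymbolSeries hχ q p p' S)
    [p.HolderConjugate p'] (hq : Measurable (Function.uncurry q)) (hS : S ≠ ⊤) :
    ∃ T : besovSpace χ p →ₗ[ℂ] Lp ℂ p (volume : Measure (E n)),
      (∀ u : besovSpace χ p, ‖T u‖ₑ ≤ 3 * S * besovNorm χ p (u : 𝓢'(E n, ℂ))) ∧
      (∀ (u : besovSpace χ p) (h : Lp ℂ 1 (volume : Measure (E n))),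
        𝓕 (u : 𝓢'(E n, ℂ)) = (h : 𝓢'(E n, ℂ)) → (T u : E n → ℂ) =ᵐ[volume] opIntegral q h) ∧
      ∀ (k : ℤ) (u : besovSpace χ p) (g : Lp ℂ p (volume : Measure (E n))),
        (u : 𝓢'(E n, ℂ)) = freqLP χ k (g : 𝓢'(E n, ℂ)) →
          (T u : E n → ℂ) =ᵐ[volume] kerOp χ q k g := by
  choose K hK hKle using fun k => Q.exists_kerLp hn hq hS k
  choose W hW hWle using fun k => exists_fatBlock p hχ k
  have hbd : ∀ u : besovSpace χ p, ∑' k, ‖K k (W k u)‖ₑ ≤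
      3 * S * besovNorm χ p (u : 𝓢'(E n, ℂ)) := fun u => by
    rw [mul_comm 3 S, mul_assoc, besovNorm, ← tsum_int_add, ← ENNReal.tsum_mul_left]
    exact ENNReal.tsum_le_tsum fun k => (hKle k _).trans (mul_le_mul_right (hWle k u) _)
  have hfin : ∀ u : besovSpace χ p, ∑' k, ‖K k (W k u)‖ₑ ≠ ⊤ := fun u =>
    ne_top_of_le_ne_top (ENNReal.mul_ne_top (ENNReal.mul_ne_top (by norm_num) hS) u.2) (hbd u)
  have hsum : ∀ u : besovSpace χ p, Summable fun k => K k (W k u) := fun u =>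
    Summable.of_enorm (hfin u)
  refine ⟨{ toFun := fun u => ∑' k, K k (W k u), map_add' := ?_, map_smul' := ?_ }, ?_, ?_, ?_⟩
  · intro u v
    simp only [map_add]
    exact (hsum u).tsum_add (hsum v)
  · intro c u
    simp only [map_smul, RingHom.id_apply]
    exact (hsum u).tsum_const_smul c
  · exact fun u => enorm_tsum_le_tsum_enorm.trans (hbd u)
  · intro u h hu
    have hh := L1.integrable_coeFn h
    have e : ∀ k, ∀ᵐ x, K k (W k u) x =
        opIntegral q (fun ξ => (bumpK χ k ξ : ℂ) * h ξ) x := fun k => by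
      have h1 := ae_eq_fourierInv_of_coe_eq hu (hW k u)
      have hi : Integrable fun ξ => fatBumpS hχ k ξ * h ξ :=
        hh.bdd_mul (fatBumpS hχ k).continuous.aestronglyMeasurable
          (Filter.Eventually.of_forall fun ξ => (fatBumpS hχ k).norm_le_seminorm ℂ ξ)
      filter_upwards [hK k (W k u)] with x hx
      rw [hx, kerOp_congr h1, Q.kerOp_fourierInv hn k hi ((memLp_congr_ae h1).mp (Lp.memLp _))]
      simp only [← mul_assoc, bumpK_mul_fatBumpS]
    change ⇑(∑' k, K k (W k u)) =ᵐ[volume] _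
    filter_upwards [Lp.hasSum_coeFn_tsum (hfin u), ae_all_iff.mpr e] with x hx hx'
    simp only [hx'] at hx
    exact hx.unique (Q.hasSum_opIntegral_bumpK hn hh x)
  -- For u = P_j g only k = j - 1, j, j + 1 contribute. The product of the bumps is symmetric in j
  -- and k, so each term equals T_q P_j applied to P_k g; the three P_k g add up to the fat block of
  -- g, which T_q P_j does not distinguish from g.
  · intro j u g hu
    have hg := Lp.memLp g
    have e : ∀ k, kerOp χ q k (W k u) =
        kerOp χ q j (cnv (𝓕⁻ (bumpS hχ k) : 𝓢(E n, ℂ)) g) := fun k => by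
      have h1 : (W k u : 𝓢'(E n, ℂ)) = TemperedDistribution.fourierMultiplierCLM ℂ (fatBumpS hχ k)
          (TemperedDistribution.fourierMultiplierCLM ℂ (bumpS hχ j) (g : 𝓢'(E n, ℂ))) := by
        rw [hW k u, hu, freqLP_eq hχ]
      rw [kerOp_congr (ae_eq_cnv_of_coe_eq h1)]
      refine Q.kerOp_cnv_congr hn hp.out (fun ξ => ?_) hg
      rw [mulS_apply, ← mul_assoc, bumpK_mul_fatBumpS, bumpS_apply, bumpS_apply, mul_comm]
    have e0 : ∀ k ∉ ({j - 1, j, j + 1} : Finset ℤ), K k (W k u) = 0 := fun k hk => by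
      have h0 : kerOp χ q k (W k u) = 0 := by
        rw [e k, Q.kerOp_cnv_congr hn hp.out (j := j) (b := 0) (fun ξ => ?_) hg]
        · funext x
          simp [kerOp, cnv]
        · rw [bumpS_apply, mul_comm, bumpK_mul_bumpK_eq_zero hχ hk]; simp
      refine (Lp.eq_zero_iff_ae_eq_zero).mpr ?_
      rw [← h0]
      exact hK k _
    have e1 : ∀ k, K k (W k u) = K j (cnvLp (𝓕⁻ (bumpS hχ k)) g) := fun k => by
      refine Lp.ext ((hK k _).trans ?_)
      rw [e k, ← kerOp_congr (coeFn_cnvLp (𝓕⁻ (bumpS hχ k)) g)]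
      exact (hK j _).symm
    change ⇑(∑' k, K k (W k u)) =ᵐ[volume] _
    rw [tsum_eq_sum e0, Finset.sum_congr rfl fun k _ => e1 k, ← map_sum, ← cnvLp_fatBumpS]
    refine (hK j _).trans (Filter.EventuallyEq.of_eq ?_)
    rw [kerOp_congr (coeFn_cnvLp (𝓕⁻ (fatBumpS hχ j)) g)]
    exact Q.kerOp_cnv_eq hn hp.out (bumpK_mul_fatBumpS hχ j) hg

end

end RoughPDO
end

noncomputable section
namespace RoughPDO

/-! ### The operator on L² -/

section
variable {n : ℕ} {χ : E n → ℝ} {hχ : IsCutoff χ} {q : E n → Sph n → ℂ} {S : ℝ≥0∞}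

/-- The functions in `L²` whose Fourier transform is integrable. -/
def integrableFourier (n : ℕ) : Submodule ℂ (Lp ℂ 2 (volume : Measure (E n))) where
  carrier := {f | Integrable ((𝓕 f : Lp ℂ 2 (volume : Measure (E n))) : E n → ℂ)}
  zero_mem' := by
    simp only [Set.mem_ofPred_eq, FourierTransform.fourier_zero]
    exact (integrable_zero _ _ _).congr (Lp.coeFn_zero _ _ _).symm
  add_mem' := by
    intro f g hf hg
    simp only [Set.mem_ofPred_eq, FourierTransform.fourier_add] at *
    exact (hf.add hg).congr (Lp.coeFn_add _ _).symm
  smul_mem' := by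
    intro c f hf
    simp only [Set.mem_ofPred_eq, FourierTransform.fourier_smul] at *
    exact (hf.smul c).congr (Lp.coeFn_smul _ _).symm

/-- Schwartz functions already belong to this subspace and are dense in L². -/
theorem denseRange_integrableFourier (n : ℕ) : DenseRange (integrableFourier n).subtype := by
  refine (SchwartzMap.denseRange_toLpCLM (F := ℂ) (p := 2) (μ := (volume : Measure (E n)))
    ENNReal.ofNat_ne_top).mono ?_
  rintro _ ⟨f, rfl⟩
  refine ⟨⟨f.toLp 2, ?_⟩, rfl⟩
  change Integrable ((𝓕 (f.toLp 2) : Lp ℂ 2 (volume : Measure (E n))) : E n → ℂ)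
  rw [SchwartzMap.toLp_fourier_eq]
  exact (𝓕 f).integrable.congr ((𝓕 f).coeFn_toLp 2 volume).symm

theorem opIntegral_congr {h h' : E n → ℂ} (hh : h =ᵐ[volume] h') :
    opIntegral q h = opIntegral q h' :=
  funext fun _ => integral_congr_ae (by
    filter_upwards [hh] with ξ hξ
    rw [opIntegrand, hξ, opIntegrand])

theorem aestronglyMeasurable_opIntegral (hq : Measurable (Function.uncurry q)) {h : E n → ℂ}
    (hh : AEStronglyMeasurable h) : AEStronglyMeasurable (opIntegral q h) := by
  refine AEStronglyMeasurable.integral_prod_right'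
    (f := fun w : E n × E n => opIntegrand q h w.1 w.2) (μ := volume) (ν := volume) ?_
  refine AEStronglyMeasurable.mul ?_ hh.comp_snd
  refine ((measurable_homSymbol hq).mul ?_).aestronglyMeasurable
  exact Continuous.measurable (by fun_prop)

theorem SymbolSeries.eLpNorm_opIntegral_le (hn : 0 < n) (Q : SymbolSeries hχ q 2 2 S)
    {h : E n → ℂ} (h1 : Integrable h) (h2 : MemLp h 2 volume) :
    eLpNorm (opIntegral q h) 2 volume ≤ S * eLpNorm h 2 volume := by
  have hm : ∀ l, AEStronglyMeasurable (opIntegral (fun x θ => pev (θ : E n) (Q.a l x)) h) :=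
    fun l => by
      have h3 := Q.measurable l
      exact aestronglyMeasurable_opIntegral h3 h1.1
  refine (eLpNorm_le_tsum_of_hasSum one_le_two hm
    (Filter.Eventually.of_forall fun x => Q.hasSum_opIntegral hn h1 x)).trans ?_
  refine (ENNReal.tsum_le_tsum fun l => Q.opIntegral_le rfl l h h1 h2).trans_eq ?_
  rw [ENNReal.tsum_mul_right, ← ENNReal.coe_tsum Q.summable, Q.tsum_eq]

/-- On the dense subspace where the Fourier transform is integrable, T is the absolutely convergent
integral, with norm at most S by Plancherel and summation in l; the rest is extension by continuity.
-/
theorem SymbolSeries.exists_l2_operator (hn : 0 < n) (Q : SymbolSeries hχ q 2 2 S)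
    (hq : Measurable (Function.uncurry q)) (hS : S ≠ ⊤) :
    ∃ T : Lp ℂ 2 (volume : Measure (E n)) →L[ℂ] Lp ℂ 2 (volume : Measure (E n)),
      ‖T‖ₑ ≤ S ∧ ∀ f : Lp ℂ 2 (volume : Measure (E n)),
        Integrable ((𝓕 f : Lp ℂ 2 (volume : Measure (E n))) : E n → ℂ) →
        (T f : E n → ℂ) =ᵐ[volume]
          opIntegral q ((𝓕 f : Lp ℂ 2 (volume : Measure (E n))) : E n → ℂ) := by
  have hle : ∀ f : integrableFourier n, eLpNorm (opIntegral q
      ((𝓕 (f : Lp ℂ 2 (volume : Measure (E n))) : Lp ℂ 2 (volume : Measure (E n))) : E n → ℂ))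
      2 volume ≤ S * ‖(f : Lp ℂ 2 (volume : Measure (E n)))‖ₑ := fun f => by
    refine (Q.eLpNorm_opIntegral_le hn f.2 (Lp.memLp _)).trans_eq ?_
    rw [← Lp.enorm_def, ← ofReal_norm, ← ofReal_norm, Lp.norm_fourier_eq]
  have hm : ∀ f : integrableFourier n, MemLp (opIntegral q
      ((𝓕 (f : Lp ℂ 2 (volume : Measure (E n))) : Lp ℂ 2 (volume : Measure (E n))) : E n → ℂ))
      2 volume := fun f => ⟨aestronglyMeasurable_opIntegral hq (Lp.memLp _).1,
    (hle f).trans_lt (ENNReal.mul_lt_top hS.lt_top enorm_lt_top)⟩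
  have hi : ∀ (f : integrableFourier n) x, Integrable (opIntegrand q
      ((𝓕 (f : Lp ℂ 2 (volume : Measure (E n))) : Lp ℂ 2 (volume : Measure (E n))) : E n → ℂ) x) :=
    fun f x => Q.integrable_opIntegrand hn f.2 x
  let T₀ : integrableFourier n →ₗ[ℂ] Lp ℂ 2 (volume : Measure (E n)) :=
    { toFun := fun f => (hm f).toLp _
      map_add' := by
        intro f g
        rw [← MemLp.toLp_add]
        congr 1
        rw [Submodule.coe_add, FourierTransform.fourier_add, opIntegral_congr (Lp.coeFn_add _ _)]
        funext x
        rw [Pi.add_apply, opIntegral, opIntegral, opIntegral, ← integral_add (hi f x) (hi g x)]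
        simp only [opIntegrand, Pi.add_apply, mul_add]
      map_smul' := by
        intro c f
        rw [RingHom.id_apply, ← MemLp.toLp_const_smul]
        congr 1
        rw [Submodule.coe_smul, FourierTransform.fourier_smul,
          opIntegral_congr (Lp.coeFn_smul _ _)]
        funext x
        rw [Pi.smul_apply, opIntegral, opIntegral, ← integral_smul]
        simp only [opIntegrand, Pi.smul_apply, mul_smul_comm] }
  have hT₀ : ∀ f : integrableFourier n,
      ‖T₀ f‖ ≤ S.toReal * ‖(integrableFourier n).subtype f‖ := fun f => by
    have h1 : ‖T₀ f‖ₑ ≤ S * ‖(f : Lp ℂ 2 (volume : Measure (E n)))‖ₑ := by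
      change ‖(hm f).toLp _‖ₑ ≤ _
      rw [Lp.enorm_toLp]; exact hle f
    have h2 := ENNReal.toReal_mono (ENNReal.mul_ne_top hS enorm_ne_top) h1
    rwa [ENNReal.toReal_mul, toReal_enorm, toReal_enorm] at h2
  refine ⟨T₀.extendOfNorm (integrableFourier n).subtype, ?_, fun f hf => ?_⟩
  · have h1 := LinearMap.opNorm_extendOfNorm_le (denseRange_integrableFourier n)
      ENNReal.toReal_nonneg hT₀
    rw [← ofReal_norm]
    exact ENNReal.ofReal_le_of_le_toReal h1
  · have h1 := LinearMap.extendOfNorm_eq (denseRange_integrableFourier n) ⟨S.toReal, hT₀⟩ ⟨f, hf⟩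
    have h2 : T₀.extendOfNorm (integrableFourier n).subtype f = T₀ ⟨f, hf⟩ := h1
    rw [h2]
    exact MemLp.coeFn_toLp (hm ⟨f, hf⟩)

end

end RoughPDO
end

theorem theorem3 (n : ℕ) (hn : 0 < n) (χ : E n → ℝ) (hχ : IsCutoff χ)
    (χ₀ : ℝ → ℝ) (hχ₀ : IsCutoff χ₀) :
    ∃ C : ℝ≥0, ∀ q : E n → Sph n → ℂ,
      Measurable (Function.uncurry q) →
      (∀ x, Integrable (q x) (sphMeasure n)) →
      (symbolNorm n χ₀ 2 q ≠ ⊤ →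
        ∃ T : Lp ℂ 2 (volume : Measure (E n)) →L[ℂ]
            Lp ℂ 2 (volume : Measure (E n)),
          ‖T‖ₑ ≤ (C : ℝ≥0∞) * symbolNorm n χ₀ 2 q ∧
          ∀ f : Lp ℂ 2 (volume : Measure (E n)),
            Integrable ((𝓕 f : Lp ℂ 2 (volume : Measure (E n))) : E n → ℂ) →
            (∀ x, Integrable (opIntegrand q
              ((𝓕 f : Lp ℂ 2 (volume : Measure (E n))) : E n → ℂ) x)) ∧
            (T f : E n → ℂ) =ᵐ[volume] opIntegral q
              ((𝓕 f : Lp ℂ 2 (volume : Measure (E n))) : E n → ℂ)) ∧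
      (∀ (p p' : ℝ≥0∞) [Fact (1 ≤ p)], 2 ≤ p → p.HolderConjugate p' →
        symbolNorm n χ₀ p' q ≠ ⊤ →
        ∃ T : besovSpace χ p →ₗ[ℂ] Lp ℂ p (volume : Measure (E n)),
          (∀ u : besovSpace χ p,
            ‖T u‖ₑ ≤ (C : ℝ≥0∞) * symbolNorm n χ₀ p' q *
              besovNorm χ p (u : 𝓢'(E n, ℂ))) ∧
          (∀ (u : besovSpace χ p) (h : Lp ℂ 1 (volume : Measure (E n))),
            𝓕 (u : 𝓢'(E n, ℂ)) = (h : 𝓢'(E n, ℂ)) →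
            (∀ x, Integrable (opIntegrand q (h : E n → ℂ) x)) ∧
            (T u : E n → ℂ) =ᵐ[volume]
              opIntegral q (h : E n → ℂ)) ∧
          (∀ (k : ℤ) (u : besovSpace χ p)
            (g : Lp ℂ p (volume : Measure (E n))),
            (u : 𝓢'(E n, ℂ)) = freqLP χ k (g : 𝓢'(E n, ℂ)) →
            (∀ x, Integrable (fun y => opKernel χ q k x (x - y) * g y)) ∧
            (T u : E n → ℂ) =ᵐ[volume]
              fun x => ∫ y, opKernel χ q k x (x - y) * g y)) := by
  obtain ⟨C, hC⟩ := exists_symbolSeries hn hχ hχ₀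
  -- The factor 3 is the overlap of the dyadic pieces and is needed only for the Besov estimate.
  refine ⟨3 * C, fun q hq hqi => ⟨fun hS => ?_, fun p p' _ h2p hpp' hS => ?_⟩⟩
  · obtain ⟨Q⟩ := hC q hq hqi 2 2 le_rfl hS
    obtain ⟨T, hT, hTf⟩ := Q.exists_l2_operator hn hq (ENNReal.mul_ne_top ENNReal.coe_ne_top hS)
    refine ⟨T, hT.trans (mul_le_mul_left ?_ _), fun f hf =>
      ⟨fun x => Q.integrable_opIntegrand hn hf x, hTf f hf⟩⟩
    exact_mod_cast le_mul_of_one_le_left (zero_le (a := C)) (by norm_num)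
  · obtain ⟨Q⟩ := hC q hq hqi p p' h2p hS
    obtain ⟨T, hT, hTh, hTg⟩ :=
      Q.exists_besov_operator hn hq (ENNReal.mul_ne_top ENNReal.coe_ne_top hS)
    refine ⟨T, fun u => (hT u).trans_eq ?_, fun u h hu =>
      ⟨fun x => Q.integrable_opIntegrand hn (L1.integrable_coeFn h) x, hTh u h hu⟩,
      fun k u g hu => ⟨fun x => (Q.integrable_and_hasSum_kerOp hn k (Lp.memLp g) x).1,
        hTg k u g hu⟩⟩
    push_cast
    ring
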